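/- Let $a>0$, $b>0$, $0<t<1$. Let $\rho_1,\rho_3$ be the measures on $(-\infty,0]$ with densities $\frac{\sqrt a}{\pi t}|x|^{-1/2}$ and $\frac{\sqrt b}{\pi(1-t)}|x|^{-1/2}$, and put $V(x)=\frac{x}{t(1-t)}-\frac{2\sqrt{ax}}{t}-\frac{2\sqrt{bx}}{1-t}$ and $I(\mu,\nu)=\iint\log\frac1{|x-y|}\,d\mu(x)\,d\nu(y)$, $I(\mu)=I(\mu,\mu)$. Let $(\mu_1,\mu_2,\mu_3)$ be a minimizer of $$E(\nu_1,\nu_2,\nu_3)=\sum_{j=1}^3 I(\nu_j)-\sum_{j=1}^2 I(\nu_j,\nu_{j+1})+\int V\,d\nu_2$$ over all triples of positive Borel measures such that $\nu_1,\nu_3$ live on $(-\infty,0]$, have mass $\frac12$ and satisfy $\nu_1\le\rho_1$, $\nu_3\le\rho_3$, such that $\nu_2$ is a probability measure on $[0,\infty)$, and such that all the integrals in $E$ converge absolutely (the kernel being $+\infty$ on the diagonal). Put $S_1=\operatorname{supp}(\rho_1-\mu_1)$, $S_2=\operatorname{supp}(\mu_2)$, $S_3=\operatorname{supp}(\rho_3-\mu_3)$,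 and let $\mathcal R$ be the compactified four-sheeted surface with sheets $$\mathcal R_1=\mathbb C\setminus S_1,\quad \mathcal R_2=\mathbb C\setminus(S_1\cup S_2),\quad \mathcal R_3=\mathbb C\setminus(S_2\cup S_3),\quad \mathcal R_4=\mathbb C\setminus S_3,$$ where $\mathcal R_j$ is joined crosswise to $\mathcal R_{j+1}$ along $S_j$ for $j=1,2,3$. Precisely, $\mathcal R$ is the quotient of eight disjoint copies of closed half-spheres, namely the closed upper and lower halves (including $\infty$) of each of the four sheets, by the following gluing along $\mathbb R\cup\{\infty\}$: the upper and lower halves of one sheet are glued along the closure of the set of real points that lie on no cut of that sheet, and, for each $j$, the upper half of either of the sheets $j,j+1$ is glued to the lower half of the other along the closure of $S_j$ (closures in the Riemann sphere). Let $\pi:\mathcal R\to\mathbb C\cup\{\infty\}$ be the projection. Then $\mathcal R$ is homeomorphic to the sphere, and the local coordinates on $\mathcal R$ in which $\pi$ is holomorphic form a complex atlas; with it, $\mathcal R$ is a compact connected Riemann surface of genus $0$. Let $F_j(z)=\int\frac{d\mu_j(x)}{z-x}$, let $\sqrt z$ be the principal branch with cut $(-\infty,0]$, and define on the sheets, for $z\notin(-\infty,0]$,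 $$\xi(z)=\begin{cases}-F_1(z)+\dfrac{\sqrt a}{t\sqrt z}+\dfrac1{t(1-t)},& z\in\mathcal R_1,\\[2mm] F_1(z)-F_2(z)-\dfrac{\sqrt a}{t\sqrt z}+\dfrac1{t(1-t)},& z\in\mathcal R_2,\\[2mm] F_2(z)-F_3(z)+\dfrac{\sqrt b}{(1-t)\sqrt z},& z\in\mathcal R_3,\\[2mm] F_3(z)-\dfrac{\sqrt b}{(1-t)\sqrt z},& z\in\mathcal R_4.\end{cases}$$ Then $\xi$ has an extension to a meromorphic function on $\mathcal R$. -/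

import Mathlib

open MeasureTheory Topology
open scoped ContDiff

noncomputable section

namespace BesselXi

/-! ### The vector equilibrium problem -/

/-- The measure on `(-∞, 0]` with density `√c / (π s) * |x| ^ (-1/2)`. The upper constraints are
`ρ₁ = constraintMeasure a t` and `ρ₃ = constraintMeasure b (1 - t)`. -/
def constraintMeasure (c s : ℝ) : Measure ℝ :=
  (volume.restrict (Set.Iic 0)).withDensity fun x =>
    ENNReal.ofReal (√c / (Real.pi * s) * |x| ^ (-(1 / 2) : ℝ))

/-- The external field acting on the second measure. -/
def externalField (a b t x : ℝ) : ℝ :=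
  x / (t * (1 - t)) - 2 * √(a * x) / t - 2 * √(b * x) / (1 - t)

/-- The absolute value of the logarithmic kernel, equal to `∞` on the diagonal. -/
def absLogKernel (p : ℝ × ℝ) : ENNReal :=
  if p.1 = p.2 then ⊤ else ENNReal.ofReal |Real.log (|p.1 - p.2|)|

/-- The (mutual) logarithmic energy of `μ` and `ν` converges absolutely. In particular the
diagonal is a null set for `μ.prod ν`. -/
def HasFiniteEnergy (μ ν : Measure ℝ) : Prop :=
  ∫⁻ p, absLogKernel p ∂(μ.prod ν) < ⊤

/-- The mutual logarithmic energy `I(μ, ν)`; `I(μ) = I(μ, μ)`. -/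
def logEnergy (μ ν : Measure ℝ) : ℝ :=
  ∫ p, Real.log (1 / |p.1 - p.2|) ∂(μ.prod ν)

/-- The energy functional. -/
def energy (a b t : ℝ) (ν₁ ν₂ ν₃ : Measure ℝ) : ℝ :=
  logEnergy ν₁ ν₁ + logEnergy ν₂ ν₂ + logEnergy ν₃ ν₃
    - logEnergy ν₁ ν₂ - logEnergy ν₂ ν₃ + ∫ x, externalField a b t x ∂ν₂

/-- The triples of measures among which the energy is minimized: mass, support and constraint
conditions, and the absolute convergence of all the integrals in the energy functional. -/
structure Admissible (a b t : ℝ) (ν₁ ν₂ ν₃ : Measure ℝ) : Prop where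
  mass₁ : ν₁ Set.univ = 1 / 2
  mass₂ : ν₂ Set.univ = 1
  mass₃ : ν₃ Set.univ = 1 / 2
  on₁ : ν₁ (Set.Ioi 0) = 0
  on₂ : ν₂ (Set.Iio 0) = 0
  on₃ : ν₃ (Set.Ioi 0) = 0
  le₁ : ν₁ ≤ constraintMeasure a t
  le₃ : ν₃ ≤ constraintMeasure b (1 - t)
  finite₁₁ : HasFiniteEnergy ν₁ ν₁
  finite₂₂ : HasFiniteEnergy ν₂ ν₂
  finite₃₃ : HasFiniteEnergy ν₃ ν₃
  finite₁₂ : HasFiniteEnergy ν₁ ν₂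
  finite₂₃ : HasFiniteEnergy ν₂ ν₃
  finite_field : Integrable (externalField a b t) ν₂

/-- `(μ₁, μ₂, μ₃)` solves the vector equilibrium problem. -/
def IsMinimizer (a b t : ℝ) (μ₁ μ₂ μ₃ : Measure ℝ) : Prop :=
  Admissible a b t μ₁ μ₂ μ₃ ∧
    ∀ ν₁ ν₂ ν₃ : Measure ℝ, Admissible a b t ν₁ ν₂ ν₃ →
      energy a b t μ₁ μ₂ μ₃ ≤ energy a b t ν₁ ν₂ ν₃

/-! ### The four-sheeted surface

The Riemann sphere is `OnePoint ℂ`. The sheets are numbered `0, 1, 2, 3`, and the cut `S i`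
(`i = 0, 1, 2`) joins the sheets `i` and `i + 1`. Every sheet is divided into a closed upper half
(`true`) and a closed lower half (`false`), both containing `ℝ ∪ {∞}`; the halves are then glued
along `ℝ ∪ {∞}`: the two halves of one sheet off the cuts in that sheet, and the halves
of two consecutive sheets crosswise along the cut that joins them. -/

/-- The closed upper or lower half of the Riemann sphere. -/
def closedHalf : Bool → Set (OnePoint ℂ)
  | true => insert OnePoint.infty ((fun z : ℂ => (z : OnePoint ℂ)) '' {z | 0 ≤ z.im})
  | false => insert OnePoint.infty ((fun z : ℂ => (z : OnePoint ℂ)) '' {z | z.im ≤ 0})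

theorem coe_mem_closedHalf_true {z : ℂ} (h : 0 ≤ z.im) : (z : OnePoint ℂ) ∈ closedHalf true :=
  Or.inr ⟨z, h, rfl⟩

theorem coe_mem_closedHalf_false {z : ℂ} (h : z.im ≤ 0) : (z : OnePoint ℂ) ∈ closedHalf false :=
  Or.inr ⟨z, h, rfl⟩

/-- The disjoint union of the eight closed half-sheets. A point is (sheet, half, position). -/
abbrev HalfSheets : Type :=
  {P : Fin 4 × Bool × OnePoint ℂ // P.2.2 ∈ closedHalf P.2.1}

/-- The union of the cuts in sheet `j`. -/
def cutsIn (S : Fin 3 → Set ℝ) (j : Fin 4) : Set ℝ :=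
  {x | ∃ i : Fin 3, (j = i.castSucc ∨ j = i.succ) ∧ x ∈ S i}

/-- The closure of a set of reals in the Riemann sphere (so `∞` belongs to it if and only if the
set is unbounded). -/
def sphereClosure (A : Set ℝ) : Set (OnePoint ℂ) :=
  closure ((fun x : ℝ => ((x : ℂ) : OnePoint ℂ)) '' A)

/-- The gluing of upper half-sheets to lower half-sheets. At the end points of the cuts (and at
`∞`) both kinds of gluing apply, which produces the branch points. -/
def Glue (S : Fin 3 → Set ℝ) (P Q : HalfSheets) : Prop :=
  P.1.2.1 = true ∧ Q.1.2.1 = false ∧ P.1.2.2 = Q.1.2.2 ∧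
    ((P.1.1 = Q.1.1 ∧ P.1.2.2 ∈ sphereClosure (cutsIn S P.1.1)ᶜ) ∨
      ∃ i : Fin 3, ((P.1.1 = i.castSucc ∧ Q.1.1 = i.succ) ∨
          (P.1.1 = i.succ ∧ Q.1.1 = i.castSucc)) ∧
        P.1.2.2 ∈ sphereClosure (S i))

/-- The compact four-sheeted surface with cuts `S 0, S 1, S 2`, with the quotient topology. -/
def Surface (S : Fin 3 → Set ℝ) : Type := Quot (Glue S)

instance (S : Fin 3 → Set ℝ) : TopologicalSpace (Surface S) :=
  inferInstanceAs (TopologicalSpace (Quot (Glue S)))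

/-- The point of the surface represented by a point of one of the half-sheets. -/
def Surface.mk (S : Fin 3 → Set ℝ) (P : HalfSheets) : Surface S := Quot.mk (Glue S) P

/-- The projection of the surface to the Riemann sphere. -/
def Surface.proj {S : Fin 3 → Set ℝ} : Surface S → OnePoint ℂ :=
  Quot.lift (fun P => P.1.2.2) fun _ _ h => h.2.2.1

/-- The points `z ∈ ℂ` that lie on no cut of sheet `j`. -/
def sheet (S : Fin 3 → Set ℝ) (j : Fin 4) : Set ℂ :=
  {z | ∀ x ∈ cutsIn S j, z ≠ (x : ℂ)}

open Classical in
/-- The point of the surface that lies over `z` in sheet `j`. (For `z ∈ sheet S j` it is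
immaterial in which half a real `z` is put.) -/
def Surface.pt (S : Fin 3 → Set ℝ) (j : Fin 4) (z : ℂ) : Surface S :=
  if h : 0 ≤ z.im then
    Surface.mk S ⟨(j, true, (z : OnePoint ℂ)), coe_mem_closedHalf_true h⟩
  else
    Surface.mk S ⟨(j, false, (z : OnePoint ℂ)), coe_mem_closedHalf_false (le_of_not_ge h)⟩

/-! ### Holomorphic maps to the Riemann sphere and meromorphic functions -/

open Classical in
/-- The coordinate `w ↦ 1 / w` of the Riemann sphere at infinity. -/
def sphereInv (w : ℂ) : OnePoint ℂ :=
  if w = 0 then OnePoint.infty else ((w⁻¹ : ℂ) : OnePoint ℂ)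

/-- The map `g` into the Riemann sphere is holomorphic at `w`: in one of the two standard
coordinates of the sphere it is given near `w` by an analytic function. -/
def SphereAnalyticAt (g : ℂ → OnePoint ℂ) (w : ℂ) : Prop :=
  (∃ h : ℂ → ℂ, AnalyticAt ℂ h w ∧ ∀ᶠ u in 𝓝 w, g u = (h u : OnePoint ℂ)) ∨
    ∃ h : ℂ → ℂ, AnalyticAt ℂ h w ∧ ∀ᶠ u in 𝓝 w, g u = sphereInv (h u)

/-- The complex structure of the surface: all the local coordinates in which the projection to the
Riemann sphere is holomorphic. -/
def holomorphicCharts (S : Fin 3 → Set ℝ) : Set (OpenPartialHomeomorph (Surface S) ℂ) :=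
  {e | ∀ w ∈ e.target, SphereAnalyticAt (fun u => Surface.proj (e.symm u)) w}

/-- A meromorphic function on a Riemann surface, with the value `∞` at its poles: a holomorphic map
to the Riemann sphere that is not identically `∞` on any nonempty open set. -/
def IsMeromorphic {X : Type} [TopologicalSpace X] [ChartedSpace ℂ X] (f : X → OnePoint ℂ) : Prop :=
  (∀ e ∈ atlas ℂ X, ∀ w ∈ e.target, SphereAnalyticAt (fun u => f (e.symm u)) w) ∧
    Dense {P | f P ≠ OnePoint.infty}

/-! ### The function `ξ` -/

/-- The cuts `supp(ρ₁ - μ₁)`, `supp(μ₂)`, `supp(ρ₃ - μ₃)`. -/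
def cuts (a b t : ℝ) (μ₁ μ₂ μ₃ : Measure ℝ) : Fin 3 → Set ℝ :=
  ![(constraintMeasure a t - μ₁).support, μ₂.support, (constraintMeasure b (1 - t) - μ₃).support]

/-- The Cauchy transform. -/
def cauchyTransform (μ : Measure ℝ) (z : ℂ) : ℂ :=
  ∫ x : ℝ, 1 / (z - (x : ℂ)) ∂μ

/-- The formula for `ξ` on the four sheets, with the principal branch of the square root. -/
def xiFormula (a b t : ℝ) (μ₁ μ₂ μ₃ : Measure ℝ) (z : ℂ) : Fin 4 → ℂ :=
  ![-cauchyTransform μ₁ z + (√a : ℂ) / (t * z ^ (1 / 2 : ℂ)) + 1 / (t * (1 - t)),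
    cauchyTransform μ₁ z - cauchyTransform μ₂ z - (√a : ℂ) / (t * z ^ (1 / 2 : ℂ))
      + 1 / (t * (1 - t)),
    cauchyTransform μ₂ z - cauchyTransform μ₃ z + (√b : ℂ) / ((1 - t) * z ^ (1 / 2 : ℂ)),
    cauchyTransform μ₃ z - (√b : ℂ) / ((1 - t) * z ^ (1 / 2 : ℂ))]

end BesselXi

end

/-! Write σ₁ = ρ₁ − μ₁, σ₃ = ρ₃ − μ₃ for the slack measures, G₁, G₃, F for the Cauchy transforms of
σ₁, σ₃, μ₂, and A = 1/(t(1−t)). Since √a/(t√z) is the transform of ρ₁ and similarly for ρ₃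
(`cauchyTransform_constraintMeasure`), the four branches of ξ are G₁ + A, −G₁ − F + A, F + G₃, −G₃
(`CutData.xiFormula_eq`), and each is holomorphic off the cuts of its own sheet. What has to be
shown is that neighbouring branches are exchanged across the cut that joins them, that the
singularities at the ends of the cuts and at infinity are at most poles, and that the glued space is
a sphere with a complex structure.

Crossing the cuts. Variation of one measure at a time gives the Euler-Lagrange conditions: 2U^{μ₁} −
U^{μ₂} is constant on the support of σ₁ (the support of μ₁ being all of (−∞, 0]), and the effective
potential is constant almost everywhere on the support of μ₂. Potentials are too rough for the
reflection principle, so they are integrated twice, reflected, and differentiated twice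
(`exists_odd_continuation`). The outcome is that 2G₁ + F, 2G₃ + F and 2F + G₁ + G₃ − A change sign
across the three cuts. These are differences of neighbouring branches, whereas the corresponding
sums are analytic there; hence the branches are interchanged (`CutData.exists_crossing`).

Shape of the cuts. The supports are (−∞, −c₁], [p, q], (−∞, −c₃] with c₁, c₃, p ≥ 0. For the slack
measures, monotonicity of Cauchy transforms on a gap contradicts the inequalities at its ends
(`IsConstrainedMin.exists_support_sub_eq`, `IsConstrainedMin.Iio_subset_support`). For μ₂, a
Liouville argument (`IsConstrainedMin.exists_slackCombination_eq`) expresses G₁ through the image of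
μ₂ under s ↦ √(s + c₁). It follows that √x (F + G₁) and √x (F + G₃) decrease on each gap of μ₂, so
√x times the derivative of the effective potential strictly increases, which is incompatible with a
gap (`IsMinimizer.not_gap`).

The surface. It now depends on four numbers only. Explicit foldings map the eight half-sheets onto
pieces of the sphere compatibly with the gluing (`nonempty_surface_homeomorph`). Near a point over ℝ
∪ {∞} a chart is a k-th root of a coordinate of the sphere, k being the length of a cycle of the
local monodromy (`IsLocalModel.exists_chart`). Coordinate changes are continuous solutions of
analytic equations, hence analytic (`analyticAt_transition`).

Extension. Cauchy transforms of finite measures are O(1/|Im z|). Together with the continuation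
across the axis this makes ξ at most of order 1/|z − x₀| at each real x₀ and bounded at infinity.
Thus in each chart the singularities are removable or poles (`IsLocalModel.hasLift`), and the
extension by limits from non-real points is meromorphic. -/

noncomputable section

namespace BesselXi

/-! ### Complex analysis -/

section ComplexAnalysis

open Complex Metric Set Filter
open scoped ComplexConjugate Interval

/-- A continuous function on a disk centred on the real axis that is holomorphic off the real axis
is holomorphic. -/
theorem differentiableOn_ball_of_off_real {f : ℂ → ℂ} {x₀ r : ℝ}
    (hc : ContinuousOn f (ball (x₀ : ℂ) r))
    (hd : ∀ z ∈ ball (x₀ : ℂ) r, z.im ≠ 0 → DifferentiableAt ℂ f z) :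
    DifferentiableOn ℂ f (ball (x₀ : ℂ) r) := by
  refine (isConservativeOn_and_continuousOn_iff_isDifferentiableOn isOpen_ball).1 ⟨?_, hc⟩
  intro z w hzw
  rw [← add_eq_zero_iff_eq_neg, wedgeIntegral_add_wedgeIntegral_eq]
  -- By Morera's theorem only integrals over rectangles matter. Cauchy's theorem for functions
  -- continuous on a closed rectangle and differentiable inside covers all rectangles whose interior
  -- misses the real axis; the others are cut along the axis.
  have key : ∀ z w : ℂ, ([[z.re, w.re]] ×ℂ [[z.im, w.im]]) ⊆ ball (x₀ : ℂ) r →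
      (0 : ℝ) ∉ Ioo (min z.im w.im) (max z.im w.im) →
      (∫ x : ℝ in z.re..w.re, f (x + z.im * I)) - (∫ x : ℝ in z.re..w.re, f (x + w.im * I)) +
        I • (∫ y : ℝ in z.im..w.im, f (re w + y * I)) -
        I • ∫ y : ℝ in z.im..w.im, f (re z + y * I) = 0 := by
    intro z w h h0
    refine integral_boundary_rect_eq_zero_of_continuousOn_of_differentiableOn f z w (hc.mono h) ?_
    intro u hu
    refine (hd u (h ?_) ?_).differentiableWithinAt
    · rw [mem_reProdIm] at hu ⊢
      exact ⟨Ioo_subset_Icc_self hu.1, Ioo_subset_Icc_self hu.2⟩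
    · rintro hu0
      rw [mem_reProdIm, hu0] at hu
      exact h0 hu.2
  by_cases h0 : (0 : ℝ) ∈ Ioo (min z.im w.im) (max z.im w.im)
  · have h0' : (0 : ℝ) ∈ [[z.im, w.im]] := Ioo_subset_Icc_self h0
    have hrect : ([[z.re, w.re]] ×ℂ [[z.im, w.im]]) ⊆ ball (x₀ : ℂ) r := hzw
    -- Read as complex numbers, `w.re` and `z.re` are corners on the real axis: `e1` concerns the
    -- part of the rectangle between `z` and the axis, `e2` the part between the axis and `w`. The
    -- two sides on the axis cancel.
    have e1 := key z (w.re : ℂ) (fun u hu => hrect (by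
        rw [mem_reProdIm] at hu ⊢
        simp only [ofReal_re, ofReal_im] at hu
        exact ⟨hu.1, uIcc_subset_uIcc_left h0' hu.2⟩)) (by
        simp only [ofReal_im, mem_Ioo, not_and_or, not_lt]
        rcases le_total z.im 0 with h | h
        · right; simp [h]
        · left; simp [h])
    have e2 := key (z.re : ℂ) w (fun u hu => hrect (by
        rw [mem_reProdIm] at hu ⊢
        simp only [ofReal_re, ofReal_im] at hu
        exact ⟨hu.1, uIcc_subset_uIcc_right h0' hu.2⟩)) (by
        simp only [ofReal_im, mem_Ioo, not_and_or, not_lt]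
        rcases le_total w.im 0 with h | h
        · right; simp [h]
        · left; simp [h])
    simp only [ofReal_re, ofReal_im] at e1 e2
    have vert : ∀ a ∈ [[z.re, w.re]],
        (∫ y : ℝ in z.im..0, f (a + y * I)) + (∫ y : ℝ in 0..w.im, f (a + y * I)) =
          ∫ y : ℝ in z.im..w.im, f (a + y * I) := by
      intro a ha
      have hcont : ContinuousOn (fun y : ℝ => f (a + y * I)) [[z.im, w.im]] := by
        refine hc.comp (by fun_prop) fun y hy => hrect ?_
        rw [mem_reProdIm]
        simpa using ⟨ha, hy⟩
      refine intervalIntegral.integral_add_adjacent_intervals ?_ ?_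
      · exact (hcont.mono (uIcc_subset_uIcc_left h0')).intervalIntegrable
      · exact (hcont.mono (uIcc_subset_uIcc_right h0')).intervalIntegrable
    rw [← vert _ left_mem_uIcc, ← vert _ right_mem_uIcc]
    simp only [smul_eq_mul] at e1 e2 ⊢
    linear_combination e1 + e2
  · exact key z w hzw h0

theorem conj_mem_ball_ofReal {x₀ r : ℝ} {z : ℂ} (hz : z ∈ ball (x₀ : ℂ) r) :
    conj z ∈ ball (x₀ : ℂ) r := by
  rw [mem_ball, Complex.dist_eq] at hz ⊢
  rwa [← conj_ofReal x₀, ← map_sub, norm_conj]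

/-- The Schwarz reflection principle. -/
theorem exists_differentiableOn_reflection {Φ : ℂ → ℂ} {x₀ r : ℝ}
    (hc : ContinuousOn Φ (ball (x₀ : ℂ) r ∩ {z | 0 ≤ z.im}))
    (hd : ∀ z ∈ ball (x₀ : ℂ) r, 0 < z.im → DifferentiableAt ℂ Φ z)
    (hre : ∀ x : ℝ, (x : ℂ) ∈ ball (x₀ : ℂ) r → (Φ x).re = 0) :
    ∃ Ψ : ℂ → ℂ, DifferentiableOn ℂ Ψ (ball (x₀ : ℂ) r) ∧
      (∀ z, 0 ≤ z.im → Ψ z = Φ z) ∧ ∀ z, z.im < 0 → Ψ z = -conj (Φ (conj z)) := by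
  classical
  refine ⟨fun z => if 0 ≤ z.im then Φ z else -conj (Φ (conj z)), ?_, fun z hz => if_pos hz,
    fun z hz => if_neg (not_le.2 hz)⟩
  refine differentiableOn_ball_of_off_real ?_ ?_
  · refine ContinuousOn.if' ?_ ?_ ?_ ?_
    · rintro a ⟨ha, hfr⟩
      have h0 : a.im = 0 := by
        have := frontier_le_subset_eq continuous_const continuous_im hfr
        exact this.symm
      rw [if_pos h0.ge]
      exact (hc a ⟨ha, h0.ge⟩).tendsto
    · rintro a ⟨ha, hfr⟩
      have h0 : a.im = 0 := by
        have := frontier_le_subset_eq continuous_const continuous_im hfr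
        exact this.symm
      rw [if_pos h0.ge]
      have hval : -conj (Φ (conj a)) = Φ a := by
        have ha' : (a.re : ℂ) = a := Complex.ext (by simp) (by simp [h0])
        have h1 := hre a.re (by rwa [ha'])
        rw [← ha', conj_ofReal]
        exact Complex.ext (by simp [h1]) (by simp)
      rw [← hval]
      refine (continuous_conj.tendsto _).comp ?_ |>.neg
      have h2 := hc (conj a) ⟨conj_mem_ball_ofReal ha, by simp [h0]⟩
      refine h2.tendsto.comp (tendsto_nhdsWithin_iff.2 ⟨?_, ?_⟩)
      · exact (continuous_conj.tendsto a).mono_left nhdsWithin_le_nhds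
      · filter_upwards [self_mem_nhdsWithin] with u hu
        exact ⟨conj_mem_ball_ofReal hu.1, by simpa using (not_le.1 hu.2).le⟩
    · exact hc
    · refine ContinuousOn.neg (continuous_conj.comp_continuousOn (hc.comp
        continuous_conj.continuousOn ?_))
      rintro u ⟨hu, hu'⟩
      exact ⟨conj_mem_ball_ofReal hu, by simpa using (not_le.1 hu').le⟩
  · intro z hz h0
    rcases lt_or_gt_of_ne h0 with h | h
    · have h1 : DifferentiableAt ℂ (fun z => -conj (Φ (conj z))) z := by
        have := hd (conj z) (conj_mem_ball_ofReal hz) (by simpa using h)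
        have h2 := (differentiableAt_conj_conj_iff (f := Φ) (x := z)).2 this
        exact h2.neg
      refine h1.congr_of_eventuallyEq ?_
      filter_upwards [(isOpen_lt continuous_im continuous_const).mem_nhds h] with u hu
      exact if_neg (not_le.2 hu)
    · refine (hd z hz h).congr_of_eventuallyEq ?_
      filter_upwards [(isOpen_lt continuous_const continuous_im).mem_nhds h] with u hu
      exact if_pos (le_of_lt hu)

/-- A holomorphic function on a disk centred on the real axis that is bounded by `C / |Im w|` is
bounded on a smaller disk. -/
theorem norm_le_of_norm_mul_im_le {f : ℂ → ℂ} {x r C : ℝ} (hr : 0 < r) {U : Set ℂ}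
    (hU : closedBall (x : ℂ) r ⊆ U) (hf : DifferentiableOn ℂ f U)
    (hC : ∀ w ∈ closedBall (x : ℂ) r, w.im ≠ 0 → ‖f w‖ * |w.im| ≤ C) (hC0 : 0 ≤ C)
    {w : ℂ} (hw : ‖w - x‖ ≤ r / 2) : ‖f w‖ ≤ 3 * C / r := by
  -- On the circle |z − x| = r the factor (z − x)² − r² has modulus exactly 2r|Im z|, so it absorbs
  -- the singular bound on the boundary. On the half-size disk its modulus is at least 3r²/4, and
  -- the maximum principle gives 8C/(3r) ≤ 3C/r.
  have hdc : DiffContOnCl ℂ (fun z : ℂ => f z * ((z - x) ^ 2 - r ^ 2)) (ball (x : ℂ) r) := by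
    refine (DifferentiableOn.mono ?_ hU).diffContOnCl_ball Subset.rfl
    fun_prop
  have hb : ∀ z ∈ frontier (ball (x : ℂ) r), ‖f z * ((z - x) ^ 2 - r ^ 2)‖ ≤ 2 * r * C := by
    intro z hz
    rw [frontier_ball _ hr.ne', mem_sphere, Complex.dist_eq] at hz
    have hsq : (z.re - x) ^ 2 + z.im ^ 2 = r ^ 2 := by
      rw [← hz, Complex.sq_norm, Complex.normSq_apply]; simp; ring
    have e : ‖(z - x) ^ 2 - (r : ℂ) ^ 2‖ = 2 * r * |z.im| := by
      have : (z - x) ^ 2 - (r : ℂ) ^ 2 = 2 * I * z.im * (z - x) := by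
        have h3 : (r : ℂ) ^ 2 = ((z.re - x) ^ 2 + z.im ^ 2 : ℝ) := by rw [hsq]; push_cast; ring
        rw [h3]
        apply Complex.ext <;> simp [pow_two] <;> ring
      rw [this, norm_mul, norm_mul, norm_mul, hz]
      simp; ring
    rw [norm_mul, e]
    by_cases h0 : z.im = 0
    · simp [h0]; positivity
    · have := hC z (by rw [mem_closedBall, Complex.dist_eq, hz]) h0
      nlinarith
  have hwcl : w ∈ closure (ball (x : ℂ) r) := by
    rw [closure_ball _ hr.ne', mem_closedBall, Complex.dist_eq]; linarith
  have h := norm_le_of_forall_mem_frontier_norm_le isBounded_ball hdc hb hwcl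
  rw [norm_mul] at h
  have h2 : 3 / 4 * r ^ 2 ≤ ‖(w - x) ^ 2 - (r : ℂ) ^ 2‖ := by
    have := norm_sub_norm_le ((r : ℂ) ^ 2) ((w - x) ^ 2)
    rw [norm_sub_rev, norm_pow, norm_pow, norm_real, Real.norm_of_nonneg hr.le] at this
    have h3 : ‖w - x‖ ^ 2 ≤ (r / 2) ^ 2 := by gcongr
    nlinarith
  rw [le_div_iff₀ hr]
  have h4 : ‖f w‖ * (3 / 4 * r ^ 2) ≤ 2 * r * C :=
    (mul_le_mul_of_nonneg_left h2 (norm_nonneg _)).trans h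
  have : r * (‖f w‖ * r * (3 / 4)) ≤ r * (2 * C) := by nlinarith
  have := le_of_mul_le_mul_left this hr
  nlinarith [norm_nonneg (f w)]

/-- An isolated singularity with polynomial growth is at most a pole. -/
theorem meromorphicAt_of_norm_mul_pow_le {f : ℂ → ℂ} {c : ℂ} {C : ℝ} {N : ℕ}
    (hd : ∀ᶠ z in 𝓝[≠] c, DifferentiableAt ℂ f z)
    (hb : ∀ᶠ z in 𝓝[≠] c, ‖f z‖ * ‖z - c‖ ^ N ≤ C) : MeromorphicAt f c := by
  classical
  -- One power more than the growth requires makes `g` continuous at `c` with value 0, whatever `f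
  -- c` is.
  set g : ℂ → ℂ := fun z => (z - c) ^ (N + 1) * f z with hg
  have hg0 : g c = 0 := by simp [hg]
  have hcont : ContinuousAt g c := by
    rw [continuousAt_iff_punctured_nhds, hg0]
    refine squeeze_zero_norm' (a := fun z => C * ‖z - c‖) ?_ ?_
    · filter_upwards [hb] with z hz
      rw [hg]
      simp only [norm_mul, norm_pow]
      calc _ = (‖f z‖ * ‖z - c‖ ^ N) * ‖z - c‖ := by ring
        _ ≤ _ := by gcongr
    · have : ContinuousAt (fun z => C * ‖z - c‖) c := by fun_prop
      have h := this.tendsto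
      simp only [sub_self, norm_zero, mul_zero] at h
      exact h.mono_left nhdsWithin_le_nhds
  have ha : AnalyticAt ℂ g c := by
    refine analyticAt_of_differentiable_on_punctured_nhds_of_continuousAt ?_ hcont
    filter_upwards [hd] with z hz
    fun_prop
  exact ⟨N + 1, by simpa [hg, smul_eq_mul] using ha⟩

/-- A function of finite order n is (z − c)ⁿ times a nonvanishing analytic function. If n ≥ 0 it is
analytic in the finite coordinate, if n < 0 its reciprocal is analytic and the coordinate at
infinity is used. The value of `f` at `c` itself is arbitrary, whence the punctured neighbourhood.
-/
theorem MeromorphicAt.exists_sphereAnalyticAt {f : ℂ → ℂ} {c : ℂ} (hf : MeromorphicAt f c) :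
    ∃ g : ℂ → OnePoint ℂ, SphereAnalyticAt g c ∧
      ∀ᶠ z in 𝓝[≠] c, g z = ((f z : ℂ) : OnePoint ℂ) := by
  rcases MeromorphicAt.eventually_eq_zero_or_eventually_ne_zero hf with h0 | h0
  · exact ⟨fun _ => ((0 : ℂ) : OnePoint ℂ), Or.inl ⟨fun _ => 0, analyticAt_const, by simp⟩, by
      filter_upwards [h0] with z hz; rw [hz]⟩
  have hord : meromorphicOrderAt f c ≠ ⊤ := (meromorphicOrderAt_ne_top_iff_eventually_ne_zero hf).2 h0
  obtain ⟨n, hn⟩ := WithTop.ne_top_iff_exists.1 hord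
  obtain ⟨g, hg, hg0, hfg⟩ := (meromorphicOrderAt_eq_int_iff hf).1 hn.symm
  rcases le_or_gt 0 n with hnn | hnn
  · lift n to ℕ using hnn
    refine ⟨fun z => (((z - c) ^ n * g z : ℂ) : OnePoint ℂ), Or.inl ⟨fun z => (z - c) ^ n * g z, ?_, .of_forall fun _ => rfl⟩, ?_⟩
    · fun_prop
    · filter_upwards [hfg] with z hz
      rw [hz]; simp
  · obtain ⟨m, rfl⟩ : ∃ m : ℕ, n = -m := ⟨n.natAbs, by omega⟩
    have hm : m ≠ 0 := by rintro rfl; simp at hnn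
    refine ⟨fun z => sphereInv ((z - c) ^ m * (g z)⁻¹), Or.inr ⟨fun z => (z - c) ^ m * (g z)⁻¹, ?_, .of_forall fun _ => rfl⟩, ?_⟩
    · have := hg.inv hg0
      fun_prop
    · filter_upwards [hfg, nhdsWithin_le_nhds (hg.continuousAt.eventually_ne hg0),
        self_mem_nhdsWithin] with z hz hz0 hzc
      have : z - c ≠ 0 := sub_ne_zero.2 hzc
      rw [sphereInv, if_neg (by positivity), hz]
      simp [mul_comm]

end ComplexAnalysis

/-! ### Cauchy transforms and logarithmic potentials -/

section Potentials

open Complex Metric Set Filter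
open scoped ComplexConjugate Interval

/-- The Cauchy transform of `μ` converges absolutely away from the support. -/
def CauchyIntegrable (μ : Measure ℝ) : Prop := Integrable (fun s : ℝ => (1 + |s|)⁻¹) μ

theorem measurable_inv_one_add_abs : Measurable fun s : ℝ => (1 + |s|)⁻¹ := by fun_prop

theorem cauchyIntegrable_of_isFiniteMeasure (μ : Measure ℝ) [IsFiniteMeasure μ] :
    CauchyIntegrable μ := by
  refine (integrable_const (1 : ℝ)).mono' measurable_inv_one_add_abs.aestronglyMeasurable
    (.of_forall fun s => ?_)
  rw [Real.norm_of_nonneg (by positivity)]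
  exact inv_le_one_of_one_le₀ (by linarith [abs_nonneg s])

theorem CauchyIntegrable.mono {μ ν : Measure ℝ} (h : CauchyIntegrable ν) (hle : μ ≤ ν) :
    CauchyIntegrable μ := Integrable.mono_measure h hle

/-- The points at positive distance from `μ`-almost all points. -/
theorem exists_pos_le_norm_sub {T : Set ℝ} (hT : IsClosed T) {z : ℂ} (hz : ∀ x ∈ T, z ≠ (x : ℂ)) :
    ∃ δ > 0, ∀ s ∈ T, δ ≤ ‖z - s‖ := by
  have hcl : IsClosed ((fun x : ℝ => (x : ℂ)) '' T) :=
    Complex.isometry_ofReal.isClosedEmbedding.isClosedMap _ hT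
  have hz' : z ∈ ((fun x : ℝ => (x : ℂ)) '' T)ᶜ := by
    rintro ⟨x, hx, rfl⟩; exact hz x hx rfl
  obtain ⟨δ, hδ, hb⟩ := Metric.isOpen_iff.1 hcl.isOpen_compl z hz'
  refine ⟨δ, hδ, fun s hs => ?_⟩
  by_contra h
  refine hb (show (s : ℂ) ∈ ball z δ from ?_) ⟨s, hs, rfl⟩
  rw [mem_ball, dist_comm, Complex.dist_eq]
  exact not_le.1 h

theorem one_add_abs_le_mul_norm_sub {δ : ℝ} (hδ : 0 < δ) {z : ℂ} {s : ℝ} (h : δ ≤ ‖z - s‖) :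
    1 + |s| ≤ (1 + (1 + ‖z‖) / δ) * ‖z - s‖ := by
  have h1 : |s| ≤ ‖z‖ + ‖z - s‖ := by
    have := norm_sub_le z (z - s)
    rw [sub_sub_cancel, norm_real, Real.norm_eq_abs] at this
    exact this
  have h2 : 1 + ‖z‖ ≤ (1 + ‖z‖) / δ * ‖z - s‖ := by
    rw [div_mul_eq_mul_div, le_div_iff₀ hδ]
    gcongr
  nlinarith

theorem inv_norm_sub_le {δ : ℝ} (hδ : 0 < δ) {z : ℂ} {s : ℝ} (h : δ ≤ ‖z - s‖) :
    ‖z - s‖⁻¹ ≤ (1 + (1 + ‖z‖) / δ) * (1 + |s|)⁻¹ := by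
  have := one_add_abs_le_mul_norm_sub hδ h
  have h0 : 0 < ‖z - s‖ := hδ.trans_le h
  rw [← div_eq_mul_inv, le_div_iff₀ (by positivity), inv_mul_le_iff₀ h0]
  linarith

/-- The weight is there for `√(s + c₁)`, which enters in `IsConstrainedMin.slackCombination_eq`; the
ordinary Cauchy transform is the case of weight 1. -/
theorem integrable_div_sub {μ : Measure ℝ} {w : ℝ → ℝ} (hw : Integrable (fun s => w s / (1 + |s|)) μ)
    (hwm : Measurable w) {δ : ℝ} (hδ : 0 < δ) {z : ℂ} (h : ∀ᵐ s ∂μ, δ ≤ ‖z - (s : ℝ)‖) :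
    Integrable (fun s : ℝ => (w s : ℂ) / (z - s)) μ := by
  refine (hw.norm.const_mul (1 + (1 + ‖z‖) / δ)).mono' ?_ ?_
  · exact Measurable.aestronglyMeasurable (by fun_prop)
  · filter_upwards [h] with s hs
    rw [norm_div, norm_div, norm_real, div_eq_mul_inv, div_eq_mul_inv ‖w s‖ ‖1 + |s|‖]
    rw [mul_left_comm, Real.norm_of_nonneg (show 0 ≤ 1 + |s| by positivity)]
    gcongr
    exact inv_norm_sub_le hδ hs

theorem hasDerivAt_integral_div_sub {μ : Measure ℝ} {w : ℝ → ℝ}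
    (hw : Integrable (fun s => w s / (1 + |s|)) μ) (hwm : Measurable w) {δ : ℝ} (hδ : 0 < δ) {z : ℂ}
    (h : ∀ᵐ s ∂μ, δ ≤ ‖z - (s : ℝ)‖) :
    HasDerivAt (fun z : ℂ => ∫ s : ℝ, (w s : ℂ) / (z - s) ∂μ)
      (∫ s : ℝ, -(w s : ℂ) / (z - s) ^ 2 ∂μ) z := by
  have hloc : ∀ s : ℝ, δ ≤ ‖z - s‖ → ∀ u ∈ ball z (δ / 2), δ / 2 ≤ ‖u - s‖ := by
    intro s hs u hu
    rw [mem_ball, Complex.dist_eq] at hu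
    have := norm_sub_le_norm_sub_add_norm_sub z u (s : ℂ)
    rw [norm_sub_rev z u] at this
    linarith
  set K : ℝ := (1 + (1 + ‖z‖ + δ / 2) / (δ / 2)) with hK
  have hK1 : 1 ≤ K := by rw [hK]; simp; positivity
  have hinv : ∀ s : ℝ, δ ≤ ‖z - s‖ → ∀ u ∈ ball z (δ / 2), ‖u - s‖⁻¹ ≤ K * (1 + |s|)⁻¹ := by
    intro s hs u hu
    refine (inv_norm_sub_le (half_pos hδ) (hloc s hs u hu)).trans ?_
    have : ‖u‖ ≤ ‖z‖ + δ / 2 := by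
      rw [mem_ball, Complex.dist_eq] at hu
      have := norm_le_norm_add_norm_sub' u z
      linarith
    have h2 : 1 + ‖u‖ ≤ 1 + ‖z‖ + δ / 2 := by linarith
    rw [hK]
    gcongr
  refine (hasDerivAt_integral_of_dominated_loc_of_deriv_le (μ := μ)
    (F' := fun u s => -(w s : ℂ) / (u - s) ^ 2)
    (bound := fun s => K ^ 2 * ‖w s / (1 + |s|)‖) (ball_mem_nhds z (half_pos hδ)) ?_
    (integrable_div_sub hw hwm hδ h) ?_ ?_ (hw.norm.const_mul _) ?_).2
  · exact .of_forall fun u => Measurable.aestronglyMeasurable (by fun_prop)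
  · exact Measurable.aestronglyMeasurable (by fun_prop)
  · filter_upwards [h] with s hs u hu
    have h1 := hinv s hs u hu
    rw [norm_div, norm_div, norm_neg, norm_real, norm_pow, div_eq_mul_inv, div_eq_mul_inv,
      Real.norm_of_nonneg (show 0 ≤ 1 + |s| by positivity), mul_left_comm, ← inv_pow]
    gcongr
    calc ‖u - s‖⁻¹ ^ 2 ≤ (K * (1 + |s|)⁻¹) ^ 2 := by gcongr
      _ = K ^ 2 * ((1 + |s|)⁻¹ * (1 + |s|)⁻¹) := by ring
      _ ≤ K ^ 2 * (1 * (1 + |s|)⁻¹) := by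
        gcongr
        exact inv_le_one_of_one_le₀ (by linarith [abs_nonneg s])
      _ = _ := by ring
  · filter_upwards [h] with s hs u hu
    have hne : u - s ≠ 0 := by
      rw [← norm_pos_iff]
      exact (half_pos hδ).trans_le (hloc s hs u hu)
    have h1 : HasDerivAt (fun u : ℂ => u - (s : ℂ)) 1 u := (hasDerivAt_id u).sub_const _
    have := (hasDerivAt_const u (w s : ℂ)).fun_div h1 hne
    simpa using this

theorem CauchyIntegrable.weight {μ : Measure ℝ} (h : CauchyIntegrable μ) :
    Integrable (fun s : ℝ => (1 : ℝ) / (1 + |s|)) μ := by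
  simpa only [one_div, CauchyIntegrable] using h

theorem CauchyIntegrable.integrable {μ : Measure ℝ} (hμ : CauchyIntegrable μ) {T : Set ℝ}
    (hT : IsClosed T) (hμT : ∀ᵐ s ∂μ, s ∈ T) {z : ℂ} (hz : ∀ x ∈ T, z ≠ (x : ℂ)) :
    Integrable (fun s : ℝ => 1 / (z - s)) μ := by
  obtain ⟨δ, hδ, h⟩ := exists_pos_le_norm_sub hT hz
  simpa using integrable_div_sub hμ.weight measurable_const hδ
    (hμT.mono fun s hs => h s hs)

theorem hasDerivAt_cauchyTransform {μ : Measure ℝ} (hμ : CauchyIntegrable μ) {T : Set ℝ}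
    (hT : IsClosed T) (hμT : ∀ᵐ s ∂μ, s ∈ T) {z : ℂ} (hz : ∀ x ∈ T, z ≠ (x : ℂ)) :
    HasDerivAt (cauchyTransform μ) (∫ s : ℝ, -1 / (z - s) ^ 2 ∂μ) z := by
  obtain ⟨δ, hδ, h⟩ := exists_pos_le_norm_sub hT hz
  have := hasDerivAt_integral_div_sub hμ.weight measurable_const hδ
    (hμT.mono fun s hs => h s hs)
  simp only [ofReal_one] at this
  exact this

theorem cauchyTransform_conj (μ : Measure ℝ) (z : ℂ) :
    cauchyTransform μ (conj z) = conj (cauchyTransform μ z) := by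
  rw [cauchyTransform, cauchyTransform, ← integral_conj]
  simp

/-- Because |z − s| ≥ |Im z| for real s. The growth estimates for ξ start from bounds of this kind,
which `norm_le_of_norm_mul_im_le` converts into bounds that survive on the real axis. -/
theorem norm_cauchyTransform_mul_im_le (μ : Measure ℝ) [IsFiniteMeasure μ] {z : ℂ} (hz : z.im ≠ 0) :
    ‖cauchyTransform μ z‖ * |z.im| ≤ μ.real univ := by
  rw [← le_div_iff₀ (abs_pos.2 hz), div_eq_inv_mul, mul_comm, cauchyTransform,
    mul_comm]
  refine (norm_integral_le_of_norm_le_const (C := |z.im|⁻¹) (.of_forall fun s => ?_)).trans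
    (le_of_eq (by simp))
  rw [norm_div, norm_one, one_div]
  gcongr
  simpa using abs_im_le_norm (z - s)

/-- The Cauchy transform at real points. -/
def cauchyReal (μ : Measure ℝ) (x : ℝ) : ℝ := ∫ s : ℝ, 1 / (x - s) ∂μ

theorem cauchyTransform_ofReal (μ : Measure ℝ) (x : ℝ) :
    cauchyTransform μ x = (cauchyReal μ x : ℂ) := by
  rw [cauchyTransform, cauchyReal, ← integral_complex_ofReal]
  simp

theorem CauchyIntegrable.integrable_real {μ : Measure ℝ} (hμ : CauchyIntegrable μ) {T : Set ℝ}
    (hT : IsClosed T) (hμT : ∀ᵐ s ∂μ, s ∈ T) {x : ℝ} (hx : x ∉ T) :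
    Integrable (fun s : ℝ => 1 / (x - s)) μ := by
  have := (hμ.integrable hT hμT (z := x) fun y hy h => hx (by
    rw [ofReal_inj] at h; rwa [h])).re
  refine this.congr (.of_forall fun s => ?_)
  change ((1 : ℂ) / ((x : ℂ) - (s : ℂ))).re = _
  rw [← ofReal_sub, ← ofReal_one, ← ofReal_div]
  exact ofReal_re _

/-! ### Logarithmic potentials on the line. -/

/-- The logarithmic potential at real points. -/
def pot (μ : Measure ℝ) (x : ℝ) : ℝ := ∫ s, -Real.log |x - s| ∂μ

/-- The logarithmic moment of `μ` is finite. -/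
def LogIntegrable (μ : Measure ℝ) : Prop := Integrable (fun s : ℝ => Real.log (1 + |s|)) μ

theorem LogIntegrable.mono {μ ν : Measure ℝ} (h : LogIntegrable ν) (hle : μ ≤ ν) :
    LogIntegrable μ := Integrable.mono_measure h hle

theorem log_abs_sub_le (x s : ℝ) : Real.log |x - s| ≤ Real.log (1 + |x|) + Real.log (1 + |s|) := by
  rw [← Real.log_mul (by positivity) (by positivity)]
  rcases eq_or_ne (x - s) 0 with h | h
  · rw [h, abs_zero, Real.log_zero]
    exact Real.log_nonneg (by nlinarith [abs_nonneg x, abs_nonneg s])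
  · refine Real.log_le_log (abs_pos.2 h) ?_
    have := abs_sub_le x 0 s
    simp only [sub_zero, zero_sub, abs_neg] at this
    nlinarith [abs_nonneg x, abs_nonneg s, mul_nonneg (abs_nonneg x) (abs_nonneg s)]

theorem abs_log_abs_sub_le {δ x s : ℝ} (hδ : 0 < δ) (h : δ ≤ |x - s|) :
    |Real.log (|x - s|)| ≤ |Real.log δ| + Real.log (1 + |x|) + Real.log (1 + |s|) := by
  rw [abs_le']
  have h1 := log_abs_sub_le x s
  have h2 := Real.log_le_log hδ h
  have h3 := neg_abs_le (Real.log δ)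
  have h4 : 0 ≤ Real.log (1 + |x|) := Real.log_nonneg (by linarith [abs_nonneg x])
  have h5 : 0 ≤ Real.log (1 + |s|) := Real.log_nonneg (by linarith [abs_nonneg s])
  have h6 := abs_nonneg (Real.log δ)
  constructor <;> linarith

theorem exists_pos_le_abs_sub {T : Set ℝ} (hT : IsClosed T) {x : ℝ} (hx : x ∉ T) :
    ∃ δ > 0, ∀ s ∈ T, δ ≤ |x - s| := by
  obtain ⟨δ, hδ, hb⟩ := Metric.isOpen_iff.1 hT.isOpen_compl x hx
  refine ⟨δ, hδ, fun s hs => ?_⟩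
  by_contra h
  refine hb (show s ∈ ball x δ from ?_) hs
  rw [mem_ball, dist_comm, Real.dist_eq]
  exact not_le.1 h

theorem LogIntegrable.integrable_log {μ : Measure ℝ} [IsFiniteMeasure μ] (hμ : LogIntegrable μ)
    {T : Set ℝ} (hT : IsClosed T) (hμT : ∀ᵐ s ∂μ, s ∈ T) {x : ℝ} (hx : x ∉ T) :
    Integrable (fun s => -Real.log |x - s|) μ := by
  obtain ⟨δ, hδ, h⟩ := exists_pos_le_abs_sub hT hx
  refine ((integrable_const (|Real.log δ| + Real.log (1 + |x|))).add hμ).mono'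
    (Measurable.aestronglyMeasurable (by fun_prop)) ?_
  filter_upwards [hμT] with s hs
  simpa using abs_log_abs_sub_le hδ (h s hs)

theorem hasDerivAt_pot {μ : Measure ℝ} [IsFiniteMeasure μ] (hμ : LogIntegrable μ) {T : Set ℝ}
    (hT : IsClosed T) (hμT : ∀ᵐ s ∂μ, s ∈ T) {x : ℝ} (hx : x ∉ T) :
    HasDerivAt (pot μ) (-cauchyReal μ x) x := by
  obtain ⟨δ, hδ, h⟩ := exists_pos_le_abs_sub hT hx
  have hloc : ∀ s : ℝ, δ ≤ |x - s| → ∀ u ∈ ball x (δ / 2), δ / 2 ≤ |u - s| := by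
    intro s hs u hu
    rw [mem_ball, Real.dist_eq] at hu
    have := abs_sub_le x u s
    rw [abs_sub_comm x u] at this
    linarith
  have := (hasDerivAt_integral_of_dominated_loc_of_deriv_le (μ := μ)
    (F := fun u s => -Real.log |u - s|) (F' := fun u s => -(1 / (u - s)))
    (bound := fun s => (δ / 2)⁻¹) (ball_mem_nhds x (half_pos hδ)) ?_
    (hμ.integrable_log hT hμT hx) ?_ ?_ (integrable_const _) ?_).2
  · rw [integral_neg] at this
    exact this
  · exact .of_forall fun u => Measurable.aestronglyMeasurable (by fun_prop)
  · exact Measurable.aestronglyMeasurable (by fun_prop)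
  · filter_upwards [hμT] with s hs u hu
    rw [norm_neg, norm_div, norm_one, one_div, Real.norm_eq_abs]
    gcongr
    exact hloc s (h s hs) u hu
  · filter_upwards [hμT] with s hs u hu
    have hne : u - s ≠ 0 := abs_pos.1 ((half_pos hδ).trans_le (hloc s (h s hs) u hu))
    have h1 : HasDerivAt (fun u : ℝ => u - s) 1 u := (hasDerivAt_id u).sub_const _
    simpa [Real.log_abs] using (h1.log hne).fun_neg

/-! ### Truncated potentials. -/

/-- The truncated logarithmic potential. -/
def potTrunc (ε : ℝ) (μ : Measure ℝ) (x : ℝ) : ℝ := ∫ s, -Real.log (max |x - s| ε) ∂μ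

theorem abs_log_max_le {ε x s : ℝ} (hε : 0 < ε) :
    |Real.log (max |x - s| ε)| ≤ 2 * |Real.log ε| + Real.log (1 + |x|) + Real.log (1 + |s|) := by
  have h4 : 0 ≤ Real.log (1 + |x|) := Real.log_nonneg (by linarith [abs_nonneg x])
  have h5 : 0 ≤ Real.log (1 + |s|) := Real.log_nonneg (by linarith [abs_nonneg s])
  have h6 := abs_nonneg (Real.log ε)
  rcases le_total |x - s| ε with h | h
  · rw [max_eq_right h]; linarith
  · rw [max_eq_left h]; linarith [abs_log_abs_sub_le (s := s) hε h]

theorem LogIntegrable.integrable_trunc {μ : Measure ℝ} [IsFiniteMeasure μ] (hμ : LogIntegrable μ)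
    {ε : ℝ} (hε : 0 < ε) (x : ℝ) : Integrable (fun s => -Real.log (max |x - s| ε)) μ := by
  refine ((integrable_const (2 * |Real.log ε| + Real.log (1 + |x|))).add hμ).mono'
    (Measurable.aestronglyMeasurable (by fun_prop)) (.of_forall fun s => ?_)
  simpa using abs_log_max_le hε

/-- The truncations are continuous and increase to `pot` as ε decreases to 0. They take over the
role of the lower semicontinuity of potentials. -/
theorem continuous_potTrunc {μ : Measure ℝ} [IsFiniteMeasure μ] (hμ : LogIntegrable μ)
    {ε : ℝ} (hε : 0 < ε) : Continuous (potTrunc ε μ) := by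
  rw [continuous_iff_continuousAt]
  intro x
  refine continuousAt_of_dominated (μ := μ)
    (bound := fun s => (2 * |Real.log ε| + Real.log (2 + |x|)) + Real.log (1 + |s|))
    (.of_forall fun u => Measurable.aestronglyMeasurable (by fun_prop)) ?_
    ((integrable_const _).add hμ) (.of_forall fun s => ?_)
  · filter_upwards [ball_mem_nhds x one_pos] with u hu
    refine .of_forall fun s => ?_
    have h1 : |u| ≤ |x| + 1 := by
      rw [mem_ball, Real.dist_eq] at hu
      have := abs_sub_abs_le_abs_sub u x
      linarith
    have h2 : Real.log (1 + |u|) ≤ Real.log (2 + |x|) :=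
      Real.log_le_log (by positivity) (by linarith)
    rw [norm_neg, Real.norm_eq_abs]
    linarith [abs_log_max_le (x := u) (s := s) hε]
  · refine ContinuousAt.neg (ContinuousAt.log (by fun_prop) ?_)
    exact (lt_max_of_lt_right hε).ne'

theorem neg_log_max_le {ε x s : ℝ} (h : x ≠ s) :
    -Real.log (max |x - s| ε) ≤ -Real.log |x - s| :=
  neg_le_neg (Real.log_le_log (abs_pos.2 (sub_ne_zero.2 h)) (le_max_left _ _))

end Potentials

/-! ### Analytic continuation across the cuts -/

section Continuation

open Complex Metric Set Filter
open scoped ComplexConjugate Interval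

/-- Since the measure lives on a bounded set, the points u − s with u near z stay in a compact part
of the upper half-plane, where g and g' are bounded. It is applied to `logPrimitive` and then to
`log`. -/
theorem hasDerivAt_integral_comp_sub {μ : Measure ℝ} [IsFiniteMeasure μ] {M : ℝ}
    (hM : ∀ᵐ s ∂μ, |s| ≤ M) {g g' : ℂ → ℂ} (hg : ∀ w : ℂ, 0 < w.im → HasDerivAt g (g' w) w)
    (hg' : ContinuousOn g' {w | 0 < w.im}) {z : ℂ} (hz : 0 < z.im) :
    HasDerivAt (fun z : ℂ => ∫ s : ℝ, g (z - s) ∂μ) (∫ s : ℝ, g' (z - s) ∂μ) z := by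
  have hsub : ∀ u ∈ closedBall z (z.im / 2), ∀ s : ℝ, 0 < (u - s).im := by
    intro u hu s
    rw [mem_closedBall, Complex.dist_eq] at hu
    have := (abs_im_le_norm (u - z)).trans hu
    rw [sub_im, abs_le] at this
    simp only [sub_im, ofReal_im, sub_zero]
    linarith
  have hcg : ContinuousOn g {w | 0 < w.im} := fun w hw =>
    (hg w hw).continuousAt.continuousWithinAt
  have hball : ball z (z.im / 2) ⊆ closedBall z (z.im / 2) := ball_subset_closedBall
  have hbd : ∀ h : ℂ → ℂ, ContinuousOn h {w | 0 < w.im} →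
      ∃ C, ∀ u ∈ closedBall z (z.im / 2), ∀ s : ℝ, |s| ≤ M → ‖h (u - s)‖ ≤ C := by
    intro h hh
    have hK : IsCompact ((fun p : ℂ × ℝ => p.1 - (p.2 : ℂ)) ''
        (closedBall z (z.im / 2) ×ˢ Icc (-M) M)) :=
      ((isCompact_closedBall _ _).prod isCompact_Icc).image (by fun_prop)
    obtain ⟨C, hC⟩ := hK.exists_bound_of_continuousOn (hh.mono (by
      rintro _ ⟨p, hp, rfl⟩
      exact hsub _ hp.1 _))
    exact ⟨C, fun u hu s hs => hC _ ⟨(u, s), ⟨hu, abs_le.1 hs⟩, rfl⟩⟩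
  have hmeas : ∀ h : ℂ → ℂ, ContinuousOn h {w | 0 < w.im} → ∀ u ∈ closedBall z (z.im / 2),
      AEStronglyMeasurable (fun s : ℝ => h (u - s)) μ := by
    intro h hh u hu
    refine Continuous.aestronglyMeasurable ?_
    exact hh.comp_continuous (by fun_prop) fun s => hsub u hu s
  obtain ⟨C, hC⟩ := hbd g hcg
  obtain ⟨C', hC'⟩ := hbd g' hg'
  have hzz : z ∈ closedBall z (z.im / 2) := mem_closedBall_self (by positivity)
  refine (hasDerivAt_integral_of_dominated_loc_of_deriv_le (μ := μ)
    (F' := fun u s => g' (u - s)) (bound := fun _ => C') (ball_mem_nhds z (half_pos hz)) ?_ ?_ ?_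
    ?_ (integrable_const _) ?_).2
  · filter_upwards [ball_mem_nhds z (half_pos hz)] with u hu using hmeas g hcg u (hball hu)
  · exact (integrable_const C).mono' (hmeas g hcg z hzz) (hM.mono fun s hs => hC z hzz s hs)
  · exact hmeas g' hg' z hzz
  · exact hM.mono fun s hs u hu => hC' u (hball hu) s hs
  · refine .of_forall fun s u hu => ?_
    exact (hg _ (hsub u (hball hu) s)).comp_sub_const _ _

/-- A second primitive of `1 / w`. -/
def logPrimitive (w : ℂ) : ℂ := w * log w - w

theorem continuousWithinAt_log_upper {w : ℂ} (hw : w ≠ 0) :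
    ContinuousWithinAt log {z | 0 ≤ z.im} w := by
  by_cases h : w ∈ slitPlane
  · exact (continuousAt_clog h).continuousWithinAt
  · rw [mem_slitPlane_iff, not_or, not_lt, not_not] at h
    refine continuousWithinAt_log_of_re_neg_of_im_zero (lt_of_le_of_ne h.1 fun h0 => hw ?_) h.2
    exact Complex.ext h0 h.2

/-- Unlike the logarithm, w log w − w is continuous at 0 too. Hence the second primitive of the
Cauchy transform of a compactly supported finite measure has continuous boundary values on the whole
line, with no regularity of the measure assumed. -/
theorem continuousOn_logPrimitive : ContinuousOn logPrimitive {z | 0 ≤ z.im} := by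
  intro w hw
  rcases eq_or_ne w 0 with rfl | h0
  · refine ContinuousWithinAt.sub ?_ continuousWithinAt_id
    refine ContinuousAt.continuousWithinAt ?_
    have hlim : Tendsto (fun w : ℂ => |‖w‖ * Real.log ‖w‖| + ‖w‖ * Real.pi) (𝓝 0) (𝓝 0) := by
      have : Continuous (fun w : ℂ => |‖w‖ * Real.log ‖w‖| + ‖w‖ * Real.pi) :=
        ((Real.continuous_mul_log.comp continuous_norm).abs).add (by fun_prop)
      simpa using this.tendsto 0
    rw [ContinuousAt]
    simp only [zero_mul]
    refine squeeze_zero_norm (fun w => ?_) hlim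
    have h1 : ‖log w‖ ≤ |Real.log ‖w‖| + Real.pi := by
      refine (norm_le_abs_re_add_abs_im _).trans ?_
      rw [log_re, log_im]
      gcongr
      exact abs_arg_le_pi w
    rw [norm_mul, abs_mul, abs_norm, ← mul_add]
    gcongr
  · exact (continuousWithinAt_id.mul (continuousWithinAt_log_upper h0)).sub continuousWithinAt_id

theorem hasDerivAt_logPrimitive {w : ℂ} (hw : 0 < w.im) : HasDerivAt logPrimitive (log w) w := by
  have hs : w ∈ slitPlane := Or.inr hw.ne'
  have h := ((hasDerivAt_id w).fun_mul (hasDerivAt_log hs)).fun_sub (hasDerivAt_id w)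
  have h0 : w ≠ 0 := slitPlane_ne_zero hs
  refine h.congr_deriv ?_
  rw [id_eq, mul_inv_cancel₀ h0]
  ring

theorem logPrimitive_ofReal_re (x : ℝ) : (logPrimitive x).re = x * Real.log x - x := by
  simp [logPrimitive, log_re]

theorem integral_log_abs_sub (s a b : ℝ) :
    ∫ y in a..b, Real.log |y - s| =
      ((b - s) * Real.log (b - s) - (b - s)) - ((a - s) * Real.log (a - s) - (a - s)) := by
  simp only [Real.log_abs]
  rw [intervalIntegral.integral_comp_sub_right (fun y => Real.log y), integral_log]
  ring

/-- Justifies Fubini in `integral_logPrimitive_re_sub`. For |s| ≤ M the translate of the interval by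
s lies in [−R, R], so the integral of |log|y − s|| in y is bounded independently of s. -/
theorem integrable_prod_log {μ : Measure ℝ} [IsFiniteMeasure μ] {M : ℝ} (hM : ∀ᵐ s ∂μ, |s| ≤ M)
    (a b : ℝ) : Integrable (fun p : ℝ × ℝ => Real.log |p.1 - p.2|)
      ((volume.restrict (Ι a b)).prod μ) := by
  have hmeas : AEStronglyMeasurable (fun p : ℝ × ℝ => Real.log |p.1 - p.2|)
      ((volume.restrict (Ι a b)).prod μ) := Measurable.aestronglyMeasurable (by fun_prop)
  set R : ℝ := |a| + |b| + |M| with hR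
  have hii : ∀ s c d : ℝ, IntervalIntegrable (fun y => Real.log |y - s|) volume c d := by
    intro s c d
    simp only [Real.log_abs]
    have h := intervalIntegral.intervalIntegrable_log' (a := c - s) (b := d - s)
    simpa using h.comp_sub_right s
  have h0 : ∀ c d : ℝ, IntervalIntegrable (fun y => |Real.log (|y|)| ) volume c d := fun c d => by
    simpa using (hii 0 c d).norm
  rw [integrable_prod_iff' hmeas]
  refine ⟨.of_forall fun s => (intervalIntegrable_iff.1 (hii s a b)), ?_⟩
  refine (integrable_const (∫ y in (-R)..R, |Real.log (|y|)| )).mono'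
    (Measurable.aestronglyMeasurable (by fun_prop) :
      AEStronglyMeasurable (fun p : ℝ × ℝ => ‖Real.log |p.2 - p.1|‖)
        (μ.prod (volume.restrict (Ι a b)))).integral_prod_right' ?_
  filter_upwards [hM] with s hs
  rw [Real.norm_of_nonneg (by positivity)]
  have hbd : ∀ c ∈ ({a, b} : Set ℝ), -R ≤ c - s ∧ c - s ≤ R := by
    intro c hc
    have h1 : |c| ≤ |a| + |b| := by
      rcases hc with rfl | rfl
      · linarith [abs_nonneg b]
      · linarith [abs_nonneg a]
    have h2 := abs_le.1 h1
    have h3 := abs_le.1 (hs.trans (le_abs_self M))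
    constructor <;> linarith
  have hR0 : -R ≤ R := (hbd a (by simp)).1.trans (hbd a (by simp)).2
  have e : ∫ y in Ι a b, ‖Real.log |y - s|‖ = ∫ y in Ι (a - s) (b - s), |Real.log (|y|)| := by
    have h1 := intervalIntegral.abs_integral_eq_abs_integral_uIoc (μ := volume) (a := a) (b := b)
      (fun y => ‖Real.log |y - s|‖)
    have h2 := intervalIntegral.abs_integral_eq_abs_integral_uIoc (μ := volume) (a := a - s)
      (b := b - s) (fun y => |Real.log (|y|)| )
    rw [abs_of_nonneg (a := ∫ y in Ι a b, _) (by positivity)] at h1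
    rw [abs_of_nonneg (a := ∫ y in Ι (a - s) (b - s), _) (by positivity)] at h2
    rw [← h1, ← h2, ← intervalIntegral.integral_comp_sub_right (fun y => |Real.log (|y|)| ) s]
    rfl
  rw [e, intervalIntegral.integral_of_le hR0]
  refine setIntegral_mono_set ?_ (.of_forall fun y => abs_nonneg _) ?_
  · exact (intervalIntegrable_iff_integrableOn_Ioc_of_le hR0).1 (h0 _ _)
  · refine LE.le.eventuallyLE (show Ι (a - s) (b - s) ⊆ Ioc (-R) R from ?_)
    rw [uIoc]
    refine Ioc_subset_Ioc ?_ ?_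
    · exact le_min (hbd a (by simp)).1 (hbd b (by simp)).1
    · exact max_le (hbd a (by simp)).2 (hbd b (by simp)).2

/-- The primitive of the logarithmic potential. -/
theorem integral_logPrimitive_re_sub {μ : Measure ℝ} [IsFiniteMeasure μ] {M : ℝ}
    (hM : ∀ᵐ s ∂μ, |s| ≤ M) (a b : ℝ) :
    ∫ y in a..b, pot μ y =
      (∫ s : ℝ, logPrimitive (a - s) ∂μ).re - (∫ s : ℝ, logPrimitive (b - s) ∂μ).re := by
  have hint : ∀ x : ℝ, Integrable (fun s : ℝ => logPrimitive (x - s)) μ := by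
    intro x
    have hcont : Continuous (fun s : ℝ => logPrimitive (x - s)) :=
      continuousOn_logPrimitive.comp_continuous (by fun_prop) fun s => by simp
    obtain ⟨C, hC⟩ := (isCompact_Icc (a := -M) (b := M)).exists_bound_of_continuousOn
      hcont.continuousOn
    exact (integrable_const C).mono' hcont.aestronglyMeasurable
      (hM.mono fun s hs => hC s (abs_le.1 hs))
  have hre : ∀ x : ℝ, (∫ s : ℝ, logPrimitive (x - s) ∂μ).re =
      ∫ s : ℝ, ((x - s) * Real.log (x - s) - (x - s)) ∂μ := by
    intro x
    have := integral_re (hint x)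
    rw [RCLike.re_eq_complex_re] at this
    rw [← this]
    refine integral_congr_ae (.of_forall fun s => ?_)
    simpa using logPrimitive_ofReal_re (x - s)
  have hintr : ∀ x : ℝ, Integrable (fun s : ℝ => (x - s) * Real.log (x - s) - (x - s)) μ := by
    intro x
    refine (hint x).re.congr (.of_forall fun s => ?_)
    simpa using logPrimitive_ofReal_re (x - s)
  rw [hre, hre, ← integral_sub (hintr a) (hintr b)]
  simp only [pot]
  rw [intervalIntegral_integral_swap (f := fun y s => -Real.log |y - s|)
    (integrable_prod_log hM a b).neg]
  refine integral_congr_ae (.of_forall fun s => ?_)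
  simp only [intervalIntegral.integral_neg, integral_log_abs_sub]
  ring

/-- If the potential of a measure on the line agrees almost everywhere on an interval with a real
analytic function, then its Cauchy transform has an analytic continuation across that interval. -/
theorem exists_odd_continuation {μ : Measure ℝ} [IsFiniteMeasure μ] {M : ℝ}
    (hM : ∀ᵐ s ∂μ, |s| ≤ M) {x₀ r : ℝ} (hr : 0 < r) {W : ℂ → ℂ}
    (hW : DifferentiableOn ℂ W (ball (x₀ : ℂ) r)) (hWc : ∀ z, W (conj z) = conj (W z))
    {w : ℝ → ℝ} (hw : ∀ x ∈ Ioo (x₀ - r) (x₀ + r), HasDerivAt w (W x).re x) {ℓ : ℝ}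
    (h : ∀ᵐ x, x ∈ Ioo (x₀ - r) (x₀ + r) → 2 * pot μ x + w x = ℓ) :
    ∃ f : ℂ → ℂ, DifferentiableOn ℂ f (ball (x₀ : ℂ) r) ∧
      (∀ z ∈ ball (x₀ : ℂ) r, 0 < z.im → f z = 2 * cauchyTransform μ z - W z) ∧
      ∀ z ∈ ball (x₀ : ℂ) r, z.im < 0 → f z = -(2 * cauchyTransform μ z - W z) := by
  -- The potential is known only almost everywhere and the transform may have no boundary values, so
  -- everything is integrated twice: `W₁` and `W₂` are successive primitives of `W`, and `Λ` below
  -- is a second primitive of the transform that is continuous up to the axis.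
  obtain ⟨W₁, hW₁⟩ := hW.isExactOn_ball
  obtain ⟨W₂, hW₂⟩ := DifferentiableOn.isExactOn_ball
    (fun z hz => (hW₁ z hz).differentiableAt.differentiableWithinAt)
  have hmem : ∀ x : ℝ, (x : ℂ) ∈ ball (x₀ : ℂ) r ↔ x ∈ Ioo (x₀ - r) (x₀ + r) := by
    intro x
    rw [mem_ball, Complex.dist_eq, ← ofReal_sub, norm_real, Real.norm_eq_abs, abs_lt, mem_Ioo]
    constructor <;> rintro ⟨h1, h2⟩ <;> constructor <;> linarith
  have hx₀ : x₀ ∈ Ioo (x₀ - r) (x₀ + r) := by constructor <;> linarith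
  have hconn : ∀ x ∈ Ioo (x₀ - r) (x₀ + r), [[x₀, x]] ⊆ Ioo (x₀ - r) (x₀ + r) := fun x hx =>
    ordConnected_Ioo.uIcc_subset hx₀ hx
  set c : ℝ := (W₁ x₀).re - w x₀ with hc
  have hW₁re : ∀ x ∈ Ioo (x₀ - r) (x₀ + r), w x = (W₁ x).re - c := by
    intro x hx
    have hd : ∀ y ∈ Ioo (x₀ - r) (x₀ + r), HasDerivAt (fun y : ℝ => (W₁ y).re - w y) 0 y := by
      intro y hy
      have h1 := (hW₁ y ((hmem y).2 hy)).real_of_complex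
      simpa using h1.fun_sub (hw y hy)
    have := (convex_Ioo (x₀ - r) (x₀ + r)).is_const_of_fderivWithin_eq_zero (𝕜 := ℝ)
      (f := fun y : ℝ => (W₁ y).re - w y)
      (fun y hy => (hd y hy).differentiableAt.differentiableWithinAt) (fun y hy => by
        rw [fderivWithin_of_isOpen isOpen_Ioo hy, (hd y hy).hasFDerivAt.fderiv]
        ext; simp) hx₀ hx
    linarith
  set Λ : ℂ → ℂ := fun z => ∫ s : ℝ, logPrimitive (z - s) ∂μ with hΛ
  have hΛd : ∀ z : ℂ, 0 < z.im → HasDerivAt Λ (∫ s : ℝ, log (z - s) ∂μ) z := fun z hz =>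
    hasDerivAt_integral_comp_sub hM (fun w hw => hasDerivAt_logPrimitive hw)
      (fun w hw => (continuousAt_clog (Or.inr (ne_of_gt hw))).continuousWithinAt) hz
  have hΛd2 : ∀ z : ℂ, 0 < z.im →
      HasDerivAt (fun z : ℂ => ∫ s : ℝ, log (z - s) ∂μ) (cauchyTransform μ z) z := by
    intro z hz
    have := hasDerivAt_integral_comp_sub hM (g := log) (g' := fun w => w⁻¹)
      (fun w hw => hasDerivAt_log (Or.inr (ne_of_gt hw)))
      (fun w hw => (continuousAt_inv₀ (slitPlane_ne_zero
        (Or.inr (ne_of_gt hw)))).continuousWithinAt) hz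
    simpa [cauchyTransform] using this
  have hΛc : ContinuousOn Λ {z | 0 ≤ z.im} := by
    intro z hz
    have hK : IsCompact ((fun p : ℂ × ℝ => p.1 - (p.2 : ℂ)) ''
        ((closedBall z 1 ∩ {z | 0 ≤ z.im}) ×ˢ Icc (-M) M)) :=
      (((isCompact_closedBall _ _).inter_right (isClosed_le continuous_const continuous_im)).prod
        isCompact_Icc).image (by fun_prop)
    obtain ⟨C, hC⟩ := hK.exists_bound_of_continuousOn (continuousOn_logPrimitive.mono (by
      rintro _ ⟨p, hp, rfl⟩
      simpa using hp.1.2))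
    refine continuousWithinAt_of_dominated (bound := fun _ => C) ?_ ?_ (integrable_const _) ?_
    · filter_upwards [self_mem_nhdsWithin] with u hu
      refine Continuous.aestronglyMeasurable ?_
      exact continuousOn_logPrimitive.comp_continuous (by fun_prop) fun s => by simpa using hu
    · filter_upwards [self_mem_nhdsWithin, nhdsWithin_le_nhds (closedBall_mem_nhds z one_pos)]
        with u hu hu1
      filter_upwards [hM] with s hs
      exact hC _ ⟨(u, s), ⟨⟨hu1, hu⟩, abs_le.1 hs⟩, rfl⟩
    · refine .of_forall fun s => ?_
      refine (continuousOn_logPrimitive (z - s) (by simpa using hz)).comp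
        (f := fun u : ℂ => u - (s : ℂ)) (by fun_prop) ?_
      intro u hu
      simpa using hu
  -- Integrated along the interval, the hypothesis `h` says that the real part of 2Λ − W₂ is affine
  -- there. Subtracting the affine function leaves a function that is imaginary on the interval, as
  -- the reflection principle requires.
  obtain ⟨A, hA⟩ : ∃ A : ℝ, ∀ x ∈ Ioo (x₀ - r) (x₀ + r),
      (2 * Λ x - W₂ x).re = A - (c + ℓ) * x := by
    refine ⟨(2 * Λ x₀ - W₂ x₀).re + (c + ℓ) * x₀, fun x hx => ?_⟩
    have h1 : ∫ y in x₀..x, pot μ y = ∫ y in x₀..x, (ℓ + c - (W₁ y).re) / 2 := by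
      refine intervalIntegral.integral_congr_ae ?_
      filter_upwards [h] with y hy hy'
      have hyI := hconn x hx (uIoc_subset_uIcc hy')
      have := hy hyI
      rw [hW₁re y hyI] at this
      linarith
    have h2 : ∫ y in x₀..x, (ℓ + c - (W₁ y).re) / 2 =
        ((ℓ + c) * x - (W₂ x).re) / 2 - ((ℓ + c) * x₀ - (W₂ x₀).re) / 2 := by
      refine intervalIntegral.integral_eq_sub_of_hasDerivAt
        (f := fun y : ℝ => ((ℓ + c) * y - (W₂ y).re) / 2) ?_ ?_
      · intro y hy
        have h1 := (hW₂ y ((hmem y).2 (hconn x hx hy))).real_of_complex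
        have h3 := ((hasDerivAt_id y).const_mul (ℓ + c)).fun_sub h1
        simpa using h3.div_const 2
      · refine ContinuousOn.intervalIntegrable ?_
        refine ContinuousOn.div_const (continuousOn_const.sub ?_) _
        intro y hy
        have := (hW₁ y ((hmem y).2 (hconn x hx hy))).continuousAt
        exact (continuous_re.continuousAt.comp (this.comp continuous_ofReal.continuousAt)
          |>.continuousWithinAt)
    rw [integral_logPrimitive_re_sub hM, h2] at h1
    simp only [sub_re, mul_re, re_ofNat, im_ofNat, zero_mul, sub_zero, hΛ]
    linarith
  obtain ⟨Ψ, hΨd, hΨu, hΨl⟩ := exists_differentiableOn_reflection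
    (Φ := fun z => 2 * Λ z - W₂ z - (A - (c + ℓ) * z)) (x₀ := x₀) (r := r) (by
      refine ContinuousOn.sub (ContinuousOn.sub (continuousOn_const.mul
        (hΛc.mono inter_subset_right)) ?_) (by fun_prop)
      exact fun z hz => (hW₂ z hz.1).continuousAt.continuousWithinAt)
    (fun z hz him => by
      have h1 := (hΛd z him).differentiableAt
      have h2 := (hW₂ z hz).differentiableAt
      fun_prop)
    (fun x hx => by
      have := hA x ((hmem x).1 hx)
      simp only [sub_re, this, ofReal_re, ← ofReal_add, ← ofReal_mul]
      ring)
  have hd2 : ∀ z ∈ ball (x₀ : ℂ) r, 0 < z.im → (∀ᶠ u in 𝓝 z,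
      HasDerivAt (fun z => 2 * Λ z - W₂ z - (A - (c + ℓ) * z))
        (2 * (∫ s : ℝ, log (u - s) ∂μ) - W₁ u + (c + ℓ)) u) ∧
      HasDerivAt (fun u : ℂ => 2 * (∫ s : ℝ, log (u - s) ∂μ) - W₁ u + (c + ℓ))
        (2 * cauchyTransform μ z - W z) z := by
    intro z hz him
    constructor
    · filter_upwards [isOpen_ball.mem_nhds hz,
        (isOpen_lt continuous_const continuous_im).mem_nhds him] with u hu hu'
      have h1 := (((hΛd u hu').const_mul 2).fun_sub (hW₂ u hu)).fun_sub
        (((hasDerivAt_id u).const_mul ((c : ℂ) + ℓ)).const_sub (A : ℂ))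
      exact h1.congr_deriv (by ring)
    · exact (((hΛd2 z him).const_mul 2).fun_sub (hW₁ z hz)).add_const _
  -- Two derivatives undo the two integrations. Below the axis the reflected function is −conj
  -- Φ(conj z), and the symmetry of `W` and of the transform under conjugation produces the opposite
  -- sign.
  refine ⟨deriv (deriv Ψ), (hΨd.deriv isOpen_ball).deriv isOpen_ball, ?_, ?_⟩
  · intro z hz him
    obtain ⟨h1, h2⟩ := hd2 z hz him
    have e1 : deriv Ψ =ᶠ[𝓝 z] fun u : ℂ => 2 * (∫ s : ℝ, log (u - s) ∂μ) - W₁ u + (c + ℓ) := by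
      filter_upwards [h1, (isOpen_lt continuous_const continuous_im).mem_nhds him] with u hu hu'
      refine (hu.congr_of_eventuallyEq ?_).deriv
      filter_upwards [(isOpen_lt continuous_const continuous_im).mem_nhds hu'] with v hv
      exact hΨu v (le_of_lt hv)
    rw [e1.deriv_eq, h2.deriv]
  · intro z hz him
    obtain ⟨h1, h2⟩ := hd2 (conj z) (conj_mem_ball_ofReal hz) (by simpa using him)
    have e1 : deriv Ψ =ᶠ[𝓝 z] fun u : ℂ =>
        -conj (2 * (∫ s : ℝ, log (conj u - s) ∂μ) - W₁ (conj u) + (c + ℓ)) := by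
      filter_upwards [continuous_conj.continuousAt.eventually h1,
        (isOpen_lt continuous_im continuous_const).mem_nhds him] with u hu hu'
      have h3 := hu.conj_conj.neg
      rw [conj_conj] at h3
      refine (h3.congr_of_eventuallyEq ?_).deriv
      filter_upwards [(isOpen_lt continuous_im continuous_const).mem_nhds hu'] with v hv
      exact hΨl v hv
    rw [e1.deriv_eq]
    have h3 := h2.conj_conj.neg
    rw [conj_conj] at h3
    refine h3.deriv.trans ?_
    rw [map_sub, map_mul, ← hWc, conj_conj, ← cauchyTransform_conj, conj_conj, conj_ofNat]

end Continuation

/-! ### Logarithmic energies -/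

section Energy

open Metric Set Filter
open scoped ENNReal

theorem measurable_absLogKernel : Measurable absLogKernel := by
  unfold absLogKernel
  refine Measurable.ite (measurableSet_eq_fun measurable_fst measurable_snd) measurable_const ?_
  fun_prop

theorem absLogKernel_swap (p : ℝ × ℝ) : absLogKernel p.swap = absLogKernel p := by
  simp only [absLogKernel, Prod.fst_swap, Prod.snd_swap, eq_comm (a := p.2), abs_sub_comm p.2]

theorem HasFiniteEnergy.symm {μ ν : Measure ℝ} [SFinite μ] [SFinite ν] (h : HasFiniteEnergy μ ν) :
    HasFiniteEnergy ν μ := by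
  rw [HasFiniteEnergy, ← lintegral_prod_swap]
  simpa only [absLogKernel_swap, HasFiniteEnergy] using h

theorem logEnergy_comm (μ ν : Measure ℝ) [SFinite μ] [SFinite ν] :
    logEnergy μ ν = logEnergy ν μ := by
  rw [logEnergy, logEnergy, ← integral_prod_swap]
  simp only [Prod.fst_swap, Prod.snd_swap, abs_sub_comm]

theorem HasFiniteEnergy.mono {μ μ' ν ν' : Measure ℝ} [SFinite ν] [SFinite ν']
    (h : HasFiniteEnergy μ' ν') (h₁ : μ ≤ μ') (h₂ : ν ≤ ν') : HasFiniteEnergy μ ν :=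
  (lintegral_mono' (Measure.prod_mono h₁ h₂) le_rfl).trans_lt h

theorem HasFiniteEnergy.add_left {μ μ' ν : Measure ℝ} [SFinite μ] [SFinite μ'] [SFinite ν]
    (h : HasFiniteEnergy μ ν) (h' : HasFiniteEnergy μ' ν) : HasFiniteEnergy (μ + μ') ν := by
  rw [HasFiniteEnergy, Measure.add_prod, lintegral_add_measure]
  exact ENNReal.add_lt_top.2 ⟨h, h'⟩

theorem HasFiniteEnergy.add_right {μ ν ν' : Measure ℝ} [SFinite μ] [SFinite ν] [SFinite ν']
    (h : HasFiniteEnergy μ ν) (h' : HasFiniteEnergy μ ν') : HasFiniteEnergy μ (ν + ν') :=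
  (h.symm.add_left h'.symm).symm

theorem HasFiniteEnergy.smul_left {μ ν : Measure ℝ} [SFinite μ] [SFinite ν]
    (h : HasFiniteEnergy μ ν) (c : NNReal) : HasFiniteEnergy (c • μ) ν := by
  rw [HasFiniteEnergy, Measure.prod_smul_left, lintegral_smul_measure]
  exact ENNReal.mul_lt_top (by simp) h

theorem HasFiniteEnergy.smul_right {μ ν : Measure ℝ} [SFinite μ] [SFinite ν]
    (h : HasFiniteEnergy μ ν) (c : NNReal) : HasFiniteEnergy μ (c • ν) :=
  (h.symm.smul_left c).symm

theorem HasFiniteEnergy.integrable {μ ν : Measure ℝ} (h : HasFiniteEnergy μ ν) :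
    Integrable (fun p : ℝ × ℝ => Real.log (1 / |p.1 - p.2|)) (μ.prod ν) := by
  refine ⟨Measurable.aestronglyMeasurable (by fun_prop), lt_of_le_of_lt ?_ h⟩
  refine lintegral_mono fun p => ?_
  rw [absLogKernel]
  split_ifs
  · exact le_top
  · simp only [one_div, Real.log_inv, enorm_neg, Real.enorm_eq_ofReal_abs]
    exact le_rfl

theorem logEnergy_add_left {μ μ' ν : Measure ℝ} [SFinite μ] [SFinite μ'] [SFinite ν]
    (h : HasFiniteEnergy μ ν) (h' : HasFiniteEnergy μ' ν) :
    logEnergy (μ + μ') ν = logEnergy μ ν + logEnergy μ' ν := by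
  rw [logEnergy, Measure.add_prod, integral_add_measure h.integrable h'.integrable]
  rfl

theorem logEnergy_add_right {μ ν ν' : Measure ℝ} [SFinite μ] [SFinite ν] [SFinite ν']
    (h : HasFiniteEnergy μ ν) (h' : HasFiniteEnergy μ ν') :
    logEnergy μ (ν + ν') = logEnergy μ ν + logEnergy μ ν' := by
  rw [logEnergy_comm, logEnergy_add_left h.symm h'.symm, logEnergy_comm ν, logEnergy_comm ν']

theorem logEnergy_smul_left {μ ν : Measure ℝ} [SFinite μ] [SFinite ν] (c : NNReal) :
    logEnergy (c • μ) ν = c * logEnergy μ ν := by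
  rw [logEnergy, Measure.prod_smul_left, integral_smul_nnreal_measure]
  rfl

theorem logEnergy_smul_right {μ ν : Measure ℝ} [SFinite μ] [SFinite ν] (c : NNReal) :
    logEnergy μ (c • ν) = c * logEnergy μ ν := by
  rw [logEnergy_comm, logEnergy_smul_left, logEnergy_comm]

theorem neg_log_eq (x s : ℝ) : Real.log (1 / |x - s|) = -Real.log |x - s| := by
  rw [one_div, Real.log_inv]

theorem HasFiniteEnergy.integrable_pot {μ ν : Measure ℝ} [SFinite μ] [SFinite ν]
    (h : HasFiniteEnergy ν μ) : Integrable (pot μ) ν := by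
  have := h.integrable.integral_prod_left
  simp only [neg_log_eq] at this
  exact this

theorem HasFiniteEnergy.ae_integrable_log {μ ν : Measure ℝ} [SFinite μ] [SFinite ν]
    (h : HasFiniteEnergy ν μ) : ∀ᵐ x ∂ν, Integrable (fun s => -Real.log |x - s|) μ := by
  simpa only [neg_log_eq] using h.integrable.prod_right_ae

theorem logEnergy_eq_integral_pot {μ ν : Measure ℝ} [SFinite μ] [SFinite ν]
    (h : HasFiniteEnergy ν μ) : logEnergy ν μ = ∫ x, pot μ x ∂ν := by
  rw [logEnergy, integral_prod _ h.integrable]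
  simp only [neg_log_eq, pot]

/-- An atom at x would charge the diagonal point (x, x), where the kernel is infinite. -/
theorem HasFiniteEnergy.measure_singleton {μ : Measure ℝ} [SFinite μ] (h : HasFiniteEnergy μ μ)
    (x : ℝ) : μ {x} = 0 := by
  by_contra h0
  refine absurd h (not_lt.2 ?_)
  have h1 : ∫⁻ p in ({x} ×ˢ {x} : Set (ℝ × ℝ)), absLogKernel p ∂(μ.prod μ) ≤
      ∫⁻ p, absLogKernel p ∂(μ.prod μ) := setLIntegral_le_lintegral _ _
  refine le_trans ?_ h1
  rw [setLIntegral_congr_fun (g := fun _ => ⊤)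
    ((measurableSet_singleton x).prod (measurableSet_singleton x)) (by
      rintro ⟨a, b⟩ ⟨ha, hb⟩
      simp only [mem_singleton_iff] at ha hb
      simp [absLogKernel, ha, hb])]
  rw [setLIntegral_const, Measure.prod_prod, ENNReal.top_mul (mul_ne_zero h0 h0)]

/-- Finite energy makes the potential converge absolutely at some point x. Away from x, log(1 + |s|)
is at most log|x − s| plus a constant; within distance 1 of x it is bounded. -/
theorem HasFiniteEnergy.logIntegrable {μ : Measure ℝ} [IsFiniteMeasure μ]
    (h : HasFiniteEnergy μ μ) : LogIntegrable μ := by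
  rcases eq_or_ne μ 0 with h0 | h0
  · rw [h0]; exact integrable_zero_measure
  have := NeZero.mk h0
  obtain ⟨x, hx⟩ := h.ae_integrable_log.exists
  have hb : Integrable (fun s => |Real.log 1| + Real.log (2 + |x|) + ‖-Real.log |x - s|‖) μ :=
    (integrable_const _).add hx.norm
  refine hb.mono' (Measurable.aestronglyMeasurable (by fun_prop)) (.of_forall fun s => ?_)
  rw [Real.norm_of_nonneg (Real.log_nonneg (by linarith [abs_nonneg s])), norm_neg,
    Real.norm_eq_abs, Real.log_one, abs_zero, zero_add]
  rcases le_or_gt 1 |x - s| with h1 | h1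
  · have h2 : 1 + |s| ≤ (2 + |x|) * |x - s| := by
      have := abs_sub_abs_le_abs_sub s x
      rw [abs_sub_comm] at this
      nlinarith [abs_nonneg x]
    calc Real.log (1 + |s|) ≤ Real.log ((2 + |x|) * |x - s|) := by
          refine Real.log_le_log (by positivity) h2
      _ = Real.log (2 + |x|) + Real.log |x - s| :=
          Real.log_mul (by positivity) (by positivity)
      _ ≤ _ := by gcongr; exact le_abs_self _
  · have h2 : Real.log (1 + |s|) ≤ Real.log (2 + |x|) := by
      refine Real.log_le_log (by positivity) ?_
      have := abs_sub_abs_le_abs_sub s x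
      rw [abs_sub_comm] at this
      linarith
    linarith [abs_nonneg (Real.log |x - s|)]

/-! ### Variations of the energy. -/

/-- The second order expansion of the energy. -/
theorem logEnergy_perturb {ν ν' α β : Measure ℝ} [IsFiniteMeasure ν] [IsFiniteMeasure ν']
    [IsFiniteMeasure α] [IsFiniteMeasure β] (h : ν' + α = ν + β) (hα : α ≤ ν)
    (hνν : HasFiniteEnergy ν ν) (hνβ : HasFiniteEnergy ν β) (hββ : HasFiniteEnergy β β) :
    HasFiniteEnergy ν' ν' ∧ logEnergy ν' ν' = logEnergy ν ν + 2 * (logEnergy ν β - logEnergy ν α) +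
      (logEnergy β β - 2 * logEnergy β α + logEnergy α α) := by
  -- The perturbed measure ν − α + β is described by an equation without subtraction. All measures
  -- involved lie below ν + β, so finiteness of its energy gives that of all the others, and the
  -- expansion comes from expanding both sides of the equation.
  have hle : ν' ≤ ν + β := h ▸ Measure.le_add_right le_rfl
  have hsum : HasFiniteEnergy (ν + β) (ν + β) :=
    (hνν.add_right hνβ).add_left (hνβ.symm.add_right hββ)
  have hαle : α ≤ ν + β := Measure.le_add_right hα
  have h1 : HasFiniteEnergy ν' ν' := hsum.mono hle hle
  have h2 : HasFiniteEnergy ν' α := hsum.mono hle hαle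
  have h3 : HasFiniteEnergy α α := hsum.mono hαle hαle
  have h4 : HasFiniteEnergy ν α := hνν.mono le_rfl hα
  have h5 : HasFiniteEnergy β α := hνβ.symm.mono le_rfl hα
  have e1 : logEnergy (ν' + α) (ν' + α) = logEnergy (ν + β) (ν + β) := by rw [h]
  have e2 : logEnergy (ν' + α) α = logEnergy (ν + β) α := by rw [h]
  rw [logEnergy_add_left (h1.add_right h2) (h2.symm.add_right h3), logEnergy_add_right h1 h2,
    logEnergy_add_right h2.symm h3, logEnergy_add_left (hνν.add_right hνβ)
    (hνβ.symm.add_right hββ), logEnergy_add_right hνν hνβ, logEnergy_add_right hνβ.symm hββ,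
    logEnergy_comm α ν', logEnergy_comm β ν] at e1
  rw [logEnergy_add_left h2 h3, logEnergy_add_left h4 h5] at e2
  exact ⟨h1, by linarith⟩

theorem logEnergy_perturb_left {ν ν' α β κ : Measure ℝ} [IsFiniteMeasure ν] [IsFiniteMeasure ν']
    [IsFiniteMeasure α] [IsFiniteMeasure β] [SFinite κ] (h : ν' + α = ν + β) (hα : α ≤ ν)
    (hνκ : HasFiniteEnergy ν κ) (hβκ : HasFiniteEnergy β κ) :
    HasFiniteEnergy ν' κ ∧ logEnergy ν' κ = logEnergy ν κ + logEnergy β κ - logEnergy α κ := by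
  have hle : ν' ≤ ν + β := h ▸ Measure.le_add_right le_rfl
  have hsum : HasFiniteEnergy (ν + β) κ := hνκ.add_left hβκ
  have h1 : HasFiniteEnergy ν' κ := hsum.mono hle le_rfl
  have h2 : HasFiniteEnergy α κ := hνκ.mono hα le_rfl
  have e : logEnergy (ν' + α) κ = logEnergy (ν + β) κ := by rw [h]
  rw [logEnergy_add_left h1 h2, logEnergy_add_left hνκ hβκ] at e
  exact ⟨h1, by linarith⟩

/-- The passage to the first variation: divide by ε and let ε tend to 0. -/
theorem nonneg_of_forall_small {P Q δ : ℝ} (hδ : 0 < δ)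
    (h : ∀ ε : ℝ, 0 < ε → ε ≤ δ → 0 ≤ ε * P + ε ^ 2 * Q) : 0 ≤ P := by
  have hlim : Tendsto (fun ε : ℝ => P + ε * Q) (𝓝[>] 0) (𝓝 P) := by
    have : ContinuousAt (fun ε : ℝ => P + ε * Q) 0 := by fun_prop
    simpa using this.tendsto.mono_left nhdsWithin_le_nhds
  refine ge_of_tendsto hlim ?_
  filter_upwards [Ioc_mem_nhdsGT hδ] with ε hε
  have := h ε hε.1 hε.2
  have e : ε * P + ε ^ 2 * Q = ε * (P + ε * Q) := by ring
  rw [e] at this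
  exact nonneg_of_mul_nonneg_right this hε.1

/-- Where |x − s| ≤ 1 translation invariance bounds the integral by the constant ∫|log|y|| over [−1,
1]; elsewhere the kernel is at most log(1 + |R|) + log(1 + |s|). -/
theorem lintegral_restrict_absLogKernel_le {R : ℝ} (hR : 0 ≤ R) :
    ∃ C : ℝ, 0 ≤ C ∧ ∀ s : ℝ, ∫⁻ x in Icc (-R) R, absLogKernel (x, s) ≤
      ENNReal.ofReal (C + 2 * R * Real.log (1 + |s|)) := by
  have h0 : IntervalIntegrable (fun y : ℝ => Real.log y) volume (-1) 1 :=
    intervalIntegral.intervalIntegrable_log'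
  have h1 : Integrable (fun y : ℝ => (Ioc (-1 : ℝ) 1).indicator (fun y => |Real.log y|) y) := by
    rw [integrable_indicator_iff measurableSet_Ioc]
    exact ((intervalIntegrable_iff_integrableOn_Ioc_of_le (by norm_num)).1 h0).norm
  set K : ℝ := ∫ y : ℝ, (Ioc (-1 : ℝ) 1).indicator (fun y => |Real.log y|) y with hK
  have hK0 : 0 ≤ K := integral_nonneg fun y => indicator_nonneg (fun _ _ => abs_nonneg _) _
  have hlog : 0 ≤ Real.log (1 + |R|) := Real.log_nonneg (by linarith [abs_nonneg R])
  refine ⟨K + 2 * R * Real.log (1 + |R|), by positivity, fun s => ?_⟩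
  have hlogs : 0 ≤ Real.log (1 + |s|) := Real.log_nonneg (by linarith [abs_nonneg s])
  have hb : ∀ᵐ x ∂(volume.restrict (Icc (-R) R)), absLogKernel (x, s) ≤
      ENNReal.ofReal ((Ioc (-1 : ℝ) 1).indicator (fun y => |Real.log y|) (x - s)) +
        ENNReal.ofReal (Real.log (1 + |R|) + Real.log (1 + |s|)) := by
    have hne : ∀ᵐ x ∂(volume.restrict (Icc (-R) R)), x ≠ s :=
      ae_restrict_of_ae (by simp [ae_iff])
    filter_upwards [hne, ae_restrict_mem measurableSet_Icc] with x hx hxR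
    rw [absLogKernel, if_neg hx, ← ENNReal.ofReal_add
      (indicator_nonneg (fun _ _ => abs_nonneg _) _) (by positivity)]
    refine ENNReal.ofReal_le_ofReal ?_
    simp only [Real.log_abs]
    by_cases hI : x - s ∈ Ioc (-1 : ℝ) 1
    · rw [indicator_of_mem hI]; linarith
    · rw [indicator_of_notMem hI, zero_add]
      have h1 : 1 ≤ |x - s| := by
        by_contra h
        rw [not_le, abs_lt] at h
        exact hI ⟨h.1, h.2.le⟩
      have h2 := log_abs_sub_le x s
      have h3 : Real.log (1 + |x|) ≤ Real.log (1 + |R|) := by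
        refine Real.log_le_log (by positivity) ?_
        have := abs_le.2 hxR
        linarith [le_abs_self R]
      rw [← Real.log_abs, abs_of_nonneg (Real.log_nonneg h1)]
      linarith
  refine (lintegral_mono_ae hb).trans ?_
  rw [lintegral_add_right _ measurable_const, setLIntegral_const, Real.volume_Icc]
  have e1 : ∫⁻ x in Icc (-R) R, ENNReal.ofReal
      ((Ioc (-1 : ℝ) 1).indicator (fun y => |Real.log y|) (x - s)) ≤ ENNReal.ofReal K := by
    refine (setLIntegral_le_lintegral _ _).trans ?_
    rw [lintegral_sub_right_eq_self (fun y => ENNReal.ofReal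
      ((Ioc (-1 : ℝ) 1).indicator (fun y => |Real.log y|) y)) s, hK,
      ofReal_integral_eq_lintegral_ofReal h1
        (.of_forall fun y => indicator_nonneg (fun _ _ => abs_nonneg _) _)]
  refine (add_le_add_left e1 _).trans ?_
  have hR2 : 0 ≤ R - -R := by linarith
  rw [← ENNReal.ofReal_mul (by positivity), ← ENNReal.ofReal_add hK0 (by positivity),
    abs_of_nonneg hR]
  refine ENNReal.ofReal_le_ofReal (le_of_eq ?_)
  ring

/-- Measures of bounded density on bounded sets have finite energy with respect to measures with
a logarithmic moment. -/
theorem hasFiniteEnergy_volume_restrict {R : ℝ} (hR : 0 ≤ R) {μ : Measure ℝ} [IsFiniteMeasure μ]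
    (hμ : LogIntegrable μ) : HasFiniteEnergy (volume.restrict (Icc (-R) R)) μ := by
  obtain ⟨C, -, hC⟩ := lintegral_restrict_absLogKernel_le hR
  rw [HasFiniteEnergy, lintegral_prod_symm _ measurable_absLogKernel.aemeasurable]
  refine (lintegral_mono hC).trans_lt ?_
  have : Integrable (fun s => C + 2 * R * Real.log (1 + |s|)) μ :=
    (integrable_const _).add (Integrable.const_mul hμ _)
  exact this.lintegral_lt_top

theorem logIntegrable_volume_restrict (R : ℝ) : LogIntegrable (volume.restrict (Icc (-R) R)) := by
  refine ContinuousOn.integrableOn_Icc (ContinuousOn.log (by fun_prop) fun s _ => ?_)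
  positivity

end Energy

/-! ### The constraint measures -/

section Constraint

open Metric Set Filter
open scoped ENNReal

/-- Substituting x = −u² gives |x|^(−1/2) |dx| = 2 du, so the constraint is a multiple of an image
of Lebesgue measure on a half-line. Masses, transforms and potentials of the constraint are computed
in the variable u. -/
theorem constraintMeasure_eq_map {c s : ℝ} (hs : 0 < s) :
    constraintMeasure c s = ENNReal.ofReal (2 * (√c / (Real.pi * s))) •
      (volume.restrict (Ioi (0 : ℝ))).map fun u : ℝ => -u ^ 2 := by
  have hf : Measurable fun u : ℝ => -u ^ 2 := by fun_prop
  have hdens : Measurable fun x : ℝ =>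
      ENNReal.ofReal (√c / (Real.pi * s) * |x| ^ (-(1 / 2) : ℝ)) := by fun_prop
  ext E hE
  rw [constraintMeasure, withDensity_apply _ hE, Measure.smul_apply, Measure.map_apply hf hE,
    smul_eq_mul, ← lintegral_indicator hE, ← restrict_Iio_eq_restrict_Iic]
  have himg : (fun u : ℝ => -u ^ 2) '' Ioi 0 = Iio 0 := by
    ext x
    simp only [mem_image, mem_Ioi, mem_Iio]
    constructor
    · rintro ⟨u, hu, rfl⟩; nlinarith
    · intro hx
      exact ⟨√(-x), Real.sqrt_pos.2 (by linarith), by rw [Real.sq_sqrt (by linarith)]; ring⟩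
  rw [← himg, lintegral_image_eq_lintegral_abs_deriv_mul measurableSet_Ioi
    (f' := fun u => -(2 * u)) (fun u _ => by
      simpa using ((hasDerivAt_id u).fun_pow 2).fun_neg.hasDerivWithinAt)]
  · have h1 : ∀ u ∈ Ioi (0 : ℝ), ENNReal.ofReal |-(2 * u)| * E.indicator (fun x =>
        ENNReal.ofReal (√c / (Real.pi * s) * |x| ^ (-(1 / 2) : ℝ))) (-u ^ 2) =
        ((fun u : ℝ => -u ^ 2) ⁻¹' E).indicator
          (fun _ => ENNReal.ofReal (2 * (√c / (Real.pi * s)))) u := by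
      intro u hu
      rw [mem_Ioi] at hu
      by_cases hE : -u ^ 2 ∈ E
      · rw [indicator_of_mem hE, indicator_of_mem (by exact hE), ← ENNReal.ofReal_mul (by positivity)]
        congr 1
        rw [abs_neg, abs_neg, abs_of_pos (by positivity), abs_of_pos (by positivity : 0 < u ^ 2),
          Real.rpow_neg (by positivity), ← Real.sqrt_eq_rpow, Real.sqrt_sq hu.le]
        field_simp
      · rw [indicator_of_notMem hE, indicator_of_notMem (by exact hE), mul_zero]
    rw [setLIntegral_congr_fun measurableSet_Ioi h1, lintegral_indicator (hf hE), setLIntegral_const]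
  · intro u hu v hv huv
    simp only [neg_inj] at huv
    exact (pow_left_inj₀ (le_of_lt hu) (le_of_lt hv) two_ne_zero).1 huv

theorem constraintMeasure_Ioi (c s : ℝ) : constraintMeasure c s (Ioi 0) = 0 := by
  rw [constraintMeasure, withDensity_apply _ measurableSet_Ioi,
    Measure.restrict_restrict measurableSet_Ioi, Ioi_inter_Iic]
  simp

theorem ae_constraintMeasure (c s : ℝ) : ∀ᵐ x ∂(constraintMeasure c s), x ∈ Iic (0 : ℝ) := by
  rw [ae_iff]
  simpa using! constraintMeasure_Ioi c s

instance constraintMeasure_nullSingleton (c s : ℝ) :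
    NullSingletonClass (constraintMeasure c s) := by
  unfold constraintMeasure; infer_instance

theorem lintegral_constraintMeasure {c s : ℝ} (hs : 0 < s) {f : ℝ → ℝ≥0∞} (hf : Measurable f) :
    ∫⁻ x, f x ∂(constraintMeasure c s) =
      ENNReal.ofReal (2 * (√c / (Real.pi * s))) * ∫⁻ u in Ioi (0 : ℝ), f (-u ^ 2) := by
  rw [constraintMeasure_eq_map hs, lintegral_smul_measure, lintegral_map hf (by fun_prop), smul_eq_mul]

theorem constraintMeasure_Iic {c s : ℝ} (hc : 0 < c) (hs : 0 < s) (R : ℝ) :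
    constraintMeasure c s (Iic R) = ⊤ := by
  rw [constraintMeasure_eq_map hs, Measure.smul_apply, Measure.map_apply (by fun_prop)
    measurableSet_Iic, smul_eq_mul]
  refine ENNReal.mul_eq_top.2 (Or.inl ⟨?_, ?_⟩)
  · have := Real.pi_pos
    have := Real.sqrt_pos.2 hc
    simp only [ne_eq, ENNReal.ofReal_eq_zero, not_le]
    positivity
  · refine top_unique ?_
    rw [← Real.volume_Ioi (a := √|R|)]
    refine le_trans (measure_mono ?_) (Measure.le_restrict_apply _ _)
    intro u hu
    rw [mem_Ioi] at hu
    have h0 : 0 < u := (Real.sqrt_nonneg _).trans_lt hu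
    refine ⟨?_, h0⟩
    rw [mem_preimage, mem_Iic]
    have := (Real.sqrt_lt' h0).1 hu
    linarith [neg_abs_le R]

theorem constraintMeasure_pos_of_isOpen {c s : ℝ} (hc : 0 < c) (hs : 0 < s) {U : Set ℝ}
    (hU : IsOpen U) {x : ℝ} (hx : x ∈ U) (hx0 : x < 0) : 0 < constraintMeasure c s U := by
  rw [constraintMeasure_eq_map hs, Measure.smul_apply, Measure.map_apply (by fun_prop)
    hU.measurableSet, smul_eq_mul, Measure.restrict_apply ((by fun_prop : Measurable
      fun u : ℝ => -u ^ 2) hU.measurableSet)]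
  refine ENNReal.mul_pos ?_ ?_
  · have := Real.pi_pos
    have := Real.sqrt_pos.2 hc
    simp only [ne_eq, ENNReal.ofReal_eq_zero, not_le]
    positivity
  · refine (IsOpen.measure_pos _ ((hU.preimage (by fun_prop)).inter isOpen_Ioi)
      ⟨√(-x), ?_, ?_⟩).ne'
    · rw [mem_preimage, Real.sq_sqrt (by linarith)]
      simpa using hx
    · exact Real.sqrt_pos.2 (by linarith)

theorem cauchyIntegrable_constraintMeasure {c s : ℝ} (hs : 0 < s) :
    CauchyIntegrable (constraintMeasure c s) := by
  refine ⟨measurable_inv_one_add_abs.aestronglyMeasurable, ?_⟩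
  rw [HasFiniteIntegral, lintegral_constraintMeasure hs (by fun_prop)]
  refine ENNReal.mul_lt_top ENNReal.ofReal_lt_top ?_
  have := (integrable_inv_one_add_sq.restrict (s := Ioi (0 : ℝ))).2
  rw [HasFiniteIntegral] at this
  refine lt_of_eq_of_lt (lintegral_congr fun u => ?_) this
  rw [abs_neg, abs_of_nonneg (sq_nonneg u)]

theorem integral_Ioi_inv_add_sq {x : ℝ} (hx : 0 < x) :
    ∫ u in Ioi (0 : ℝ), (x + u ^ 2)⁻¹ = Real.pi / (2 * √x) := by
  have hs : 0 < √x := Real.sqrt_pos.2 hx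
  have h1 := integral_comp_mul_left_Ioi (fun u : ℝ => (x + u ^ 2)⁻¹) 0 hs
  have h2 : ∀ v : ℝ, (x + (√x * v) ^ 2)⁻¹ = x⁻¹ * (1 + v ^ 2)⁻¹ := by
    intro v
    rw [mul_pow, Real.sq_sqrt hx.le, ← mul_inv]
    congr 1; ring
  simp only [h2, mul_zero, smul_eq_mul, integral_const_mul] at h1
  rw [integral_Ioi_inv_one_add_sq, Real.arctan_zero, sub_zero] at h1
  have h3 : √x * (√x)⁻¹ = 1 := mul_inv_cancel₀ hs.ne'
  have h4 : x = √x * √x := (Real.mul_self_sqrt hx.le).symm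
  calc ∫ u in Ioi (0 : ℝ), (x + u ^ 2)⁻¹ = √x * ((√x)⁻¹ * ∫ u in Ioi (0 : ℝ), (x + u ^ 2)⁻¹) := by
        rw [← mul_assoc, h3, one_mul]
    _ = √x * (x⁻¹ * (Real.pi / 2)) := by rw [h1]
    _ = _ := by
      conv_lhs => rw [h4]
      rw [Real.sqrt_mul_self hs.le]
      field_simp

theorem cauchyReal_constraintMeasure {c s : ℝ} (hs : 0 < s) {x : ℝ} (hx : 0 < x) :
    cauchyReal (constraintMeasure c s) x = √c / (s * √x) := by
  rw [cauchyReal, constraintMeasure_eq_map hs, integral_smul_measure,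
    integral_map (by fun_prop) (Measurable.aestronglyMeasurable (by fun_prop))]
  have : ∀ u : ℝ, 1 / (x - -u ^ 2) = (x + u ^ 2)⁻¹ := fun u => by rw [one_div, sub_neg_eq_add]
  simp only [this]
  rw [integral_Ioi_inv_add_sq hx, ENNReal.toReal_ofReal (by positivity), smul_eq_mul]
  have := Real.pi_pos
  have := Real.sqrt_pos.2 hx
  field_simp

theorem mem_slitPlane_iff_forall {z : ℂ} :
    z ∈ Complex.slitPlane ↔ ∀ x ∈ Iic (0 : ℝ), z ≠ (x : ℂ) := by
  rw [Complex.mem_slitPlane_iff_not_le_zero]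
  constructor
  · rintro h x hx rfl
    exact h (by rw [Complex.le_def]; simpa using hx)
  · intro h h0
    rw [Complex.le_def] at h0
    exact h z.re h0.1 (Complex.ext (by simp) (by simpa using h0.2))

/-- Both sides are holomorphic on the slit plane and agree on (1, ∞) by the elementary integral.
This is what turns the square root terms of ξ into Cauchy transforms of slack measures. -/
theorem cauchyTransform_constraintMeasure {c s : ℝ} (hs : 0 < s) {z : ℂ}
    (hz : z ∈ Complex.slitPlane) :
    cauchyTransform (constraintMeasure c s) z = (√c : ℂ) / (s * z ^ (1 / 2 : ℂ)) := by
  have hd1 : DifferentiableOn ℂ (cauchyTransform (constraintMeasure c s)) Complex.slitPlane :=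
    fun z hz => (hasDerivAt_cauchyTransform (cauchyIntegrable_constraintMeasure hs) isClosed_Iic
      (ae_constraintMeasure c s)
      (mem_slitPlane_iff_forall.1 hz)).differentiableAt.differentiableWithinAt
  have hd2 : DifferentiableOn ℂ (fun z : ℂ => (√c : ℂ) / (s * z ^ (1 / 2 : ℂ)))
      Complex.slitPlane := by
    intro z hz
    have h0 : z ≠ 0 := Complex.slitPlane_ne_zero hz
    have h1 : DifferentiableAt ℂ (fun z : ℂ => z ^ (1 / 2 : ℂ)) z :=
      differentiableAt_id.cpow_const hz
    refine (DifferentiableAt.div (by fun_prop) (by fun_prop) ?_).differentiableWithinAt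
    refine mul_ne_zero (by exact_mod_cast hs.ne') ?_
    rw [Complex.cpow_def_of_ne_zero h0]
    exact Complex.exp_ne_zero _
  have hconn : IsPreconnected Complex.slitPlane :=
    (Complex.starConvex_one_slitPlane.isPathConnected
      Complex.one_mem_slitPlane).isConnected.isPreconnected
  refine (hd1.analyticOnNhd Complex.isOpen_slitPlane).eqOn_of_preconnected_of_frequently_eq
    (hd2.analyticOnNhd Complex.isOpen_slitPlane) hconn Complex.one_mem_slitPlane ?_ hz
  have ht : Tendsto (fun x : ℝ => (x : ℂ)) (𝓝[>] 1) (𝓝[≠] 1) := by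
    refine tendsto_nhdsWithin_iff.2 ⟨?_, ?_⟩
    · have := Complex.continuous_ofReal.tendsto 1
      rw [Complex.ofReal_one] at this
      exact this.mono_left nhdsWithin_le_nhds
    · filter_upwards [self_mem_nhdsWithin] with x hx
      simpa using (ne_of_gt (mem_Ioi.1 hx))
  refine ht.frequently (Eventually.frequently ?_)
  filter_upwards [self_mem_nhdsWithin] with x hx
  have hx0 : 0 < x := one_pos.trans hx
  rw [cauchyTransform_ofReal, cauchyReal_constraintMeasure hs hx0]
  have : (x : ℂ) ^ (1 / 2 : ℂ) = (√x : ℂ) := by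
    rw [Real.sqrt_eq_rpow, Complex.ofReal_cpow hx0.le]
    simp
  rw [this]
  push_cast
  rfl

/-- The density of the constraint measure is bounded away from `0`. -/
theorem constraintMeasure_apply_le {c s δ : ℝ} (hs : 0 < s) (hδ : 0 < δ) {E : Set ℝ}
    (hE : MeasurableSet E) (hEδ : E ⊆ Iic (-δ)) :
    constraintMeasure c s E ≤
      ENNReal.ofReal (√c / (Real.pi * s) * δ ^ (-(1 / 2) : ℝ)) * volume E := by
  rw [constraintMeasure, withDensity_apply _ hE, ← setLIntegral_const]
  have hpi := Real.pi_pos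
  calc _ ≤ ∫⁻ x in E, ENNReal.ofReal (√c / (Real.pi * s) * |x| ^ (-(1 / 2) : ℝ)) :=
        lintegral_mono' (Measure.restrict_mono le_rfl Measure.restrict_le_self) le_rfl
    _ ≤ _ := by
      refine setLIntegral_mono' hE fun x hx => ENNReal.ofReal_le_ofReal ?_
      have := hEδ hx
      rw [mem_Iic] at this
      have hx : δ ≤ |x| := by rw [abs_of_neg (by linarith)]; linarith
      have := Real.rpow_le_rpow_of_nonpos hδ hx (show (-(1 / 2) : ℝ) ≤ 0 by norm_num)
      gcongr

theorem constraintMeasure_restrict_le {c s δ : ℝ} (hs : 0 < s) (hδ : 0 < δ) {E : Set ℝ}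
    (hE : MeasurableSet E) (hEδ : E ⊆ Iic (-δ)) :
    (constraintMeasure c s).restrict E ≤
      (√c / (Real.pi * s) * δ ^ (-(1 / 2) : ℝ)).toNNReal • volume.restrict E := by
  refine Measure.le_iff.2 fun A hA => ?_
  rw [Measure.restrict_apply hA, Measure.smul_apply, Measure.restrict_apply hA]
  exact constraintMeasure_apply_le hs hδ (hA.inter hE) (inter_subset_right.trans hEδ)

/-- The value is ∫ log(ε/|t|) dt over [−ε, ε], whatever x is. For measures of bounded density it
controls the truncation error uniformly in x. -/
theorem lintegral_log_max_sub (ε : ℝ) (hε : 0 < ε) (x : ℝ) :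
    ∫⁻ s, ENNReal.ofReal (Real.log (max |x - s| ε) - Real.log |x - s|) =
      ENNReal.ofReal (2 * ε) := by
  rw [lintegral_sub_left_eq_self (fun t => ENNReal.ofReal (Real.log (max |t| ε) - Real.log |t|)) x]
  have h1 : ∀ t : ℝ, ENNReal.ofReal (Real.log (max |t| ε) - Real.log |t|) =
      (Ioc (-ε) ε).indicator (fun t => ENNReal.ofReal (Real.log ε - Real.log t)) t := by
    intro t
    by_cases ht : t ∈ Ioc (-ε) ε
    · rw [indicator_of_mem ht, max_eq_right (abs_le.2 ⟨ht.1.le, ht.2⟩), Real.log_abs]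
    · rw [indicator_of_notMem ht, max_eq_left, sub_self, ENNReal.ofReal_zero]
      by_contra h
      rw [not_le, abs_lt] at h
      exact ht ⟨h.1, h.2.le⟩
  simp only [h1]
  rw [lintegral_indicator measurableSet_Ioc]
  have hii : IntervalIntegrable (fun t => Real.log ε - Real.log t) volume (-ε) ε :=
    intervalIntegrable_const.sub intervalIntegral.intervalIntegrable_log'
  have hle : -ε ≤ ε := by linarith
  rw [← ofReal_integral_eq_lintegral_ofReal
    ((intervalIntegrable_iff_integrableOn_Ioc_of_le hle).1 hii),
    ← intervalIntegral.integral_of_le hle]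
  · rw [intervalIntegral.integral_sub intervalIntegrable_const
      intervalIntegral.intervalIntegrable_log', integral_log]
    simp only [intervalIntegral.integral_const, smul_eq_mul, Real.log_neg_eq_log]
    congr 1; ring
  · have : ∀ᵐ t ∂(volume.restrict (Ioc (-ε) ε)), t ≠ 0 := ae_restrict_of_ae (by simp [ae_iff])
    filter_upwards [ae_restrict_mem measurableSet_Ioc, this] with t ht ht0
    simp only [Pi.zero_apply, sub_nonneg]
    rw [← Real.log_abs t]
    exact Real.log_le_log (abs_pos.2 ht0) (abs_le.2 ⟨ht.1.le, ht.2⟩)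

theorem log_le_log_max (x s ε : ℝ) :
    Real.log |x - s| ≤ Real.log (max |x - s| ε) ∨ x = s := by
  by_cases h : x = s
  · exact Or.inr h
  · exact Or.inl (Real.log_le_log (abs_pos.2 (sub_ne_zero.2 h)) (le_max_left _ _))

/-- Comparison with the truncated potential for measures below the constraint. -/
theorem pot_sub_potTrunc_le {c s δ ε x : ℝ} (hs : 0 < s) (hδ : 0 < δ) (hε : 0 < ε)
    (hx : x + ε ≤ -δ) {μ : Measure ℝ} [IsFiniteMeasure μ] (hμ : LogIntegrable μ)
    (hle : μ ≤ constraintMeasure c s) :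
    Integrable (fun s => -Real.log |x - s|) μ ∧
    |pot μ x - potTrunc ε μ x| ≤ √c / (Real.pi * s) * δ ^ (-(1 / 2) : ℝ) * (2 * ε) := by
  set C := √c / (Real.pi * s) * δ ^ (-(1 / 2) : ℝ) with hC
  have hC0 : 0 ≤ C := by have := Real.pi_pos; positivity
  set h : ℝ → ℝ := fun s => Real.log (max |x - s| ε) - Real.log |x - s| with hh
  have hna : ∀ᵐ s ∂μ, x ≠ s := by
    have : μ {x} = 0 := le_antisymm ((hle _).trans (by simp)) bot_le
    rw [ae_iff]
    simpa [eq_comm] using this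
  have h0 : ∀ᵐ s ∂μ, 0 ≤ h s := by
    filter_upwards [hna] with s hs'
    exact sub_nonneg.2 ((log_le_log_max x s ε).resolve_right hs')
  have hhm : Measurable h := by fun_prop
  have hbd : ∫⁻ s, ENNReal.ofReal (h s) ∂μ ≤ ENNReal.ofReal (C * (2 * ε)) := by
    have hsupp : ∀ s ∉ Icc (x - ε) (x + ε), h s = 0 := by
      intro s hs'
      simp only [hh]
      rw [max_eq_left, sub_self]
      by_contra h'
      rw [not_le, abs_lt] at h'
      exact hs' ⟨by linarith, by linarith⟩
    calc ∫⁻ s, ENNReal.ofReal (h s) ∂μ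
        = ∫⁻ s in Icc (x - ε) (x + ε), ENNReal.ofReal (h s) ∂μ := by
          rw [← lintegral_indicator measurableSet_Icc]
          refine lintegral_congr fun s => ?_
          by_cases hs' : s ∈ Icc (x - ε) (x + ε)
          · rw [indicator_of_mem hs']
          · rw [indicator_of_notMem hs', hsupp s hs', ENNReal.ofReal_zero]
      _ ≤ ∫⁻ s, ENNReal.ofReal (h s) ∂(C.toNNReal • volume) := by
          refine lintegral_mono' ?_ le_rfl
          refine (Measure.restrict_mono le_rfl hle).trans ?_
          refine (constraintMeasure_restrict_le hs hδ measurableSet_Icc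
            fun y hy => hy.2.trans hx).trans ?_
          gcongr
          exact Measure.restrict_le_self
      _ = _ := by
          rw [lintegral_smul_measure, lintegral_log_max_sub ε hε x, ENNReal.ofReal_mul hC0]
          rfl
  have hint : Integrable h μ := by
    refine ⟨hhm.aestronglyMeasurable, ?_⟩
    rw [hasFiniteIntegral_iff_ofReal h0]
    exact hbd.trans_lt ENNReal.ofReal_lt_top
  have hT := hμ.integrable_trunc hε x
  have heq : ∀ s, -Real.log |x - s| = -Real.log (max |x - s| ε) + h s := fun s => by
    simp only [hh]; ring
  refine ⟨?_, ?_⟩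
  · simp only [heq]; exact hT.add hint
  · have e : pot μ x - potTrunc ε μ x = ∫ s, h s ∂μ := by
      rw [pot]
      simp only [heq]
      rw [integral_add hT hint, potTrunc]; ring
    rw [e, abs_of_nonneg (integral_nonneg_of_ae h0), integral_eq_lintegral_of_nonneg_ae h0
      hhm.aestronglyMeasurable]
    exact ENNReal.toReal_le_of_le_ofReal (by positivity) hbd

/-- Away from 0 the density of μ is bounded, so near x the truncated potentials converge uniformly,
with error O(ε), and uniform limits of continuous functions are continuous. -/
theorem continuousAt_pot_of_le_constraintMeasure {c s x : ℝ} (hs : 0 < s) (hx : x < 0)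
    {μ : Measure ℝ} [IsFiniteMeasure μ] (hμ : LogIntegrable μ)
    (hle : μ ≤ constraintMeasure c s) : ContinuousAt (pot μ) x := by
  obtain ⟨δ, hδ, hxδ⟩ : ∃ δ > 0, x = -(3 * δ) := ⟨-x / 3, by linarith, by ring⟩
  set C := √c / (Real.pi * s) * δ ^ (-(1 / 2) : ℝ) with hC
  have hC0 : 0 ≤ C := by have := Real.pi_pos; positivity
  rw [Metric.continuousAt_iff']
  intro η hη
  -- The truncation errors at `x` and at `y` are each at most η/4. Since x = −3δ and ε ≤ δ, every y
  -- within δ of x satisfies y + ε ≤ −δ, where the density bound applies.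
  set ε := min δ (η / (8 * (C + 1))) with hε
  have hε0 : 0 < ε := by positivity
  have hCε : C * (2 * ε) ≤ η / 4 := by
    have h1 : ε ≤ η / (8 * (C + 1)) := min_le_right _ _
    rw [le_div_iff₀ (by positivity)] at h1
    nlinarith
  have hcont := Metric.continuousAt_iff'.1 ((continuous_potTrunc hμ hε0).continuousAt (x := x)) (η / 4)
    (by positivity)
  filter_upwards [hcont, ball_mem_nhds x hδ] with y hy hyx
  rw [mem_ball, Real.dist_eq, abs_lt] at hyx
  rw [Real.dist_eq] at hy ⊢
  have hεδ : ε ≤ δ := min_le_left _ _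
  have h1 := (pot_sub_potTrunc_le hs hδ hε0 (x := x) (by linarith) hμ hle).2
  have h2 := (pot_sub_potTrunc_le hs hδ hε0 (x := y) (by linarith) hμ hle).2
  have h1' := abs_le.1 (h1.trans hCε)
  have h2' := abs_le.1 (h2.trans hCε)
  have h3 := abs_lt.1 hy
  rw [abs_lt]
  constructor <;> linarith

end Constraint

/-! ### The Euler-Lagrange conditions -/

section EulerLagrange

open Metric Set Filter
open scoped ENNReal NNReal

/-- `μ` minimizes `I(μ) - I(μ, ν)` under the constraint `μ ≤ constraintMeasure c s`. -/
structure IsConstrainedMin (c s : ℝ) (μ ν : Measure ℝ) : Prop where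
  mass : μ univ = 1 / 2
  mass' : ν univ = 1
  on : μ (Ioi 0) = 0
  on' : ν (Iio 0) = 0
  le : μ ≤ constraintMeasure c s
  finite : HasFiniteEnergy μ μ
  finite' : HasFiniteEnergy ν ν
  finite_mutual : HasFiniteEnergy μ ν
  min : ∀ μ' : Measure ℝ, μ' univ = 1 / 2 → μ' (Ioi 0) = 0 → μ' ≤ constraintMeasure c s →
    HasFiniteEnergy μ' μ' → HasFiniteEnergy μ' ν →
      logEnergy μ μ - logEnergy μ ν ≤ logEnergy μ' μ' - logEnergy μ' ν

variable {c s : ℝ} {μ ν : Measure ℝ}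

theorem IsConstrainedMin.isFiniteMeasure (h : IsConstrainedMin c s μ ν) : IsFiniteMeasure μ :=
  ⟨by rw [h.mass]; simp⟩

theorem IsConstrainedMin.isFiniteMeasure' (h : IsConstrainedMin c s μ ν) : IsFiniteMeasure ν :=
  ⟨by rw [h.mass']; simp⟩

theorem IsConstrainedMin.ae_mem (h : IsConstrainedMin c s μ ν) : ∀ᵐ x ∂μ, x ∈ Iic (0 : ℝ) := by
  rw [ae_iff]; simpa using! h.on

theorem IsConstrainedMin.ae_mem' (h : IsConstrainedMin c s μ ν) : ∀ᵐ x ∂ν, x ∈ Ici (0 : ℝ) := by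
  rw [ae_iff]; simpa using! h.on'

theorem IsConstrainedMin.sub_add (h : IsConstrainedMin c s μ ν) :
    constraintMeasure c s - μ + μ = constraintMeasure c s := by
  have := h.isFiniteMeasure
  exact Measure.sub_add_cancel_of_le h.le

/-- First variation for moving mass from A to B: a small multiple of μ on A is replaced by a
multiple of the slack on B of the same mass. Adding slack cannot violate the constraint. B has to be
bounded and away from 0 so that the slack on it has bounded density and finite energy. -/
theorem IsConstrainedMin.integral_exchange (hs : 0 < s) (h : IsConstrainedMin c s μ ν) {A B : Set ℝ}
    (hA : MeasurableSet A) (hB : MeasurableSet B) {δ R : ℝ} (hδ : 0 < δ) (hBR : B ⊆ Icc (-R) (-δ)) :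
    Integrable (fun x => 2 * pot μ x - pot ν x) (μ.restrict A) ∧
    Integrable (fun x => 2 * pot μ x - pot ν x) ((constraintMeasure c s - μ).restrict B) ∧
    (constraintMeasure c s - μ).real B * ∫ x in A, (2 * pot μ x - pot ν x) ∂μ ≤
      μ.real A * ∫ x in B, (2 * pot μ x - pot ν x) ∂(constraintMeasure c s - μ) := by
  have := h.isFiniteMeasure
  have := h.isFiniteMeasure'
  set σ := constraintMeasure c s - μ with hσ
  have hsum : σ + μ = constraintMeasure c s := h.sub_add
  have hσρ : σ ≤ constraintMeasure c s := Measure.sub_le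
  rcases B.eq_empty_or_nonempty with rfl | hBne
  · simp only [Measure.restrict_empty, integrable_zero_measure, measureReal_empty,
      zero_mul, integral_zero_measure, mul_zero, le_refl, and_true]
    exact ((h.finite.integrable_pot.const_mul 2).sub h.finite_mutual.integrable_pot).integrableOn
  have hR0 : 0 ≤ R := by
    obtain ⟨y, hy⟩ := hBne
    have := hBR hy
    linarith [this.1, this.2]
  set C : ℝ≥0 := (√c / (Real.pi * s) * δ ^ (-(1 / 2) : ℝ)).toNNReal with hC
  have hσB : σ.restrict B ≤ C • volume.restrict (Icc (-R) R) := by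
    refine (Measure.restrict_mono le_rfl hσρ).trans ?_
    refine (constraintMeasure_restrict_le hs hδ hB fun x hx => (hBR hx).2).trans ?_
    gcongr
    exact fun x hx => ⟨(hBR hx).1, (hBR hx).2.trans (by linarith)⟩
  have hσBfin : IsFiniteMeasure (σ.restrict B) := isFiniteMeasure_of_le _ hσB
  have hV1 : HasFiniteEnergy (volume.restrict (Icc (-R) R)) μ :=
    hasFiniteEnergy_volume_restrict hR0 h.finite.logIntegrable
  have hV2 : HasFiniteEnergy (volume.restrict (Icc (-R) R)) ν :=
    hasFiniteEnergy_volume_restrict hR0 h.finite'.logIntegrable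
  have hV3 : HasFiniteEnergy (volume.restrict (Icc (-R) R)) (volume.restrict (Icc (-R) R)) :=
    hasFiniteEnergy_volume_restrict hR0 (logIntegrable_volume_restrict R)
  have hb1 : HasFiniteEnergy (σ.restrict B) μ := (hV1.smul_left C).mono hσB le_rfl
  have hb2 : HasFiniteEnergy (σ.restrict B) ν := (hV2.smul_left C).mono hσB le_rfl
  have hb3 : HasFiniteEnergy (σ.restrict B) (σ.restrict B) :=
    ((hV3.smul_left C).smul_right C).mono hσB hσB
  have hAle : μ.restrict A ≤ μ := Measure.restrict_le_self
  have ha1 : HasFiniteEnergy (μ.restrict A) μ := h.finite.mono hAle le_rfl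
  have ha2 : HasFiniteEnergy (μ.restrict A) ν := h.finite_mutual.mono hAle le_rfl
  have i1 : Integrable (fun x => 2 * pot μ x - pot ν x) (μ.restrict A) :=
    (ha1.integrable_pot.const_mul 2).sub ha2.integrable_pot
  have i2 : Integrable (fun x => 2 * pot μ x - pot ν x) (σ.restrict B) :=
    (hb1.integrable_pot.const_mul 2).sub hb2.integrable_pot
  refine ⟨i1, i2, ?_⟩
  rw [integral_sub (ha1.integrable_pot.const_mul 2) ha2.integrable_pot,
    integral_sub (hb1.integrable_pot.const_mul 2) hb2.integrable_pot, integral_const_mul,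
    integral_const_mul, ← logEnergy_eq_integral_pot ha1, ← logEnergy_eq_integral_pot ha2,
    ← logEnergy_eq_integral_pot hb1, ← logEnergy_eq_integral_pot hb2]
  set p : ℝ≥0 := (μ A).toNNReal with hp
  set q : ℝ≥0 := (σ B).toNNReal with hq
  have hpA : (p : ℝ≥0∞) = μ A := ENNReal.coe_toNNReal (measure_ne_top μ A)
  have hqB : (q : ℝ≥0∞) = σ B := ENNReal.coe_toNNReal (by
    have := measure_ne_top (σ.restrict B) univ
    rwa [Measure.restrict_apply_univ] at this)
  have hpr : μ.real A = p := rfl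
  have hqr : σ.real B = q := rfl
  rw [hpr, hqr]
  rw [← sub_nonneg]
  -- The bound on ε gives εp ≤ 1 and εq ≤ 1, so no more is removed than μ has on A and no more is
  -- added than the slack on B. `Q` is the energy of the signed direction, p times the slack on B
  -- minus q times μ on A.
  refine nonneg_of_forall_small (δ := 1 / (1 + p + q))
    (Q := p ^ 2 * logEnergy (σ.restrict B) (σ.restrict B) -
      2 * p * q * logEnergy (σ.restrict B) (μ.restrict A) +
      q ^ 2 * logEnergy (μ.restrict A) (μ.restrict A)) (by positivity) fun ε' hε' hεle => ?_
  lift ε' to ℝ≥0 using hε'.le with ε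
  rw [le_div_iff₀ (by positivity)] at hεle
  have hεq : ε * q ≤ 1 := by
    rw [← NNReal.coe_le_coe]; push_cast
    nlinarith [mul_nonneg hε'.le p.2, mul_nonneg hε'.le q.2]
  have hεp : ε * p ≤ 1 := by
    rw [← NNReal.coe_le_coe]; push_cast
    nlinarith [mul_nonneg hε'.le p.2, mul_nonneg hε'.le q.2]
  set α : Measure ℝ := (ε * q) • μ.restrict A with hα
  set β : Measure ℝ := (ε * p) • σ.restrict B with hβ
  have hαle : α ≤ μ := by
    refine le_trans ?_ hAle
    calc α ≤ (1 : ℝ≥0) • μ.restrict A := by rw [hα]; gcongr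
      _ = _ := one_smul _ _
  have hβle : β ≤ σ := by
    refine le_trans ?_ (Measure.restrict_le_self (s := B))
    calc β ≤ (1 : ℝ≥0) • σ.restrict B := by rw [hβ]; gcongr
      _ = _ := one_smul _ _
  set μ' : Measure ℝ := μ.restrict Aᶜ + (1 - ε * q) • μ.restrict A + β with hμ'
  have hadd : μ' + α = μ + β := by
    have e1 : (1 - ε * q) • μ.restrict A + (ε * q) • μ.restrict A = μ.restrict A := by
      rw [← add_smul, tsub_add_cancel_of_le hεq, one_smul]
    have e2 : μ.restrict Aᶜ + μ.restrict A = μ := by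
      rw [add_comm, Measure.restrict_add_restrict_compl hA]
    rw [hμ', hα]
    calc _ = μ.restrict Aᶜ + ((1 - ε * q) • μ.restrict A + (ε * q) • μ.restrict A) + β := by abel
      _ = _ := by rw [e1, e2]
  have hμ'fin : IsFiniteMeasure μ' := by rw [hμ']; infer_instance
  have hle' : μ' ≤ μ + β := hadd ▸ Measure.le_add_right le_rfl
  have hμ'ρ : μ' ≤ constraintMeasure c s := by
    refine hle'.trans ?_
    rw [← hsum, add_comm]
    gcongr
  obtain ⟨f1, e1⟩ := logEnergy_perturb hadd hαle h.finite (β := β)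
    ((hb1.smul_left (ε * p)).symm) ((hb3.smul_left (ε * p)).smul_right (ε * p))
  obtain ⟨f2, e2⟩ := logEnergy_perturb_left hadd hαle h.finite_mutual (hb2.smul_left (ε * p))
  have hmass : μ' univ = 1 / 2 := by
    have h1 : μ' univ + α univ = μ univ + β univ := by
      rw [← Measure.add_apply, hadd, Measure.add_apply]
    have h2 : α univ = β univ := by
      rw [hα, hβ, Measure.smul_apply, Measure.smul_apply, Measure.restrict_apply_univ,
        Measure.restrict_apply_univ, ← hpA, ← hqB, ENNReal.smul_def, ENNReal.smul_def,
        smul_eq_mul, smul_eq_mul, ← ENNReal.coe_mul, ← ENNReal.coe_mul]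
      congr 1; ring
    rw [h2] at h1
    rw [← h.mass]
    exact (ENNReal.add_left_inj (measure_ne_top β univ)).1 h1
  have hon : μ' (Ioi 0) = 0 := le_antisymm ((hμ'ρ _).trans (by rw [constraintMeasure_Ioi])) bot_le
  have hmin := h.min μ' hmass hon hμ'ρ f1 f2
  rw [e1, e2, logEnergy_comm μ β, logEnergy_comm μ α] at hmin
  simp only [hα, hβ, logEnergy_smul_left, logEnergy_smul_right] at hmin
  push_cast at hmin ⊢
  nlinarith

theorem IsConstrainedMin.continuousAt_phi (hs : 0 < s) (h : IsConstrainedMin c s μ ν) {x : ℝ}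
    (hx : x < 0) : ContinuousAt (fun x => 2 * pot μ x - pot ν x) x := by
  have := h.isFiniteMeasure
  have := h.isFiniteMeasure'
  have h1 := continuousAt_pot_of_le_constraintMeasure hs hx h.finite.logIntegrable h.le
  have h2 := (hasDerivAt_pot h.finite'.logIntegrable isClosed_Ici h.ae_mem'
    (not_le.2 hx : x ∉ Ici (0 : ℝ))).continuousAt
  fun_prop

/-- If φ were larger at x than at y, moving mass from a small ball around x, charged by μ, to one
around y, charged by the slack, would lower the energy. Continuity of φ on the negative axis
separates the two values by a number m on these balls. -/
theorem IsConstrainedMin.phi_le (hs : 0 < s) (h : IsConstrainedMin c s μ ν) {x y : ℝ}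
    (hx : x < 0) (hy : y < 0) (hxμ : x ∈ μ.support) (hyσ : y ∈ (constraintMeasure c s - μ).support) :
    2 * pot μ x - pot ν x ≤ 2 * pot μ y - pot ν y := by
  by_contra! hlt
  have := h.isFiniteMeasure
  set φ : ℝ → ℝ := fun x => 2 * pot μ x - pot ν x with hφ
  set m := (φ x + φ y) / 2 with hm
  have hmx : m < φ x := by rw [hm]; linarith
  have hmy : φ y < m := by rw [hm]; linarith
  have e1 := (h.continuousAt_phi hs hx).eventually_const_lt hmx
  have e2 := ((h.continuousAt_phi hs hy).eventually_lt_const hmy).and (gt_mem_nhds hy)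
  obtain ⟨r1, hr1, h1⟩ := Metric.eventually_nhds_iff_ball.1 e1
  obtain ⟨r2, hr2, h2⟩ := Metric.eventually_nhds_iff_ball.1 e2
  set A := ball x r1 with hA
  -- Half the radius: the larger ball consists of negative numbers, so B keeps a positive distance
  -- from 0.
  set B := ball y (r2 / 2) with hB
  have hBA : B ⊆ ball y r2 := ball_subset_ball (by linarith)
  have hBR : B ⊆ Icc (-(|y| + r2)) (-(-y - r2 / 2)) := by
    intro z hz
    rw [hB, mem_ball, Real.dist_eq, abs_lt] at hz
    constructor
    · linarith [neg_abs_le y]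
    · linarith
  have hδ : 0 < -y - r2 / 2 := by
    have hmem : y + r2 / 2 ∈ ball y r2 := by
      rw [mem_ball, Real.dist_eq, add_sub_cancel_left, abs_of_pos (by positivity)]
      linarith
    linarith [(h2 _ hmem).2]
  obtain ⟨i1, i2, hle⟩ := h.integral_exchange hs (A := A) (B := B) measurableSet_ball
    measurableSet_ball hδ hBR
  set σ := constraintMeasure c s - μ with hσ
  have hμA : 0 < μ.real A := by
    rw [measureReal_def, ENNReal.toReal_pos_iff]
    exact ⟨(Measure.mem_support_iff_forall x).1 hxμ _ (ball_mem_nhds x hr1), measure_lt_top _ _⟩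
  have hσfin : σ B < ⊤ := by
    refine lt_of_le_of_lt ((Measure.sub_le (μ := constraintMeasure c s)) B) ?_
    refine (constraintMeasure_apply_le hs hδ measurableSet_ball fun z hz => (hBR hz).2).trans_lt ?_
    exact ENNReal.mul_lt_top ENNReal.ofReal_lt_top measure_ball_lt_top
  have hσB : 0 < σ.real B := by
    rw [measureReal_def, ENNReal.toReal_pos_iff]
    exact ⟨(Measure.mem_support_iff_forall y).1 hyσ _ (ball_mem_nhds y (by positivity)), hσfin⟩
  have : IsFiniteMeasure (σ.restrict B) := ⟨by rwa [Measure.restrict_apply_univ]⟩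
  have b1 : μ.real A * m < ∫ z in A, φ z ∂μ := by
    have hpos : 0 < ∫ z in A, (φ z - m) ∂μ := by
      rw [setIntegral_pos_iff_support_of_nonneg_ae]
      · refine lt_of_lt_of_le ((Measure.mem_support_iff_forall x).1 hxμ _ (ball_mem_nhds x hr1))
          (measure_mono fun z hz => ⟨?_, hz⟩)
        have := h1 z hz
        exact (sub_pos.2 this).ne'
      · filter_upwards [ae_restrict_mem measurableSet_ball] with z hz
        exact (sub_pos.2 (h1 z hz)).le
      · exact i1.sub (integrable_const m)
    rw [integral_sub i1 (integrable_const m), integral_const, smul_eq_mul,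
      measureReal_restrict_apply_univ] at hpos
    linarith
  have b2 : ∫ z in B, φ z ∂σ ≤ σ.real B * m := by
    have : ∫ z in B, φ z ∂σ ≤ ∫ z in B, m ∂σ := by
      refine integral_mono_ae i2 (integrable_const m) ?_
      filter_upwards [ae_restrict_mem measurableSet_ball] with z hz
      exact (h2 z (hBA hz)).1.le
    rwa [integral_const, smul_eq_mul, measureReal_restrict_apply_univ] at this
  nlinarith

/-! ### The problem for three measures. -/

variable {a b t : ℝ} {μ₁ μ₂ μ₃ : Measure ℝ}

/-- With μ₂ and μ₃ fixed, the energy depends on the first measure only through I(ν₁) − I(ν₁, μ₂).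
The third measure is symmetric, so the theory of `IsConstrainedMin` is developed once and used for
both outer measures. -/
theorem IsMinimizer.left (h : IsMinimizer a b t μ₁ μ₂ μ₃) : IsConstrainedMin a t μ₁ μ₂ := by
  obtain ⟨h, hmin⟩ := h
  have : IsFiniteMeasure μ₁ := ⟨by rw [h.mass₁]; simp⟩
  have : IsFiniteMeasure μ₂ := ⟨by rw [h.mass₂]; simp⟩
  refine ⟨h.mass₁, h.mass₂, h.on₁, h.on₂, h.le₁, h.finite₁₁, h.finite₂₂, h.finite₁₂, ?_⟩
  intro μ' hm hon hle hf hf'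
  have := hmin μ' μ₂ μ₃ ⟨hm, h.mass₂, h.mass₃, hon, h.on₂, h.on₃, hle, h.le₃, hf, h.finite₂₂,
    h.finite₃₃, hf', h.finite₂₃, h.finite_field⟩
  simp only [energy] at this
  linarith

theorem IsMinimizer.right (h : IsMinimizer a b t μ₁ μ₂ μ₃) :
    IsConstrainedMin b (1 - t) μ₃ μ₂ := by
  obtain ⟨h, hmin⟩ := h
  have : IsFiniteMeasure μ₃ := ⟨by rw [h.mass₃]; simp⟩
  have : IsFiniteMeasure μ₂ := ⟨by rw [h.mass₂]; simp⟩
  refine ⟨h.mass₃, h.mass₂, h.on₃, h.on₂, h.le₃, h.finite₃₃, h.finite₂₂, h.finite₂₃.symm, ?_⟩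
  intro μ' hm hon hle hf hf'
  have : IsFiniteMeasure μ' := ⟨by rw [hm]; simp⟩
  have := hmin μ₁ μ₂ μ' ⟨h.mass₁, h.mass₂, hm, h.on₁, h.on₂, hon, h.le₁, hle, h.finite₁₁,
    h.finite₂₂, hf, h.finite₁₂, hf'.symm, h.finite_field⟩
  simp only [energy] at this
  rw [logEnergy_comm μ₃ μ₂, logEnergy_comm μ' μ₂]
  linarith

/-- The effective potential on the positive half-line. -/
def effectivePotential (a b t : ℝ) (μ₁ μ₂ μ₃ : Measure ℝ) (x : ℝ) : ℝ :=
  2 * pot μ₂ x - pot μ₁ x - pot μ₃ x + externalField a b t x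

/-- First variation of the energy in the direction κ − κ(ℝ) μ₂. There is no upper constraint on the
second measure, so κ may be any positive measure on [0, ∞) with finite energies. -/
theorem IsMinimizer.le_integral_effectivePotential (h : IsMinimizer a b t μ₁ μ₂ μ₃)
    {κ : Measure ℝ} [IsFiniteMeasure κ] (hκ : κ (Iio 0) = 0) (hκκ : HasFiniteEnergy κ κ)
    (h1 : HasFiniteEnergy κ μ₁) (h2 : HasFiniteEnergy κ μ₂) (h3 : HasFiniteEnergy κ μ₃)
    (hV : Integrable (externalField a b t) κ) :
    Integrable (effectivePotential a b t μ₁ μ₂ μ₃) κ ∧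
      κ.real univ * ∫ x, effectivePotential a b t μ₁ μ₂ μ₃ x ∂μ₂ ≤
        ∫ x, effectivePotential a b t μ₁ μ₂ μ₃ x ∂κ := by
  have hL := h.left
  have hR := h.right
  have f1 := hL.isFiniteMeasure
  have f2 := hL.isFiniteMeasure'
  have f3 := hR.isFiniteMeasure
  obtain ⟨h, hmin⟩ := h
  have hint : ∀ {ν : Measure ℝ} [IsFiniteMeasure ν], HasFiniteEnergy ν μ₁ → HasFiniteEnergy ν μ₂ →
      HasFiniteEnergy ν μ₃ → Integrable (externalField a b t) ν →
      Integrable (effectivePotential a b t μ₁ μ₂ μ₃) ν ∧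
      ∫ x, effectivePotential a b t μ₁ μ₂ μ₃ x ∂ν = 2 * logEnergy ν μ₂ - logEnergy ν μ₁ -
        logEnergy ν μ₃ + ∫ x, externalField a b t x ∂ν := by
    intro ν _ g1 g2 g3 gV
    have i2 := g2.integrable_pot.const_mul 2
    refine ⟨((i2.sub g1.integrable_pot).sub g3.integrable_pot).add gV, ?_⟩
    rw [logEnergy_eq_integral_pot g1, logEnergy_eq_integral_pot g2, logEnergy_eq_integral_pot g3,
      ← integral_const_mul]
    have j1 := integral_sub i2 g1.integrable_pot
    have j2 := integral_sub (i2.sub g1.integrable_pot) g3.integrable_pot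
    have j3 := integral_add ((i2.sub g1.integrable_pot).sub g3.integrable_pot) gV
    simp only [Pi.sub_apply] at j1 j2 j3
    rw [← j1, ← j2, ← j3]
    rfl
  have h12 := h.finite₁₂.symm
  obtain ⟨-, e0⟩ := hint h12 h.finite₂₂ h.finite₂₃ h.finite_field
  obtain ⟨ei, e⟩ := hint h1 h2 h3 hV
  refine ⟨ei, ?_⟩
  rw [e, e0, ← sub_nonneg]
  set p : ℝ≥0 := (κ univ).toNNReal with hp
  have hpA : (p : ℝ≥0∞) = κ univ := ENNReal.coe_toNNReal (measure_ne_top κ _)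
  have hpr : κ.real univ = p := rfl
  rw [hpr]
  refine nonneg_of_forall_small (δ := 1 / (1 + p))
    (Q := logEnergy κ κ - 2 * p * logEnergy κ μ₂ + p ^ 2 * logEnergy μ₂ μ₂) (by positivity)
    fun ε' hε' hεle => ?_
  lift ε' to ℝ≥0 using hε'.le with ε
  rw [le_div_iff₀ (by positivity)] at hεle
  have hεp : ε * p ≤ 1 := by
    rw [← NNReal.coe_le_coe]; push_cast
    nlinarith [mul_nonneg hε'.le p.2]
  set α : Measure ℝ := (ε * p) • μ₂ with hα
  set β : Measure ℝ := ε • κ with hβ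
  have hαle : α ≤ μ₂ := by
    calc α ≤ (1 : ℝ≥0) • μ₂ := by rw [hα]; gcongr
      _ = _ := one_smul _ _
  set ν : Measure ℝ := (1 - ε * p) • μ₂ + β with hν
  have hadd : ν + α = μ₂ + β := by
    have e1 : (1 - ε * p) • μ₂ + (ε * p) • μ₂ = μ₂ := by
      rw [← add_smul, tsub_add_cancel_of_le hεp, one_smul]
    rw [hν, hα]
    calc _ = ((1 - ε * p) • μ₂ + (ε * p) • μ₂) + β := by abel
      _ = _ := by rw [e1]
  obtain ⟨g1, e1⟩ := logEnergy_perturb hadd hαle h.finite₂₂ (β := β)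
    ((h2.smul_left ε).symm) ((hκκ.smul_left ε).smul_right ε)
  obtain ⟨g2, e2⟩ := logEnergy_perturb_left hadd hαle h12 (h1.smul_left ε)
  obtain ⟨g3, e3⟩ := logEnergy_perturb_left hadd hαle h.finite₂₃ (h3.smul_left ε)
  have hmass : ν univ = 1 := by
    have h1 : ν univ + α univ = μ₂ univ + β univ := by
      rw [← Measure.add_apply, hadd, Measure.add_apply]
    have h2 : α univ = β univ := by
      rw [hα, hβ, Measure.smul_apply, Measure.smul_apply, ← hpA, h.mass₂, ENNReal.smul_def,
        ENNReal.smul_def, smul_eq_mul, smul_eq_mul, ← ENNReal.coe_mul, mul_one]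
    rw [h2] at h1
    rw [← h.mass₂]
    exact (ENNReal.add_left_inj (measure_ne_top β univ)).1 h1
  have hon : ν (Iio 0) = 0 := by
    rw [hν, hβ, Measure.add_apply, Measure.smul_apply, Measure.smul_apply, hκ, h.on₂]
    simp
  have hVν : Integrable (externalField a b t) ν := by
    rw [hν, hβ]
    exact (h.finite_field.smul_measure_nnreal).add_measure hV.smul_measure_nnreal
  have eV : ∫ x, externalField a b t x ∂ν = (1 - ε * p) * ∫ x, externalField a b t x ∂μ₂ +
      ε * ∫ x, externalField a b t x ∂κ := by
    rw [hν, hβ, integral_add_measure h.finite_field.smul_measure_nnreal hV.smul_measure_nnreal,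
      integral_smul_nnreal_measure, integral_smul_nnreal_measure, NNReal.smul_def, NNReal.smul_def,
      NNReal.coe_sub hεp]
    simp
  have := hmin μ₁ ν μ₃ ⟨h.mass₁, hmass, h.mass₃, h.on₁, hon, h.on₃, h.le₁, h.le₃, h.finite₁₁, g1,
    h.finite₃₃, g2.symm, g3, hVν⟩
  simp only [energy] at this
  rw [logEnergy_comm μ₁ ν, logEnergy_comm μ₁ μ₂, e1, e2, e3, eV, logEnergy_comm μ₂ β] at this
  simp only [hα, hβ, logEnergy_smul_left, logEnergy_smul_right] at this
  push_cast at this ⊢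
  nlinarith

theorem IsMinimizer.continuousAt_externalPart (h : IsMinimizer a b t μ₁ μ₂ μ₃) {x : ℝ}
    (hx : 0 < x) : ContinuousAt (fun x => -pot μ₁ x - pot μ₃ x + externalField a b t x) x := by
  have f1 := h.left.isFiniteMeasure
  have f3 := h.right.isFiniteMeasure
  have h1 := (hasDerivAt_pot h.left.finite.logIntegrable isClosed_Iic h.left.ae_mem
    (not_le.2 hx : x ∉ Iic (0 : ℝ))).continuousAt
  have h3 := (hasDerivAt_pot h.right.finite.logIntegrable isClosed_Iic h.right.ae_mem
    (not_le.2 hx : x ∉ Iic (0 : ℝ))).continuousAt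
  have hV : ContinuousAt (externalField a b t) x := by
    unfold externalField; fun_prop
  exact (h1.neg.sub h3).add hV

theorem continuous_externalField : Continuous (externalField a b t) := by
  unfold externalField; fun_prop

/-- The constant ℓ is the μ₂-mean of the effective potential ψ. Restrictions of μ₂ as directions
give ψ ≥ ℓ μ₂-almost everywhere, hence equality because ℓ is the mean; restrictions of Lebesgue
measure to subsets of [0, N] give ψ ≥ ℓ almost everywhere. In the last clause the truncated
expression is continuous and lies below ψ, so the bound by ℓ passes from almost every point to every
positive point of the support. -/
theorem IsMinimizer.exists_effectivePotential (h : IsMinimizer a b t μ₁ μ₂ μ₃) :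
    ∃ ℓ : ℝ, (∀ᵐ x, 0 < x → ℓ ≤ effectivePotential a b t μ₁ μ₂ μ₃ x) ∧
      (∀ᵐ x ∂μ₂, effectivePotential a b t μ₁ μ₂ μ₃ x = ℓ) ∧
      ∀ ε > 0, ∀ x ∈ μ₂.support, 0 < x → 2 * potTrunc ε μ₂ x +
        (-pot μ₁ x - pot μ₃ x + externalField a b t x) ≤ ℓ := by
  have f1 := h.left.isFiniteMeasure
  have f2 := h.left.isFiniteMeasure'
  have f3 := h.right.isFiniteMeasure
  set ψ := effectivePotential a b t μ₁ μ₂ μ₃ with hψ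
  set ℓ : ℝ := ∫ x, ψ x ∂μ₂ with hℓ
  have l1 := h.left.finite.logIntegrable
  have l2 := h.left.finite'.logIntegrable
  have l3 := h.right.finite.logIntegrable
  have hae : ∀ᵐ x ∂μ₂, ψ x = ℓ := by
    have hi : Integrable ψ μ₂ := (h.le_integral_effectivePotential h.1.on₂ h.1.finite₂₂
      h.1.finite₁₂.symm h.1.finite₂₂ h.1.finite₂₃ h.1.finite_field).1
    have hle : (fun _ => ℓ) ≤ᵐ[μ₂] ψ := by
      refine ae_le_of_forall_setIntegral_le (integrable_const _) hi fun E hE _ => ?_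
      have hEle : μ₂.restrict E ≤ μ₂ := Measure.restrict_le_self
      have := (h.le_integral_effectivePotential (κ := μ₂.restrict E)
        (le_antisymm ((hEle _).trans h.1.on₂.le) bot_le) (h.1.finite₂₂.mono hEle hEle)
        (h.1.finite₁₂.symm.mono hEle le_rfl) (h.1.finite₂₂.mono hEle le_rfl)
        (h.1.finite₂₃.mono hEle le_rfl) h.1.finite_field.integrableOn).2
      rwa [integral_const, smul_eq_mul]
    have h0 : ∫ x, (ψ x - ℓ) ∂μ₂ = 0 := by
      rw [integral_sub hi (integrable_const _), integral_const, measureReal_def, h.1.mass₂]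
      simp [hℓ]
    rw [integral_eq_zero_iff_of_nonneg_ae] at h0
    · filter_upwards [h0] with x hx
      simpa [sub_eq_zero] using hx
    · filter_upwards [hle] with x hx using sub_nonneg.2 hx
    · exact hi.sub (integrable_const _)
  refine ⟨ℓ, ?_, hae, ?_⟩
  · have key : ∀ N : ℕ, ∀ᵐ x, x ∈ Icc (0 : ℝ) N → ℓ ≤ ψ x := by
      intro N
      rw [← ae_restrict_iff' measurableSet_Icc]
      have hN : (0 : ℝ) ≤ N := N.cast_nonneg
      have hle0 : volume.restrict (Icc (0 : ℝ) N) ≤ volume.restrict (Icc (-(N : ℝ)) N) :=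
        Measure.restrict_mono (Icc_subset_Icc_left (by linarith)) le_rfl
      have hκ : ∀ E : Set ℝ, Integrable ψ ((volume.restrict (Icc (0 : ℝ) N)).restrict E) ∧
          ((volume.restrict (Icc (0 : ℝ) N)).restrict E).real univ * ℓ ≤
            ∫ x, ψ x ∂((volume.restrict (Icc (0 : ℝ) N)).restrict E) := by
        intro E
        have hle : (volume.restrict (Icc (0 : ℝ) N)).restrict E ≤
            volume.restrict (Icc (-(N : ℝ)) N) := Measure.restrict_le_self.trans hle0
        refine h.le_integral_effectivePotential ?_
          ((hasFiniteEnergy_volume_restrict hN (logIntegrable_volume_restrict N)).mono hle hle)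
          ((hasFiniteEnergy_volume_restrict hN l1).mono hle le_rfl)
          ((hasFiniteEnergy_volume_restrict hN l2).mono hle le_rfl)
          ((hasFiniteEnergy_volume_restrict hN l3).mono hle le_rfl) ?_
        · refine le_antisymm ((Measure.restrict_le_self _).trans ?_) bot_le
          have : Iio (0 : ℝ) ∩ Icc 0 N = ∅ :=
            eq_empty_of_forall_notMem fun y hy => not_le.2 hy.1 hy.2.1
          rw [Measure.restrict_apply measurableSet_Iio, this, measure_empty]
        · exact Integrable.mono_measure
            (continuous_externalField.continuousOn.integrableOn_Icc) hle
      have h0 := (hκ univ).1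
      rw [Measure.restrict_univ] at h0
      refine ae_le_of_forall_setIntegral_le (integrable_const _) h0 fun E hE _ => ?_
      rw [integral_const, smul_eq_mul]
      exact (hκ E).2
    filter_upwards [ae_all_iff.2 key] with x hx hx0
    obtain ⟨N, hN⟩ := exists_nat_ge x
    exact hx N ⟨hx0.le, hN⟩
  · intro ε hε x hx hx0
    by_contra! hlt
    have hc : ContinuousAt (fun x => 2 * potTrunc ε μ₂ x +
        (-pot μ₁ x - pot μ₃ x + externalField a b t x)) x :=
      ((continuous_potTrunc l2 hε).continuousAt.const_mul 2).add (h.continuousAt_externalPart hx0)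
    have hev := hc.eventually_const_lt hlt
    have hpos := (Measure.mem_support_iff_forall x).1 hx _ hev
    refine hpos.ne' ?_
    have hna : ∀ᵐ x ∂μ₂, ∀ᵐ s ∂μ₂, x ≠ s := by
      refine .of_forall fun x => ?_
      rw [ae_iff]
      simpa [eq_comm] using h.1.finite₂₂.measure_singleton x
    have hall : ∀ᵐ x ∂μ₂, 2 * potTrunc ε μ₂ x +
        (-pot μ₁ x - pot μ₃ x + externalField a b t x) ≤ ℓ := by
      filter_upwards [hae, h.1.finite₂₂.ae_integrable_log, hna] with x h1 h2 h3
      have : potTrunc ε μ₂ x ≤ pot μ₂ x := by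
        refine integral_mono_ae (l2.integrable_trunc hε x) h2 ?_
        filter_upwards [h3] with s hs
        exact neg_log_max_le hs
      rw [← h1, hψ, effectivePotential]
      linarith
    rw [ae_iff] at hall
    refine measure_mono_null ?_ hall
    intro y hy
    exact not_le.2 hy

end EulerLagrange

/-! ### The supports of the constrained measures -/

section Supports

open Metric Set Filter
open scoped ENNReal NNReal Interval

theorem integral_lt_integral_of_ae_lt {α : Type*} [MeasurableSpace α] {κ : Measure α} (hκ : κ ≠ 0)
    {f g : α → ℝ} (hf : Integrable f κ) (hg : Integrable g κ) (h : ∀ᵐ x ∂κ, f x < g x) :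
    ∫ x, f x ∂κ < ∫ x, g x ∂κ := by
  rw [← sub_pos, ← integral_sub hg hf, integral_pos_iff_support_of_nonneg_ae]
  · refine pos_iff_ne_zero.2 fun h0 => hκ ?_
    rw [← Measure.measure_univ_eq_zero]
    refine measure_mono_null (t := {x | ¬ f x < g x} ∪ Function.support fun x => g x - f x) ?_
      (measure_union_null (ae_iff.1 h) h0)
    intro x _
    by_cases hx : f x < g x
    · exact Or.inr (sub_pos.2 hx).ne'
    · exact Or.inl hx
  · filter_upwards [h] with x hx using (sub_pos.2 hx).le
  · exact hg.sub hf

theorem constraintMeasure_restrict_Ioi {c s R : ℝ} (hs : 0 < s) (hR : 0 < R) :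
    (constraintMeasure c s).restrict (Ioi (-R ^ 2)) = ENNReal.ofReal (2 * (√c / (Real.pi * s))) •
      (volume.restrict (Ioo (0 : ℝ) R)).map fun u : ℝ => -u ^ 2 := by
  have hf : Measurable fun u : ℝ => -u ^ 2 := by fun_prop
  rw [constraintMeasure_eq_map hs, Measure.restrict_smul, Measure.restrict_map hf measurableSet_Ioi,
    Measure.restrict_restrict (hf measurableSet_Ioi)]
  congr 3
  ext u
  simp only [mem_inter_iff, mem_preimage, mem_Ioi, mem_Ioo, neg_lt_neg_iff]
  constructor
  · rintro ⟨h1, h2⟩; exact ⟨h2, lt_of_pow_lt_pow_left₀ 2 hR.le h1⟩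
  · rintro ⟨h1, h2⟩; exact ⟨pow_lt_pow_left₀ h2 h1.le two_ne_zero, h1⟩

theorem isFiniteMeasure_constraintMeasure_restrict {c s R : ℝ} (hs : 0 < s) (hR : 0 < R) :
    IsFiniteMeasure ((constraintMeasure c s).restrict (Ioi (-R ^ 2))) := by
  rw [constraintMeasure_restrict_Ioi hs hR]
  exact Measure.smul_finite _ ENNReal.ofReal_ne_top

theorem logIntegrable_constraintMeasure_restrict {c s R : ℝ} (hs : 0 < s) (hR : 0 < R) :
    LogIntegrable ((constraintMeasure c s).restrict (Ioi (-R ^ 2))) := by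
  have := isFiniteMeasure_constraintMeasure_restrict (c := c) hs hR
  refine Integrable.of_bound (C := R ^ 2)
    (by fun_prop : Measurable fun s : ℝ => Real.log (1 + |s|)).aestronglyMeasurable ?_
  filter_upwards [ae_restrict_mem measurableSet_Ioi, ae_restrict_of_ae (ae_constraintMeasure c s)]
    with x hx hx0
  rw [mem_Ioi] at hx
  rw [mem_Iic] at hx0
  rw [Real.norm_eq_abs, abs_of_nonneg (Real.log_nonneg (by linarith [abs_nonneg x]))]
  have := Real.log_le_sub_one_of_pos (by linarith [abs_nonneg x] : 0 < 1 + |x|)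
  rw [abs_of_nonpos hx0] at *
  linarith

theorem integral_log_abs_sq_sub {R w : ℝ} (hR : 0 < R) :
    ∫ u in Ioo 0 R, Real.log |u ^ 2 - w ^ 2| =
      (R - w) * Real.log (R - w) + (R + w) * Real.log (R + w) - 2 * R := by
  have h : ∀ᵐ u : ℝ, u ∈ Ι 0 R → Real.log |u ^ 2 - w ^ 2| =
      Real.log (u - w) + Real.log (u + w) := by
    have h1 : ∀ᵐ u : ℝ, u ≠ w := by rw [ae_iff]; simp
    have h2 : ∀ᵐ u : ℝ, u ≠ -w := by rw [ae_iff]; simp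
    filter_upwards [h1, h2] with u hu1 hu2 _
    rw [Real.log_abs, show u ^ 2 - w ^ 2 = (u - w) * (u + w) by ring, Real.log_mul]
    · exact sub_ne_zero.2 hu1
    · exact fun h => hu2 (by linarith)
  have i1 : IntervalIntegrable (fun u => Real.log (u - w)) volume 0 R := by
    have := (intervalIntegral.intervalIntegrable_log' (a := 0 - w) (b := R - w)).comp_sub_right w
    simpa using this
  have i2 : IntervalIntegrable (fun u => Real.log (u + w)) volume 0 R := by
    have := (intervalIntegral.intervalIntegrable_log' (a := 0 + w) (b := R + w)).comp_add_right w
    simpa using this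
  rw [← integral_Ioc_eq_integral_Ioo, ← intervalIntegral.integral_of_le hR.le,
    intervalIntegral.integral_congr_ae h, intervalIntegral.integral_add i1 i2,
    intervalIntegral.integral_comp_sub_right, intervalIntegral.integral_comp_add_right,
    integral_log, integral_log]
  simp only [zero_sub, Real.log_neg_eq_log]
  ring_nf

/-- The whole constraint has infinite mass, so it is cut off at −R². In the variable u its potential
is elementary, with w = √(−x). As R → ∞ the derivative tends to 0, which is the reason why the
potential of μ can be traded for that of the slack in `IsConstrainedMin.hasDerivAt_pot_of_gap`. -/
theorem hasDerivAt_pot_constraintMeasure {c s R x : ℝ} (hs : 0 < s) (hR : 0 < R) (hx : x < 0)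
    (hxR : -R ^ 2 < x) :
    HasDerivAt (pot ((constraintMeasure c s).restrict (Ioi (-R ^ 2))))
      (√c / (Real.pi * s) / √(-x) * (Real.log (R + √(-x)) - Real.log (R - √(-x)))) x := by
  set k := 2 * (√c / (Real.pi * s)) with hk
  have hk0 : 0 ≤ k := by have := Real.pi_pos; positivity
  have hf : Measurable fun u : ℝ => -u ^ 2 := by fun_prop
  have hpot : ∀ y < 0, pot ((constraintMeasure c s).restrict (Ioi (-R ^ 2))) y =
      -k * ((R - √(-y)) * Real.log (R - √(-y)) + (R + √(-y)) * Real.log (R + √(-y)) - 2 * R) := by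
    intro y hy
    rw [pot, constraintMeasure_restrict_Ioi hs hR, integral_smul_measure,
      integral_map hf.aemeasurable
        (by fun_prop : Measurable fun s : ℝ => -Real.log |y - s|).aestronglyMeasurable, ← integral_log_abs_sq_sub hR,
      ENNReal.toReal_ofReal hk0, integral_neg, smul_eq_mul]
    simp only [Real.sq_sqrt (by linarith : 0 ≤ -y), sub_neg_eq_add, neg_mul, mul_neg]
    congr 2
    refine integral_congr_ae (.of_forall fun u => ?_)
    simp only
    rw [add_comm]
  have hw : √(-x) < R := by
    rw [Real.sqrt_lt' hR]; linarith
  have hw0 : 0 < √(-x) := Real.sqrt_pos.2 (by linarith)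
  have h1 : HasDerivAt (fun y => √(-y)) (-1 / (2 * √(-x))) x :=
    (hasDerivAt_neg x).sqrt (by linarith)
  have h2 := h1.const_sub R
  have h3 := h1.const_add R
  have h4 := (h2.fun_mul (h2.log (by linarith))).fun_add (h3.fun_mul (h3.log (by linarith)))
  have h5 := (h4.sub_const (2 * R)).const_mul (-k)
  refine (h5.congr_of_eventuallyEq ?_).congr_deriv ?_
  · filter_upwards [Iio_mem_nhds hx] with y hy using hpot y hy
  · have : R - √(-x) ≠ 0 := by linarith
    have : R + √(-x) ≠ 0 := by linarith
    rw [hk]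
    field_simp
    ring_nf

variable {c s : ℝ} {μ ν : Measure ℝ}

theorem IsConstrainedMin.logIntegrable (h : IsConstrainedMin c s μ ν) : LogIntegrable μ := by
  have := h.isFiniteMeasure
  exact h.finite.logIntegrable

theorem IsConstrainedMin.sub_ae_mem : ∀ᵐ x ∂(constraintMeasure c s - μ), x ∈ Iic (0 : ℝ) :=
  ae_mono Measure.sub_le (ae_constraintMeasure c s)

theorem tendsto_setIntegral_Iic_constraintMeasure {c s x : ℝ} (hs : 0 < s) :
    Tendsto (fun n : ℕ => ∫ y in Iic (-((n : ℝ) + 1) ^ 2), 1 / (x - y) ∂(constraintMeasure c s))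
      atTop (𝓝 0) := by
  obtain ⟨m, hm⟩ := exists_nat_gt (-x)
  have := tendsto_setIntegral_of_antitone (μ := constraintMeasure c s)
    (s := fun n : ℕ => Iic (-((n : ℝ) + 1) ^ 2)) (f := fun y => 1 / (x - y))
    (fun n => measurableSet_Iic) (fun i j hij => Iic_subset_Iic.2 (by gcongr)) ⟨m, ?_⟩
  · have he : (⋂ n : ℕ, Iic (-((n : ℝ) + 1) ^ 2)) = ∅ := by
      refine eq_empty_of_forall_notMem fun y hy => ?_
      obtain ⟨n, hn⟩ := exists_nat_gt (-y)
      have := mem_iInter.1 hy n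
      rw [mem_Iic] at this
      nlinarith [n.cast_nonneg (α := ℝ)]
    rwa [he, setIntegral_empty] at this
  · refine CauchyIntegrable.integrable_real
      ((cauchyIntegrable_constraintMeasure hs).mono Measure.restrict_le_self) isClosed_Iic
      (ae_restrict_mem measurableSet_Iic) (x := x) ?_
    rw [mem_Iic, not_le]
    nlinarith [m.cast_nonneg (α := ℝ)]

theorem tendsto_log_add_sub_log_sub (w : ℝ) :
    Tendsto (fun n : ℕ => Real.log ((n : ℝ) + 1 + w) - Real.log ((n : ℝ) + 1 - w)) atTop (𝓝 0) := by
  have h1 := (Real.tendsto_log_comp_add_sub_log (2 * w)).comp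
    (tendsto_atTop_add_const_right atTop (1 - w) tendsto_natCast_atTop_atTop)
  refine h1.congr fun n => ?_
  simp only [Function.comp]
  congr 2 <;> ring_nf

/-- Where the constraint is attained, the derivative of the potential is a Cauchy transform of the
slack measure. -/
theorem IsConstrainedMin.hasDerivAt_pot_of_gap (hs : 0 < s) (h : IsConstrainedMin c s μ ν)
    {α β x : ℝ} (hαβ : (constraintMeasure c s - μ) (Ioo α β) = 0) (hx : x ∈ Ioo α β) (hx0 : x < 0) :
    HasDerivAt (pot μ) (cauchyReal (constraintMeasure c s - μ) x) x := by
  have := h.isFiniteMeasure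
  set σ := constraintMeasure c s - μ with hσ
  have hsum : σ + μ = constraintMeasure c s := h.sub_add
  have hσρ : σ ≤ constraintMeasure c s := Measure.sub_le
  have hσT : ∀ᵐ y ∂σ, y ∈ (Ioo α β)ᶜ := by rw [ae_iff]; simpa using! hαβ
  have hT : IsClosed (Ioo α β)ᶜ := isOpen_Ioo.isClosed_compl
  have hσC : CauchyIntegrable σ := (cauchyIntegrable_constraintMeasure hs).mono hσρ
  set w := √(-x) with hw
  set e : ℕ → ℝ := fun n => √c / (Real.pi * s) / w *
    (Real.log ((n : ℝ) + 1 + w) - Real.log ((n : ℝ) + 1 - w)) with he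
  -- With R = n + 1, the potential of μ equals that of μ below −R², plus that of the constraint
  -- above −R², minus that of the slack above −R². On differentiation the pieces add up to the full
  -- transform of the slack, the logarithmic term `e n`, and minus the tail of the transform of the
  -- constraint.
  have key : ∀ n : ℕ, -x < n → HasDerivAt (pot μ) (cauchyReal σ x + (e n -
      ∫ y in Iic (-((n : ℝ) + 1) ^ 2), 1 / (x - y) ∂(constraintMeasure c s))) x := by
    intro n hn
    set R : ℝ := (n : ℝ) + 1 with hR
    have hR0 : 0 < R := by positivity
    have hxR : -R ^ 2 < x := by nlinarith
    have hxI : x ∉ Iic (-R ^ 2) := by simpa using hxR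
    set ρR := (constraintMeasure c s).restrict (Ioi (-R ^ 2)) with hρR
    have hρf : IsFiniteMeasure ρR := isFiniteMeasure_constraintMeasure_restrict hs hR0
    have hρl : LogIntegrable ρR := logIntegrable_constraintMeasure_restrict hs hR0
    have hσR : σ.restrict (Ioi (-R ^ 2)) ≤ ρR := Measure.restrict_mono le_rfl hσρ
    have hσf : IsFiniteMeasure (σ.restrict (Ioi (-R ^ 2))) := isFiniteMeasure_of_le _ hσR
    have hσl := hρl.mono hσR
    have d1 := hasDerivAt_pot_constraintMeasure (c := c) hs hR0 hx0 hxR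
    have d2 := hasDerivAt_pot hσl hT (ae_restrict_of_ae hσT) (not_not_intro hx)
    have d3 := hasDerivAt_pot (h.logIntegrable.mono Measure.restrict_le_self) isClosed_Iic
      (ae_restrict_mem (μ := μ) measurableSet_Iic) hxI
    have hμl : μ.restrict (Ioi (-R ^ 2)) ≤ ρR := Measure.restrict_mono le_rfl h.le
    refine (((d3.add d1).sub d2).congr_of_eventuallyEq ?_).congr_deriv ?_
    · filter_upwards [Ioo_mem_nhds hx.1 hx.2, Iio_mem_nhds hx0, Ioi_mem_nhds hxR] with y hy hy0 hyR
      have hδ : 0 < -y / 2 := by rw [mem_Iio] at hy0; linarith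
      have i1 := (pot_sub_potTrunc_le hs hδ hδ (x := y) (by linarith) hρl
        Measure.restrict_le_self).1
      have iμ := (pot_sub_potTrunc_le hs hδ hδ (x := y) (by linarith) h.logIntegrable h.le).1
      have e1 : pot ρR y = pot (σ.restrict (Ioi (-R ^ 2))) y + pot (μ.restrict (Ioi (-R ^ 2))) y := by
        rw [pot, hρR, ← hsum, Measure.restrict_add, integral_add_measure (i1.mono_measure hσR)
          (i1.mono_measure hμl)]
        rfl
      have e2 : pot μ y = pot (μ.restrict (Iic (-R ^ 2))) y + pot (μ.restrict (Ioi (-R ^ 2))) y := by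
        rw [pot, ← integral_add_compl (measurableSet_Iic (a := -R ^ 2)) iμ, compl_Iic]
        rfl
      simp only [Pi.add_apply, Pi.sub_apply]
      linarith
    · have j0 : Integrable (fun y => 1 / (x - y)) ((constraintMeasure c s).restrict (Iic (-R ^ 2))) :=
        CauchyIntegrable.integrable_real ((cauchyIntegrable_constraintMeasure hs).mono
          Measure.restrict_le_self) isClosed_Iic (ae_restrict_mem measurableSet_Iic) hxI
      have j1 := hσC.integrable_real hT hσT (not_not_intro hx)
      have c1 : cauchyReal σ x = cauchyReal (σ.restrict (Iic (-R ^ 2))) x +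
          cauchyReal (σ.restrict (Ioi (-R ^ 2))) x := by
        rw [cauchyReal, ← integral_add_compl (measurableSet_Iic (a := -R ^ 2)) j1, compl_Iic]
        rfl
      have c2 : ∫ y in Iic (-R ^ 2), 1 / (x - y) ∂(constraintMeasure c s) =
          cauchyReal (σ.restrict (Iic (-R ^ 2))) x + cauchyReal (μ.restrict (Iic (-R ^ 2))) x := by
        rw [← hsum, Measure.restrict_add, integral_add_measure
          (j0.mono_measure (Measure.restrict_mono le_rfl hσρ))
          (j0.mono_measure (Measure.restrict_mono le_rfl h.le))]
        rfl
      simp only [he]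
      linarith
  have hlim : Tendsto (fun n : ℕ => cauchyReal σ x + (e n -
      ∫ y in Iic (-((n : ℝ) + 1) ^ 2), 1 / (x - y) ∂(constraintMeasure c s))) atTop
      (𝓝 (cauchyReal σ x)) := by
    have h1 := ((tendsto_log_add_sub_log_sub w).const_mul (√c / (Real.pi * s) / w)).sub
      (tendsto_setIntegral_Iic_constraintMeasure (c := c) (x := x) hs)
    simpa using h1.const_add (cauchyReal σ x)
  obtain ⟨m, hm⟩ := exists_nat_gt (-x)
  -- The derivative of `pot μ` does not depend on `n`, so it equals the limit, in which both
  -- corrections disappear.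
  have hconst := hlim.congr' (f₂ := fun _ => deriv (pot μ) x) <| by
    filter_upwards [eventually_ge_atTop m] with n hn
    exact (key n (hm.trans_le (by exact_mod_cast hn))).deriv.symm
  rw [tendsto_nhds_unique hconst tendsto_const_nhds]
  exact (key m hm).differentiableAt.hasDerivAt

theorem IsConstrainedMin.hasDerivAt_pot_right (h : IsConstrainedMin c s μ ν) {x : ℝ} (hx : x < 0) :
    HasDerivAt (pot ν) (-cauchyReal ν x) x := by
  have := h.isFiniteMeasure'
  exact hasDerivAt_pot h.finite'.logIntegrable isClosed_Ici h.ae_mem' (by simpa using hx)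

/-! ### Gaps in the supports of the slack and of μ. -/

theorem _root_.IsClosed.exists_gap_left {S : Set ℝ} (hS : IsClosed S) {x y : ℝ} (hx : x ∉ S)
    (hy : y ∈ S) (hyx : y < x) : ∃ α ∈ S, α < x ∧ ∀ z ∈ Ioc α x, z ∉ S := by
  have hb : BddAbove (S ∩ Iic x) := ⟨x, fun z hz => hz.2⟩
  have hm := (hS.inter isClosed_Iic).csSup_mem ⟨y, hy, hyx.le⟩ hb
  refine ⟨_, hm.1, hm.2.lt_of_ne fun h => hx (h ▸ hm.1), fun z hz hzS => ?_⟩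
  exact not_le.2 hz.1 (le_csSup hb ⟨hzS, hz.2⟩)

theorem _root_.IsClosed.exists_gap_right {S : Set ℝ} (hS : IsClosed S) {x y : ℝ} (hx : x ∉ S)
    (hy : y ∈ S) (hyx : x < y) : ∃ β ∈ S, x < β ∧ ∀ z ∈ Ico x β, z ∉ S := by
  have hb : BddBelow (S ∩ Ici x) := ⟨x, fun z hz => hz.2⟩
  have hm := (hS.inter isClosed_Ici).csInf_mem ⟨y, hy, hyx.le⟩ hb
  refine ⟨_, hm.1, lt_of_le_of_ne hm.2 fun h => hx (h ▸ hm.1), fun z hz hzS => ?_⟩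
  exact not_le.2 hz.2 (csInf_le hb ⟨hzS, hz.1⟩)

theorem mem_support_of_eq_on_isOpen {κ : Measure ℝ} {U : Set ℝ} (hU : IsOpen U) {x : ℝ}
    (hx : x ∈ U) (h : ∀ V, IsOpen V → V ⊆ U → x ∈ V → 0 < κ V) : x ∈ κ.support := by
  rw [Measure.mem_support_iff_forall]
  intro W hW
  obtain ⟨V, hVW, hV, hxV⟩ := _root_.mem_nhds_iff.1 hW
  exact (h (V ∩ U) (hV.inter hU) inter_subset_right ⟨hxV, hx⟩).trans_le
    (measure_mono (inter_subset_left.trans hVW))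

theorem IsConstrainedMin.ioo_subset_support (hc : 0 < c) (hs : 0 < s) (h : IsConstrainedMin c s μ ν)
    {α β : ℝ} (hαβ : (constraintMeasure c s - μ) (Ioo α β) = 0) (hβ : β ≤ 0) :
    Ioo α β ⊆ μ.support := by
  intro x hx
  refine mem_support_of_eq_on_isOpen isOpen_Ioo hx fun V hV hVU hxV => ?_
  have h1 := constraintMeasure_pos_of_isOpen hc hs hV hxV (hx.2.trans_le hβ)
  rwa [← h.sub_add, Measure.add_apply, measure_mono_null hVU hαβ, zero_add] at h1

theorem IsConstrainedMin.ioo_subset_support_sub (hc : 0 < c) (hs : 0 < s)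
    (h : IsConstrainedMin c s μ ν) {α β : ℝ} (hαβ : μ (Ioo α β) = 0) (hβ : β ≤ 0) :
    Ioo α β ⊆ (constraintMeasure c s - μ).support := by
  intro x hx
  refine mem_support_of_eq_on_isOpen isOpen_Ioo hx fun V hV hVU hxV => ?_
  have h1 := constraintMeasure_pos_of_isOpen hc hs hV hxV (hx.2.trans_le hβ)
  rwa [← h.sub_add, Measure.add_apply, measure_mono_null hVU hαβ, add_zero] at h1

theorem measure_eq_zero_of_forall_notMem_support {κ : Measure ℝ} {A : Set ℝ}
    (h : ∀ x ∈ A, x ∉ κ.support) : κ A = 0 :=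
  measure_mono_null h Measure.measure_compl_support

theorem IsConstrainedMin.sub_Iic_ne_zero (hc : 0 < c) (hs : 0 < s) (h : IsConstrainedMin c s μ ν)
    (x : ℝ) : (constraintMeasure c s - μ) (Iic x) ≠ 0 := by
  have := h.isFiniteMeasure
  intro h0
  have := constraintMeasure_Iic hc hs x
  rw [← h.sub_add, Measure.add_apply, h0, zero_add] at this
  exact measure_ne_top μ _ this

theorem IsConstrainedMin.sub_ne_zero (hc : 0 < c) (hs : 0 < s) (h : IsConstrainedMin c s μ ν) :
    constraintMeasure c s - μ ≠ 0 := fun h0 => h.sub_Iic_ne_zero hc hs 0 (by rw [h0]; simp)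

theorem sub_pos_of_not_mem_Ioo {α β x y z : ℝ} (hx : x ∈ Ioo α β) (hy : y ∈ Ioo α β) (hxy : x < y)
    (hz : z ∈ (Ioo α β)ᶜ) : 1 / (y - z) < 1 / (x - z) := by
  rw [mem_compl_iff, mem_Ioo, not_and_or, not_lt, not_lt] at hz
  rcases hz with hz | hz
  · exact one_div_lt_one_div_of_lt (by linarith [hx.1]) (by linarith)
  · exact one_div_lt_one_div_of_neg_of_lt (by linarith [hy.2]) (by linarith)

theorem cauchyReal_lt {κ : Measure ℝ} (hκ : CauchyIntegrable κ) (hκ0 : κ ≠ 0) {α β x y : ℝ}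
    (hαβ : κ (Ioo α β) = 0) (hx : x ∈ Ioo α β) (hy : y ∈ Ioo α β) (hxy : x < y) :
    cauchyReal κ y < cauchyReal κ x := by
  have hT : ∀ᵐ z ∂κ, z ∈ (Ioo α β)ᶜ := by rw [ae_iff]; simpa using! hαβ
  have hTc : IsClosed (Ioo α β)ᶜ := isOpen_Ioo.isClosed_compl
  refine integral_lt_integral_of_ae_lt hκ0 (hκ.integrable_real hTc hT (not_not_intro hy))
    (hκ.integrable_real hTc hT (not_not_intro hx)) ?_
  filter_upwards [hT] with z hz using sub_pos_of_not_mem_Ioo hx hy hxy hz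

/-- The slack is unbounded to the left, since the constraint has infinite mass there. On a gap of
its support the constraint is attained, so the gap lies in the support of μ and φ = 2U^μ − U^ν is
there at most its value at either end. By the mean value theorem φ' is ≤ 0 somewhere to the left of
x and ≥ 0 somewhere to the right. But φ' = 2G + F is a sum of Cauchy transforms of positive measures
off the gap, hence strictly decreasing. -/
theorem IsConstrainedMin.exists_support_sub_eq (hc : 0 < c) (hs : 0 < s)
    (h : IsConstrainedMin c s μ ν) :
    ∃ c₁ : ℝ, 0 ≤ c₁ ∧ (constraintMeasure c s - μ).support = Iic (-c₁) := by
  have := h.isFiniteMeasure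
  have := h.isFiniteMeasure'
  set σ := constraintMeasure c s - μ with hσ
  have hσC : CauchyIntegrable σ := (cauchyIntegrable_constraintMeasure hs).mono Measure.sub_le
  have hcl : IsClosed σ.support := Measure.isClosed_support
  have h0 : σ.support ⊆ Iic 0 :=
    Measure.support_subset_of_isClosed isClosed_Iic IsConstrainedMin.sub_ae_mem
  have hunb : ∀ x, ∃ y ∈ σ.support, y ≤ x := by
    intro x
    by_contra! hx
    exact h.sub_Iic_ne_zero hc hs x (measure_eq_zero_of_forall_notMem_support
      fun y hy hyσ => not_le.2 (hx y hyσ) hy)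
  have hlower : ∀ x y, y ∈ σ.support → x < y → x ∈ σ.support := by
    intro x y hy hxy
    by_contra hx
    obtain ⟨y', hy', hyx'⟩ := hunb (x - 1)
    obtain ⟨α, hα, hαx, hα'⟩ := hcl.exists_gap_left hx hy' (by linarith)
    obtain ⟨β, hβ, hxβ, hβ'⟩ := hcl.exists_gap_right hx hy hxy
    have hgap : σ (Ioo α β) = 0 := by
      refine measure_eq_zero_of_forall_notMem_support fun z hz => ?_
      rcases le_total z x with hzx | hzx
      · exact hα' z ⟨hz.1, hzx⟩
      · exact hβ' z ⟨hzx, hz.2⟩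
    -- If β were 0, it would be an isolated point of the support of the slack, which has no atoms
    -- and does not charge (0, ∞).
    have hβ0 : β < 0 := by
      refine lt_of_le_of_ne (h0 hβ) fun hβ0 => ?_
      subst hβ0
      have hpos := (Measure.mem_support_iff_forall _).1 hβ (Ioi α) (Ioi_mem_nhds (hαx.trans hxβ))
      refine hpos.ne' (measure_mono_null (t := Ioo α 0 ∪ ({0} ∪ Ioi 0)) ?_
        (measure_union_null hgap (measure_union_null ?_ ?_)))
      · intro z hz
        rcases lt_trichotomy z 0 with h | h | h
        · exact Or.inl ⟨hz, h⟩
        · exact Or.inr (Or.inl h)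
        · exact Or.inr (Or.inr h)
      · exact le_antisymm ((Measure.sub_le _).trans (by simp)) bot_le
      · exact le_antisymm ((Measure.sub_le _).trans (constraintMeasure_Ioi c s).le) bot_le
    have hsub := h.ioo_subset_support hc hs hgap hβ0.le
    set φ : ℝ → ℝ := fun x => 2 * pot μ x - pot ν x with hφ
    have hd : ∀ z ∈ Ioo α β, HasDerivAt φ (2 * cauchyReal σ z - -cauchyReal ν z) z := fun z hz =>
      ((h.hasDerivAt_pot_of_gap hs hgap hz (hz.2.trans hβ0)).const_mul 2).sub
        (h.hasDerivAt_pot_right (hz.2.trans hβ0))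
    have hcont : ContinuousOn φ (Icc α β) := fun z hz =>
      (h.continuousAt_phi hs (hz.2.trans_lt hβ0)).continuousWithinAt
    have hxm : x ∈ Ioo α β := ⟨hαx, hxβ⟩
    have h1 : φ x ≤ φ α := h.phi_le hs (hxβ.trans hβ0) (hαx.trans (hxβ.trans hβ0)) (hsub hxm) hα
    have h2 : φ x ≤ φ β := h.phi_le hs (hxβ.trans hβ0) hβ0 (hsub hxm) hβ
    obtain ⟨p, hp, hp'⟩ := exists_hasDerivAt_eq_slope φ _ hαx
      (hcont.mono (Icc_subset_Icc_right hxβ.le)) fun z hz => hd z ⟨hz.1, hz.2.trans hxβ⟩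
    obtain ⟨q, hq, hq'⟩ := exists_hasDerivAt_eq_slope φ _ hxβ
      (hcont.mono (Icc_subset_Icc_left hαx.le)) fun z hz => hd z ⟨hαx.trans hz.1, hz.2⟩
    have hp0 : (φ x - φ α) / (x - α) ≤ 0 :=
      div_nonpos_of_nonpos_of_nonneg (by linarith) (by linarith)
    have hq0 : 0 ≤ (φ β - φ x) / (β - x) := div_nonneg (by linarith) (by linarith)
    have hpm : p ∈ Ioo α β := ⟨hp.1, hp.2.trans hxβ⟩
    have hqm : q ∈ Ioo α β := ⟨hαx.trans hq.1, hq.2⟩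
    have hpq : p < q := hp.2.trans hq.1
    have m1 := cauchyReal_lt hσC (h.sub_ne_zero hc hs) hgap hpm hqm hpq
    have m2 := cauchyReal_lt (cauchyIntegrable_of_isFiniteMeasure ν)
      (fun h' => by have := h.mass'; rw [h'] at this; simp at this)
      (measure_mono_null (fun z hz => hz.2.trans hβ0) h.on' : ν (Ioo α β) = 0) hpm hqm hpq
    linarith
  obtain ⟨y, hy, -⟩ := hunb 0
  have hm := hcl.csSup_mem ⟨y, hy⟩ ⟨0, h0⟩
  refine ⟨-sSup σ.support, by simpa using h0 hm, ?_⟩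
  rw [neg_neg]
  refine Subset.antisymm (fun z hz => le_csSup ⟨0, h0⟩ hz) fun z hz => ?_
  rcases (mem_Iic.1 hz).eq_or_lt with hz | hz
  · exact hz ▸ hm
  · exact hlower _ _ hm hz

/-- On a gap of μ the slack has full support, so φ is there at least its value at an end belonging
to the support of μ. The function to look at is z φ'(z) = −2 ∫ z/(z − y) dμ + ∫ z/(z − y) dν. On a
gap between negative points it strictly decreases, whereas the mean value theorem yields p φ'(p) ≤ 0
≤ q φ'(q) with p < q. On a gap reaching 0 it is positive, against p φ'(p) ≤ 0. On a gap reaching −∞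
it is less than −2·(1/2) + 1 = 0, by the masses 1/2 and 1, against q φ'(q) ≥ 0. -/
theorem IsConstrainedMin.Iio_subset_support (hc : 0 < c) (hs : 0 < s)
    (h : IsConstrainedMin c s μ ν) : Iio 0 ⊆ μ.support := by
  have := h.isFiniteMeasure
  have := h.isFiniteMeasure'
  intro x (hx0 : x < 0)
  by_contra hx
  have hcl : IsClosed μ.support := Measure.isClosed_support
  have h0 : μ.support ⊆ Iic 0 := Measure.support_subset_of_isClosed isClosed_Iic h.ae_mem
  set φ : ℝ → ℝ := fun x => 2 * pot μ x - pot ν x with hφ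
  have hna : ∀ᵐ z ∂μ, z ≠ 0 := by rw [ae_iff]; simpa using h.finite.measure_singleton 0
  have hna' : ∀ᵐ z ∂ν, z ≠ 0 := by rw [ae_iff]; simpa using h.finite'.measure_singleton 0
  have hμ0 : μ ≠ 0 := fun h' => by
    have := h.mass
    rw [h'] at this
    exact absurd this.symm (by simp)
  have hν0 : ν ≠ 0 := fun h' => by have := h.mass'; rw [h'] at this; simp at this
  have hμr : μ.real univ = 1 / 2 := by rw [measureReal_def, h.mass]; simp
  have hνr : ν.real univ = 1 := by rw [measureReal_def, h.mass']; simp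
  have hd : ∀ {A : Set ℝ} (hA : IsOpen A) (hA0 : A ⊆ Iio 0) (hμA : μ A = 0), ∀ z ∈ A,
      HasDerivAt φ (2 * -cauchyReal μ z - -cauchyReal ν z) z := fun hA hA0 hμA z hz =>
    ((hasDerivAt_pot h.logIntegrable hA.isClosed_compl (by rw [ae_iff]; simpa using! hμA)
      (not_not_intro hz)).const_mul 2).sub (h.hasDerivAt_pot_right (hA0 hz))
  have hmul : ∀ {A : Set ℝ} (hA : IsOpen A) (hA0 : A ⊆ Iio 0) (hμA : μ A = 0), ∀ z ∈ A,
      Integrable (fun y => z / (z - y)) μ ∧ Integrable (fun y => z / (z - y)) ν ∧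
      z * (2 * -cauchyReal μ z - -cauchyReal ν z) =
        -2 * ∫ y, z / (z - y) ∂μ + ∫ y, z / (z - y) ∂ν := by
    intro A hA hA0 hμA z hz
    have i1 := (cauchyIntegrable_of_isFiniteMeasure μ).integrable_real hA.isClosed_compl
      (by rw [ae_iff]; simpa using! hμA) (not_not_intro hz)
    have i2 := (cauchyIntegrable_of_isFiniteMeasure ν).integrable_real isClosed_Ici h.ae_mem'
      (by simpa using hA0 hz)
    have e : (fun y => z / (z - y)) = fun y => z * (1 / (z - y)) := by ext; rw [mul_one_div]
    rw [e]
    refine ⟨i1.const_mul z, i2.const_mul z, ?_⟩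
    rw [integral_const_mul, integral_const_mul, cauchyReal, cauchyReal]
    ring
  have hcont : ∀ z < 0, ContinuousAt φ z := fun z hz => h.continuousAt_phi hs hz
  by_cases hL : ∃ y ∈ μ.support, y < x
  · obtain ⟨y, hy, hyx⟩ := hL
    obtain ⟨α, hα, hαx, hα'⟩ := hcl.exists_gap_left hx hy hyx
    by_cases hU : ∃ y ∈ μ.support, x < y ∧ y < 0
    · obtain ⟨y, hy, hxy, hy0⟩ := hU
      obtain ⟨β, hβ, hxβ, hβ'⟩ := hcl.exists_gap_right hx hy hxy
      have hβ0 : β < 0 := by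
        by_contra! hb
        exact hβ' y ⟨hxy.le, hy0.trans_le hb⟩ hy
      have hgap : μ (Ioo α β) = 0 := by
        refine measure_eq_zero_of_forall_notMem_support fun z hz => ?_
        rcases le_total z x with hzx | hzx
        · exact hα' z ⟨hz.1, hzx⟩
        · exact hβ' z ⟨hzx, hz.2⟩
      have hsub := h.ioo_subset_support_sub hc hs hgap hβ0.le
      have hgap0 : Ioo α β ⊆ Iio 0 := fun z hz => hz.2.trans hβ0
      have hxm : x ∈ Ioo α β := ⟨hαx, hxβ⟩
      have h1 : φ α ≤ φ x := h.phi_le hs (hαx.trans hx0) hx0 hα (hsub hxm)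
      have h2 : φ β ≤ φ x := h.phi_le hs hβ0 hx0 hβ (hsub hxm)
      have hcont' : ContinuousOn φ (Icc α β) := fun z hz =>
        (hcont z (hz.2.trans_lt hβ0)).continuousWithinAt
      obtain ⟨p, hp, hp'⟩ := exists_hasDerivAt_eq_slope φ _ hαx
        (hcont'.mono (Icc_subset_Icc_right hxβ.le)) fun z hz =>
          hd isOpen_Ioo hgap0 hgap z ⟨hz.1, hz.2.trans hxβ⟩
      obtain ⟨q, hq, hq'⟩ := exists_hasDerivAt_eq_slope φ _ hxβ
        (hcont'.mono (Icc_subset_Icc_left hαx.le)) fun z hz =>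
          hd isOpen_Ioo hgap0 hgap z ⟨hαx.trans hz.1, hz.2⟩
      have hp0 : 0 ≤ (φ x - φ α) / (x - α) := div_nonneg (by linarith) (by linarith)
      have hq0 : (φ β - φ x) / (β - x) ≤ 0 :=
        div_nonpos_of_nonpos_of_nonneg (by linarith) (by linarith)
      rw [← hp'] at hp0
      rw [← hq'] at hq0
      have hpm : p ∈ Ioo α β := ⟨hp.1, hp.2.trans hxβ⟩
      have hqm : q ∈ Ioo α β := ⟨hαx.trans hq.1, hq.2⟩
      have hpq : p < q := hp.2.trans hq.1
      obtain ⟨i1, i2, e1⟩ := hmul isOpen_Ioo hgap0 hgap p hpm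
      obtain ⟨i3, i4, e2⟩ := hmul isOpen_Ioo hgap0 hgap q hqm
      have hq00 : q < 0 := hgap0 hqm
      have hp00 : p < 0 := hgap0 hpm
      have s1 : ∫ y, p / (p - y) ∂μ < ∫ y, q / (q - y) ∂μ := by
        refine integral_lt_integral_of_ae_lt hμ0 i1 i3 ?_
        have hT : ∀ᵐ z ∂μ, z ∈ (Ioo α β)ᶜ := by rw [ae_iff]; simpa using! hgap
        filter_upwards [hT, hna, h.ae_mem] with z hz hz0 hz0'
        have hz1 : z < 0 := lt_of_le_of_ne hz0' hz0
        have := sub_pos_of_not_mem_Ioo hpm hqm hpq hz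
        have hpz : p - z ≠ 0 := fun hh => hz (by rwa [← sub_eq_zero.1 hh])
        have hqz : q - z ≠ 0 := fun hh => hz (by rwa [← sub_eq_zero.1 hh])
        have e1 : p / (p - z) = 1 + z * (1 / (p - z)) := by field_simp; ring
        have e2 : q / (q - z) = 1 + z * (1 / (q - z)) := by field_simp; ring
        rw [e1, e2]
        nlinarith
      have s2 : ∫ y, q / (q - y) ∂ν < ∫ y, p / (p - y) ∂ν := by
        refine integral_lt_integral_of_ae_lt hν0 i4 i2 ?_
        filter_upwards [hna', h.ae_mem'] with z hz0 hz0'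
        have hz1 : 0 < z := lt_of_le_of_ne hz0' (Ne.symm hz0)
        rw [← neg_div_neg_eq, ← neg_div_neg_eq p, div_lt_div_iff₀ (by linarith) (by linarith)]
        nlinarith
      nlinarith [mul_nonpos_of_nonpos_of_nonneg hp00.le hp0, mul_nonneg_of_nonpos_of_nonpos hq00.le hq0]
    · push Not at hU
      have hgap : μ (Ioo α 0) = 0 := by
        refine measure_eq_zero_of_forall_notMem_support fun z hz => ?_
        rcases lt_or_ge x z with hzx | hzx
        · exact fun hz' => not_le.2 hz.2 (hU z hz' hzx)
        · exact hα' z ⟨hz.1, hzx⟩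
      have hsub := h.ioo_subset_support_sub hc hs hgap le_rfl
      have hgap0 : Ioo α 0 ⊆ Iio 0 := fun z hz => hz.2
      have h1 : φ α ≤ φ x := h.phi_le hs (hαx.trans hx0) hx0 hα (hsub ⟨hαx, hx0⟩)
      obtain ⟨p, hp, hp'⟩ := exists_hasDerivAt_eq_slope φ _ hαx
        (fun z hz => (hcont z (hz.2.trans_lt hx0)).continuousWithinAt) fun z hz =>
          hd isOpen_Ioo hgap0 hgap z ⟨hz.1, hz.2.trans hx0⟩
      have hp0 : 0 ≤ (φ x - φ α) / (x - α) := div_nonneg (by linarith) (by linarith)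
      rw [← hp'] at hp0
      have hpm : p ∈ Ioo α 0 := ⟨hp.1, hp.2.trans hx0⟩
      obtain ⟨i1, i2, e1⟩ := hmul isOpen_Ioo hgap0 hgap p hpm
      have hp00 : p < 0 := hpm.2
      have s1 : ∫ y, p / (p - y) ∂μ < ∫ y, (0 : ℝ) ∂μ := by
        refine integral_lt_integral_of_ae_lt hμ0 i1 (integrable_zero _ _ _) ?_
        have hT : ∀ᵐ z ∂μ, z ∈ (Ioo α 0)ᶜ := by rw [ae_iff]; simpa using! hgap
        filter_upwards [hT, hna, h.ae_mem] with z hz hz0 hz0'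
        have hz1 : z < 0 := lt_of_le_of_ne hz0' hz0
        have hz2 : z ≤ α := by
          by_contra! hh
          exact hz ⟨hh, hz1⟩
        exact div_neg_of_neg_of_pos hp00 (by linarith [hp.1])
      have s2 : 0 ≤ ∫ y, p / (p - y) ∂ν := by
        refine integral_nonneg_of_ae ?_
        filter_upwards [h.ae_mem'] with z hz
        exact div_nonneg_of_nonpos hp00.le (by rw [mem_Ici] at hz; linarith)
      rw [integral_zero] at s1
      nlinarith [mul_nonpos_of_nonpos_of_nonneg hp00.le hp0]
  · push Not at hL
    have hU : ∃ y ∈ μ.support, x < y ∧ y < 0 := by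
      by_contra! hU
      refine hμ0 (Measure.measure_univ_eq_zero.1 ?_)
      refine measure_mono_null (t := {z | z ∉ μ.support} ∪ {0}) ?_
        (measure_union_null Measure.measure_compl_support (h.finite.measure_singleton 0))
      intro z _
      by_cases hz : z ∈ μ.support
      · have hzx : x < z := lt_of_le_of_ne (hL z hz) fun hh => hx (hh ▸ hz)
        exact Or.inr (le_antisymm (h0 hz) (hU z hz hzx))
      · exact Or.inl hz
    obtain ⟨y, hy, hxy, hy0⟩ := hU
    obtain ⟨β, hβ, hxβ, hβ'⟩ := hcl.exists_gap_right hx hy hxy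
    have hβ0 : β < 0 := by
      by_contra! hb
      exact hβ' y ⟨hxy.le, hy0.trans_le hb⟩ hy
    have hgap : μ (Iio β) = 0 := by
      refine measure_eq_zero_of_forall_notMem_support fun z hz hz' => ?_
      exact hβ' z ⟨hL z hz', hz⟩ hz'
    have hsub := h.ioo_subset_support_sub hc hs (α := x - 1)
      (measure_mono_null (fun z hz => hz.2) hgap) hβ0.le
    have hgap0 : Iio β ⊆ Iio 0 := fun z hz => lt_trans hz hβ0
    have h2 : φ β ≤ φ x := h.phi_le hs hβ0 hx0 hβ (hsub ⟨by linarith, hxβ⟩)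
    obtain ⟨q, hq, hq'⟩ := exists_hasDerivAt_eq_slope φ _ hxβ
      (fun z hz => (hcont z (hz.2.trans_lt hβ0)).continuousWithinAt) fun z hz =>
        hd isOpen_Iio hgap0 hgap z hz.2
    have hq0 : (φ β - φ x) / (β - x) ≤ 0 :=
      div_nonpos_of_nonpos_of_nonneg (by linarith) (by linarith)
    rw [← hq'] at hq0
    obtain ⟨i1, i2, e1⟩ := hmul isOpen_Iio hgap0 hgap q hq.2
    have hq00 : q < 0 := hq.2.trans hβ0
    have s1 : ∫ y, (1 : ℝ) ∂μ < ∫ y, q / (q - y) ∂μ := by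
      refine integral_lt_integral_of_ae_lt hμ0 (integrable_const _) i1 ?_
      have hT : ∀ᵐ z ∂μ, z ∈ (Iio β)ᶜ := by rw [ae_iff]; simpa using! hgap
      filter_upwards [hT, hna, h.ae_mem] with z hz hz0 hz0'
      have hz1 : z < 0 := lt_of_le_of_ne hz0' hz0
      have hz2 : β ≤ z := not_lt.1 hz
      rw [← neg_div_neg_eq, one_lt_div (by linarith [hq.2])]
      linarith
    have s2 : ∫ y, q / (q - y) ∂ν ≤ ∫ y, (1 : ℝ) ∂ν := by
      refine integral_mono_ae i2 (integrable_const _) ?_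
      filter_upwards [h.ae_mem'] with z hz
      rw [mem_Ici] at hz
      rw [← neg_div_neg_eq, div_le_one (by linarith)]
      linarith
    rw [integral_const, hμr, smul_eq_mul, mul_one] at s1
    rw [integral_const, hνr, smul_eq_mul, mul_one] at s2
    nlinarith [mul_nonneg_of_nonpos_of_nonpos hq00.le hq0]

theorem IsConstrainedMin.exists_phi_eq (hc : 0 < c) (hs : 0 < s) (h : IsConstrainedMin c s μ ν)
    {c₁ : ℝ} (hc₁ : 0 ≤ c₁) (hS : (constraintMeasure c s - μ).support = Iic (-c₁)) :
    ∃ ℓ, ∀ x < -c₁, 2 * pot μ x - pot ν x = ℓ := by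
  refine ⟨2 * pot μ (-c₁ - 1) - pot ν (-c₁ - 1), fun x hx => ?_⟩
  have hsupp := h.Iio_subset_support hc hs
  have m1 : x ∈ (constraintMeasure c s - μ).support := by rw [hS]; exact hx.le
  have m2 : -c₁ - 1 ∈ (constraintMeasure c s - μ).support := by
    rw [hS, mem_Iic]; linarith
  have n1 : x < 0 := by linarith
  have n2 : -c₁ - 1 < 0 := by linarith
  exact le_antisymm (h.phi_le hs n1 n2 (hsupp n1) m2) (h.phi_le hs n2 n1 (hsupp n2) m1)

end Supports

/-! ### The principal square root -/

section SquareRoot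

open Complex Metric Set Filter
open scoped ComplexConjugate

/-- The principal branch of the complex square root. -/
def csqrt (z : ℂ) : ℂ := z ^ (1 / 2 : ℂ)

theorem csqrt_sq (z : ℂ) : csqrt z ^ 2 = z := by
  rw [csqrt, ← Complex.cpow_nat_mul]
  norm_num

theorem csqrt_ne_zero {z : ℂ} (hz : z ≠ 0) : csqrt z ≠ 0 := fun h => hz (by
  rw [← csqrt_sq z, h]; simp)

theorem norm_csqrt (z : ℂ) : ‖csqrt z‖ = √‖z‖ := by
  rw [← Real.sqrt_sq (norm_nonneg (csqrt z)), ← norm_pow, csqrt_sq]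

theorem csqrt_ofReal {x : ℝ} (hx : 0 ≤ x) : csqrt x = (√x : ℂ) := by
  rw [csqrt, Real.sqrt_eq_rpow, Complex.ofReal_cpow hx]
  norm_num

theorem csqrt_eq {z : ℂ} (hz : z ≠ 0) :
    csqrt z = √‖z‖ * exp ((arg z / 2 : ℝ) * I) := by
  rw [csqrt, cpow_def_of_ne_zero hz, log]
  have : (Real.log ‖z‖ + arg z * I) * (1 / 2 : ℂ) =
      ((Real.log ‖z‖ * (1 / 2 : ℝ) : ℝ) : ℂ) + (arg z / 2 : ℝ) * I := by push_cast; ring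
  rw [this, Complex.exp_add, ← ofReal_exp, Real.sqrt_eq_rpow, Real.rpow_def_of_pos (norm_pos_iff.2 hz)]

theorem csqrt_re {z : ℂ} (hz : z ≠ 0) : (csqrt z).re = √‖z‖ * Real.cos (arg z / 2) := by
  rw [csqrt_eq hz, re_ofReal_mul, exp_ofReal_mul_I_re]

theorem csqrt_re_pos {z : ℂ} (hz : z ∈ slitPlane) : 0 < (csqrt z).re := by
  have h0 := slitPlane_ne_zero hz
  rw [csqrt_re h0]
  have h1 := neg_pi_lt_arg z
  have h2 := (arg_le_pi z).lt_of_ne (mem_slitPlane_iff_arg.1 hz).1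
  exact mul_pos (Real.sqrt_pos.2 (norm_pos_iff.2 h0))
    (Real.cos_pos_of_mem_Ioo ⟨by linarith, by linarith⟩)

theorem differentiableAt_csqrt {z : ℂ} (hz : z ∈ slitPlane) : DifferentiableAt ℂ csqrt z :=
  differentiableAt_id.cpow_const hz

theorem mem_slitPlane_of_im_ne_zero {z : ℂ} (hz : z.im ≠ 0) : z ∈ slitPlane := Or.inr hz

/-- The function i√(−z) is holomorphic off [0, ∞). This formula and its counterpart below the axis
express that the square root continues across the negative axis with a change of sign. -/
theorem csqrt_of_im_pos {z : ℂ} (hz : 0 < z.im) : csqrt z = I * csqrt (-z) := by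
  have h0 : z ≠ 0 := fun h => by simp [h] at hz
  rw [csqrt_eq h0, csqrt_eq (neg_ne_zero.2 h0), norm_neg, arg_neg_eq_arg_sub_pi_of_im_pos hz,
    mul_left_comm]
  congr 1
  calc exp ((arg z / 2 : ℝ) * I)
      = exp (Real.pi / 2 * I + ((arg z - Real.pi) / 2 : ℝ) * I) := by
        congr 1; push_cast; ring
    _ = _ := by rw [Complex.exp_add, exp_pi_div_two_mul_I]

theorem csqrt_of_im_neg {z : ℂ} (hz : z.im < 0) : csqrt z = -(I * csqrt (-z)) := by
  have h := csqrt_of_im_pos (z := -z) (by simpa using hz)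
  rw [neg_neg] at h
  rw [h, ← mul_assoc, I_mul_I]; ring

end SquareRoot

/-! ### Extension of functions from the non-real points -/

section RealExtension

open Complex Metric Set Filter

/-- The extension by continuity of a function from the non-real points. -/
def realExt (f : ℂ → ℂ) (z : ℂ) : ℂ := limUnder (𝓝[{w | w.im ≠ 0}] z) f

theorem dense_im_ne_zero : Dense {w : ℂ | w.im ≠ 0} := by
  have := (dense_compl_singleton (0 : ℝ)).preimage Complex.isOpenMap_im
  exact this

theorem nhdsWithin_im_ne_zero_neBot (z : ℂ) : (𝓝[{w : ℂ | w.im ≠ 0}] z).NeBot :=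
  mem_closure_iff_nhdsWithin_neBot.1 (dense_im_ne_zero z)

theorem realExt_eq {f g : ℂ → ℂ} {U : Set ℂ} (hU : IsOpen U) (hg : ContinuousOn g U)
    (hfg : ∀ z ∈ U, z.im ≠ 0 → g z = f z) {z : ℂ} (hz : z ∈ U) : realExt f z = g z := by
  have := nhdsWithin_im_ne_zero_neBot z
  refine Tendsto.limUnder_eq ?_
  have h1 : Tendsto g (𝓝[{w | w.im ≠ 0}] z) (𝓝 (g z)) :=
    ((hg z hz).continuousAt (hU.mem_nhds hz)).tendsto.mono_left nhdsWithin_le_nhds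
  refine h1.congr' ?_
  filter_upwards [self_mem_nhdsWithin, mem_nhdsWithin_of_mem_nhds (hU.mem_nhds hz)] with w hw hwU
    using hfg w hwU hw

theorem isOpen_im_ne_zero : IsOpen {w : ℂ | w.im ≠ 0} :=
  isOpen_compl_singleton.preimage Complex.continuous_im

theorem realExt_eq_self {f : ℂ → ℂ} (hd : ∀ z, z.im ≠ 0 → DifferentiableAt ℂ f z) {z : ℂ}
    (hz : z.im ≠ 0) : realExt f z = f z :=
  realExt_eq isOpen_im_ne_zero (fun z hz => (hd z hz).continuousAt.continuousWithinAt)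
    (fun _ _ _ => rfl) hz

theorem differentiableAt_realExt {f g : ℂ → ℂ} {U : Set ℂ} (hU : IsOpen U)
    (hg : DifferentiableOn ℂ g U) (hfg : ∀ z ∈ U, z.im ≠ 0 → g z = f z) {z : ℂ} (hz : z ∈ U) :
    DifferentiableAt ℂ (realExt f) z := by
  refine ((hg z hz).differentiableAt (hU.mem_nhds hz)).congr_of_eventuallyEq ?_
  filter_upwards [hU.mem_nhds hz] with w hw using realExt_eq hU hg.continuousOn hfg hw

/-- A function with at most a growth `1 / |Im z|` near a real point has at most a simple pole
there. -/
theorem norm_mul_norm_sub_le {g : ℂ → ℂ} {e : ℝ} {C : ℝ} (hC0 : 0 ≤ C) {z : ℂ} (hz : z ≠ e)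
    (hg : ∀ w ∈ closedBall (e : ℂ) (2 * ‖z - e‖), w ≠ e → DifferentiableAt ℂ g w)
    (hC : ∀ w ∈ closedBall (e : ℂ) (2 * ‖z - e‖), w.im ≠ 0 → ‖g w‖ * |w.im| ≤ C) :
    ‖g z‖ * ‖z - e‖ ≤ 6 * C := by
  set d := ‖z - e‖ with hd
  have hd0 : 0 < d := norm_pos_iff.2 (sub_ne_zero.2 hz)
  -- Either |Im z| is comparable to d and the hypothesis suffices, or |Re z − e| > 3d/4. Then the
  -- disk of radius d/2 about Re z avoids e, stays within 2d of it, and contains z in its half-size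
  -- disk.
  by_cases him : d / 4 ≤ |z.im|
  · have h1 := hC z (by rw [mem_closedBall, Complex.dist_eq]; linarith) fun h0 => by
      rw [h0, abs_zero] at him; linarith
    nlinarith [norm_nonneg (g z)]
  · push Not at him
    have hre : d ≤ |z.re - e| + |z.im| := by
      have := Complex.norm_le_abs_re_add_abs_im (z - e)
      simpa using this
    have hre' : |z.re - e| ≤ d := by
      simpa using Complex.abs_re_le_norm (z - e)
    have hdist : ∀ w ∈ closedBall (z.re : ℂ) (d / 2), w ∈ closedBall (e : ℂ) (2 * d) ∧ w ≠ e := by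
      intro w hw
      rw [mem_closedBall, Complex.dist_eq] at hw ⊢
      have e1 : ‖(z.re : ℂ) - e‖ = |z.re - e| := by
        rw [← ofReal_sub, norm_real, Real.norm_eq_abs]
      have h1 : ‖w - e‖ ≤ ‖w - z.re‖ + ‖(z.re : ℂ) - e‖ := norm_sub_le_norm_sub_add_norm_sub _ _ _
      have h2 : ‖(z.re : ℂ) - e‖ ≤ ‖(z.re : ℂ) - w‖ + ‖w - e‖ := norm_sub_le_norm_sub_add_norm_sub _ _ _
      rw [norm_sub_rev (z.re : ℂ) w] at h2
      refine ⟨by linarith, fun h => ?_⟩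
      rw [h, sub_self, norm_zero] at h2
      rw [h] at hw
      linarith
    have h1 := norm_le_of_norm_mul_im_le (f := g) (x := z.re) (r := d / 2) (C := C) (by positivity)
      subset_rfl (fun w hw => (hg w (hdist w hw).1 (hdist w hw).2).differentiableWithinAt)
      (fun w hw => hC w (hdist w hw).1) hC0 (w := z) ?_
    · rw [le_div_iff₀ (by positivity)] at h1
      linarith
    · have : z - z.re = z.im * I := by
        apply Complex.ext <;> simp
      rw [this, norm_mul, norm_I, norm_real, mul_one, Real.norm_eq_abs]
      linarith

/-- A Liouville argument. The local extensions fit together to a holomorphic function off e. The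
growth hypothesis makes it O(|z − e|^(−1/2)) near e, so that e is removable, and bounded near
infinity. -/
theorem eq_const_of_local_extension {f : ℂ → ℂ} {e K : ℝ} (hK : 0 ≤ K)
    (hd : ∀ z, z.im ≠ 0 → DifferentiableAt ℂ f z)
    (hloc : ∀ x : ℝ, x ≠ e → ∃ r > 0, ∃ g : ℂ → ℂ, DifferentiableOn ℂ g (ball (x : ℂ) r) ∧
      ∀ z ∈ ball (x : ℂ) r, z.im ≠ 0 → g z = f z)
    (hb : ∀ z, z.im ≠ 0 → ‖f z‖ * |z.im| ≤ K * √‖z - e‖ * (1 + √‖z - e‖)) :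
    ∃ k, ∀ z, z.im ≠ 0 → f z = k := by
  set g := realExt f with hg
  have hgf : ∀ z, z.im ≠ 0 → g z = f z := fun z hz => realExt_eq_self hd hz
  have hgd : ∀ z : ℂ, z ≠ e → DifferentiableAt ℂ g z := by
    intro z hz
    by_cases hzi : z.im = 0
    · have hzr : z = (z.re : ℂ) := by apply Complex.ext <;> simp [hzi]
      obtain ⟨r, hr, u, hu, huf⟩ := hloc z.re (fun h => hz (by rw [hzr, h]))
      exact differentiableAt_realExt isOpen_ball hu huf (by rw [← hzr]; exact mem_ball_self hr)
    · exact differentiableAt_realExt isOpen_im_ne_zero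
        (fun z hz => (hd z hz).differentiableWithinAt) (fun _ _ _ => rfl) hzi
  have hbd : ∀ z : ℂ, z ≠ e → ‖g z‖ * ‖z - e‖ ≤
      6 * (K * √(2 * ‖z - e‖) * (1 + √(2 * ‖z - e‖))) := by
    intro z hz
    refine norm_mul_norm_sub_le (by positivity) hz (fun w _ hw => hgd w hw) fun w hw hwi => ?_
    rw [mem_closedBall, Complex.dist_eq] at hw
    rw [hgf w hwi]
    refine (hb w hwi).trans ?_
    gcongr
  have ho : (fun z => g z - g e) =o[𝓝[≠] (e : ℂ)] fun z => (z - e)⁻¹ := by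
    have h1 : Tendsto (fun z : ℂ => 6 * (K * √(2 * ‖z - e‖) * (1 + √(2 * ‖z - e‖))) +
        ‖g e‖ * ‖z - e‖) (𝓝[≠] (e : ℂ)) (𝓝 0) := by
      have : Continuous (fun z : ℂ => 6 * (K * √(2 * ‖z - e‖) * (1 + √(2 * ‖z - e‖))) +
        ‖g e‖ * ‖z - e‖) := by fun_prop
      have h := this.tendsto (e : ℂ)
      simp only [sub_self, norm_zero, mul_zero, Real.sqrt_zero, zero_mul, add_zero] at h
      exact h.mono_left nhdsWithin_le_nhds
    rw [Asymptotics.isLittleO_iff]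
    intro ε hε
    filter_upwards [h1.eventually (gt_mem_nhds hε), self_mem_nhdsWithin] with z hz hze
    have hpos : 0 < ‖z - e‖ := norm_pos_iff.2 (sub_ne_zero.2 hze)
    rw [norm_inv, ← div_eq_mul_inv, le_div_iff₀ hpos]
    have := norm_sub_le (g z) (g e)
    nlinarith [hbd z hze]
  have hE := differentiableOn_update_limUnder_of_isLittleO (s := univ) (c := (e : ℂ)) (f := g)
    univ_mem (fun z hz => (hgd z hz.2).differentiableWithinAt) ho
  set E := Function.update g (e : ℂ) (limUnder (𝓝[≠] (e : ℂ)) g) with hEdef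
  rw [differentiableOn_univ] at hE
  have hEg : ∀ z : ℂ, z ≠ e → E z = g z := fun z hz => Function.update_of_ne hz _ _
  have hbounded : Bornology.IsBounded (range E) := by
    obtain ⟨C, hC⟩ := (isCompact_closedBall (e : ℂ) 1).exists_bound_of_continuousOn
      hE.continuous.continuousOn
    rw [isBounded_iff_forall_norm_le]
    refine ⟨max C (6 * (K * 2 * 3)), ?_⟩
    rintro _ ⟨z, rfl⟩
    by_cases hz : z ∈ closedBall (e : ℂ) 1
    · exact (hC z hz).trans (le_max_left _ _)
    · rw [mem_closedBall, Complex.dist_eq, not_le] at hz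
      refine le_trans ?_ (le_max_right _ _)
      have hze : z ≠ e := fun h => by rw [h] at hz; simp at hz; linarith
      rw [hEg z hze]
      have h := hbd z hze
      set d := ‖z - e‖
      have hs : √(2 * d) * (1 + √(2 * d)) ≤ 6 * d := by
        have h2 : √(2 * d) ≤ 2 * d := by
          rw [Real.sqrt_le_left (by linarith)]; nlinarith
        have h3 := Real.mul_self_sqrt (by linarith : 0 ≤ 2 * d)
        nlinarith
      have : ‖g z‖ * d ≤ 6 * (K * 6) * d := by
        refine h.trans ?_
        rw [mul_assoc K]
        nlinarith [mul_le_mul_of_nonneg_left hs hK]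
      have := le_of_mul_le_mul_right this (by linarith)
      linarith
  refine ⟨E 0, fun z hz => ?_⟩
  have hze : z ≠ e := fun h => hz (by rw [h]; simp)
  rw [← hgf z hz, ← hEg z hze]
  exact hE.apply_eq_apply_of_bounded hbounded z 0

end RealExtension

/-! ### The Cauchy transform of the slack measure -/

section Slack

open Complex Metric Set Filter
open scoped ComplexConjugate

variable {c s : ℝ} {μ ν : Measure ℝ}

theorem IsConstrainedMin.cauchyIntegrable_sub (hs : 0 < s) :
    CauchyIntegrable (constraintMeasure c s - μ) :=
  (cauchyIntegrable_constraintMeasure hs).mono Measure.sub_le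

theorem ne_ofReal_of_im_ne_zero {z : ℂ} (hz : z.im ≠ 0) (T : Set ℝ) : ∀ x ∈ T, z ≠ (x : ℂ) :=
  fun x _ h => hz (by rw [h, ofReal_im])

theorem integrable_inv_sub_of_im_ne_zero (κ : Measure ℝ) (hκ : CauchyIntegrable κ) {z : ℂ}
    (hz : z.im ≠ 0) : Integrable (fun s : ℝ => 1 / (z - s)) κ :=
  hκ.integrable isClosed_univ (.of_forall fun x => mem_univ x) (ne_ofReal_of_im_ne_zero hz _)

theorem cauchyTransform_add_measure {κ κ' : Measure ℝ} {z : ℂ}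
    (h : Integrable (fun s : ℝ => 1 / (z - s)) κ) (h' : Integrable (fun s : ℝ => 1 / (z - s)) κ') :
    cauchyTransform (κ + κ') z = cauchyTransform κ z + cauchyTransform κ' z :=
  integral_add_measure h h'

theorem IsConstrainedMin.cauchyTransform_sub (hs : 0 < s) (h : IsConstrainedMin c s μ ν) {z : ℂ}
    (hz : z ∈ slitPlane) : cauchyTransform (constraintMeasure c s - μ) z =
      √c / (s * csqrt z) - cauchyTransform μ z := by
  have := h.isFiniteMeasure
  have hz' := mem_slitPlane_iff_forall.1 hz
  rw [csqrt, ← cauchyTransform_constraintMeasure hs hz, eq_sub_iff_add_eq,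
    ← cauchyTransform_add_measure, h.sub_add]
  · exact (cauchyIntegrable_sub hs).integrable isClosed_Iic sub_ae_mem hz'
  · exact (cauchyIntegrable_of_isFiniteMeasure μ).integrable isClosed_Iic h.ae_mem hz'

theorem ne_ofReal_of_mem_ball {x₀ r : ℝ} {z : ℂ} (hz : z ∈ ball (x₀ : ℂ) r) :
    ∀ x ∈ (Ioo (x₀ - r) (x₀ + r))ᶜ, z ≠ (x : ℂ) := by
  rintro x hx rfl
  rw [mem_ball, Complex.dist_eq, ← ofReal_sub, norm_real, Real.norm_eq_abs, abs_lt] at hz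
  exact hx ⟨by linarith, by linarith⟩

theorem abs_re_sub_lt_of_mem_ball {x₀ r : ℝ} {z : ℂ} (hz : z ∈ ball (x₀ : ℂ) r) :
    |z.re - x₀| < r := by
  rw [mem_ball, Complex.dist_eq] at hz
  exact (by simpa using Complex.abs_re_le_norm (z - x₀) : |z.re - x₀| ≤ _).trans_lt hz

theorem ofReal_mem_ball {x₀ r x : ℝ} : (x : ℂ) ∈ ball (x₀ : ℂ) r ↔ x ∈ Ioo (x₀ - r) (x₀ + r) := by
  rw [mem_ball, Complex.dist_eq, ← ofReal_sub, norm_real, Real.norm_eq_abs, abs_lt, mem_Ioo]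
  constructor <;> rintro ⟨h1, h2⟩ <;> constructor <;> linarith

theorem differentiableAt_cauchyTransform {κ : Measure ℝ} (hκ : CauchyIntegrable κ) {T : Set ℝ}
    (hT : IsClosed T) (hμT : ∀ᵐ s ∂κ, s ∈ T) {z : ℂ} (hz : ∀ x ∈ T, z ≠ (x : ℂ)) :
    DifferentiableAt ℂ (cauchyTransform κ) z :=
  (hasDerivAt_cauchyTransform hκ hT hμT hz).differentiableAt

theorem ne_ofReal_of_re_lt {z : ℂ} {e : ℝ} (hz : z.re < e) : ∀ x ∈ Ici e, z ≠ (x : ℂ) := by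
  rintro x hx rfl
  exact not_lt.2 hx hz

theorem ne_ofReal_of_lt_re {z : ℂ} {e : ℝ} (hz : e < z.re) : ∀ x ∈ Iic e, z ≠ (x : ℂ) := by
  rintro x hx rfl
  exact not_lt.2 hx hz

/-- Across the interior of the support of the slack measure the function `2 F - F'`
changes its sign. -/
theorem IsConstrainedMin.exists_continuation (hc : 0 < c) (hs : 0 < s)
    (h : IsConstrainedMin c s μ ν) {c₁ : ℝ} (hc₁ : 0 ≤ c₁)
    (hS : (constraintMeasure c s - μ).support = Iic (-c₁)) {x₀ r : ℝ} (hr : 0 < r)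
    (hx₀ : x₀ + r ≤ -c₁) :
    ∃ f : ℂ → ℂ, DifferentiableOn ℂ f (ball (x₀ : ℂ) r) ∧
      (∀ z ∈ ball (x₀ : ℂ) r, 0 < z.im → f z = 2 * cauchyTransform μ z - cauchyTransform ν z) ∧
      ∀ z ∈ ball (x₀ : ℂ) r, z.im < 0 →
        f z = -(2 * cauchyTransform μ z - cauchyTransform ν z) := by
  have := h.isFiniteMeasure
  have := h.isFiniteMeasure'
  obtain ⟨ℓ, hℓ⟩ := h.exists_phi_eq hc hs hc₁ hS
  set B := Ioo (x₀ - r) (x₀ + r) with hB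
  have hBc : IsClosed Bᶜ := isOpen_Ioo.isClosed_compl
  have hfar : ∀ᵐ y ∂(μ.restrict Bᶜ), y ∈ Bᶜ := ae_restrict_mem measurableSet_Ioo.compl
  have hbd : ∀ᵐ y ∂(μ.restrict B), |y| ≤ |x₀| + r := by
    filter_upwards [ae_restrict_mem measurableSet_Ioo] with y hy
    have : |y - x₀| ≤ r := abs_le.2 ⟨by linarith [hy.1], by linarith [hy.2]⟩
    calc |y| = |(y - x₀) + x₀| := by ring_nf
      _ ≤ _ := (abs_add_le _ _).trans (by linarith)
  have hzre : ∀ z ∈ ball (x₀ : ℂ) r, z.re < 0 := fun z hz => by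
    have := (abs_lt.1 (abs_re_sub_lt_of_mem_ball hz)).2
    linarith
  have hC : ∀ κ : Measure ℝ, [IsFiniteMeasure κ] → CauchyIntegrable κ :=
    fun κ _ => cauchyIntegrable_of_isFiniteMeasure κ
  -- `exists_odd_continuation` needs a measure of bounded support, so only the part of μ on B is
  -- kept. The potentials of ν and of the rest of μ are analytic on B and are moved into the
  -- external function.
  have hW : DifferentiableOn ℂ (fun z => -2 * cauchyTransform (μ.restrict Bᶜ) z +
      cauchyTransform ν z) (ball (x₀ : ℂ) r) := fun z hz =>
    (((differentiableAt_cauchyTransform (hC _) hBc hfar (ne_ofReal_of_mem_ball hz)).const_mul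
      (-2)).fun_add (differentiableAt_cauchyTransform (hC _) isClosed_Ici h.ae_mem'
        (ne_ofReal_of_re_lt (hzre z hz)))).differentiableWithinAt
  have hw : ∀ x ∈ Ioo (x₀ - r) (x₀ + r), HasDerivAt (fun x => 2 * pot (μ.restrict Bᶜ) x - pot ν x)
      (-2 * cauchyTransform (μ.restrict Bᶜ) x + cauchyTransform ν x).re x := by
    intro x hx
    have hx0 : x < 0 := by linarith [hx.2]
    have d1 := hasDerivAt_pot (h.logIntegrable.mono (Measure.restrict_le_self (s := Bᶜ))) hBc hfar
      (not_not_intro hx)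
    refine ((d1.const_mul 2).fun_sub (h.hasDerivAt_pot_right hx0)).congr_deriv ?_
    rw [cauchyTransform_ofReal, cauchyTransform_ofReal]
    simp
  have hconst : ∀ x, x ∈ Ioo (x₀ - r) (x₀ + r) → 2 * pot (μ.restrict B) x +
      (2 * pot (μ.restrict Bᶜ) x - pot ν x) = ℓ := by
    intro x hx
    have hx0 : x < 0 := by linarith [hx.2]
    have hδ : 0 < -x / 2 := by linarith
    have i := (pot_sub_potTrunc_le hs hδ hδ (x := x) (by linarith) h.logIntegrable h.le).1
    have e : pot μ x = pot (μ.restrict B) x + pot (μ.restrict Bᶜ) x := by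
      rw [pot, ← integral_add_compl measurableSet_Ioo i]; rfl
    rw [← hℓ x (by linarith [hx.2]), e]
    ring
  obtain ⟨f, hf, hup, hlo⟩ := exists_odd_continuation hbd hr hW
    (fun z => by simp only [map_add, map_mul, cauchyTransform_conj, map_neg, map_ofNat]) hw
    (.of_forall hconst)
  have hsplit : ∀ z : ℂ, z.im ≠ 0 → cauchyTransform μ z =
      cauchyTransform (μ.restrict B) z + cauchyTransform (μ.restrict Bᶜ) z := fun z hz => by
    rw [← cauchyTransform_add_measure (integrable_inv_sub_of_im_ne_zero _ (hC _) hz)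
      (integrable_inv_sub_of_im_ne_zero _ (hC _) hz),
      Measure.restrict_add_restrict_compl measurableSet_Ioo]
  refine ⟨f, hf, fun z hz hzi => ?_, fun z hz hzi => ?_⟩
  · rw [hup z hz hzi, hsplit z hzi.ne']; ring
  · rw [hlo z hz hzi, hsplit z hzi.ne]; ring

/-! ### A Liouville argument in the variable √(z + c₁). -/

/-- The image of a measure under `s ↦ √(s + c₁)`. -/
def sqrtImage (c₁ : ℝ) (ν : Measure ℝ) : Measure ℝ := ν.map fun s => √(s + c₁)

theorem measurable_sqrt_add (c₁ : ℝ) : Measurable fun s : ℝ => √(s + c₁) := by fun_prop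

instance (c₁ : ℝ) (ν : Measure ℝ) [IsFiniteMeasure ν] : IsFiniteMeasure (sqrtImage c₁ ν) := by
  unfold sqrtImage; infer_instance

theorem ae_sqrtImage {c₁ : ℝ} (hν : ∀ᵐ s ∂ν, s ∈ Ici (0 : ℝ)) :
    ∀ᵐ v ∂(sqrtImage c₁ ν), v ∈ Ici (√c₁) := by
  refine (ae_map_iff (measurable_sqrt_add c₁).aemeasurable measurableSet_Ici).2 ?_
  filter_upwards [hν] with s hs'
  exact Real.sqrt_le_sqrt (by rw [mem_Ici] at hs'; linarith)

theorem cauchyTransform_sqrtImage (c₁ : ℝ) (ν : Measure ℝ) (z : ℂ) :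
    cauchyTransform (sqrtImage c₁ ν) z = ∫ s : ℝ, 1 / (z - (√(s + c₁) : ℝ)) ∂ν := by
  rw [cauchyTransform, sqrtImage, integral_map (measurable_sqrt_add c₁).aemeasurable]
  exact (by fun_prop : Measurable fun v : ℝ => 1 / (z - (v : ℂ))).aestronglyMeasurable

theorem cauchyReal_sqrtImage (c₁ : ℝ) (ν : Measure ℝ) (x : ℝ) :
    cauchyReal (sqrtImage c₁ ν) x = ∫ s : ℝ, 1 / (x - √(s + c₁)) ∂ν := by
  rw [cauchyReal, sqrtImage, integral_map (measurable_sqrt_add c₁).aemeasurable]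
  exact (by fun_prop : Measurable fun v : ℝ => 1 / (x - v)).aestronglyMeasurable

/-- The combination of Cauchy transforms that turns out to be constant. -/
def slackCombination (c₁ : ℝ) (σ ν : Measure ℝ) (z : ℂ) : ℂ :=
  2 * csqrt (z + c₁) * cauchyTransform σ z - cauchyTransform (sqrtImage c₁ ν) (-csqrt (z + c₁))

theorem add_mem_slitPlane {z : ℂ} {c₁ : ℝ} (hz : ∀ x ∈ Iic (-c₁), z ≠ (x : ℂ)) :
    z + c₁ ∈ slitPlane := by
  rw [mem_slitPlane_iff_forall]
  intro x hx h
  refine hz (x - c₁) (by rw [mem_Iic] at hx ⊢; linarith) ?_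
  push_cast
  rw [← h]; ring

/-- Off (−∞, −c₁] the root √(z + c₁) has positive real part, so its negative avoids the half-line
[√c₁, ∞) that carries the image measure. In particular there is no singularity on the support of ν.
-/
theorem IsConstrainedMin.differentiableAt_slackCombination (hs : 0 < s)
    (h : IsConstrainedMin c s μ ν) {c₁ : ℝ}
    (hS : (constraintMeasure c s - μ).support = Iic (-c₁)) {z : ℂ}
    (hz : ∀ x ∈ Iic (-c₁), z ≠ (x : ℂ)) :
    DifferentiableAt ℂ (slackCombination c₁ (constraintMeasure c s - μ) ν) z := by
  have := h.isFiniteMeasure'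
  have hz' := add_mem_slitPlane hz
  have d1 : DifferentiableAt ℂ (fun z => csqrt (z + c₁)) z :=
    DifferentiableAt.comp z (f := fun z : ℂ => z + c₁) (differentiableAt_csqrt hz') (by fun_prop)
  have hσ : ∀ᵐ x ∂(constraintMeasure c s - μ), x ∈ Iic (-c₁) := by
    rw [← hS]; exact Measure.support_mem_ae
  have d2 := differentiableAt_cauchyTransform (cauchyIntegrable_sub hs) isClosed_Iic hσ hz
  have d3 : DifferentiableAt ℂ (fun z => cauchyTransform (sqrtImage c₁ ν) (-csqrt (z + c₁))) z := by
    refine DifferentiableAt.comp z (f := fun z : ℂ => -csqrt (z + c₁))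
      (differentiableAt_cauchyTransform (cauchyIntegrable_of_isFiniteMeasure _) isClosed_Ici
        (ae_sqrtImage h.ae_mem') (ne_ofReal_of_re_lt ?_)) d1.neg
    have := csqrt_re_pos hz'
    rw [neg_re]
    linarith [Real.sqrt_nonneg c₁]
  exact ((d1.const_mul 2).fun_mul d2).fun_sub d3

theorem IsConstrainedMin.integrable_sqrt_weight (h : IsConstrainedMin c s μ ν) (c₁ : ℝ) :
    Integrable (fun s => √(s + c₁) / (1 + |s|)) ν := by
  have := h.isFiniteMeasure'
  refine Integrable.of_bound (C := 1 + |c₁|)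
    (by fun_prop : Measurable fun s : ℝ => √(s + c₁) / (1 + |s|)).aestronglyMeasurable ?_
  refine .of_forall fun s => ?_
  rw [Real.norm_eq_abs, abs_of_nonneg (by positivity), div_le_iff₀ (by positivity),
    Real.sqrt_le_left (by positivity)]
  nlinarith [le_abs_self s, le_abs_self c₁, abs_nonneg s, abs_nonneg c₁,
    mul_nonneg (abs_nonneg s) (abs_nonneg c₁)]

/-- With u² = z + c₁ and v² = s + c₁ one has 1/(−u − v) = −(u − v)/(z − s). This form shows the
behaviour across (−∞, −c₁): both u and 2G + F change sign there, and the remaining integral is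
analytic off [0, ∞). -/
theorem IsConstrainedMin.slackCombination_eq (h : IsConstrainedMin c s μ ν) {c₁ : ℝ} (hc₁ : 0 ≤ c₁)
    {z : ℂ} (hz : z.im ≠ 0) :
    slackCombination c₁ (constraintMeasure c s - μ) ν z =
      csqrt (z + c₁) * (2 * cauchyTransform (constraintMeasure c s - μ) z + cauchyTransform ν z) -
        ∫ s : ℝ, ((√(s + c₁) : ℝ) : ℂ) / (z - s) ∂ν := by
  have := h.isFiniteMeasure'
  have i1 := integrable_inv_sub_of_im_ne_zero ν (cauchyIntegrable_of_isFiniteMeasure ν) hz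
  obtain ⟨δ, hδ, hδ'⟩ := exists_pos_le_norm_sub isClosed_univ (ne_ofReal_of_im_ne_zero hz univ)
  have i2 := integrable_div_sub (h.integrable_sqrt_weight c₁) (measurable_sqrt_add c₁) hδ
    (.of_forall fun s => hδ' s (mem_univ s))
  have hsl : z + c₁ ∈ slitPlane := mem_slitPlane_of_im_ne_zero (by simpa using hz)
  have key : cauchyTransform (sqrtImage c₁ ν) (-csqrt (z + c₁)) =
      -(csqrt (z + c₁) * cauchyTransform ν z - ∫ s : ℝ, ((√(s + c₁) : ℝ) : ℂ) / (z - s) ∂ν) := by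
    rw [cauchyTransform_sqrtImage, cauchyTransform, ← integral_const_mul,
      ← integral_sub (i1.const_mul _) i2, ← integral_neg]
    refine integral_congr_ae ?_
    filter_upwards [h.ae_mem'] with y hy
    rw [mem_Ici] at hy
    have hv : ((√(y + c₁) : ℝ) : ℂ) ^ 2 = y + c₁ := by
      rw [← ofReal_pow, Real.sq_sqrt (by linarith)]; push_cast; ring
    have hu := csqrt_sq (z + c₁)
    have hzy : z - y ≠ 0 := _root_.sub_ne_zero.2 (ne_ofReal_of_im_ne_zero hz univ y (mem_univ y))
    have huv : -csqrt (z + c₁) - (√(y + c₁) : ℝ) ≠ 0 := fun h0 => by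
      have h1 := congrArg re h0
      simp only [sub_re, neg_re, ofReal_re, zero_re] at h1
      linarith [csqrt_re_pos hsl, Real.sqrt_nonneg (y + c₁)]
    field_simp
    linear_combination hv - hu
  rw [slackCombination, key]
  ring

theorem cauchyTransform_mul_im_le_one {κ : Measure ℝ} (hκ : κ univ = 1 / 2) {z : ℂ}
    (hz : z.im ≠ 0) : ‖cauchyTransform κ z‖ * |z.im| ≤ 1 / 2 := by
  have : IsFiniteMeasure κ := ⟨by rw [hκ]; simp⟩
  refine (norm_cauchyTransform_mul_im_le κ hz).trans ?_
  rw [measureReal_def, hκ]; simp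

theorem norm_cauchyTransform_sqrtImage_le {c₁ : ℝ} (hν : ν univ = 1) {u : ℂ} (hu : 0 < u.re) :
    ‖cauchyTransform (sqrtImage c₁ ν) (-u)‖ ≤ 1 / ‖u‖ := by
  have : IsFiniteMeasure ν := ⟨by rw [hν]; simp⟩
  have hu0 : 0 < ‖u‖ := norm_pos_iff.2 fun h => by simp [h] at hu
  rw [cauchyTransform_sqrtImage]
  have h1 := norm_integral_le_of_norm_le_const (μ := ν) (C := 1 / ‖u‖)
    (f := fun y : ℝ => 1 / (-u - (√(y + c₁) : ℝ))) (.of_forall fun y => ?_)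
  · rwa [measureReal_def, hν, ENNReal.toReal_one, mul_one] at h1
  · rw [norm_div, norm_one]
    refine one_div_le_one_div_of_le hu0 ?_
    have hv := Real.sqrt_nonneg (y + c₁)
    rw [← neg_add', norm_neg, ← sq_le_sq₀ (norm_nonneg _) (norm_nonneg _), ← normSq_eq_norm_sq,
      ← normSq_eq_norm_sq, normSq_apply, normSq_apply]
    simp only [add_re, ofReal_re, add_im, ofReal_im, add_zero]
    nlinarith

/-- The two expressions for the combination show that it is holomorphic across both sides of −c₁.
The bounds 1/|Im z| for transforms of finite measures and the explicit √c/(s√z) give the growth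
required in `eq_const_of_local_extension`. The identity expresses the slack transform through ν
alone. -/
theorem IsConstrainedMin.exists_slackCombination_eq (hc : 0 < c) (hs : 0 < s)
    (h : IsConstrainedMin c s μ ν) {c₁ : ℝ} (hc₁ : 0 ≤ c₁)
    (hS : (constraintMeasure c s - μ).support = Iic (-c₁)) :
    ∃ k, ∀ z : ℂ, z.im ≠ 0 → slackCombination c₁ (constraintMeasure c s - μ) ν z = k := by
  have := h.isFiniteMeasure
  have := h.isFiniteMeasure'
  refine eq_const_of_local_extension (e := -c₁) (K := 2 * (√c / s) * (1 + √c₁) + 2) (by positivity)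
    (fun z hz => h.differentiableAt_slackCombination hs hS (ne_ofReal_of_im_ne_zero hz _)) ?_ ?_
  · intro x hx
    rcases lt_or_gt_of_ne hx with hx | hx
    · set r := -c₁ - x with hr
      have hr0 : 0 < r := by linarith
      obtain ⟨f, hf, hup, hlo⟩ := h.exists_continuation hc hs hc₁ hS hr0 (by linarith : x + r ≤ -c₁)
      have hre : ∀ z ∈ ball (x : ℂ) r, z.re < -c₁ := fun z hz => by
        have := (abs_lt.1 (abs_re_sub_lt_of_mem_ball hz)).2
        linarith
      -- The formula of the upper half-plane, with i√(−·) in place of the principal root so that it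
      -- is holomorphic on the whole disk. Here 2G + F is written as 2√c/(s√z) minus 2F_μ − F_ν, the
      -- latter continued by `f`. Below the axis the sign changes cancel.
      refine ⟨r, hr0, fun z => I * csqrt (-(z + c₁)) * (2 * (√c / (s * (I * csqrt (-z)))) - f z) -
        ∫ y : ℝ, ((√(y + c₁) : ℝ) : ℂ) / (z - y) ∂ν, fun z hz => ?_, fun z hz hzi => ?_⟩
      · have hz1 : -(z + c₁) ∈ slitPlane := by
          refine Or.inl ?_
          simp only [neg_re, add_re, ofReal_re]
          linarith [hre z hz]
        have hz2 : -z ∈ slitPlane := by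
          refine Or.inl ?_
          rw [neg_re]
          linarith [hre z hz]
        have d1 : DifferentiableAt ℂ (fun z => csqrt (-(z + c₁))) z :=
          DifferentiableAt.comp z (f := fun z : ℂ => -(z + c₁)) (differentiableAt_csqrt hz1)
            (by fun_prop)
        have d2 : DifferentiableAt ℂ (fun z => csqrt (-z)) z :=
          DifferentiableAt.comp z (f := fun z : ℂ => -z) (differentiableAt_csqrt hz2) (by fun_prop)
        have hne : (s : ℂ) * (I * csqrt (-z)) ≠ 0 :=
          mul_ne_zero (ofReal_ne_zero.2 hs.ne') (mul_ne_zero I_ne_zero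
            (csqrt_ne_zero (slitPlane_ne_zero hz2)))
        obtain ⟨δ, hδ, hδ'⟩ := exists_pos_le_norm_sub isClosed_Ici
          (ne_ofReal_of_re_lt (by linarith [hre z hz] : z.re < 0))
        have d3 := (hasDerivAt_integral_div_sub (h.integrable_sqrt_weight c₁)
          (measurable_sqrt_add c₁) hδ (h.ae_mem'.mono hδ')).differentiableAt
        have d4 := (hf z hz).differentiableAt (isOpen_ball.mem_nhds hz)
        have d5 : DifferentiableAt ℂ (fun z => (√c : ℂ) / (s * (I * csqrt (-z)))) z :=
          (differentiableAt_const _).fun_div ((d2.const_mul I).const_mul (s : ℂ)) hne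
        exact (((d1.const_mul I).fun_mul ((d5.const_mul 2).fun_sub d4)).fun_sub
          d3).differentiableWithinAt
      · beta_reduce
        rw [h.slackCombination_eq hc₁ hzi, h.cauchyTransform_sub hs (mem_slitPlane_of_im_ne_zero hzi)]
        rcases lt_or_gt_of_ne hzi with hzi | hzi
        · rw [hlo z hz hzi, csqrt_of_im_neg (z := z + c₁) (by simpa using hzi), csqrt_of_im_neg hzi,
            mul_neg, div_neg]
          ring
        · rw [hup z hz hzi, csqrt_of_im_pos (z := z + c₁) (by simpa using hzi), csqrt_of_im_pos hzi]
          ring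
    · refine ⟨x + c₁, by linarith, _, fun z hz => ?_, fun z _ _ => rfl⟩
      refine (h.differentiableAt_slackCombination hs hS
        (ne_ofReal_of_lt_re ?_)).differentiableWithinAt
      have := (abs_lt.1 (abs_re_sub_lt_of_mem_ball hz)).1
      linarith
  · intro z hz
    have hsl : z ∈ slitPlane := mem_slitPlane_of_im_ne_zero hz
    have hslc : z + c₁ ∈ slitPlane := mem_slitPlane_of_im_ne_zero (by simpa using hz)
    have ez : z - ((-c₁ : ℝ) : ℂ) = z + c₁ := by push_cast; ring
    rw [ez]
    set d := ‖z + c₁‖ with hd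
    have hd0 : 0 < d := norm_pos_iff.2 (slitPlane_ne_zero hslc)
    have hzd : ‖z‖ ≤ d + c₁ := by
      calc ‖z‖ = ‖(z + c₁) - c₁‖ := by ring_nf
        _ ≤ d + ‖(c₁ : ℂ)‖ := norm_sub_le _ _
        _ = d + c₁ := by rw [norm_real, Real.norm_of_nonneg hc₁]
    have hsz : √‖z‖ ≤ √d + √c₁ := by
      rw [Real.sqrt_le_left (by positivity)]
      nlinarith [Real.sq_sqrt hd0.le, Real.sq_sqrt hc₁, Real.sqrt_nonneg d, Real.sqrt_nonneg c₁,
        mul_nonneg (Real.sqrt_nonneg d) (Real.sqrt_nonneg c₁)]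
    have hzi : |z.im| ≤ d := by simpa using Complex.abs_im_le_norm (z + c₁)
    have hzi' : |z.im| ≤ ‖z‖ := Complex.abs_im_le_norm z
    have hz0 : 0 < ‖z‖ := norm_pos_iff.2 (slitPlane_ne_zero hsl)
    have b1 : ‖cauchyTransform (constraintMeasure c s - μ) z‖ * |z.im| ≤
        √c / s * (√d + √c₁) + 1 / 2 := by
      rw [h.cauchyTransform_sub hs hsl]
      have e1 : ‖(√c : ℂ) / (s * csqrt z)‖ = √c / s / √‖z‖ := by
        rw [norm_div, norm_mul, norm_csqrt, norm_real, norm_real, Real.norm_of_nonneg hs.le,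
          Real.norm_of_nonneg (Real.sqrt_nonneg c), div_div]
      calc _ ≤ (‖(√c : ℂ) / (s * csqrt z)‖ + ‖cauchyTransform μ z‖) * |z.im| := by
            gcongr; exact norm_sub_le _ _
        _ = √c / s / √‖z‖ * |z.im| + ‖cauchyTransform μ z‖ * |z.im| := by rw [add_mul, e1]
        _ ≤ √c / s / √‖z‖ * ‖z‖ + 1 / 2 := by
            gcongr; exact cauchyTransform_mul_im_le_one h.mass hz
        _ = √c / s * √‖z‖ + 1 / 2 := by
            rw [div_mul_eq_mul_div, mul_div_assoc, Real.div_sqrt]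
        _ ≤ _ := by gcongr
    have b2 := norm_cauchyTransform_sqrtImage_le (c₁ := c₁) h.mass' (csqrt_re_pos hslc)
    rw [norm_csqrt] at b2
    have b3 : 1 / √d * |z.im| ≤ √d := by
      rw [div_mul_eq_mul_div, one_mul, div_le_iff₀ (Real.sqrt_pos.2 hd0), Real.mul_self_sqrt hd0.le]
      exact hzi
    calc _ ≤ (2 * √d * ‖cauchyTransform (constraintMeasure c s - μ) z‖ + 1 / √d) * |z.im| := by
          gcongr
          refine (norm_sub_le _ _).trans (add_le_add ?_ b2)
          rw [norm_mul, norm_mul, norm_csqrt, Complex.norm_two]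
      _ = 2 * √d * (‖cauchyTransform (constraintMeasure c s - μ) z‖ * |z.im|) +
          1 / √d * |z.im| := by ring
      _ ≤ 2 * √d * (√c / s * (√d + √c₁) + 1 / 2) + √d := by gcongr
      _ ≤ (2 * (√c / s) * (1 + √c₁) + 2) * √d * (1 + √d) := by
          have : 0 ≤ √c / s := by positivity
          have h1 := Real.sqrt_nonneg d
          have h2 := Real.sqrt_nonneg c₁
          have : 0 ≤ √c / s * (√d * (1 + √c₁ * √d)) := by positivity
          nlinarith [mul_nonneg h1 h1]

end Slack

/-! ### The slack measure on the real line and monotonicity in the gaps -/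

section Gaps

open Complex Metric Set Filter
open scoped NNReal

variable {c s : ℝ} {μ ν : Measure ℝ}

theorem cauchyReal_eq_re (κ : Measure ℝ) (x : ℝ) :
    cauchyReal κ x = (cauchyTransform κ x).re := by
  rw [cauchyTransform_ofReal, ofReal_re]

theorem continuousAt_cauchyReal {κ : Measure ℝ} (hκ : CauchyIntegrable κ) {T : Set ℝ}
    (hT : IsClosed T) (hμT : ∀ᵐ s ∂κ, s ∈ T) {x : ℝ} (hx : x ∉ T) :
    ContinuousAt (cauchyReal κ) x := by
  have h1 := (differentiableAt_cauchyTransform hκ hT hμT (z := x)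
    (fun y hy h => hx (by rwa [ofReal_injective h]))).continuousAt
  have h2 : ContinuousAt (fun x : ℝ => (cauchyTransform κ x).re) x :=
    continuous_re.continuousAt.comp (ContinuousAt.comp (f := fun x : ℝ => (x : ℂ)) h1
      continuous_ofReal.continuousAt)
  exact h2.congr (.of_forall fun y => (cauchyReal_eq_re κ y).symm)

theorem ae_lt_of_support_sub_eq {c₁ : ℝ}
    (hS : (constraintMeasure c s - μ).support = Iic (-c₁)) :
    ∀ᵐ x ∂(constraintMeasure c s - μ), x < -c₁ := by
  have hσ : ∀ᵐ x ∂(constraintMeasure c s - μ), x ∈ Iic (-c₁) := by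
    rw [← hS]; exact Measure.support_mem_ae
  have hne : ∀ᵐ x ∂(constraintMeasure c s - μ), x ≠ -c₁ := by
    rw [ae_iff]
    simpa using le_antisymm ((Measure.sub_le {-c₁}).trans (by simp)) bot_le
  filter_upwards [hσ, hne] with x h1 h2 using lt_of_le_of_ne h1 h2

/-- The slack transform is o(1/u) at distance u² to the right of −c₁. This is dominated convergence:
u/(u² + d) ≤ d^(−1/2), with d the distance from y to −c₁, is integrable near −c₁ because c₁ > 0
makes the density bounded there. -/
theorem tendsto_mul_cauchyReal_sub (hs : 0 < s) {c₁ : ℝ} (hc₁ : 0 < c₁) {σ : Measure ℝ}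
    (hσ : σ ≤ constraintMeasure c s) (hlt : ∀ᵐ x ∂σ, x < -c₁) :
    Tendsto (fun u : ℝ => u * cauchyReal σ (u ^ 2 - c₁)) (𝓝[>] 0) (𝓝 0) := by
  set E := Ioo (-c₁ - 1) (-c₁) with hE
  set g : ℝ → ℝ := fun y => E.indicator (fun y => (-c₁ - y) ^ (-(1 / 2) : ℝ)) y +
    (2 + c₁) * (1 + |y|)⁻¹ with hg
  have hgi : Integrable g σ := by
    refine Integrable.add ?_ (((cauchyIntegrable_constraintMeasure hs).mono hσ).const_mul _)
    rw [integrable_indicator_iff measurableSet_Ioo]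
    have hle := (Measure.restrict_mono le_rfl hσ).trans (constraintMeasure_restrict_le (c := c) hs
      hc₁ (measurableSet_Ioo (a := -c₁ - 1) (b := -c₁)) (fun y hy => hy.2.le))
    refine Integrable.mono_measure ?_ hle
    refine Integrable.smul_measure_nnreal ?_
    have h1 := (intervalIntegral.intervalIntegrable_rpow' (a := 0) (b := 1)
      (r := (-(1 / 2) : ℝ)) (by norm_num)).comp_sub_left (-c₁)
    rw [sub_zero] at h1
    have h2 := h1.symm.1
    exact h2.mono_set Ioo_subset_Ioc_self
  have hlim := tendsto_integral_filter_of_dominated_convergence (μ := σ) (l := 𝓝[>] (0 : ℝ))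
    (F := fun u y => u * (1 / (u ^ 2 - c₁ - y))) (f := fun _ => (0 : ℝ)) g
    (.of_forall fun u => (by fun_prop : Measurable fun y : ℝ =>
      u * (1 / (u ^ 2 - c₁ - y))).aestronglyMeasurable) ?_ hgi ?_
  · rw [integral_zero] at hlim
    refine hlim.congr fun u => ?_
    rw [integral_const_mul, cauchyReal]
  · filter_upwards [Ioo_mem_nhdsGT (zero_lt_one' ℝ)] with u hu
    filter_upwards [hlt] with y hy
    have hy0 : 0 < -c₁ - y := by linarith
    have hpos : 0 < u ^ 2 - c₁ - y := by nlinarith [sq_nonneg u]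
    rw [Real.norm_eq_abs, abs_of_nonneg (by have := hu.1; positivity), mul_one_div]
    have hr2 : 0 ≤ (2 + c₁) * (1 + |y|)⁻¹ := by positivity
    by_cases hyE : y ∈ E
    · simp only [hg]
      rw [indicator_of_mem hyE, Real.rpow_neg hy0.le, ← Real.sqrt_eq_rpow]
      have hsq := Real.sq_sqrt hy0.le
      have hsp := Real.sqrt_pos.2 hy0
      have : u / (u ^ 2 - c₁ - y) ≤ (√(-c₁ - y))⁻¹ := by
        rw [div_le_iff₀ hpos, inv_mul_eq_div, le_div_iff₀ hsp]
        nlinarith [sq_nonneg (u - √(-c₁ - y)), hu.1, mul_pos hu.1 hsp]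
      linarith
    · simp only [hg]
      rw [indicator_of_notMem hyE, zero_add]
      have hy1 : y ≤ -c₁ - 1 := by
        by_contra! hh; exact hyE ⟨hh, hy⟩
      rw [abs_of_nonpos (by linarith), ← div_eq_mul_inv, div_le_div_iff₀ hpos (by linarith)]
      nlinarith [hu.1, hu.2, sq_nonneg u, mul_nonneg hc₁.le (by linarith : 0 ≤ -c₁ - 1 - y),
        mul_nonneg (sub_nonneg.2 hu.2.le) (by linarith : 0 ≤ 1 - y)]
  · filter_upwards [hlt] with y hy
    have hy0 : 0 < -c₁ - y := by linarith
    have hc : ContinuousAt (fun u : ℝ => u * (1 / (u ^ 2 - c₁ - y))) 0 := by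
      refine continuousAt_id.mul (ContinuousAt.div₀ continuousAt_const (by fun_prop) ?_)
      simp only [ne_eq, OfNat.ofNat_ne_zero, not_false_eq_true, zero_pow]
      linarith
    have := hc.tendsto
    rw [zero_mul] at this
    exact this.mono_left nhdsWithin_le_nhds

/-- The constant combination read off on the real axis. Letting x → −c₁ removes the slack term and
determines the constant. When c₁ = 0 the constant stays undetermined, but it then has no influence
on monotonicity. -/
theorem IsConstrainedMin.exists_two_mul_sqrt_mul_cauchyReal (hc : 0 < c) (hs : 0 < s)
    (h : IsConstrainedMin c s μ ν) {c₁ : ℝ} (hc₁ : 0 ≤ c₁)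
    (hS : (constraintMeasure c s - μ).support = Iic (-c₁)) :
    ∃ k : ℝ, (∀ x, -c₁ < x → 2 * √(x + c₁) * cauchyReal (constraintMeasure c s - μ) x =
      k + cauchyReal (sqrtImage c₁ ν) (-√(x + c₁))) ∧
      (0 < c₁ → k = -cauchyReal (sqrtImage c₁ ν) 0) := by
  have := h.isFiniteMeasure'
  obtain ⟨k, hk⟩ := h.exists_slackCombination_eq hc hs hc₁ hS
  set σ := constraintMeasure c s - μ with hσ
  have hreal : ∀ x, -c₁ < x → 2 * √(x + c₁) * cauchyReal σ x =
      k.re + cauchyReal (sqrtImage c₁ ν) (-√(x + c₁)) := by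
    intro x hx
    have hd := (h.differentiableAt_slackCombination hs hS (z := (x : ℂ))
      (ne_ofReal_of_lt_re (by simpa using hx))).continuousAt
    have := nhdsWithin_im_ne_zero_neBot (x : ℂ)
    have h1 : Tendsto (slackCombination c₁ σ ν) (𝓝[{w | w.im ≠ 0}] (x : ℂ)) (𝓝 k) :=
      tendsto_const_nhds.congr' (by filter_upwards [self_mem_nhdsWithin] with z hz using (hk z hz).symm)
    have h2 := tendsto_nhds_unique (hd.tendsto.mono_left nhdsWithin_le_nhds) h1
    rw [← h2, slackCombination, ← ofReal_add, csqrt_ofReal (by linarith), cauchyTransform_ofReal,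
      ← ofReal_neg, cauchyTransform_ofReal, sub_re, ofReal_re]
    have : (2 * (√(x + c₁) : ℂ) * (cauchyReal σ x : ℂ)).re = 2 * √(x + c₁) * cauchyReal σ x := by
      rw [← ofReal_ofNat, ← ofReal_mul, ← ofReal_mul, ofReal_re]
    rw [this]; ring
  refine ⟨k.re, hreal, fun hc0 => ?_⟩
  have l1 := (tendsto_mul_cauchyReal_sub hs hc0 Measure.sub_le (ae_lt_of_support_sub_eq hS)).const_mul 2
  have hcont : ContinuousAt (cauchyReal (sqrtImage c₁ ν)) (-0) :=
    continuousAt_cauchyReal (cauchyIntegrable_of_isFiniteMeasure _) isClosed_Ici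
      (ae_sqrtImage h.ae_mem') (by simpa using hc0)
  have l2 : Tendsto (fun u : ℝ => k.re + cauchyReal (sqrtImage c₁ ν) (-u)) (𝓝[>] 0)
      (𝓝 (k.re + cauchyReal (sqrtImage c₁ ν) (-0))) :=
    ((hcont.tendsto.comp continuous_neg.continuousAt.tendsto).mono_left
      nhdsWithin_le_nhds).const_add _
  have l3 := l1.congr' (f₂ := fun u : ℝ => k.re + cauchyReal (sqrtImage c₁ ν) (-u)) <| by
    filter_upwards [self_mem_nhdsWithin] with u hu
    rw [mem_Ioi] at hu
    have := hreal (u ^ 2 - c₁) (by nlinarith)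
    rw [sub_add_cancel, Real.sqrt_sq hu.le] at this
    rw [← this]; ring
  have := tendsto_nhds_unique l2 l3
  rw [neg_zero] at this
  linarith

theorem sqrtImage_Ioo {c₁ α β : ℝ} (hα : 0 ≤ α) (hc₁ : 0 ≤ c₁) (hν : ν (Ioo α β) = 0) :
    sqrtImage c₁ ν (Ioo (√(α + c₁)) (√(β + c₁))) = 0 := by
  rw [sqrtImage, Measure.map_apply (measurable_sqrt_add c₁) measurableSet_Ioo]
  refine measure_mono_null ?_ hν
  rintro y ⟨h1, h2⟩
  rw [Real.sqrt_lt_sqrt_iff (by linarith)] at h1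
  rw [Real.sqrt_lt_sqrt_iff (by linarith)] at h2
  exact ⟨by linarith, by linarith⟩

/-- With X, Y, P, Q, r the roots of x, y, x + c₁, y + c₁, c₁, the claim is YP − XQ ≤ v(Y − X). It
follows from Y²P² − X²Q² = r²(Y² − X²), since YP + XQ ≥ r(X + Y) and r ≤ v. -/
theorem sqrt_div_sub_antitone {c₁ x y v : ℝ} (hc₁ : 0 ≤ c₁) (hx : 0 < x) (hxy : x < y)
    (hv : √c₁ ≤ v) (hsign : 0 < (√(x + c₁) - v) * (√(y + c₁) - v)) :
    √y / (√(y + c₁) - v) ≤ √x / (√(x + c₁) - v) := by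
  have hmul : √y * (√(x + c₁) - v) ≤ √x * (√(y + c₁) - v) := by
    have e1 := Real.sq_sqrt hx.le
    have e2 := Real.sq_sqrt (hx.trans hxy).le
    have e3 := Real.sq_sqrt (by linarith : 0 ≤ x + c₁)
    have e4 := Real.sq_sqrt (by linarith : 0 ≤ y + c₁)
    have e5 := Real.sq_sqrt hc₁
    have p1 := Real.sqrt_pos.2 hx
    have p2 := Real.sqrt_pos.2 (hx.trans hxy)
    have l1 := Real.sqrt_lt_sqrt hx.le hxy
    have l2 := Real.sqrt_le_sqrt (by linarith : c₁ ≤ x + c₁)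
    have l3 := Real.sqrt_le_sqrt (by linarith : c₁ ≤ y + c₁)
    have p3 := Real.sqrt_nonneg c₁
    have p4 : 0 < √(x + c₁) := Real.sqrt_pos.2 (by linarith)
    have p5 : 0 < √(y + c₁) := Real.sqrt_pos.2 (by linarith)
    set X := √x
    set Y := √y
    set P := √(x + c₁)
    set Q := √(y + c₁)
    set r := √c₁
    have key : (Y * P - X * Q) * (Y * P + X * Q) ≤ r * (Y - X) * (Y * P + X * Q) := by
      have e : (Y * P - X * Q) * (Y * P + X * Q) = r ^ 2 * (Y - X) * (Y + X) := by
        have : (Y * P - X * Q) * (Y * P + X * Q) = Y ^ 2 * P ^ 2 - X ^ 2 * Q ^ 2 := by ring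
        rw [this, e2, e3, e1, e4, e5]
        have : (c₁ : ℝ) * (Y - X) * (Y + X) = c₁ * (Y ^ 2 - X ^ 2) := by ring
        rw [this, e1, e2]; ring
      rw [e]
      have : r * (Y + X) ≤ Y * P + X * Q := by nlinarith
      have h0 : 0 ≤ r * (Y - X) := mul_nonneg p3 (by linarith)
      nlinarith [mul_le_mul_of_nonneg_left this h0]
    have h1 : Y * P - X * Q ≤ r * (Y - X) :=
      le_of_mul_le_mul_right key (by positivity)
    nlinarith [mul_le_mul_of_nonneg_right hv (by linarith : 0 ≤ Y - X)]
  rw [← sub_nonneg]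
  have hx0 : √(x + c₁) - v ≠ 0 := fun h0 => by rw [h0, zero_mul] at hsign; exact lt_irrefl _ hsign
  have hy0 : √(y + c₁) - v ≠ 0 := fun h0 => by rw [h0, mul_zero] at hsign; exact lt_irrefl _ hsign
  rw [div_sub_div _ _ hx0 hy0]
  exact div_nonneg (by linarith) hsign.le

/-- Combining the transforms of the image measure κ at u and −u, where u = √(z + c₁), gives 2u(F +
G) = k + ∫ dκ(v)/(u − v). If c₁ > 0 the value of k turns √z (F + G) into half the integral of (1/v)
√z/(u − v), and each integrand decreases by `sqrt_div_sub_antitone`. If c₁ = 0 then √z = u, and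
Cauchy transforms decrease on gaps. -/
theorem IsConstrainedMin.sqrt_mul_antitone (hc : 0 < c) (hs : 0 < s) (h : IsConstrainedMin c s μ ν)
    {α β x y : ℝ} (hα : 0 ≤ α) (hν : ν (Ioo α β) = 0) (hx : x ∈ Ioo α β) (hy : y ∈ Ioo α β)
    (hxy : x < y) :
    √y * (cauchyReal ν y + cauchyReal (constraintMeasure c s - μ) y) ≤
      √x * (cauchyReal ν x + cauchyReal (constraintMeasure c s - μ) x) := by
  have := h.isFiniteMeasure'
  obtain ⟨c₁, hc₁, hS⟩ := h.exists_support_sub_eq hc hs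
  obtain ⟨k, hk, hk0⟩ := h.exists_two_mul_sqrt_mul_cauchyReal hc hs hc₁ hS
  set σ := constraintMeasure c s - μ with hσ
  set κ := sqrtImage c₁ ν with hκ
  set I := Ioo (√(α + c₁)) (√(β + c₁)) with hI
  have hIc : IsClosed Iᶜ := isOpen_Ioo.isClosed_compl
  have hκI : ∀ᵐ v ∂κ, v ∈ Iᶜ := by
    rw [ae_iff]; simpa using! sqrtImage_Ioo hα hc₁ hν
  have hmem : ∀ z ∈ Ioo α β, √(z + c₁) ∈ I := fun z hz =>
    ⟨Real.sqrt_lt_sqrt (by linarith) (by linarith [hz.1]),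
      Real.sqrt_lt_sqrt (by linarith [hz.1]) (by linarith [hz.2])⟩
  have hκC : CauchyIntegrable κ := cauchyIntegrable_of_isFiniteMeasure _
  have hge := ae_sqrtImage (c₁ := c₁) h.ae_mem'
  have hint : ∀ z ∈ Ioo α β, Integrable (fun v => 1 / (√(z + c₁) - v)) κ := fun z hz =>
    hκC.integrable_real hIc hκI (not_not_intro (hmem z hz))
  have hpos : ∀ z ∈ Ioo α β, 0 < √(z + c₁) := fun z hz => Real.sqrt_pos.2 (by linarith [hz.1])
  have hformula : ∀ z ∈ Ioo α β, 2 * √(z + c₁) * (cauchyReal ν z + cauchyReal σ z) =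
      k + cauchyReal κ (√(z + c₁)) := by
    intro z hz
    have j1 := hint z hz
    have j2 : Integrable (fun v => 1 / (-√(z + c₁) - v)) κ :=
      hκC.integrable_real isClosed_Ici hge (by
        rw [mem_Ici, not_le]; linarith [hpos z hz, Real.sqrt_nonneg c₁])
    have hm := (measurable_sqrt_add c₁).aemeasurable (μ := ν)
    rw [hκ, sqrtImage, integrable_map_measure
      (by fun_prop : Measurable fun v : ℝ => 1 / (√(z + c₁) - v)).aestronglyMeasurable hm] at j1
    rw [hκ, sqrtImage, integrable_map_measure
      (by fun_prop : Measurable fun v : ℝ => 1 / (-√(z + c₁) - v)).aestronglyMeasurable hm] at j2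
    simp only [Function.comp_def] at j1 j2
    have e : 2 * √(z + c₁) * cauchyReal ν z = cauchyReal κ (√(z + c₁)) -
        cauchyReal κ (-√(z + c₁)) := by
      rw [hκ, cauchyReal_sqrtImage, cauchyReal_sqrtImage, ← integral_sub j1 j2, cauchyReal,
        ← integral_const_mul]
      have hT : ∀ᵐ z ∂ν, z ∈ (Ioo α β)ᶜ := by rw [ae_iff]; simpa using! hν
      refine integral_congr_ae ?_
      filter_upwards [h.ae_mem', hT] with v hv hvI
      rw [mem_Ici] at hv
      have hv2 := Real.sq_sqrt (by linarith : 0 ≤ v + c₁)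
      have hz2 := Real.sq_sqrt (by linarith [hz.1] : 0 ≤ z + c₁)
      have hzv : z - v ≠ 0 := fun h0 => hvI (by rwa [← sub_eq_zero.1 h0])
      have hfac : z - v = (√(z + c₁) - √(v + c₁)) * (√(z + c₁) + √(v + c₁)) := by
        linear_combination hv2 - hz2
      have h2 : √(z + c₁) + √(v + c₁) ≠ 0 := fun h0 => hzv (by rw [hfac, h0, mul_zero])
      have h1 : √(z + c₁) - √(v + c₁) ≠ 0 := fun h0 => hzv (by rw [hfac, h0, zero_mul])
      have h3 : -√(z + c₁) - √(v + c₁) ≠ 0 := fun h0 => h2 (by linarith)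
      rw [hfac]
      field_simp
      ring
    have := hk z (by linarith [hz.1])
    linarith
  have hx0 : 0 < x := hα.trans_lt hx.1
  have hy0 : 0 < y := hα.trans_lt hy.1
  have hdiv : ∀ z ∈ Ioo α β, √z * (cauchyReal ν z + cauchyReal σ z) =
      1 / 2 * (√z / √(z + c₁) * (k + cauchyReal κ (√(z + c₁)))) := by
    intro z hz
    rw [← hformula z hz]
    have := hpos z hz
    field_simp
  rw [hdiv x hx, hdiv y hy]
  refine mul_le_mul_of_nonneg_left ?_ (by norm_num)
  have hsign : ∀ v ∈ Iᶜ, 0 < (√(x + c₁) - v) * (√(y + c₁) - v) := by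
    intro v hv
    have h1 := hmem x hx
    have h2 := hmem y hy
    rw [hI, mem_compl_iff, mem_Ioo, not_and_or, not_lt, not_lt] at hv
    rcases hv with hv | hv
    · exact mul_pos (by linarith [h1.1]) (by linarith [h2.1])
    · exact mul_pos_of_neg_of_neg (by linarith [h1.2]) (by linarith [h2.2])
  rcases hc₁.eq_or_lt with hc0 | hc0
  · have hone : ∀ z ∈ Ioo α β, √z / √(z + c₁) = 1 := fun z hz => by
      rw [← hc0, add_zero, div_self]
      have := hpos z hz
      rw [← hc0, add_zero] at this
      exact this.ne'
    rw [hone x hx, hone y hy, one_mul, one_mul]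
    refine add_le_add le_rfl (integral_mono_ae (hint y hy) (hint x hx) ?_)
    filter_upwards [hκI] with v hv
    exact (sub_pos_of_not_mem_Ioo (hmem x hx) (hmem y hy)
      (Real.sqrt_lt_sqrt (by linarith) (by linarith)) hv).le
  · have j0 : Integrable (fun v => 1 / (0 - v)) κ :=
      hκC.integrable_real isClosed_Ici hge (by
        rw [mem_Ici, not_le]; exact Real.sqrt_pos.2 hc0)
    have hcomb : ∀ z ∈ Ioo α β, √z / √(z + c₁) * (k + cauchyReal κ (√(z + c₁))) =
        ∫ v, √z / √(z + c₁) * (1 / (√(z + c₁) - v) - 1 / (0 - v)) ∂κ := by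
      intro z hz
      rw [integral_const_mul, integral_sub (hint z hz) j0, hk0 hc0, cauchyReal, cauchyReal]
      ring
    rw [hcomb x hx, hcomb y hy]
    refine integral_mono_ae (((hint y hy).sub j0).const_mul _) (((hint x hx).sub j0).const_mul _) ?_
    filter_upwards [hκI, hge] with v hv hv0
    rw [mem_Ici] at hv0
    have hvp : 0 < v := (Real.sqrt_pos.2 hc0).trans_le hv0
    have hs0 := hsign v hv
    have hx1 : √(x + c₁) - v ≠ 0 := fun h0 => by rw [h0, zero_mul] at hs0; exact lt_irrefl _ hs0
    have hy1 : √(y + c₁) - v ≠ 0 := fun h0 => by rw [h0, mul_zero] at hs0; exact lt_irrefl _ hs0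
    have hx2 := (hpos x hx).ne'
    have hy2 := (hpos y hy).ne'
    have ex : √x / √(x + c₁) * (1 / (√(x + c₁) - v) - 1 / (0 - v)) =
        1 / v * (√x / (√(x + c₁) - v)) := by
      rw [zero_sub]; field_simp; ring
    have ey : √y / √(y + c₁) * (1 / (√(y + c₁) - v) - 1 / (0 - v)) =
        1 / v * (√y / (√(y + c₁) - v)) := by
      rw [zero_sub]; field_simp; ring
    simp only [ex, ey]
    exact mul_le_mul_of_nonneg_left (sqrt_div_sub_antitone hc₁ hx0 hxy hv0 hs0) (by positivity)

/-! ### The effective potential on gaps and at infinity. -/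

variable {a b t : ℝ} {μ₁ μ₂ μ₃ : Measure ℝ}

theorem IsConstrainedMin.cauchyReal_sub (hs : 0 < s) (h : IsConstrainedMin c s μ ν) {x : ℝ}
    (hx : 0 < x) : cauchyReal (constraintMeasure c s - μ) x =
      √c / (s * √x) - cauchyReal μ x := by
  have := h.isFiniteMeasure
  have hx' : x ∉ Iic (0 : ℝ) := not_le.2 hx
  rw [← cauchyReal_constraintMeasure hs hx, eq_sub_iff_add_eq]
  conv_rhs => rw [← h.sub_add]
  exact (integral_add_measure ((cauchyIntegrable_sub hs).integrable_real isClosed_Iic sub_ae_mem hx')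
    ((cauchyIntegrable_of_isFiniteMeasure μ).integrable_real isClosed_Iic h.ae_mem hx')).symm

theorem hasDerivAt_sqrt_mul (ha : 0 < a) {x : ℝ} (hx : 0 < x) :
    HasDerivAt (fun x => √(a * x)) (√a / (2 * √x)) x := by
  have h1 := (Real.hasDerivAt_sqrt hx.ne').const_mul (√a)
  refine (h1.congr_of_eventuallyEq (.of_forall fun y => ?_)).congr_deriv (by ring)
  exact Real.sqrt_mul ha.le y

theorem hasDerivAt_externalField (ha : 0 < a) (hb : 0 < b) {x : ℝ} (hx : 0 < x) :
    HasDerivAt (externalField a b t) (1 / (t * (1 - t)) - √a / (t * √x) - √b / ((1 - t) * √x)) x := by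
  have h1 := (hasDerivAt_id x).div_const (t * (1 - t))
  have h2 := ((hasDerivAt_sqrt_mul ha hx).const_mul 2).div_const t
  have h3 := ((hasDerivAt_sqrt_mul hb hx).const_mul 2).div_const (1 - t)
  refine ((h1.fun_sub h2).fun_sub h3).congr_deriv ?_
  have := (Real.sqrt_pos.2 hx).ne'
  have e : ∀ w y : ℝ, 2 * (w / (2 * √x)) / y = w / (y * √x) := fun w y => by
    rw [mul_div_assoc', mul_div_mul_left _ _ two_ne_zero, div_div, mul_comm]
  rw [e, e]

/-- The square roots in the derivative of the field complete the transforms of μ₁ and μ₃ to slack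
transforms. The two copies of F are shared out between these, so that
`IsConstrainedMin.sqrt_mul_antitone` applies to each bracket. -/
theorem IsMinimizer.hasDerivAt_effectivePotential (ha : 0 < a) (hb : 0 < b) (ht₀ : 0 < t)
    (ht₁ : t < 1) (h : IsMinimizer a b t μ₁ μ₂ μ₃) {α β x : ℝ} (hαβ : μ₂ (Ioo α β) = 0)
    (hx : x ∈ Ioo α β) (hx0 : 0 < x) :
    HasDerivAt (effectivePotential a b t μ₁ μ₂ μ₃) (1 / (t * (1 - t)) -
      (cauchyReal μ₂ x + cauchyReal (constraintMeasure a t - μ₁) x) -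
      (cauchyReal μ₂ x + cauchyReal (constraintMeasure b (1 - t) - μ₃) x)) x := by
  have f1 := h.left.isFiniteMeasure
  have f2 := h.left.isFiniteMeasure'
  have f3 := h.right.isFiniteMeasure
  have hx' : x ∉ Iic (0 : ℝ) := not_le.2 hx0
  have d1 := hasDerivAt_pot h.left.logIntegrable isClosed_Iic h.left.ae_mem hx'
  have d3 := hasDerivAt_pot h.right.logIntegrable isClosed_Iic h.right.ae_mem hx'
  have d2 := hasDerivAt_pot h.left.finite'.logIntegrable (isOpen_Ioo (a := α) (b := β)).isClosed_compl
    (by rw [ae_iff]; simpa using! hαβ) (not_not_intro hx)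
  refine ((((d2.const_mul 2).fun_sub d1).fun_sub d3).fun_add
    (hasDerivAt_externalField ha hb hx0)).congr_deriv ?_
  rw [h.left.cauchyReal_sub ht₀ hx0, h.right.cauchyReal_sub (by linarith) hx0]
  ring

theorem log_one_add_sq_le {x : ℝ} (hx : 0 ≤ x) : Real.log (1 + x) ≤ 2 * (1 + √x) := by
  have h1 := Real.log_le_sub_one_of_pos (Real.sqrt_pos.2 (by linarith : 0 < 1 + x))
  rw [Real.log_sqrt (by linarith)] at h1
  have h2 : √(1 + x) ≤ 1 + √x := by
    rw [Real.sqrt_le_left (by positivity)]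
    nlinarith [Real.sq_sqrt hx, Real.sqrt_nonneg x]
  linarith

/-- The external field is A x − K√x, while the potential of μ₂ is no less than minus a logarithm and
the potentials of μ₁, μ₃ are ≤ 0 beyond 1. At a support point x > 1 the truncated inequality becomes
A x ≤ (K + 4)√x + Q, which fails once √x > (K + 4 + Q)/A. -/
theorem IsMinimizer.bddAbove_support (ha : 0 < a) (hb : 0 < b) (ht₀ : 0 < t)
    (ht₁ : t < 1) (h : IsMinimizer a b t μ₁ μ₂ μ₃) : BddAbove μ₂.support := by
  have f1 := h.left.isFiniteMeasure
  have f2 := h.left.isFiniteMeasure'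
  have f3 := h.right.isFiniteMeasure
  obtain ⟨ℓ, -, -, hℓ⟩ := h.exists_effectivePotential
  have l2 := h.left.finite'.logIntegrable
  set A := 1 / (t * (1 - t)) with hA
  have ht1 : 0 < 1 - t := by linarith
  have hA0 : 0 < A := by positivity
  set K := 2 * √a / t + 2 * √b / (1 - t) with hK
  have hK0 : 0 ≤ K := by positivity
  set L := ∫ s, Real.log (1 + |s|) ∂μ₂ with hL
  set Q := 4 + 2 * |L| + |ℓ| with hQ
  refine ⟨max 1 (((K + 4 + Q) / A) ^ 2), fun x hx => ?_⟩
  by_contra! hlt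
  have hx1 : 1 < x := (le_max_left _ _).trans_lt hlt
  have hx2 : ((K + 4 + Q) / A) ^ 2 < x := (le_max_right _ _).trans_lt hlt
  have hx0 : 0 < x := by linarith
  have h1 := hℓ 1 one_pos x hx hx0
  have hpot : ∀ {κ : Measure ℝ} [IsFiniteMeasure κ], (∀ᵐ s ∂κ, s ∈ Iic (0 : ℝ)) → pot κ x ≤ 0 := by
    intro κ _ hκ
    refine integral_nonpos_of_ae ?_
    filter_upwards [hκ] with s hs
    rw [mem_Iic] at hs
    simp only [Pi.zero_apply, Left.neg_nonpos_iff]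
    exact Real.log_nonneg (by rw [le_abs]; left; linarith)
  have p1 := hpot h.left.ae_mem
  have p3 := hpot h.right.ae_mem
  have ptr : -Real.log (1 + x) - L ≤ potTrunc 1 μ₂ x := by
    have e : -Real.log (1 + x) - L = ∫ s, (-Real.log (1 + x) - Real.log (1 + |s|)) ∂μ₂ := by
      rw [integral_sub (integrable_const _) l2, integral_const, measureReal_def, h.1.mass₂]
      simp [hL]
    rw [e]
    refine integral_mono ((integrable_const _).sub l2) (l2.integrable_trunc one_pos x) fun s => ?_
    have : max |x - s| 1 ≤ (1 + x) * (1 + |s|) := by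
      refine max_le ?_ ?_
      · have := abs_sub x s
        rw [abs_of_pos hx0] at this
        nlinarith [abs_nonneg s]
      · nlinarith [abs_nonneg s]
    have h2 := Real.log_le_log (lt_max_of_lt_right one_pos) this
    rw [Real.log_mul (by linarith) (by linarith [abs_nonneg s])] at h2
    simp only
    linarith
  have hV : externalField a b t x = A * x - K * √x := by
    rw [externalField, Real.sqrt_mul ha.le, Real.sqrt_mul hb.le, hA, hK]
    ring
  have hlog := log_one_add_sq_le hx0.le
  have hsq := Real.sq_sqrt hx0.le
  have hs1 : 1 ≤ √x := Real.one_le_sqrt.2 hx1.le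
  have hfin : A * x ≤ (K + 4) * √x + Q := by
    have := le_abs_self L
    have := le_abs_self ℓ
    linarith
  have hs2 : (K + 4 + Q) / A < √x := Real.lt_sqrt_of_sq_lt hx2
  rw [div_lt_iff₀ hA0] at hs2
  have hQ0 : 0 ≤ Q := by positivity
  nlinarith

/-- Here y is the end of the gap nearer to x, and m is the distance from x to the farther end. For s
outside the gap, max(|y − s|, |x − y|) ≤ |x − s|(1 + |x − y|/m); logarithms and log(1 + h) ≤ h give
the bound. It provides an upper estimate of the potential near an end of a gap, where lower
semicontinuity is of no use. -/
theorem pot_le_potTrunc {κ : Measure ℝ} [IsFiniteMeasure κ] (hκ : LogIntegrable κ)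
    {α β x y : ℝ} (hκ1 : κ.real univ = 1) (hαβ : κ (Ioo α β) = 0) (hx : x ∈ Ioo α β)
    (hy : y = α ∧ |x - y| ≤ β - x ∨ y = β ∧ |x - y| ≤ x - α) :
    pot κ x ≤ potTrunc |x - y| κ y + |x - y| / max (β - x) (x - α) := by
  have hT : ∀ᵐ z ∂κ, z ∈ (Ioo α β)ᶜ := by rw [ae_iff]; simpa using! hαβ
  have hε : 0 < |x - y| := abs_pos.2 (sub_ne_zero.2 (by
    rcases hy with ⟨h, -⟩ | ⟨h, -⟩
    · rw [h]; exact hx.1.ne'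
    · rw [h]; exact hx.2.ne))
  have i1 := hκ.integrable_log isOpen_Ioo.isClosed_compl hT (not_not_intro hx)
  have e : potTrunc |x - y| κ y + |x - y| / max (β - x) (x - α) =
      ∫ s, (-Real.log (max |y - s| |x - y|) + |x - y| / max (β - x) (x - α)) ∂κ := by
    rw [integral_add (hκ.integrable_trunc hε y) (integrable_const _), integral_const, hκ1, one_smul]
    rfl
  rw [e]
  refine integral_mono_ae i1 ((hκ.integrable_trunc hε y).add (integrable_const _)) ?_
  filter_upwards [hT] with s hs
  have hxs : 0 < |x - s| := abs_pos.2 (sub_ne_zero.2 fun h0 => hs (h0 ▸ hx))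
  set m := max (β - x) (x - α) with hm
  have hm0 : 0 < m := lt_max_of_lt_left (by linarith [hx.2])
  have key : max |y - s| |x - y| ≤ |x - s| * (1 + |x - y| / m) := by
    rw [mem_compl_iff, mem_Ioo, not_and_or, not_lt, not_lt] at hs
    have hnn : 0 ≤ |x - s| * (|x - y| / m) := by positivity
    rw [mul_add, mul_one]
    rcases hy with ⟨rfl, hle⟩ | ⟨rfl, hle⟩
    · rw [abs_of_pos (by linarith [hx.1] : 0 < x - y)] at *
      have hmm : m = β - x := max_eq_left hle
      rcases hs with hs | hs
      · rw [abs_of_pos (by linarith [hx.1] : 0 < x - s)] at *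
        refine max_le ?_ (by linarith)
        rw [abs_of_nonneg (by linarith)]
        linarith [hx.1]
      · rw [abs_of_neg (by linarith [hx.2] : x - s < 0)] at *
        have : x - y ≤ -(x - s) * ((x - y) / m) := by
          rw [← mul_div_assoc, le_div_iff₀ hm0, hmm]
          nlinarith [hx.1, hx.2]
        refine max_le ?_ (by linarith [hx.1, hx.2])
        rw [abs_of_neg (by linarith [hx.1, hx.2])]
        linarith
    · rw [abs_of_neg (by linarith [hx.2] : x - y < 0)] at *
      have hmm : m = x - α := max_eq_right (by linarith)
      rcases hs with hs | hs
      · rw [abs_of_pos (by linarith [hx.1] : 0 < x - s)] at *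
        have : -(x - y) ≤ (x - s) * (-(x - y) / m) := by
          rw [← mul_div_assoc, le_div_iff₀ hm0, hmm]
          nlinarith [hx.1, hx.2]
        refine max_le ?_ (by linarith [hx.1, hx.2])
        rw [abs_of_pos (by linarith [hx.1, hx.2])]
        linarith
      · rw [abs_of_neg (by linarith [hx.2] : x - s < 0)] at *
        refine max_le ?_ (by linarith)
        rw [abs_of_nonpos (by linarith)]
        linarith [hx.2]
  have h1 := Real.log_le_log (lt_max_of_lt_right hε) key
  have h2 : 0 < 1 + |x - y| / m := by positivity
  rw [Real.log_mul hxs.ne' h2.ne'] at h1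
  have h3 := Real.log_le_sub_one_of_pos h2
  linarith

end Gaps

/-! ### The support of the second measure -/

section SecondSupport

open Metric Set Filter

variable {a b t : ℝ} {μ₁ μ₂ μ₃ : Measure ℝ}

theorem IsMinimizer.support_subset_Ici (h : IsMinimizer a b t μ₁ μ₂ μ₃) : μ₂.support ⊆ Ici 0 :=
  Measure.support_subset_of_isClosed isClosed_Ici h.left.ae_mem'

theorem le_of_ae_le_of_continuousAt {f : ℝ → ℝ} {ℓ x : ℝ} (hx : 0 < x) (hf : ContinuousAt f x)
    (h : ∀ᵐ x, 0 < x → ℓ ≤ f x) : ℓ ≤ f x := by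
  by_contra! hlt
  have h1 := (hf.eventually_lt_const hlt).and (Ioi_mem_nhds hx)
  have h2 := Measure.measure_pos_of_mem_nhds volume h1
  refine h2.ne' (measure_mono_null ?_ (ae_iff.1 h))
  intro y hy hy'
  exact not_lt.2 (hy' hy.2) hy.1

/-- From inside a gap the upper limit of the effective potential at a positive end is at most ℓ: the
potential is compared with a truncation at the end, which is a support point, and the remaining
terms are continuous. -/
theorem IsMinimizer.eventually_effectivePotential_lt (h : IsMinimizer a b t μ₁ μ₂ μ₃) {ℓ : ℝ}
    (hℓ : ∀ ε > 0, ∀ x ∈ μ₂.support, 0 < x → 2 * potTrunc ε μ₂ x +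
        (-pot μ₁ x - pot μ₃ x + externalField a b t x) ≤ ℓ) {α β y η : ℝ} (hαβ : α < β)
    (hgap : μ₂ (Ioo α β) = 0) (hy : y = α ∨ y = β) (hyS : y ∈ μ₂.support) (hy0 : 0 < y)
    (hη : 0 < η) :
    ∀ᶠ x in 𝓝[Ioo α β] y, effectivePotential a b t μ₁ μ₂ μ₃ x < ℓ + η := by
  have f2 := h.left.isFiniteMeasure'
  set R : ℝ → ℝ := fun x => -pot μ₁ x - pot μ₃ x + externalField a b t x with hR
  have hmax : max (β - y) (y - α) ≠ 0 := by
    refine (lt_max_iff.2 ?_).ne'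
    rcases hy with rfl | rfl
    · exact Or.inl (by linarith)
    · exact Or.inr (by linarith)
  have hg : ContinuousAt (fun x => (R x - R y) + 2 * (|x - y| / max (β - x) (x - α))) y := by
    have h1 := h.continuousAt_externalPart hy0
    refine (h1.sub continuousAt_const).add (continuousAt_const.mul (ContinuousAt.div₀ ?_ ?_ hmax))
    · fun_prop
    · fun_prop
  have hlt := hg.eventually_lt_const (u := η) (by simpa using hη)
  have hnear : ∀ᶠ x in 𝓝 y, |x - y| < (β - α) / 2 := by
    filter_upwards [ball_mem_nhds y (by linarith : 0 < (β - α) / 2)] with x hx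
    rwa [mem_ball, Real.dist_eq] at hx
  filter_upwards [self_mem_nhdsWithin, mem_nhdsWithin_of_mem_nhds hlt,
    mem_nhdsWithin_of_mem_nhds hnear] with x hx hlt hnear
  have hxy : 0 < |x - y| := abs_pos.2 (sub_ne_zero.2 (by
    rcases hy with rfl | rfl
    · exact hx.1.ne'
    · exact hx.2.ne))
  have h1 := pot_le_potTrunc h.left.finite'.logIntegrable (by rw [measureReal_def, h.1.mass₂]; simp)
    hgap hx (y := y) (by
      rcases hy with rfl | rfl
      · refine Or.inl ⟨rfl, ?_⟩
        have := (abs_lt.1 hnear).2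
        linarith
      · refine Or.inr ⟨rfl, ?_⟩
        have := (abs_lt.1 hnear).1
        linarith)
  have h2 := hℓ _ hxy y hyS hy0
  simp only [hR] at hlt
  rw [effectivePotential]
  linarith

/-- On a gap √x ψ'(x) strictly increases, being √x A minus two decreasing functions. According to
the sign of ψ' at the midpoint, ψ strictly decreases on the left half or strictly increases on the
right half. As ψ ≥ ℓ on the gap, it would stay above ℓ by a fixed amount near the corresponding end,
where its upper limit is at most ℓ. -/
theorem IsMinimizer.not_gap (ha : 0 < a) (hb : 0 < b) (ht₀ : 0 < t)
    (ht₁ : t < 1) (h : IsMinimizer a b t μ₁ μ₂ μ₃) {α β : ℝ} (hα : α ∈ μ₂.support)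
    (hβ : β ∈ μ₂.support) (hαβ : α < β) (hgap : μ₂ (Ioo α β) = 0) : False := by
  -- If α were 0, it would be an isolated point of the support, hence an atom of μ₂.
  have hα0 : 0 < α := by
    refine lt_of_le_of_ne (h.support_subset_Ici hα) fun h0 => ?_
    subst h0
    have hpos := (Measure.mem_support_iff_forall _).1 hα (Iio β) (Iio_mem_nhds hαβ)
    refine hpos.ne' (measure_mono_null (t := Iio 0 ∪ ({0} ∪ Ioo 0 β)) ?_
      (measure_union_null h.1.on₂ (measure_union_null (by
        have := h.left.isFiniteMeasure'
        exact h.1.finite₂₂.measure_singleton 0) hgap)))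
    intro z hz
    rcases lt_trichotomy z 0 with h | h | h
    · exact Or.inl h
    · exact Or.inr (Or.inl h)
    · exact Or.inr (Or.inr ⟨h, hz⟩)
  obtain ⟨ℓ, hae, -, hℓ⟩ := h.exists_effectivePotential
  set ψ := effectivePotential a b t μ₁ μ₂ μ₃ with hψ
  set Q₁ : ℝ → ℝ := fun x => cauchyReal μ₂ x + cauchyReal (constraintMeasure a t - μ₁) x with hQ₁
  set Q₃ : ℝ → ℝ := fun x => cauchyReal μ₂ x + cauchyReal (constraintMeasure b (1 - t) - μ₃) x
    with hQ₃
  set D : ℝ → ℝ := fun x => 1 / (t * (1 - t)) - Q₁ x - Q₃ x with hD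
  have hd : ∀ x ∈ Ioo α β, HasDerivAt ψ (D x) x := fun x hx =>
    h.hasDerivAt_effectivePotential ha hb ht₀ ht₁ hgap hx (hα0.trans hx.1)
  have hψℓ : ∀ x ∈ Ioo α β, ℓ ≤ ψ x := fun x hx =>
    le_of_ae_le_of_continuousAt (hα0.trans hx.1) (hd x hx).continuousAt hae
  have hmono : ∀ x ∈ Ioo α β, ∀ y ∈ Ioo α β, x < y → √x * D x < √y * D y := by
    intro x hx y hy hxy
    have h1 := h.left.sqrt_mul_antitone ha ht₀ hα0.le hgap hx hy hxy
    have h3 := h.right.sqrt_mul_antitone hb (by linarith) hα0.le hgap hx hy hxy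
    have h2 := Real.sqrt_lt_sqrt (hα0.trans hx.1).le hxy
    have hA : 0 < 1 / (t * (1 - t)) := by
      have : 0 < 1 - t := by linarith
      positivity
    have e : ∀ z, √z * D z = √z * (1 / (t * (1 - t))) - √z * Q₁ z - √z * Q₃ z := fun z => by
      simp only [hD]; ring
    rw [e, e]
    have := mul_lt_mul_of_pos_right h2 hA
    simp only [hQ₁, hQ₃]
    linarith
  have hmvt : ∀ u ∈ Ioo α β, ∀ v ∈ Ioo α β, u < v →
      ∃ w ∈ Ioo u v, w ∈ Ioo α β ∧ D w = (ψ v - ψ u) / (v - u) := by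
    intro u hu v hv huv
    have hsub : Icc u v ⊆ Ioo α β := fun w hw => ⟨hu.1.trans_le hw.1, hw.2.trans_lt hv.2⟩
    obtain ⟨w, hw, hw'⟩ := exists_hasDerivAt_eq_slope ψ D huv
      (fun z hz => (hd z (hsub hz)).continuousAt.continuousWithinAt)
      fun z hz => hd z (hsub (Ioo_subset_Icc_self hz))
    exact ⟨w, hw, hsub (Ioo_subset_Icc_self hw), hw'⟩
  set m := (α + β) / 2 with hm
  have hmI : m ∈ Ioo α β := ⟨by linarith, by linarith⟩
  have hsq : ∀ x ∈ Ioo α β, 0 < √x := fun x hx => Real.sqrt_pos.2 (hα0.trans hx.1)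
  rcases le_total (D m) 0 with hDm | hDm
  · have hneg : ∀ x ∈ Ioo α β, x < m → D x < 0 := by
      intro x hx hxm
      have := hmono x hx m hmI hxm
      have h1 := hsq m hmI
      have h2 := hsq x hx
      by_contra! hh
      nlinarith [mul_nonneg h2.le hh]
    have hanti : ∀ u ∈ Ioo α β, ∀ v ∈ Ioo α β, u < v → v ≤ m → ψ v < ψ u := by
      intro u hu v hv huv hvm
      obtain ⟨w, hw, hwI, hw'⟩ := hmvt u hu v hv huv
      have := hneg w hwI (hw.2.trans_le hvm)
      rw [hw', div_neg_iff] at this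
      rcases this with h | h <;> linarith
    set x₁ := (α + m) / 2 with hx₁
    have hx₁I : x₁ ∈ Ioo α β := ⟨by linarith [hmI.1], by linarith [hmI.1, hmI.2]⟩
    have h1 := hanti x₁ hx₁I m hmI (by linarith [hmI.1]) le_rfl
    have hev := h.eventually_effectivePotential_lt hℓ hαβ hgap (Or.inl rfl) hα hα0
      (η := ψ x₁ - ℓ) (by linarith [hψℓ m hmI])
    have hev2 : ∀ᶠ x in 𝓝[Ioo α β] α, x < x₁ := mem_nhdsWithin_of_mem_nhds (Iio_mem_nhds hx₁I.1)
    have hev3 : ∀ᶠ x in 𝓝[Ioo α β] α, x ∈ Ioo α β := self_mem_nhdsWithin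
    rw [nhdsWithin_Ioo_eq_nhdsGT hαβ] at hev hev2 hev3
    obtain ⟨x, ⟨hx1, hx2⟩, hx3⟩ := ((hev.and hev2).and hev3).exists
    have := hanti x hx3 x₁ hx₁I hx2 (by linarith [hmI.1])
    linarith
  · have hpos : ∀ x ∈ Ioo α β, m < x → 0 < D x := by
      intro x hx hxm
      have := hmono m hmI x hx hxm
      have h1 := hsq m hmI
      have h2 := hsq x hx
      by_contra! hh
      nlinarith [mul_nonneg h1.le hDm, mul_nonneg h2.le (neg_nonneg.2 hh)]
    have hincr : ∀ u ∈ Ioo α β, ∀ v ∈ Ioo α β, u < v → m ≤ u → ψ u < ψ v := by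
      intro u hu v hv huv hmu
      obtain ⟨w, hw, hwI, hw'⟩ := hmvt u hu v hv huv
      have := hpos w hwI (hmu.trans_lt hw.1)
      rw [hw', div_pos_iff] at this
      rcases this with h | h <;> linarith
    set x₁ := (m + β) / 2 with hx₁
    have hx₁I : x₁ ∈ Ioo α β := ⟨by linarith [hmI.1, hmI.2], by linarith [hmI.2]⟩
    have h1 := hincr m hmI x₁ hx₁I (by linarith [hmI.2]) le_rfl
    have hev := h.eventually_effectivePotential_lt hℓ hαβ hgap (Or.inr rfl) hβ (hα0.trans hαβ)
      (η := ψ x₁ - ℓ) (by linarith [hψℓ m hmI])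
    have hev2 : ∀ᶠ x in 𝓝[Ioo α β] β, x₁ < x := mem_nhdsWithin_of_mem_nhds (Ioi_mem_nhds hx₁I.2)
    have hev3 : ∀ᶠ x in 𝓝[Ioo α β] β, x ∈ Ioo α β := self_mem_nhdsWithin
    rw [nhdsWithin_Ioo_eq_nhdsLT hαβ] at hev hev2 hev3
    obtain ⟨x, ⟨hx1, hx2⟩, hx3⟩ := ((hev.and hev2).and hev3).exists
    have := hincr x₁ hx₁I x hx3 hx2 (by linarith [hmI.2])
    linarith

theorem IsMinimizer.exists_support_eq_Icc (ha : 0 < a) (hb : 0 < b) (ht₀ : 0 < t)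
    (ht₁ : t < 1) (h : IsMinimizer a b t μ₁ μ₂ μ₃) :
    ∃ p q : ℝ, 0 ≤ p ∧ p < q ∧ μ₂.support = Icc p q := by
  have f2 := h.left.isFiniteMeasure'
  set S := μ₂.support with hS
  have hcl : IsClosed S := Measure.isClosed_support
  have hne : S.Nonempty := Measure.nonempty_support fun h0 => by
    have := h.1.mass₂
    rw [h0] at this
    simp at this
  have hbb : BddBelow S := ⟨0, fun x hx => h.support_subset_Ici hx⟩
  have hba : BddAbove S := h.bddAbove_support ha hb ht₀ ht₁
  have hp := hcl.csInf_mem hne hbb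
  have hq := hcl.csSup_mem hne hba
  have hsub : S ⊆ Icc (sInf S) (sSup S) := fun x hx => ⟨csInf_le hbb hx, le_csSup hba hx⟩
  refine ⟨sInf S, sSup S, h.support_subset_Ici hp, ?_, ?_⟩
  · refine lt_of_le_of_ne (hsub hp).2 fun heq => ?_
    have h1 : μ₂ univ = 0 := by
      refine measure_mono_null (t := Sᶜ ∪ {sInf S}) (fun x _ => ?_) (measure_union_null
        Measure.measure_compl_support (h.1.finite₂₂.measure_singleton _))
      by_cases hx : x ∈ S
      · have := hsub hx
        rw [← heq] at this
        exact Or.inr (le_antisymm this.2 this.1)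
      · exact Or.inl hx
    rw [h.1.mass₂] at h1
    exact one_ne_zero h1
  · refine Subset.antisymm hsub fun x hx => ?_
    by_contra hxS
    obtain ⟨α, hα, hαx, hα'⟩ := hcl.exists_gap_left hxS hp
      (lt_of_le_of_ne hx.1 fun h0 => hxS (h0 ▸ hp))
    obtain ⟨β, hβ, hxβ, hβ'⟩ := hcl.exists_gap_right hxS hq
      (lt_of_le_of_ne hx.2 fun h0 => hxS (h0 ▸ hq))
    refine h.not_gap ha hb ht₀ ht₁ hα hβ (hαx.trans hxβ)
      (measure_eq_zero_of_forall_notMem_support fun z hz => ?_)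
    rcases le_total z x with hzx | hzx
    · exact hα' z ⟨hz.1, hzx⟩
    · exact hβ' z ⟨hzx, hz.2⟩

end SecondSupport

/-! ### Analytic continuation of the function `ξ` across the real line -/

section Crossing

open Complex Metric Set Filter
open scoped ComplexConjugate

variable {a b t : ℝ} {μ₁ μ₂ μ₃ : Measure ℝ}

/-- The parameters of a minimizer, together with the end points of the three cuts. -/
structure CutData (a b t : ℝ) (μ₁ μ₂ μ₃ : Measure ℝ) (c₁ c₃ p q : ℝ) : Prop where
  ha : 0 < a
  hb : 0 < b
  ht₀ : 0 < t
  ht₁ : t < 1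
  min : IsMinimizer a b t μ₁ μ₂ μ₃
  hc₁ : 0 ≤ c₁
  hc₃ : 0 ≤ c₃
  hp : 0 ≤ p
  hpq : p < q
  hS₁ : (constraintMeasure a t - μ₁).support = Iic (-c₁)
  hS₂ : μ₂.support = Icc p q
  hS₃ : (constraintMeasure b (1 - t) - μ₃).support = Iic (-c₃)

theorem IsMinimizer.exists_cutData (ha : 0 < a) (hb : 0 < b) (ht₀ : 0 < t) (ht₁ : t < 1)
    (h : IsMinimizer a b t μ₁ μ₂ μ₃) : ∃ c₁ c₃ p q, CutData a b t μ₁ μ₂ μ₃ c₁ c₃ p q := by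
  obtain ⟨c₁, hc₁, hS₁⟩ := h.left.exists_support_sub_eq ha ht₀
  obtain ⟨c₃, hc₃, hS₃⟩ := h.right.exists_support_sub_eq hb (by linarith)
  obtain ⟨p, q, hp, hpq, hS₂⟩ := h.exists_support_eq_Icc ha hb ht₀ ht₁
  exact ⟨c₁, c₃, p, q, ha, hb, ht₀, ht₁, h, hc₁, hc₃, hp, hpq, hS₁, hS₂, hS₃⟩

/-- The gluing permutation in terms of the cuts that are present. -/
def gluePerm (b₁ b₂ b₃ : Prop) [Decidable b₁] [Decidable b₂] [Decidable b₃] :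
    Equiv.Perm (Fin 4) :=
  (if b₁ then Equiv.swap 0 1 else 1) * (if b₂ then Equiv.swap 1 2 else 1) *
    (if b₃ then Equiv.swap 2 3 else 1)

open Classical in
/-- The gluing permutation immediately to the right of `x`. -/
def gluePermRight (c₁ c₃ p q x : ℝ) : Equiv.Perm (Fin 4) :=
  gluePerm (x < -c₁) (p ≤ x ∧ x < q) (x < -c₃)

open Classical in
/-- The gluing permutation immediately to the left of `x`. -/
def gluePermLeft (c₁ c₃ p q x : ℝ) : Equiv.Perm (Fin 4) :=
  gluePerm (x ≤ -c₁) (p < x ∧ x ≤ q) (x ≤ -c₃)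

theorem IsConstrainedMin.differentiableOn_slack {c s : ℝ} {μ : Measure ℝ} (hs : 0 < s)
    {c₁ : ℝ} (hS : (constraintMeasure c s - μ).support = Iic (-c₁)) {x r : ℝ} (hx : -c₁ ≤ x - r) :
    DifferentiableOn ℂ (cauchyTransform (constraintMeasure c s - μ)) (ball (x : ℂ) r) := by
  intro z hz
  refine (differentiableAt_cauchyTransform (cauchyIntegrable_sub hs) isClosed_Iic
    ((ae_lt_of_support_sub_eq hS).mono fun y hy => le_of_lt hy)
    (ne_ofReal_of_lt_re ?_)).differentiableWithinAt
  have := (abs_lt.1 (abs_re_sub_lt_of_mem_ball hz)).1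
  linarith

/-- 2G + F equals 2√c/(s√z) minus 2F_μ − F_ν, and both terms change sign across the cut. -/
theorem IsConstrainedMin.exists_slack_continuation {c s : ℝ} {μ ν : Measure ℝ} (hc : 0 < c)
    (hs : 0 < s) (h : IsConstrainedMin c s μ ν) {c₁ : ℝ} (hc₁ : 0 ≤ c₁)
    (hS : (constraintMeasure c s - μ).support = Iic (-c₁)) {x₀ r : ℝ} (hr : 0 < r)
    (hx₀ : x₀ + r ≤ -c₁) :
    ∃ f : ℂ → ℂ, DifferentiableOn ℂ f (ball (x₀ : ℂ) r) ∧
      (∀ z ∈ ball (x₀ : ℂ) r, 0 < z.im →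
        f z = 2 * cauchyTransform (constraintMeasure c s - μ) z + cauchyTransform ν z) ∧
      ∀ z ∈ ball (x₀ : ℂ) r, z.im < 0 →
        f z = -(2 * cauchyTransform (constraintMeasure c s - μ) z + cauchyTransform ν z) := by
  obtain ⟨f, hf, hup, hlo⟩ := h.exists_continuation hc hs hc₁ hS hr hx₀
  refine ⟨fun z => 2 * (√c / (s * (I * csqrt (-z)))) - f z, fun z hz => ?_, fun z hz hzi => ?_,
    fun z hz hzi => ?_⟩
  · have hz2 : -z ∈ slitPlane := by
      refine Or.inl ?_
      rw [neg_re]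
      have := (abs_lt.1 (abs_re_sub_lt_of_mem_ball hz)).2
      linarith
    have d2 : DifferentiableAt ℂ (fun z => csqrt (-z)) z :=
      DifferentiableAt.comp z (f := fun z : ℂ => -z) (differentiableAt_csqrt hz2) (by fun_prop)
    have hne : (s : ℂ) * (I * csqrt (-z)) ≠ 0 :=
      mul_ne_zero (ofReal_ne_zero.2 hs.ne') (mul_ne_zero I_ne_zero
        (csqrt_ne_zero (slitPlane_ne_zero hz2)))
    exact ((((differentiableAt_const _).fun_div ((d2.const_mul I).const_mul (s : ℂ)) hne).const_mul
      2).fun_sub ((hf z hz).differentiableAt (isOpen_ball.mem_nhds hz))).differentiableWithinAt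
  · beta_reduce
    rw [h.cauchyTransform_sub hs (mem_slitPlane_of_im_ne_zero hzi.ne'), hup z hz hzi,
      ← csqrt_of_im_pos hzi]
    ring
  · beta_reduce
    rw [h.cauchyTransform_sub hs (mem_slitPlane_of_im_ne_zero hzi.ne), hlo z hz hzi,
      csqrt_of_im_neg hzi, mul_neg, div_neg]
    ring

/-- On the support of the second measure the effective potential is constant. -/
theorem IsMinimizer.exists_effectivePotential_eq (h : IsMinimizer a b t μ₁ μ₂ μ₃) :
    ∃ ℓ : ℝ, ∀ᵐ x, 0 < x → x ∈ μ₂.support → effectivePotential a b t μ₁ μ₂ μ₃ x = ℓ := by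
  have f2 := h.left.isFiniteMeasure'
  obtain ⟨ℓ, hae, -, hℓ⟩ := h.exists_effectivePotential
  have l2 := h.left.finite'.logIntegrable
  refine ⟨ℓ, ?_⟩
  have hint : ∀ᵐ x, Integrable (fun s => -Real.log |x - s|) μ₂ := by
    have key : ∀ N : ℕ, ∀ᵐ x, x ∈ Icc (-(N : ℝ)) N → Integrable (fun s => -Real.log |x - s|) μ₂ := by
      intro N
      rw [← ae_restrict_iff' measurableSet_Icc]
      exact (hasFiniteEnergy_volume_restrict N.cast_nonneg l2).ae_integrable_log
    filter_upwards [ae_all_iff.2 key] with x hx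
    obtain ⟨N, hN⟩ := exists_nat_ge |x|
    exact hx N (abs_le.1 hN)
  filter_upwards [hae, hint] with x hx hi hx0 hxS
  refine le_antisymm ?_ (hx hx0)
  have hna : ∀ᵐ s ∂μ₂, s ≠ x := by rw [ae_iff]; simpa using h.1.finite₂₂.measure_singleton x
  set ε : ℕ → ℝ := fun n => 1 / ((n : ℝ) + 1) with hε
  have hεpos : ∀ n, 0 < ε n := fun n => by positivity
  -- By monotone convergence the bound for truncations passes to the full potential at every support
  -- point where the latter converges, which is almost every one.
  have hlim : Tendsto (fun n => potTrunc (ε n) μ₂ x) atTop (𝓝 (pot μ₂ x)) := by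
    refine integral_tendsto_of_tendsto_of_monotone (fun n => l2.integrable_trunc (hεpos n) x) hi
      ?_ ?_
    · refine .of_forall fun s m n hmn => neg_le_neg ?_
      exact Real.log_le_log (lt_max_of_lt_right (hεpos n))
        (max_le_max le_rfl (one_div_le_one_div_of_le (by positivity) (by simpa using hmn)))
    · filter_upwards [hna] with s hs
      have hpos : 0 < |x - s| := abs_pos.2 (_root_.sub_ne_zero.2 hs.symm)
      have h0 := (tendsto_one_div_add_atTop_nhds_zero_nat (𝕜 := ℝ)).eventually (gt_mem_nhds hpos)
      refine tendsto_const_nhds.congr' ?_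
      filter_upwards [h0] with n hn
      rw [max_eq_left hn.le]
  have h1 := (hlim.const_mul 2).add_const (-pot μ₁ x - pot μ₃ x + externalField a b t x)
  have h2 := le_of_tendsto h1 (.of_forall fun n => hℓ (ε n) (hεpos n) x hxS hx0)
  rw [effectivePotential]
  linarith

/-- As in `IsConstrainedMin.exists_continuation`: μ₂ is split at the disk, and everything except its
part in the disk, including the field and the outer measures, forms the analytic external function.
The condition 0 ≤ x₀ − r keeps the disk away from the outer measures and from the branch of the
square roots. -/
theorem IsMinimizer.exists_middle_continuation (ha : 0 < a) (hb : 0 < b) (ht₀ : 0 < t)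
    (ht₁ : t < 1) (h : IsMinimizer a b t μ₁ μ₂ μ₃) {x₀ r : ℝ} (hr : 0 < r) (hx0 : 0 ≤ x₀ - r)
    (hS : Ioo (x₀ - r) (x₀ + r) ⊆ μ₂.support) :
    ∃ f : ℂ → ℂ, DifferentiableOn ℂ f (ball (x₀ : ℂ) r) ∧
      (∀ z ∈ ball (x₀ : ℂ) r, 0 < z.im → f z = 2 * cauchyTransform μ₂ z - (1 / (t * (1 - t)) -
        cauchyTransform (constraintMeasure a t - μ₁) z -
        cauchyTransform (constraintMeasure b (1 - t) - μ₃) z)) ∧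
      ∀ z ∈ ball (x₀ : ℂ) r, z.im < 0 → f z = -(2 * cauchyTransform μ₂ z - (1 / (t * (1 - t)) -
        cauchyTransform (constraintMeasure a t - μ₁) z -
        cauchyTransform (constraintMeasure b (1 - t) - μ₃) z)) := by
  have f1 := h.left.isFiniteMeasure
  have f2 := h.left.isFiniteMeasure'
  have f3 := h.right.isFiniteMeasure
  obtain ⟨ℓ, hℓ⟩ := h.exists_effectivePotential_eq
  set B := Ioo (x₀ - r) (x₀ + r) with hB
  set G₁ := cauchyTransform (constraintMeasure a t - μ₁)
  set G₃ := cauchyTransform (constraintMeasure b (1 - t) - μ₃)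
  have hBc : IsClosed Bᶜ := isOpen_Ioo.isClosed_compl
  have hfar : ∀ᵐ y ∂(μ₂.restrict Bᶜ), y ∈ Bᶜ := ae_restrict_mem measurableSet_Ioo.compl
  have hbd : ∀ᵐ y ∂(μ₂.restrict B), |y| ≤ |x₀| + r := by
    filter_upwards [ae_restrict_mem measurableSet_Ioo] with y hy
    have : |y - x₀| ≤ r := abs_le.2 ⟨by linarith [hy.1], by linarith [hy.2]⟩
    calc |y| = |(y - x₀) + x₀| := by ring_nf
      _ ≤ _ := (abs_add_le _ _).trans (by linarith)
  have hzre : ∀ z ∈ ball (x₀ : ℂ) r, 0 < z.re := fun z hz => by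
    have := (abs_lt.1 (abs_re_sub_lt_of_mem_ball hz)).1
    linarith
  have hC : ∀ κ : Measure ℝ, [IsFiniteMeasure κ] → CauchyIntegrable κ :=
    fun κ _ => cauchyIntegrable_of_isFiniteMeasure κ
  have hG : ∀ {c s : ℝ} {μ : Measure ℝ} (hs : 0 < s), ∀ z ∈ ball (x₀ : ℂ) r,
      DifferentiableAt ℂ (cauchyTransform (constraintMeasure c s - μ)) z := fun hs z hz =>
    differentiableAt_cauchyTransform (IsConstrainedMin.cauchyIntegrable_sub hs) isClosed_Iic
      IsConstrainedMin.sub_ae_mem (ne_ofReal_of_lt_re (hzre z hz))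
  have ht' : 0 < 1 - t := by linarith
  have hW : DifferentiableOn ℂ (fun z => -2 * cauchyTransform (μ₂.restrict Bᶜ) z +
      (1 / (t * (1 - t)) - G₁ z - G₃ z)) (ball (x₀ : ℂ) r) := fun z hz =>
    (((differentiableAt_cauchyTransform (hC _) hBc hfar (ne_ofReal_of_mem_ball hz)).const_mul
      (-2)).fun_add (((differentiableAt_const _).fun_sub (hG ht₀ z hz)).fun_sub
        (hG ht' z hz))).differentiableWithinAt
  have hw : ∀ x ∈ Ioo (x₀ - r) (x₀ + r), HasDerivAt (fun x => 2 * pot (μ₂.restrict Bᶜ) x -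
      pot μ₁ x - pot μ₃ x + externalField a b t x)
      (-2 * cauchyTransform (μ₂.restrict Bᶜ) x + (1 / (t * (1 - t)) - G₁ x - G₃ x)).re x := by
    intro x hx
    have hxp : 0 < x := by linarith [hx.1]
    have hx' : x ∉ Iic (0 : ℝ) := not_le.2 hxp
    have d1 := hasDerivAt_pot h.left.logIntegrable isClosed_Iic h.left.ae_mem hx'
    have d3 := hasDerivAt_pot h.right.logIntegrable isClosed_Iic h.right.ae_mem hx'
    have d2 := hasDerivAt_pot (h.left.finite'.logIntegrable.mono (Measure.restrict_le_self (s := Bᶜ)))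
      hBc hfar (not_not_intro hx)
    refine ((((d2.const_mul 2).fun_sub d1).fun_sub d3).fun_add
      (hasDerivAt_externalField ha hb hxp)).congr_deriv ?_
    have e : (1 / (t * (1 - t)) : ℂ) = ((1 / (t * (1 - t)) : ℝ) : ℂ) := by push_cast; ring
    simp only [G₁, G₃]
    rw [cauchyTransform_ofReal, cauchyTransform_ofReal, cauchyTransform_ofReal, e,
      h.left.cauchyReal_sub ht₀ hxp, h.right.cauchyReal_sub ht' hxp, ← ofReal_sub, ← ofReal_sub,
      ← ofReal_ofNat, ← ofReal_neg, ← ofReal_mul, ← ofReal_add, ofReal_re]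
    ring
  have hconst : ∀ᵐ x, x ∈ Ioo (x₀ - r) (x₀ + r) → 2 * pot (μ₂.restrict B) x +
      (2 * pot (μ₂.restrict Bᶜ) x - pot μ₁ x - pot μ₃ x + externalField a b t x) = ℓ := by
    have hint : ∀ᵐ x, x ∈ Icc (-(|x₀| + r)) (|x₀| + r) →
        Integrable (fun s => -Real.log |x - s|) μ₂ := by
      rw [← ae_restrict_iff' measurableSet_Icc]
      exact (hasFiniteEnergy_volume_restrict (by positivity)
        h.left.finite'.logIntegrable).ae_integrable_log
    filter_upwards [hℓ, hint] with x hx hi hxB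
    have habs := abs_le.1 (le_refl |x₀|)
    have i := hi ⟨by linarith [hxB.1], by linarith [hxB.2]⟩
    have e : pot μ₂ x = pot (μ₂.restrict B) x + pot (μ₂.restrict Bᶜ) x := by
      rw [pot, ← integral_add_compl measurableSet_Ioo i]; rfl
    have := hx (by linarith [hxB.1]) (hS hxB)
    rw [effectivePotential, e] at this
    linarith
  have hconj : ∀ z : ℂ, -2 * cauchyTransform (μ₂.restrict Bᶜ) (conj z) +
      (1 / (t * (1 - t)) - G₁ (conj z) - G₃ (conj z)) =
      conj (-2 * cauchyTransform (μ₂.restrict Bᶜ) z + (1 / (t * (1 - t)) - G₁ z - G₃ z)) := by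
    intro z
    simp only [G₁, G₃, map_add, map_mul, map_sub, map_div₀, map_one, conj_ofReal,
      cauchyTransform_conj, map_neg, map_ofNat]
  obtain ⟨f, hf, hup, hlo⟩ := exists_odd_continuation hbd hr hW hconj hw hconst
  have hsplit : ∀ z : ℂ, z.im ≠ 0 → cauchyTransform μ₂ z =
      cauchyTransform (μ₂.restrict B) z + cauchyTransform (μ₂.restrict Bᶜ) z := fun z hz => by
    rw [← cauchyTransform_add_measure (integrable_inv_sub_of_im_ne_zero _ (hC _) hz)
      (integrable_inv_sub_of_im_ne_zero _ (hC _) hz),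
      Measure.restrict_add_restrict_compl measurableSet_Ioo]
  refine ⟨f, hf, fun z hz hzi => ?_, fun z hz hzi => ?_⟩
  · rw [hup z hz hzi, hsplit z hzi.ne']; ring
  · rw [hlo z hz hzi, hsplit z hzi.ne]; ring

variable {c₁ c₃ p q : ℝ}

/-- In this form the principal square root has disappeared, and the only singularities are on the
supports of the slack measures and of μ₂, that is, on the cuts. -/
theorem CutData.xiFormula_eq (h : CutData a b t μ₁ μ₂ μ₃ c₁ c₃ p q) {z : ℂ} (hz : z ∈ slitPlane) :
    xiFormula a b t μ₁ μ₂ μ₃ z =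
      ![cauchyTransform (constraintMeasure a t - μ₁) z + 1 / (t * (1 - t)),
        -cauchyTransform (constraintMeasure a t - μ₁) z - cauchyTransform μ₂ z + 1 / (t * (1 - t)),
        cauchyTransform μ₂ z + cauchyTransform (constraintMeasure b (1 - t) - μ₃) z,
        -cauchyTransform (constraintMeasure b (1 - t) - μ₃) z] := by
  rw [h.min.left.cauchyTransform_sub h.ht₀ hz,
    h.min.right.cauchyTransform_sub (by linarith [h.ht₁]) hz, xiFormula, csqrt]
  ext j
  fin_cases j <;> simp <;> ring

/-- Away from the end points of the cuts, `ξ` continues analytically across the real line. -/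
theorem CutData.exists_crossing (h : CutData a b t μ₁ μ₂ μ₃ c₁ c₃ p q) {x r : ℝ} (hr : 0 < r)
    (h₁ : -c₁ ∉ Ioo (x - r) (x + r)) (h₃ : -c₃ ∉ Ioo (x - r) (x + r))
    (hp : p ∉ Ioo (x - r) (x + r)) (hq : q ∉ Ioo (x - r) (x + r)) (j : Fin 4) :
    ∃ f : ℂ → ℂ, DifferentiableOn ℂ f (ball (x : ℂ) r) ∧
      (∀ z ∈ ball (x : ℂ) r, 0 < z.im → f z = xiFormula a b t μ₁ μ₂ μ₃ z j) ∧
      ∀ z ∈ ball (x : ℂ) r, z.im < 0 →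
        f z = xiFormula a b t μ₁ μ₂ μ₃ z (gluePermRight c₁ c₃ p q x j) := by
  have f2 := h.min.left.isFiniteMeasure'
  have ht' : 0 < 1 - t := by linarith [h.ht₁]
  have hc₁ := h.hc₁
  have hc₃ := h.hc₃
  have hp0 := h.hp
  have hpq := h.hpq
  set G₁ := cauchyTransform (constraintMeasure a t - μ₁) with hG₁
  set G₃ := cauchyTransform (constraintMeasure b (1 - t) - μ₃) with hG₃
  set F := cauchyTransform μ₂ with hF
  have hxi : ∀ z : ℂ, z.im ≠ 0 → xiFormula a b t μ₁ μ₂ μ₃ z =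
      ![G₁ z + 1 / (t * (1 - t)), -G₁ z - F z + 1 / (t * (1 - t)), F z + G₃ z, -G₃ z] :=
    fun z hz => h.xiFormula_eq (mem_slitPlane_of_im_ne_zero hz)
  have halt : ∀ {e : ℝ}, e ∉ Ioo (x - r) (x + r) → x + r ≤ e ∨ e ≤ x - r := fun {e} he => by
    by_contra! hh
    exact he ⟨hh.2, hh.1⟩
  have dF : x + r ≤ p ∨ q ≤ x - r → DifferentiableOn ℂ F (ball (x : ℂ) r) := by
    intro hx z hz
    have hmem : ∀ᵐ y ∂μ₂, y ∈ Icc p q := by rw [← h.hS₂]; exact Measure.support_mem_ae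
    refine (differentiableAt_cauchyTransform (cauchyIntegrable_of_isFiniteMeasure _) isClosed_Icc
      hmem fun y hy hzy => ?_).differentiableWithinAt
    rw [hzy, ofReal_mem_ball] at hz
    rcases hx with hx | hx
    · linarith [hz.2, hy.1]
    · linarith [hz.1, hy.2]
  -- If the sum S of two branches is analytic and their difference changes sign across the interval,
  -- with continuation D, then (S + D)/2 and (S − D)/2 continue each branch into the other.
  have comb : ∀ {S D : ℂ → ℂ} {i k : Fin 4}, DifferentiableOn ℂ S (ball (x : ℂ) r) →
      DifferentiableOn ℂ D (ball (x : ℂ) r) →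
      (∀ z, z.im ≠ 0 → xiFormula a b t μ₁ μ₂ μ₃ z i + xiFormula a b t μ₁ μ₂ μ₃ z k = S z) →
      (∀ z ∈ ball (x : ℂ) r, 0 < z.im →
        D z = xiFormula a b t μ₁ μ₂ μ₃ z i - xiFormula a b t μ₁ μ₂ μ₃ z k) →
      (∀ z ∈ ball (x : ℂ) r, z.im < 0 →
        D z = -(xiFormula a b t μ₁ μ₂ μ₃ z i - xiFormula a b t μ₁ μ₂ μ₃ z k)) →
      (∃ f : ℂ → ℂ, DifferentiableOn ℂ f (ball (x : ℂ) r) ∧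
        (∀ z ∈ ball (x : ℂ) r, 0 < z.im → f z = xiFormula a b t μ₁ μ₂ μ₃ z i) ∧
        ∀ z ∈ ball (x : ℂ) r, z.im < 0 → f z = xiFormula a b t μ₁ μ₂ μ₃ z k) ∧
      ∃ f : ℂ → ℂ, DifferentiableOn ℂ f (ball (x : ℂ) r) ∧
        (∀ z ∈ ball (x : ℂ) r, 0 < z.im → f z = xiFormula a b t μ₁ μ₂ μ₃ z k) ∧
        ∀ z ∈ ball (x : ℂ) r, z.im < 0 → f z = xiFormula a b t μ₁ μ₂ μ₃ z i := by
    intro S D i k hS hD hsum hup hlo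
    refine ⟨⟨fun z => (S z + D z) / 2, (hS.fun_add hD).div_const 2, fun z hz hzi => ?_,
      fun z hz hzi => ?_⟩, ⟨fun z => (S z - D z) / 2, (hS.fun_sub hD).div_const 2,
      fun z hz hzi => ?_, fun z hz hzi => ?_⟩⟩ <;> beta_reduce
    · rw [← hsum z hzi.ne', hup z hz hzi]; ring
    · rw [← hsum z hzi.ne, hlo z hz hzi]; ring
    · rw [← hsum z hzi.ne', hup z hz hzi]; ring
    · rw [← hsum z hzi.ne, hlo z hz hzi]; ring
  have same : ∀ {S : ℂ → ℂ} {i : Fin 4}, DifferentiableOn ℂ S (ball (x : ℂ) r) →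
      (∀ z, z.im ≠ 0 → xiFormula a b t μ₁ μ₂ μ₃ z i = S z) →
      ∃ f : ℂ → ℂ, DifferentiableOn ℂ f (ball (x : ℂ) r) ∧
        (∀ z ∈ ball (x : ℂ) r, 0 < z.im → f z = xiFormula a b t μ₁ μ₂ μ₃ z i) ∧
        ∀ z ∈ ball (x : ℂ) r, z.im < 0 → f z = xiFormula a b t μ₁ μ₂ μ₃ z i :=
    fun {S i} hS hsum => ⟨S, hS, fun z _ hzi => (hsum z hzi.ne').symm,
      fun z _ hzi => (hsum z hzi.ne).symm⟩
  have hcon : DifferentiableOn ℂ (fun _ : ℂ => (1 / (t * (1 - t)) : ℂ)) (ball (x : ℂ) r) :=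
    differentiableOn_const _
  have dG₁ : -c₁ ≤ x - r → DifferentiableOn ℂ G₁ (ball (x : ℂ) r) := fun hx =>
    IsConstrainedMin.differentiableOn_slack h.ht₀ h.hS₁ hx
  have dG₃ : -c₃ ≤ x - r → DifferentiableOn ℂ G₃ (ball (x : ℂ) r) := fun hx =>
    IsConstrainedMin.differentiableOn_slack ht' h.hS₃ hx
  have left : ¬ (p ≤ x ∧ x < q) → (j = 0 ∨ j = 1) →
      ∃ f : ℂ → ℂ, DifferentiableOn ℂ f (ball (x : ℂ) r) ∧
      (∀ z ∈ ball (x : ℂ) r, 0 < z.im → f z = xiFormula a b t μ₁ μ₂ μ₃ z j) ∧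
      ∀ z ∈ ball (x : ℂ) r, z.im < 0 →
        f z = xiFormula a b t μ₁ μ₂ μ₃ z (gluePermRight c₁ c₃ p q x j) := by
    intro hpx hj
    have hF' : DifferentiableOn ℂ F (ball (x : ℂ) r) := by
      refine dF ?_
      rcases halt hp with h' | h'
      · exact Or.inl h'
      · rcases halt hq with h'' | h''
        · exact absurd ⟨by linarith, by linarith⟩ hpx
        · exact Or.inr h''
    rcases halt h₁ with h' | h'
    · obtain ⟨D, hD, hup, hlo⟩ := h.min.left.exists_slack_continuation h.ha h.ht₀ hc₁ h.hS₁ hr h'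
      obtain ⟨k1, k2⟩ := comb (S := fun z => 2 * (1 / (t * (1 - t))) - F z) (D := D) (i := 0) (k := 1)
        ((hcon.const_mul 2).fun_sub hF') hD (fun z hz => by rw [hxi z hz]; simp; ring)
        (fun z hz hzi => by rw [hup z hz hzi, hxi z hzi.ne']; simp; ring)
        (fun z hz hzi => by rw [hlo z hz hzi, hxi z hzi.ne]; simp; ring)
      have hx1 : x < -c₁ := by linarith
      rcases hj with rfl | rfl
      · have : gluePermRight c₁ c₃ p q x 0 = 1 := by
          rw [gluePermRight, gluePerm, if_pos hx1, if_neg hpx]; split_ifs <;> decide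
        rw [this]; exact k1
      · have : gluePermRight c₁ c₃ p q x 1 = 0 := by
          rw [gluePermRight, gluePerm, if_pos hx1, if_neg hpx]; split_ifs <;> decide
        rw [this]; exact k2
    · have hx1 : ¬ x < -c₁ := by linarith
      rcases hj with rfl | rfl
      · have : gluePermRight c₁ c₃ p q x 0 = 0 := by
          rw [gluePermRight, gluePerm, if_neg hx1, if_neg hpx]; split_ifs <;> decide
        rw [this]
        exact same ((dG₁ h').fun_add hcon) fun z hz => by rw [hxi z hz]; simp
      · have : gluePermRight c₁ c₃ p q x 1 = 1 := by
          rw [gluePermRight, gluePerm, if_neg hx1, if_neg hpx]; split_ifs <;> decide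
        rw [this]
        exact same (((dG₁ h').fun_neg.fun_sub hF').fun_add hcon) fun z hz => by rw [hxi z hz]; simp
  have right : ¬ (p ≤ x ∧ x < q) → (j = 2 ∨ j = 3) →
      ∃ f : ℂ → ℂ, DifferentiableOn ℂ f (ball (x : ℂ) r) ∧
      (∀ z ∈ ball (x : ℂ) r, 0 < z.im → f z = xiFormula a b t μ₁ μ₂ μ₃ z j) ∧
      ∀ z ∈ ball (x : ℂ) r, z.im < 0 →
        f z = xiFormula a b t μ₁ μ₂ μ₃ z (gluePermRight c₁ c₃ p q x j) := by
    intro hpx hj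
    have hF' : DifferentiableOn ℂ F (ball (x : ℂ) r) := by
      refine dF ?_
      rcases halt hp with h' | h'
      · exact Or.inl h'
      · rcases halt hq with h'' | h''
        · exact absurd ⟨by linarith, by linarith⟩ hpx
        · exact Or.inr h''
    rcases halt h₃ with h' | h'
    · obtain ⟨D, hD, hup, hlo⟩ := h.min.right.exists_slack_continuation h.hb ht' hc₃ h.hS₃ hr h'
      obtain ⟨k1, k2⟩ := comb (S := F) (D := D) (i := 2) (k := 3) hF' hD
        (fun z hz => by rw [hxi z hz]; simp)
        (fun z hz hzi => by rw [hup z hz hzi, hxi z hzi.ne']; simp; ring)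
        (fun z hz hzi => by rw [hlo z hz hzi, hxi z hzi.ne]; simp; ring)
      have hx1 : x < -c₃ := by linarith
      rcases hj with rfl | rfl
      · have : gluePermRight c₁ c₃ p q x 2 = 3 := by
          rw [gluePermRight, gluePerm, if_pos hx1, if_neg hpx]; split_ifs <;> decide
        rw [this]; exact k1
      · have : gluePermRight c₁ c₃ p q x 3 = 2 := by
          rw [gluePermRight, gluePerm, if_pos hx1, if_neg hpx]; split_ifs <;> decide
        rw [this]; exact k2
    · have hx1 : ¬ x < -c₃ := by linarith
      rcases hj with rfl | rfl
      · have : gluePermRight c₁ c₃ p q x 2 = 2 := by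
          rw [gluePermRight, gluePerm, if_neg hx1, if_neg hpx]; split_ifs <;> decide
        rw [this]
        exact same (hF'.fun_add (dG₃ h')) fun z hz => by rw [hxi z hz]; simp
      · have : gluePermRight c₁ c₃ p q x 3 = 3 := by
          rw [gluePermRight, gluePerm, if_neg hx1, if_neg hpx]; split_ifs <;> decide
        rw [this]
        exact same (dG₃ h').fun_neg fun z hz => by rw [hxi z hz]; simp
  -- Over the middle cut neither outer cut is present, because −c₁, −c₃ ≤ 0 ≤ p. Elsewhere F is
  -- analytic, and the pairs of sheets 0, 1 and 2, 3 are treated separately.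
  by_cases hpx : p ≤ x ∧ x < q
  · have h1' : ¬ x < -c₁ := by linarith [hpx.1]
    have h3' : ¬ x < -c₃ := by linarith [hpx.1]
    have g1 : -c₁ ≤ x - r := (halt h₁).resolve_left (by linarith)
    have g3 : -c₃ ≤ x - r := (halt h₃).resolve_left (by linarith)
    have gp : p ≤ x - r := (halt hp).resolve_left (by linarith [hpx.1])
    have gq : x + r ≤ q := (halt hq).resolve_right (by linarith [hpx.2])
    obtain ⟨D, hD, hup, hlo⟩ := h.min.exists_middle_continuation h.ha h.hb h.ht₀ h.ht₁ hr
      (hp0.trans gp) (fun y hy => by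
        rw [h.hS₂]; exact ⟨gp.trans hy.1.le, hy.2.le.trans gq⟩)
    obtain ⟨k2, k1⟩ := comb (S := fun z => 1 / (t * (1 - t)) - G₁ z + G₃ z) (D := D) (i := 2)
      (k := 1) ((hcon.fun_sub (dG₁ g1)).fun_add (dG₃ g3)) hD
      (fun z hz => by rw [hxi z hz]; simp; ring)
      (fun z hz hzi => by rw [hup z hz hzi, hxi z hzi.ne']; simp; ring)
      (fun z hz hzi => by rw [hlo z hz hzi, hxi z hzi.ne]; simp; ring)
    have e : gluePermRight c₁ c₃ p q x = Equiv.swap 1 2 := by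
      simp only [gluePermRight, gluePerm, h1', h3', hpx]; simp
    rw [e]
    fin_cases j
    · exact same ((dG₁ g1).fun_add hcon) fun z hz => by rw [hxi z hz]; simp
    · exact k1
    · exact k2
    · exact same (dG₃ g3).fun_neg fun z hz => by rw [hxi z hz]; simp
  · fin_cases j
    · exact left hpx (Or.inl rfl)
    · exact left hpx (Or.inr rfl)
    · exact right hpx (Or.inl rfl)
    · exact right hpx (Or.inr rfl)

/-! ### Growth of ξ at real points and at infinity. -/

theorem CutData.exists_norm_xiFormula_mul_im_le (h : CutData a b t μ₁ μ₂ μ₃ c₁ c₃ p q) :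
    ∃ C, 0 ≤ C ∧ ∀ z : ℂ, z.im ≠ 0 → ∀ j, ‖xiFormula a b t μ₁ μ₂ μ₃ z j‖ * |z.im| ≤
      C * (1 + ‖z‖) := by
  have hm₂ : μ₂ univ = 1 := h.min.1.mass₂
  have f2 := h.min.left.isFiniteMeasure'
  have ht' : 0 < 1 - t := by linarith [h.ht₁]
  have ht := h.ht₀
  set A := 1 / (t * (1 - t)) with hA
  have hA0 : 0 ≤ A := by positivity
  have hG : ∀ {c s : ℝ} {μ ν : Measure ℝ} (hs : 0 < s), IsConstrainedMin c s μ ν → ∀ z : ℂ,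
      z.im ≠ 0 → ‖cauchyTransform (constraintMeasure c s - μ) z‖ * |z.im| ≤
        (√c / s + 1) * (1 + ‖z‖) := by
    intro c s μ ν hs hmin z hz
    have hz0 : z ≠ 0 := fun h0 => hz (by rw [h0, zero_im])
    have hz1 : 0 < ‖z‖ := norm_pos_iff.2 hz0
    rw [hmin.cauchyTransform_sub hs (mem_slitPlane_of_im_ne_zero hz)]
    have e1 : ‖(√c : ℂ) / (s * csqrt z)‖ = √c / s / √‖z‖ := by
      rw [norm_div, norm_mul, norm_csqrt, norm_real, norm_real, Real.norm_of_nonneg hs.le,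
        Real.norm_of_nonneg (Real.sqrt_nonneg c), div_div]
    have hsq : √‖z‖ ≤ 1 + ‖z‖ := by
      rw [Real.sqrt_le_left (by positivity)]; nlinarith
    calc _ ≤ (‖(√c : ℂ) / (s * csqrt z)‖ + ‖cauchyTransform μ z‖) * |z.im| := by
          gcongr; exact norm_sub_le _ _
      _ = √c / s / √‖z‖ * |z.im| + ‖cauchyTransform μ z‖ * |z.im| := by rw [add_mul, e1]
      _ ≤ √c / s / √‖z‖ * ‖z‖ + 1 / 2 := by
          gcongr
          · exact Complex.abs_im_le_norm z
          · exact cauchyTransform_mul_im_le_one hmin.mass hz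
      _ = √c / s * √‖z‖ + 1 / 2 := by
          rw [div_mul_eq_mul_div, mul_div_assoc, Real.div_sqrt]
      _ ≤ √c / s * (1 + ‖z‖) + 1 * (1 + ‖z‖) := by gcongr; linarith
      _ = _ := by ring
  refine ⟨(√a / t + 1) + (√b / (1 - t) + 1) + 1 + A, by positivity, fun z hz j => ?_⟩
  have g1 := hG ht h.min.left z hz
  have g3 := hG ht' h.min.right z hz
  have gF : ‖cauchyTransform μ₂ z‖ * |z.im| ≤ 1 * (1 + ‖z‖) := by
    refine (norm_cauchyTransform_mul_im_le μ₂ hz).trans ?_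
    rw [measureReal_def, hm₂, ENNReal.toReal_one]
    linarith [norm_nonneg z]
  have gA : A * |z.im| ≤ A * (1 + ‖z‖) := by
    gcongr; linarith [Complex.abs_im_le_norm z]
  have hAn : ‖(1 / (t * (1 - t)) : ℂ)‖ = A := by
    have : (1 / (t * (1 - t)) : ℂ) = (A : ℂ) := by rw [hA]; push_cast; ring
    rw [this, norm_real, Real.norm_of_nonneg hA0]
  set G₁ := cauchyTransform (constraintMeasure a t - μ₁) z
  set G₃ := cauchyTransform (constraintMeasure b (1 - t) - μ₃) z
  set F := cauchyTransform μ₂ z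
  have hle : ‖xiFormula a b t μ₁ μ₂ μ₃ z j‖ ≤ ‖G₁‖ + ‖G₃‖ + ‖F‖ + A := by
    rw [h.xiFormula_eq (mem_slitPlane_of_im_ne_zero hz), ← hAn]
    have n1 := norm_nonneg G₁
    have n2 := norm_nonneg G₃
    have n3 := norm_nonneg F
    have n4 := norm_nonneg (1 / (t * (1 - t)) : ℂ)
    fin_cases j
    · exact (norm_add_le _ _).trans (by linarith)
    · refine (norm_add_le _ _).trans ?_
      have := norm_sub_le (-G₁) F
      rw [norm_neg] at this
      linarith
    · exact (norm_add_le _ _).trans (by linarith)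
    · exact (norm_neg _).le.trans (by linarith)
  calc _ ≤ (‖G₁‖ + ‖G₃‖ + ‖F‖ + A) * |z.im| := by gcongr
    _ = ‖G₁‖ * |z.im| + ‖G₃‖ * |z.im| + ‖F‖ * |z.im| + A * |z.im| := by ring
    _ ≤ _ := by linarith

/-- If z is much closer to the axis than Re z is to the ends of the cuts, the branch through z
continues to a disk about Re z. On it `norm_le_of_norm_mul_im_le` replaces 1/|Im z| by 1/d; a disk
of radius 3d/8 gives the factor 8. -/
theorem CutData.norm_xiFormula_le (h : CutData a b t μ₁ μ₂ μ₃ c₁ c₃ p q) {C : ℝ} (hC0 : 0 ≤ C)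
    (hC : ∀ z : ℂ, z.im ≠ 0 → ∀ j, ‖xiFormula a b t μ₁ μ₂ μ₃ z j‖ * |z.im| ≤ C * (1 + ‖z‖))
    {z : ℂ} (hz : z.im ≠ 0) {d : ℝ} (hd : 0 < d) (him : |z.im| < d / 8)
    (hE : ∀ e : ℝ, e = -c₁ ∨ e = -c₃ ∨ e = p ∨ e = q → 3 * d / 4 ≤ |e - z.re|) (j : Fin 4) :
    ‖xiFormula a b t μ₁ μ₂ μ₃ z j‖ ≤ 8 * C * (1 + ‖z‖ + d) / d := by
  have hE' : ∀ e : ℝ, e = -c₁ ∨ e = -c₃ ∨ e = p ∨ e = q →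
      e ∉ Ioo (z.re - 3 * d / 4) (z.re + 3 * d / 4) := fun e he hmem => by
    have := hE e he
    have h2 : |e - z.re| < 3 * d / 4 := abs_lt.2 ⟨by linarith [hmem.1], by linarith [hmem.2]⟩
    linarith
  obtain ⟨i, f, hf, hfC, hfz⟩ : ∃ i, ∃ f : ℂ → ℂ, DifferentiableOn ℂ f (ball (z.re : ℂ) (3 * d / 4)) ∧
      (∀ w ∈ ball (z.re : ℂ) (3 * d / 4), w.im ≠ 0 → f w = xiFormula a b t μ₁ μ₂ μ₃ w j ∨
        f w = xiFormula a b t μ₁ μ₂ μ₃ w i) ∧ f z = xiFormula a b t μ₁ μ₂ μ₃ z j := by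
    have hzb : z ∈ ball (z.re : ℂ) (3 * d / 4) := by
      have : z - z.re = z.im * I := by apply Complex.ext <;> simp
      rw [mem_ball, Complex.dist_eq, this, norm_mul, norm_I, norm_real, mul_one, Real.norm_eq_abs]
      linarith
    set g := gluePermRight c₁ c₃ p q z.re with hg
    have hcr := h.exists_crossing (x := z.re) (r := 3 * d / 4) (by positivity)
      (hE' _ (Or.inl rfl)) (hE' _ (Or.inr (Or.inl rfl))) (hE' _ (Or.inr (Or.inr (Or.inl rfl))))
      (hE' _ (Or.inr (Or.inr (Or.inr rfl))))
    -- Crossings are indexed by the sheet above the axis. For z below it, the sheet to start from is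
    -- the one whose continuation downwards is `j`.
    rcases lt_or_gt_of_ne hz with hz | hz
    · obtain ⟨f, hf, hup, hlo⟩ := hcr (g.symm j)
      rw [← hg, Equiv.apply_symm_apply] at hlo
      refine ⟨g.symm j, f, hf, fun w hw hwi => ?_, hlo z hzb hz⟩
      rcases lt_or_gt_of_ne hwi with hwi | hwi
      · exact Or.inl (hlo w hw hwi)
      · exact Or.inr (hup w hw hwi)
    · obtain ⟨f, hf, hup, hlo⟩ := hcr j
      refine ⟨g j, f, hf, fun w hw hwi => ?_, hup z hzb hz⟩
      rcases lt_or_gt_of_ne hwi with hwi | hwi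
      · exact Or.inr (hlo w hw hwi)
      · exact Or.inl (hup w hw hwi)
  have hzr : ‖z - z.re‖ = |z.im| := by
    have : z - z.re = z.im * I := by apply Complex.ext <;> simp
    rw [this, norm_mul, norm_I, norm_real, mul_one, Real.norm_eq_abs]
  have h1 := norm_le_of_norm_mul_im_le (f := f) (x := z.re) (r := 3 * d / 8)
    (C := C * (1 + ‖z‖ + d)) (by positivity)
    (closedBall_subset_ball (by linarith : 3 * d / 8 < 3 * d / 4)) hf ?_ (by positivity) (w := z)
    (by rw [hzr]; linarith)
  · rw [← hfz]
    refine h1.trans (le_of_eq ?_)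
    field_simp
  · intro w hw hwi
    have hwz : ‖w‖ ≤ ‖z‖ + d := by
      rw [mem_closedBall, Complex.dist_eq] at hw
      have e1 : w = (w - z.re) + (z.re : ℂ) := by ring
      have e2 : ‖(z.re : ℂ)‖ ≤ ‖z‖ := by
        rw [norm_real]; exact Complex.abs_re_le_norm z
      rw [e1]
      exact (norm_add_le _ _).trans (by linarith)
    have hC' : C * (1 + ‖w‖) ≤ C * (1 + ‖z‖ + d) :=
      mul_le_mul_of_nonneg_left (by linarith) hC0
    rcases hfC w (closedBall_subset_ball (by linarith : 3 * d / 8 < 3 * d / 4) hw) hwi with e | e <;>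
      rw [e]
    · exact (hC w hwi j).trans hC'
    · exact (hC w hwi i).trans hC'

/-- Taken with d = |z − x₀|: the ends of cuts other than x₀ are far away on this scale, and x₀
itself is far from Re z when |Im z| is small compared with d. -/
theorem CutData.exists_norm_xiFormula_mul_le (h : CutData a b t μ₁ μ₂ μ₃ c₁ c₃ p q) (x₀ : ℝ) :
    ∃ C, ∀ᶠ z : ℂ in 𝓝 (x₀ : ℂ), z.im ≠ 0 → ∀ j,
      ‖xiFormula a b t μ₁ μ₂ μ₃ z j‖ * ‖z - x₀‖ ≤ C := by
  obtain ⟨C, hC0, hC⟩ := h.exists_norm_xiFormula_mul_im_le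
  have hfar : ∀ e : ℝ, ∀ᶠ z : ℂ in 𝓝 (x₀ : ℂ), e = x₀ ∨ 2 * ‖z - x₀‖ ≤ |e - x₀| := by
    intro e
    rcases eq_or_ne e x₀ with rfl | he
    · exact .of_forall fun _ => Or.inl rfl
    · have : 0 < |e - x₀| / 2 := half_pos (abs_pos.2 (_root_.sub_ne_zero.2 he))
      filter_upwards [ball_mem_nhds (x₀ : ℂ) this] with z hz
      rw [mem_ball, Complex.dist_eq] at hz
      exact Or.inr (by linarith)
  refine ⟨8 * C * (1 + (|x₀| + 1) + 1), ?_⟩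
  filter_upwards [hfar (-c₁), hfar (-c₃), hfar p, hfar q, ball_mem_nhds (x₀ : ℂ) one_pos]
    with z h1 h3 hp hq hz1 hz j
  rw [mem_ball, Complex.dist_eq] at hz1
  set d := ‖z - x₀‖ with hd
  have hd0 : 0 < d := norm_pos_iff.2 (_root_.sub_ne_zero.2 fun h0 => hz (by rw [h0, ofReal_im]))
  have hzn : ‖z‖ ≤ |x₀| + 1 := by
    have e1 : z = (z - x₀) + (x₀ : ℂ) := by ring
    rw [e1]
    refine (norm_add_le _ _).trans ?_
    rw [norm_real, Real.norm_eq_abs]; linarith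
  rcases le_or_gt (d / 8) |z.im| with him | him
  · have := hC z hz j
    have h2 : C * (1 + ‖z‖) ≤ C * (1 + (|x₀| + 1) + 1) :=
      mul_le_mul_of_nonneg_left (by linarith) hC0
    nlinarith [norm_nonneg (xiFormula a b t μ₁ μ₂ μ₃ z j)]
  · have hre : d ≤ |z.re - x₀| + |z.im| := by
      simpa using Complex.norm_le_abs_re_add_abs_im (z - x₀)
    have hre' : |z.re - x₀| ≤ d := by simpa using Complex.abs_re_le_norm (z - x₀)
    have := h.norm_xiFormula_le hC0 hC hz hd0 him (fun e he => ?_) j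
    · rw [le_div_iff₀ hd0] at this
      refine this.trans ?_
      gcongr
    · have key : e = x₀ ∨ 2 * d ≤ |e - x₀| := by rcases he with rfl | rfl | rfl | rfl <;> assumption
      rcases key with rfl | key
      · rw [abs_sub_comm]; linarith
      · have := abs_sub_le e z.re x₀
        linarith

/-- The same argument with d = |z|, on whose scale all ends of the cuts are close to 0. -/
theorem CutData.exists_norm_xiFormula_le (h : CutData a b t μ₁ μ₂ μ₃ c₁ c₃ p q) :
    ∃ C R : ℝ, ∀ z : ℂ, R ≤ ‖z‖ → z.im ≠ 0 → ∀ j, ‖xiFormula a b t μ₁ μ₂ μ₃ z j‖ ≤ C := by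
  obtain ⟨C, hC0, hC⟩ := h.exists_norm_xiFormula_mul_im_le
  refine ⟨24 * C, 1 + 8 * (|c₁| + |c₃| + |p| + |q|), fun z hR hz j => ?_⟩
  have n1 := abs_nonneg c₁
  have n2 := abs_nonneg c₃
  have n3 := abs_nonneg p
  have n4 := abs_nonneg q
  have hd0 : 1 ≤ ‖z‖ := by linarith
  rcases le_or_gt (‖z‖ / 8) |z.im| with him | him
  · have := hC z hz j
    have h2 : C * (1 + ‖z‖) ≤ C * (2 * ‖z‖) :=
      mul_le_mul_of_nonneg_left (by linarith) hC0
    have h3 : ‖xiFormula a b t μ₁ μ₂ μ₃ z j‖ * ‖z‖ ≤ 24 * C * ‖z‖ := by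
      nlinarith [norm_nonneg (xiFormula a b t μ₁ μ₂ μ₃ z j)]
    exact le_of_mul_le_mul_right h3 (by linarith)
  · have hre := Complex.norm_le_abs_re_add_abs_im z
    have := h.norm_xiFormula_le hC0 hC hz (d := ‖z‖) (by linarith) him (fun e he => ?_) j
    · refine this.trans ?_
      rw [div_le_iff₀ (by linarith)]
      nlinarith
    · have key : |e| ≤ ‖z‖ / 8 := by
        rcases he with rfl | rfl | rfl | rfl <;>
          (try rw [abs_neg]) <;> linarith
      have := abs_sub_abs_le_abs_sub z.re e
      rw [abs_sub_comm] at this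
      linarith

end Crossing

/-! ### The gluing of the half-sheets near a real point and near infinity -/

section LocalGluing

open Complex Metric Set Filter OnePoint

theorem sphereInv_of_ne_zero {w : ℂ} (hw : w ≠ 0) : sphereInv w = ((w⁻¹ : ℂ) : OnePoint ℂ) :=
  if_neg hw

@[simp]
theorem sphereInv_zero : sphereInv 0 = infty := if_pos rfl

theorem tendsto_coe_cobounded : Tendsto ((↑) : ℂ → OnePoint ℂ) (Bornology.cobounded ℂ) (𝓝 infty) := by
  rw [cobounded_eq_cocompact, ← coclosedCompact_eq_cocompact]
  exact tendsto_coe_infty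

/-- The inversion of the Riemann sphere. -/
def sphereInversionFun (x : OnePoint ℂ) : OnePoint ℂ :=
  OnePoint.elim x ((0 : ℂ) : OnePoint ℂ) sphereInv

@[simp]
theorem sphereInversionFun_coe (w : ℂ) : sphereInversionFun w = sphereInv w := rfl

@[simp]
theorem sphereInversionFun_infty : sphereInversionFun infty = ((0 : ℂ) : OnePoint ℂ) := rfl

theorem sphereInversionFun_sphereInv (w : ℂ) : sphereInversionFun (sphereInv w) = w := by
  rcases eq_or_ne w 0 with rfl | hw
  · simp
  · rw [sphereInv_of_ne_zero hw, sphereInversionFun_coe, sphereInv_of_ne_zero (inv_ne_zero hw),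
      inv_inv]

theorem continuous_sphereInversionFun : Continuous sphereInversionFun := by
  rw [continuous_iff_continuousAt]
  intro x
  induction x using OnePoint.rec with
  | infty =>
    rw [continuousAt_infty', coclosedCompact_eq_cocompact, ← cobounded_eq_cocompact]
    have h0 : Tendsto (fun w : ℂ => ((w⁻¹ : ℂ) : OnePoint ℂ)) (Bornology.cobounded ℂ)
        (𝓝 ((0 : ℂ) : OnePoint ℂ)) :=
      (continuous_coe.tendsto 0).comp tendsto_inv₀_cobounded
    refine h0.congr' ?_
    filter_upwards [Bornology.eventually_ne_cobounded (0 : ℂ)] with w hw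
    exact (sphereInv_of_ne_zero hw).symm
  | coe w =>
    rw [continuousAt_coe]
    rcases eq_or_ne w 0 with rfl | hw
    · rw [continuousAt_iff_punctured_nhds]
      have h0 : Tendsto (fun w : ℂ => ((w⁻¹ : ℂ) : OnePoint ℂ)) (𝓝[≠] 0) (𝓝 infty) :=
        tendsto_coe_cobounded.comp tendsto_inv₀_nhdsNE_zero
      simp only [Function.comp_apply, sphereInversionFun_coe, sphereInv_zero]
      refine h0.congr' ?_
      filter_upwards [self_mem_nhdsWithin] with w hw
      exact (sphereInv_of_ne_zero hw).symm
    · have h0 : ContinuousAt (fun w : ℂ => ((w⁻¹ : ℂ) : OnePoint ℂ)) w :=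
        continuous_coe.continuousAt.comp (continuousAt_inv₀ hw)
      refine h0.congr ?_
      filter_upwards [isOpen_ne.mem_nhds hw] with w hw
      exact (sphereInv_of_ne_zero hw).symm

/-- The inversion of the Riemann sphere, as a homeomorphism. -/
def sphereInversion : OnePoint ℂ ≃ₜ OnePoint ℂ where
  toFun := sphereInversionFun
  invFun := sphereInversionFun
  left_inv x := by
    induction x using OnePoint.rec with
    | infty => simp
    | coe w => exact sphereInversionFun_sphereInv w
  right_inv x := by
    induction x using OnePoint.rec with
    | infty => simp
    | coe w => exact sphereInversionFun_sphereInv w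
  continuous_toFun := continuous_sphereInversionFun
  continuous_invFun := continuous_sphereInversionFun

theorem isOpenEmbedding_sphereInv : IsOpenEmbedding sphereInv :=
  sphereInversion.isOpenEmbedding.comp isOpenEmbedding_coe

@[simp]
theorem coe_mem_closedHalf_true_iff {z : ℂ} : (z : OnePoint ℂ) ∈ closedHalf true ↔ 0 ≤ z.im := by
  simp [closedHalf]

@[simp]
theorem coe_mem_closedHalf_false_iff {z : ℂ} : (z : OnePoint ℂ) ∈ closedHalf false ↔ z.im ≤ 0 := by
  simp [closedHalf]

theorem infty_mem_closedHalf (h : Bool) : infty ∈ closedHalf h := by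
  cases h <;> exact mem_insert _ _

/-- The coordinate at infinity is −1/z and not 1/z because it preserves the upper and the lower
half. -/
theorem sphereInv_neg_mem_closedHalf {y : ℂ} :
    (sphereInv (-y) ∈ closedHalf true ↔ 0 ≤ y.im) ∧
      (sphereInv (-y) ∈ closedHalf false ↔ y.im ≤ 0) := by
  rcases eq_or_ne y 0 with rfl | hy
  · simp [infty_mem_closedHalf]
  · have h : 0 < normSq (-y) := normSq_pos.2 (neg_ne_zero.2 hy)
    rw [sphereInv_of_ne_zero (neg_ne_zero.2 hy), coe_mem_closedHalf_true_iff,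
      coe_mem_closedHalf_false_iff, inv_im, neg_im, neg_neg]
    exact ⟨by rw [le_div_iff₀ h, zero_mul], by rw [div_le_iff₀ h, zero_mul]⟩

theorem coe_mem_sphereClosure {A : Set ℝ} {x : ℝ} :
    ((x : ℂ) : OnePoint ℂ) ∈ sphereClosure A ↔ x ∈ closure A := by
  have : IsEmbedding (fun x : ℝ => ((x : ℂ) : OnePoint ℂ)) :=
    isOpenEmbedding_coe.isEmbedding.comp isometry_ofReal.isEmbedding
  rw [this.closure_eq_preimage_closure_image]
  rfl

theorem infty_mem_sphereClosure {A : Set ℝ} {f : ℝ → ℝ} (hf : Tendsto f atTop (Bornology.cobounded ℝ))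
    (hA : ∀ᶠ y in atTop, f y ∈ A) : infty ∈ sphereClosure A := by
  have h : Tendsto (fun y => ((f y : ℂ) : OnePoint ℂ)) atTop (𝓝 infty) := by
    refine tendsto_coe_cobounded.comp ?_
    rw [← tendsto_norm_atTop_iff_cobounded] at hf ⊢
    simpa using hf
  exact mem_closure_of_tendsto h (hA.mono fun y hy => mem_image_of_mem _ hy)

theorem infty_notMem_sphereClosure_Icc {p q : ℝ} : infty ∉ sphereClosure (Icc p q) := by
  have h : IsClosed ((fun x : ℝ => ((x : ℂ) : OnePoint ℂ)) '' Icc p q) :=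
    (isCompact_Icc.image (continuous_coe.comp continuous_ofReal)).isClosed
  rw [sphereClosure, h.closure_eq]
  simp

/-- The cuts `(-infty, -c₁]`, `[p, q]`, `(-infty, -c₃]`. -/
def stdCuts (c₁ c₃ p q : ℝ) : Fin 3 → Set ℝ := ![Iic (-c₁), Icc p q, Iic (-c₃)]

variable {c₁ c₃ p q : ℝ}

theorem cutsIn_stdCuts : cutsIn (stdCuts c₁ c₃ p q) =
    ![Iic (-c₁), Iic (-c₁) ∪ Icc p q, Icc p q ∪ Iic (-c₃), Iic (-c₃)] := by
  funext j
  ext x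
  simp only [cutsIn, stdCuts, Fin.exists_fin_succ]
  fin_cases j <;> simp [Fin.ext_iff]

/-- The conditions for gluing sheet `j` above to sheet `l` below, in terms of the position `x`. -/
theorem glue_iff {S : Fin 3 → Set ℝ} {j l : Fin 4} {x : OnePoint ℂ} (hu : x ∈ closedHalf true)
    (hl : x ∈ closedHalf false) :
    Glue S ⟨(j, true, x), hu⟩ ⟨(l, false, x), hl⟩ ↔ (j = l ∧ x ∈ sphereClosure (cutsIn S j)ᶜ) ∨
      ∃ i : Fin 3, ((j = i.castSucc ∧ l = i.succ) ∨ (j = i.succ ∧ l = i.castSucc)) ∧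
        x ∈ sphereClosure (S i) := by
  simp [Glue]

/-- Under the hypotheses the middle cut is never present together with an outer one, so the
transpositions involved are disjoint and each sheet is moved across at most one cut. What remains is
a finite check over truth values. -/
theorem eq_gluePerm_iff {b₁ b₂ b₃ : Prop} [Decidable b₁] [Decidable b₂] [Decidable b₃]
    (h₁ : ¬(b₁ ∧ b₂)) (h₃ : ¬(b₂ ∧ b₃)) (j l : Fin 4) :
    l = gluePerm b₁ b₂ b₃ j ↔
      (j = l ∧ ![¬b₁, ¬b₁ ∧ ¬b₂, ¬b₂ ∧ ¬b₃, ¬b₃] j) ∨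
      ∃ i : Fin 3, ((j = i.castSucc ∧ l = i.succ) ∨ (j = i.succ ∧ l = i.castSucc)) ∧
        ![b₁, b₂, b₃] i := by
  have key : ∀ b₁ b₂ b₃ : Bool, ¬(b₁ ∧ b₂) → ¬(b₂ ∧ b₃) → ∀ j l : Fin 4,
      l = gluePerm b₁ b₂ b₃ j ↔ (j = l ∧ ![!b₁, !b₁ && !b₂, !b₂ && !b₃, !b₃] j) ∨
        ∃ i : Fin 3, ((j = i.castSucc ∧ l = i.succ) ∨ (j = i.succ ∧ l = i.castSucc)) ∧
          ![b₁, b₂, b₃] i := by decide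
  have h := key (decide b₁) (decide b₂) (decide b₃) (by simpa using h₁) (by simpa using h₃) j l
  have e1 : (![!decide b₁, !decide b₁ && !decide b₂, !decide b₂ && !decide b₃, !decide b₃] j = true)
      = ![¬b₁, ¬b₁ ∧ ¬b₂, ¬b₂ ∧ ¬b₃, ¬b₃] j := by fin_cases j <;> simp
  have e2 : ∀ i, (![decide b₁, decide b₂, decide b₃] i = true) = ![b₁, b₂, b₃] i := by
    intro i; fin_cases i <;> simp
  simp only [e1, e2] at h
  simpa only [decide_eq_true_eq] using h

/-- A description of both one-sided gluing permutations in terms of closures. -/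
theorem glue_iff_eq_or_eq {S : Fin 3 → Set ℝ} {j l : Fin 4} {x : OnePoint ℂ}
    (hu : x ∈ closedHalf true) (hl : x ∈ closedHalf false) {b₁ b₂ b₃ d₁ d₂ d₃ : Prop}
    [Decidable b₁] [Decidable b₂] [Decidable b₃] [Decidable d₁] [Decidable d₂] [Decidable d₃]
    (hb₁ : ¬(b₁ ∧ b₂)) (hb₃ : ¬(b₂ ∧ b₃)) (hd₁ : ¬(d₁ ∧ d₂)) (hd₃ : ¬(d₂ ∧ d₃))
    (h₁ : ∀ i, x ∈ sphereClosure (S i) ↔ ![b₁, b₂, b₃] i ∨ ![d₁, d₂, d₃] i)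
    (h₂ : ∀ j, x ∈ sphereClosure (cutsIn S j)ᶜ ↔ ![¬b₁, ¬b₁ ∧ ¬b₂, ¬b₂ ∧ ¬b₃, ¬b₃] j ∨
      ![¬d₁, ¬d₁ ∧ ¬d₂, ¬d₂ ∧ ¬d₃, ¬d₃] j) :
    Glue S ⟨(j, true, x), hu⟩ ⟨(l, false, x), hl⟩ ↔
      l = gluePerm b₁ b₂ b₃ j ∨ l = gluePerm d₁ d₂ d₃ j := by
  rw [glue_iff, eq_gluePerm_iff hb₁ hb₃, eq_gluePerm_iff hd₁ hd₃, h₂]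
  simp only [h₁, and_or_left, exists_or]
  rw [or_or_or_comm]

theorem mem_closure_compl_Iic_union_Icc {c x : ℝ} (hc : 0 ≤ c) (hp : 0 ≤ p) (hpq : p < q) :
    x ∈ closure (Iic (-c) ∪ Icc p q)ᶜ ↔ (-c ≤ x ∧ x ≤ p ∧ -c < p) ∨ q ≤ x := by
  have : (Iic (-c) ∪ Icc p q)ᶜ = Ioo (-c) p ∪ Ioi q := by
    ext y; simp only [mem_compl_iff, mem_union, mem_Iic, mem_Icc, mem_Ioo, mem_Ioi]; grind
  rw [this, closure_union, closure_Ioi]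
  rcases (show -c ≤ p by linarith).eq_or_lt with h | h
  · simp [h]
  · rw [closure_Ioo h.ne]; simp [h]

/-- A point is in the closure of a cut, or of the complement of the cuts in a sheet, exactly when
that set is present immediately to its left or to its right. So the gluing at x is the union of the
two one-sided permutations, and these differ only at ends of cuts. -/
theorem glue_stdCuts_coe_iff (hc₁ : 0 ≤ c₁) (hc₃ : 0 ≤ c₃) (hp : 0 ≤ p) (hpq : p < q)
    {j l : Fin 4} {x : ℝ} (hu : ((x : ℂ) : OnePoint ℂ) ∈ closedHalf true)
    (hl : ((x : ℂ) : OnePoint ℂ) ∈ closedHalf false) :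
    Glue (stdCuts c₁ c₃ p q) ⟨(j, true, ((x : ℂ) : OnePoint ℂ)), hu⟩
        ⟨(l, false, ((x : ℂ) : OnePoint ℂ)), hl⟩ ↔
      l = gluePermRight c₁ c₃ p q x j ∨ l = gluePermLeft c₁ c₃ p q x j := by
  refine glue_iff_eq_or_eq hu hl ?_ ?_ ?_ ?_ (fun i => ?_) fun j => ?_
  · rintro ⟨h, h'⟩; linarith [h'.1]
  · rintro ⟨h, h'⟩; linarith [h.1]
  · rintro ⟨h, h'⟩; linarith [h'.1]
  · rintro ⟨h, h'⟩; linarith [h.1]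
  · rw [coe_mem_sphereClosure]
    have := hpq.le
    fin_cases i <;> simp [stdCuts] <;> grind
  · rw [coe_mem_sphereClosure, cutsIn_stdCuts]
    fin_cases j
    · simp; grind
    · refine (mem_closure_compl_Iic_union_Icc hc₁ hp hpq).trans ?_
      simp; grind
    · refine ?_
      simp only [Fin.reduceFinMk, Matrix.cons_val]
      rw [union_comm, mem_closure_compl_Iic_union_Icc hc₃ hp hpq]
      simp; grind
    · simp; grind

theorem infty_mem_sphereClosure_Iic (c : ℝ) : infty ∈ sphereClosure (Iic c) :=
  infty_mem_sphereClosure (f := fun y => -y)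
    (by rw [← tendsto_norm_atTop_iff_cobounded]; simpa using tendsto_abs_atTop_atTop)
    ((eventually_ge_atTop (-c)).mono fun y hy => by simp only [mem_Iic]; linarith)

theorem infty_mem_sphereClosure_compl_cutsIn (j : Fin 4) :
    infty ∈ sphereClosure (cutsIn (stdCuts c₁ c₃ p q) j)ᶜ := by
  refine infty_mem_sphereClosure (f := fun y => y)
    (by rw [← tendsto_norm_atTop_iff_cobounded]; simpa using tendsto_abs_atTop_atTop) ?_
  filter_upwards [eventually_gt_atTop (-c₁), eventually_gt_atTop (-c₃), eventually_gt_atTop q]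
    with y h1 h2 h3
  rw [cutsIn_stdCuts]
  fin_cases j <;> simp <;> grind

theorem glue_stdCuts_infty_iff {j l : Fin 4} :
    Glue (stdCuts c₁ c₃ p q) ⟨(j, true, infty), infty_mem_closedHalf _⟩
        ⟨(l, false, infty), infty_mem_closedHalf _⟩ ↔
      l = gluePerm True False True j ∨ l = gluePerm False False False j := by
  refine glue_iff_eq_or_eq _ _ (by simp) (by simp) (by simp) (by simp) (fun i => ?_) fun j => ?_
  · fin_cases i <;> simp [stdCuts, infty_mem_sphereClosure_Iic, infty_notMem_sphereClosure_Icc]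
  · have := infty_mem_sphereClosure_compl_cutsIn (c₁ := c₁) (c₃ := c₃) (p := p) (q := q) j
    fin_cases j <;> simpa using this

/-- A local coordinate `ι` of the sphere at the point `ι 0` of `ℝ ∪ {∞}`, in which the gluing is
given by the permutation `L` to the left of `0` and `R` to the right of `0`. -/
structure IsLocalModel (S : Fin 3 → Set ℝ) (ι : ℂ → OnePoint ℂ) (r : ℝ)
    (L R : Equiv.Perm (Fin 4)) : Prop where
  isOpenEmbedding : IsOpenEmbedding ι
  mem_true : ∀ y, ι y ∈ closedHalf true ↔ 0 ≤ y.im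
  mem_false : ∀ y, ι y ∈ closedHalf false ↔ y.im ≤ 0
  sphereAnalyticAt : ∀ (f : ℂ → ℂ) w, AnalyticAt ℂ f w → SphereAnalyticAt (fun u => ι (f u)) w
  pos : 0 < r
  glue : ∀ (j l : Fin 4) (y : ℝ) (hu : ι y ∈ closedHalf true) (hl : ι y ∈ closedHalf false),
    |y| < r → (Glue S ⟨(j, true, ι y), hu⟩ ⟨(l, false, ι y), hl⟩ ↔
      (0 ≤ y ∧ l = R j) ∨ (y ≤ 0 ∧ l = L j))

theorem exists_pos_forall_abs_sub_lt (x : ℝ) (s : Finset ℝ) :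
    ∃ r > 0, ∀ e ∈ s, |e - x| < r → e = x := by
  have : ∀ᶠ r : ℝ in 𝓝[>] 0, ∀ e ∈ s, |e - x| < r → e = x := by
    rw [Filter.eventually_all_finset]
    intro e _
    by_cases he : e = x
    · exact .of_forall fun _ _ => he
    · have h0 : 0 < |e - x| := abs_pos.2 (sub_ne_zero.2 he)
      filter_upwards [Ioo_mem_nhdsGT h0] with r hr h
      exact absurd h hr.2.le.not_gt
  obtain ⟨r, h1, h2⟩ := (this.and self_mem_nhdsWithin).exists
  exact ⟨r, h2, h1⟩

theorem exists_isLocalModel_coe (hc₁ : 0 ≤ c₁) (hc₃ : 0 ≤ c₃) (hp : 0 ≤ p) (hpq : p < q) (x : ℝ) :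
    ∃ r, IsLocalModel (stdCuts c₁ c₃ p q) (fun y => ((x + y : ℂ) : OnePoint ℂ)) r
      (gluePermLeft c₁ c₃ p q x) (gluePermRight c₁ c₃ p q x) := by
  obtain ⟨r, hr, h⟩ := exists_pos_forall_abs_sub_lt x {-c₁, -c₃, p, q}
  have k1 := h (-c₁) (by simp)
  have k3 := h (-c₃) (by simp)
  have kp := h p (by simp)
  have kq := h q (by simp)
  refine ⟨r, ⟨isOpenEmbedding_coe.comp (Homeomorph.addLeft (x : ℂ)).isOpenEmbedding,
    fun y => by simp, fun y => by simp,
    fun f w hf => Or.inl ⟨_, analyticAt_const.add hf, .of_forall fun _ => rfl⟩, hr, fun j l y hu hl hy => ?_⟩⟩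
  have hyl := abs_lt.1 hy
  simp only [← ofReal_add] at hu hl ⊢
  rw [glue_stdCuts_coe_iff hc₁ hc₃ hp hpq hu hl]
  have far : ∀ e, (|e - x| < r → e = x) → e = x ∨ e ≤ x - r ∨ x + r ≤ e := fun e he => by
    by_contra! hcon
    exact hcon.1 (he (abs_lt.2 ⟨by linarith, by linarith⟩))
  have f1 := far _ k1
  have f3 := far _ k3
  have fp := far _ kp
  have fq := far _ kq
  rcases lt_trichotomy y 0 with h0 | h0 | h0
  · have e1 : gluePermRight c₁ c₃ p q (x + y) = gluePermLeft c₁ c₃ p q x := by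
      simp only [gluePermRight, gluePermLeft]; congr 1 <;> grind
    have e2 : gluePermLeft c₁ c₃ p q (x + y) = gluePermLeft c₁ c₃ p q x := by
      simp only [gluePermLeft]; congr 1 <;> grind
    simp [e1, e2, h0.le, h0.not_ge]
  · simp [h0]
  · have e1 : gluePermRight c₁ c₃ p q (x + y) = gluePermRight c₁ c₃ p q x := by
      simp only [gluePermRight]; congr 1 <;> grind
    have e2 : gluePermLeft c₁ c₃ p q (x + y) = gluePermRight c₁ c₃ p q x := by
      simp only [gluePermRight, gluePermLeft]; congr 1 <;> grind
    simp [e1, e2, h0.le, h0.not_ge]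

/-- With y = −1/z, small negative y correspond to z near +∞, where no cut is present, and small
positive y to z near −∞, where both outer cuts are. The radius guarantees that |1/y| exceeds the
absolute values of all ends of cuts. -/
theorem exists_isLocalModel_infty (hc₁ : 0 ≤ c₁) (hc₃ : 0 ≤ c₃) (hp : 0 ≤ p) (hpq : p < q) :
    ∃ r, IsLocalModel (stdCuts c₁ c₃ p q) (fun y => sphereInv (-y)) r
      (gluePerm False False False) (gluePerm True False True) := by
  have hM : 0 < 1 + c₁ + c₃ + q := by linarith
  refine ⟨(1 + c₁ + c₃ + q)⁻¹, ⟨isOpenEmbedding_sphereInv.comp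
    (Homeomorph.neg ℂ).isOpenEmbedding, fun y => sphereInv_neg_mem_closedHalf.1,
    fun y => sphereInv_neg_mem_closedHalf.2,
    fun f w hf => Or.inr ⟨_, hf.neg, .of_forall fun _ => rfl⟩, inv_pos.2 hM, fun j l y hu hl hy => ?_⟩⟩
  rcases eq_or_ne y 0 with rfl | h0
  · have e : sphereInv (-((0 : ℝ) : ℂ)) = infty := by simp
    simp only [e] at hu hl ⊢
    rw [glue_stdCuts_infty_iff]
    simp
  · have e : sphereInv (-(y : ℂ)) = (((-y⁻¹ : ℝ) : ℂ) : OnePoint ℂ) := by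
      rw [sphereInv_of_ne_zero (neg_ne_zero.2 (ofReal_ne_zero.2 h0))]
      push_cast
      rw [inv_neg]
    simp only [e] at hu hl ⊢
    rw [glue_stdCuts_coe_iff hc₁ hc₃ hp hpq hu hl]
    have hy' : 1 + c₁ + c₃ + q < |y⁻¹| := by
      rw [abs_inv]; exact (lt_inv_comm₀ (abs_pos.2 h0) hM).1 hy
    rcases lt_or_gt_of_ne h0 with h0 | h0
    · rw [abs_of_neg (inv_lt_zero.2 h0)] at hy'
      have e1 : gluePermRight c₁ c₃ p q (-y⁻¹) = gluePerm False False False := by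
        simp only [gluePermRight]; congr 1 <;> grind
      have e2 : gluePermLeft c₁ c₃ p q (-y⁻¹) = gluePerm False False False := by
        simp only [gluePermLeft]; congr 1 <;> grind
      simp [e1, e2, h0.le, h0.not_ge]
    · rw [abs_of_pos (inv_pos.2 h0)] at hy'
      have e1 : gluePermRight c₁ c₃ p q (-y⁻¹) = gluePerm True False True := by
        simp only [gluePermRight]; congr 1 <;> grind
      have e2 : gluePermLeft c₁ c₃ p q (-y⁻¹) = gluePerm True False True := by
        simp only [gluePermLeft]; congr 1 <;> grind
      simp [e1, e2, h0.le, h0.not_ge]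

end LocalGluing

/-! ### The surface is homeomorphic to the sphere -/

section Sphere

open Complex Metric Set Filter OnePoint

variable {c₁ c₃ p q : ℝ}

theorem continuous_onePoint_map {f : ℂ → ℂ} (hf : Continuous f) {K : ℝ}
    (h : ∀ z, ‖z‖ ≤ 2 * ‖f z‖ + K) : Continuous (OnePoint.map f) := by
  refine continuous_map hf ?_
  rw [coclosedCompact_eq_cocompact, ← cobounded_eq_cocompact, ← tendsto_norm_atTop_iff_cobounded]
  have h1 : Tendsto (fun z : ℂ => (‖z‖ - K) / 2) (Bornology.cobounded ℂ) atTop :=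
    (tendsto_atTop_add_const_right _ (-K) tendsto_norm_cobounded_atTop).atTop_div_const two_pos
  exact tendsto_atTop_mono (fun z => by linarith [h z]) h1

/-! ### Folding half-planes onto quadrants. -/

/-- The map `x + i y ↦ ((r + x) + i (r - x)) / 2`, where `r ^ 2 = x ^ 2 + y ^ 2`, folds the plane
onto the closed first quadrant. -/
def quarter (z : ℂ) : ℂ := ⟨(‖z‖ + z.re) / 2, (‖z‖ - z.re) / 2⟩

theorem continuous_quarter : Continuous quarter := by
  have : quarter = fun z => ((((‖z‖ + z.re) / 2 : ℝ) : ℂ) + ((‖z‖ - z.re) / 2 : ℝ) * I) := by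
    funext z; apply Complex.ext <;> simp [quarter]
  rw [this]
  fun_prop

theorem quarter_re_nonneg (z : ℂ) : 0 ≤ (quarter z).re := by
  have := neg_le_of_abs_le (abs_re_le_norm z)
  simp only [quarter]; linarith

theorem quarter_im_nonneg (z : ℂ) : 0 ≤ (quarter z).im := by
  have := le_of_abs_le (abs_re_le_norm z)
  simp only [quarter]; linarith

theorem norm_le_two_mul_norm_quarter (z : ℂ) : ‖z‖ ≤ 2 * ‖quarter z‖ := by
  have h1 := (le_abs_self _).trans (abs_re_le_norm (quarter z))
  have h2 := (le_abs_self _).trans (abs_im_le_norm (quarter z))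
  have : (quarter z).re + (quarter z).im = ‖z‖ := by simp only [quarter]; ring
  linarith

theorem norm_sq_eq_re_sq_add_im_sq (z : ℂ) : ‖z‖ ^ 2 = z.re ^ 2 + z.im ^ 2 := by
  rw [← normSq_eq_norm_sq, normSq_apply]; ring

/-- The open and closed halves, in terms of a sign. -/
def InHalf (h : Bool) (z : ℂ) : Prop := if h then 0 ≤ z.im else z.im ≤ 0

theorem coe_mem_closedHalf {h : Bool} {z : ℂ} : (z : OnePoint ℂ) ∈ closedHalf h ↔ InHalf h z := by
  cases h <;> simp [InHalf]

/-- |z| and Re z determine |Im z|, and the half-plane determines the sign. Thus `quarter` is an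
elementary topological substitute for the square root: each closed half-plane goes bijectively onto
the quadrant, the positive axis to its horizontal side and the negative axis to its vertical one. -/
theorem quarter_inj {h : Bool} {z w : ℂ} (hz : InHalf h z) (hw : InHalf h w)
    (e : quarter z = quarter w) : z = w := by
  have e1 := congrArg re e
  have e2 := congrArg im e
  simp only [quarter] at e1 e2
  have hre : z.re = w.re := by linarith
  have hn : ‖z‖ = ‖w‖ := by linarith
  have k1 := norm_sq_eq_re_sq_add_im_sq z
  have k2 := norm_sq_eq_re_sq_add_im_sq w
  have k3 : (z.im - w.im) * (z.im + w.im) = 0 := by rw [hn, hre] at k1; linarith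
  refine Complex.ext hre ?_
  rcases mul_eq_zero.1 k3 with k | k
  · linarith
  · cases h <;> simp only [InHalf] at hz hw <;> grind

theorem exists_quarter_eq (h : Bool) {v : ℂ} (h1 : 0 ≤ v.re) (h2 : 0 ≤ v.im) :
    ∃ z, InHalf h z ∧ quarter z = v := by
  have key : ∀ ε : ℝ, ε ^ 2 = 1 → quarter ⟨v.re - v.im, ε * (2 * √(v.re * v.im))⟩ = v := by
    intro ε hε
    have : ‖(⟨v.re - v.im, ε * (2 * √(v.re * v.im))⟩ : ℂ)‖ = v.re + v.im := by
      rw [← sq_eq_sq₀ (norm_nonneg _) (by positivity), norm_sq_eq_re_sq_add_im_sq]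
      have := Real.sq_sqrt (mul_nonneg h1 h2)
      simp only [mul_pow, hε, this]
      ring
    apply Complex.ext <;> simp only [quarter, this] <;> ring
  cases h
  · exact ⟨_, by simp [InHalf], key (-1) (by norm_num)⟩
  · exact ⟨_, by simp [InHalf], key 1 (by norm_num)⟩

theorem quarter_ofReal_of_nonneg {x : ℝ} (hx : 0 ≤ x) : quarter x = x := by
  apply Complex.ext <;> simp [quarter, abs_of_nonneg hx]

theorem quarter_ofReal_of_nonpos {x : ℝ} (hx : x ≤ 0) : quarter x = ⟨0, -x⟩ := by
  apply Complex.ext <;> simp [quarter, abs_of_nonpos hx]; ring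

theorem im_eq_zero_of_norm_eq_abs_re {z : ℂ} (h : ‖z‖ = |z.re|) : z = z.re := by
  have := norm_sq_eq_re_sq_add_im_sq z
  rw [h, sq_abs] at this
  have h0 : z.im ^ 2 = 0 := by linarith
  exact Complex.ext (by simp) (by simpa using h0)

theorem eq_ofReal_of_quarter_im {z : ℂ} (h : (quarter z).im = 0) : ∃ x : ℝ, 0 ≤ x ∧ z = x := by
  simp only [quarter] at h
  have h1 : z.re = ‖z‖ := by linarith
  have h2 : 0 ≤ z.re := h1 ▸ norm_nonneg z
  exact ⟨z.re, h2, im_eq_zero_of_norm_eq_abs_re (by rw [abs_of_nonneg h2, h1])⟩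

theorem eq_ofReal_of_quarter_re {z : ℂ} (h : (quarter z).re = 0) : ∃ x : ℝ, x ≤ 0 ∧ z = x := by
  simp only [quarter] at h
  have h1 : -z.re = ‖z‖ := by linarith
  have h2 : z.re ≤ 0 := by linarith [norm_nonneg z]
  exact ⟨z.re, h2, im_eq_zero_of_norm_eq_abs_re (by rw [abs_of_nonpos h2, h1])⟩

/-- The inner sheet is folded onto the part of the upper half-plane to the right of `-c`. -/
def foldIn (c : ℝ) (z : ℂ) : ℂ := quarter (z + c) - c

/-- The outer sheet is folded onto the part of the upper half-plane to the left of `-c`. -/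
def foldOut (c : ℝ) (z : ℂ) : ℂ := ⟨-(quarter (z + c)).re - c, (quarter (z + c)).im⟩

theorem norm_add_ofReal_ge (z : ℂ) (c : ℝ) : ‖z‖ ≤ ‖z + c‖ + |c| := by
  have := norm_sub_le (z + c) c
  rwa [add_sub_cancel_right, norm_real, Real.norm_eq_abs] at this

theorem continuous_map_foldIn (c : ℝ) : Continuous (OnePoint.map (foldIn c)) := by
  refine continuous_onePoint_map (K := 3 * |c|)
    ((continuous_quarter.comp (by fun_prop)).sub continuous_const) fun z => ?_
  have h1 := norm_add_ofReal_ge z c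
  have h2 := norm_le_two_mul_norm_quarter (z + c)
  have h3 := norm_add_le (foldIn c z) c
  rw [foldIn, sub_add_cancel, norm_real, Real.norm_eq_abs, ← foldIn] at h3
  linarith

theorem norm_neg_re_im (x y : ℝ) : ‖(⟨-x, y⟩ : ℂ)‖ = ‖(⟨x, y⟩ : ℂ)‖ := by
  rw [← sq_eq_sq₀ (norm_nonneg _) (norm_nonneg _), norm_sq_eq_re_sq_add_im_sq,
    norm_sq_eq_re_sq_add_im_sq]
  simp

theorem foldOut_add (c : ℝ) (z : ℂ) :
    foldOut c z + c = ⟨-(quarter (z + c)).re, (quarter (z + c)).im⟩ := by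
  apply Complex.ext <;> simp [foldOut]

theorem continuous_map_foldOut (c : ℝ) : Continuous (OnePoint.map (foldOut c)) := by
  have hq : Continuous fun z : ℂ => quarter (z + c) := continuous_quarter.comp (by fun_prop)
  refine continuous_onePoint_map (K := 3 * |c|) ?_ fun z => ?_
  · have : foldOut c = fun z => (((-(quarter (z + c)).re - c : ℝ) : ℂ) +
        ((quarter (z + c)).im : ℝ) * I) := by
      funext z; apply Complex.ext <;> simp [foldOut]
    rw [this]
    fun_prop
  · have h1 := norm_add_ofReal_ge z c
    have h2 := norm_le_two_mul_norm_quarter (z + c)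
    have h3 := norm_add_le (foldOut c z) c
    rw [foldOut_add, norm_neg_re_im, norm_real, Real.norm_eq_abs] at h3
    have h4 : ‖(⟨(quarter (z + c)).re, (quarter (z + c)).im⟩ : ℂ)‖ = ‖quarter (z + c)‖ := rfl
    linarith

theorem InHalf.add_ofReal {h : Bool} {z : ℂ} (hz : InHalf h z) (c : ℝ) : InHalf h (z + c) := by
  simpa [InHalf] using hz

theorem foldIn_inj {c : ℝ} {h : Bool} {z w : ℂ} (hz : InHalf h z) (hw : InHalf h w)
    (e : foldIn c z = foldIn c w) : z = w :=
  add_right_cancel (quarter_inj (hz.add_ofReal c) (hw.add_ofReal c) (sub_left_injective e))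

theorem foldOut_inj {c : ℝ} {h : Bool} {z w : ℂ} (hz : InHalf h z) (hw : InHalf h w)
    (e : foldOut c z = foldOut c w) : z = w := by
  refine add_right_cancel (quarter_inj (hz.add_ofReal c) (hw.add_ofReal c) ?_)
  have e1 := congrArg re e
  have e2 := congrArg im e
  simp only [foldOut] at e1 e2
  exact Complex.ext (by linarith) e2

/-- The two folded images meet only on the line Re w = −c, and both foldings map the cut (−∞, −c]
onto the upper half of this line in the same way. -/
theorem eq_of_foldIn_eq_foldOut {c : ℝ} {z w : ℂ} (e : foldIn c z = foldOut c w) :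
    ∃ x : ℝ, x ≤ -c ∧ z = x ∧ w = x := by
  have e1 := congrArg re e
  have e2 := congrArg im e
  simp only [foldIn, foldOut, sub_re, sub_im, ofReal_re, ofReal_im, sub_zero] at e1 e2
  have n1 := quarter_re_nonneg (z + c)
  have n2 := quarter_re_nonneg (w + c)
  obtain ⟨x, hx, hzx⟩ := eq_ofReal_of_quarter_re (z := z + c) (by linarith)
  obtain ⟨y, hy, hwy⟩ := eq_ofReal_of_quarter_re (z := w + c) (by linarith)
  rw [hzx, hwy, quarter_ofReal_of_nonpos hx, quarter_ofReal_of_nonpos hy] at e2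
  simp only [neg_inj] at e2
  subst e2
  refine ⟨x - c, by linarith, ?_, ?_⟩
  · rw [ofReal_sub, ← hzx]; ring
  · rw [ofReal_sub, ← hwy]; ring

theorem foldIn_ofReal_of_ge {c x : ℝ} (h : -c ≤ x) : foldIn c x = x := by
  rw [foldIn, ← ofReal_add, quarter_ofReal_of_nonneg (by linarith)]; simp

theorem foldIn_ofReal_of_le {c x : ℝ} (h : x ≤ -c) : foldIn c x = ⟨-c, -x - c⟩ := by
  rw [foldIn, ← ofReal_add, quarter_ofReal_of_nonpos (by linarith)]
  apply Complex.ext <;> simp; ring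

theorem foldOut_ofReal_of_ge {c x : ℝ} (h : -c ≤ x) : foldOut c x = (-x - 2 * c : ℝ) := by
  rw [foldOut, ← ofReal_add, quarter_ofReal_of_nonneg (by linarith)]
  apply Complex.ext <;> simp; ring

theorem foldOut_ofReal_of_le {c x : ℝ} (h : x ≤ -c) : foldOut c x = ⟨-c, -x - c⟩ := by
  rw [foldOut, ← ofReal_add, quarter_ofReal_of_nonpos (by linarith)]
  apply Complex.ext <;> simp; ring

theorem exists_foldIn_eq {c : ℝ} (h : Bool) {w : ℂ} (h1 : -c ≤ w.re) (h2 : 0 ≤ w.im) :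
    ∃ z, InHalf h z ∧ foldIn c z = w := by
  obtain ⟨z, hz, e⟩ := exists_quarter_eq h (v := w + c) (by simpa using by linarith) (by simpa)
  refine ⟨z - c, by simpa [InHalf] using hz, ?_⟩
  rw [foldIn, sub_add_cancel, e, add_sub_cancel_right]

theorem exists_foldOut_eq {c : ℝ} (h : Bool) {w : ℂ} (h1 : w.re ≤ -c) (h2 : 0 ≤ w.im) :
    ∃ z, InHalf h z ∧ foldOut c z = w := by
  obtain ⟨z, hz, e⟩ := exists_quarter_eq h (v := ⟨-w.re - c, w.im⟩) (by simpa using by linarith) h2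
  refine ⟨z - c, by simpa [InHalf] using hz, ?_⟩
  rw [foldOut, sub_add_cancel, e]
  apply Complex.ext <;> simp

/-! ### Folding half-spheres onto quarter-spheres. -/

/-- The interval `[p, q]` in the sphere. -/
def IsSeg (p q : ℝ) (w : OnePoint ℂ) : Prop := ∃ s : ℝ, w = (s : ℂ) ∧ p ≤ s ∧ s ≤ q

/-- The closure of the complement of `[p, q]` in the real line compactified. -/
def IsCoSeg (p q : ℝ) (w : OnePoint ℂ) : Prop :=
  w = infty ∨ ∃ s : ℝ, w = (s : ℂ) ∧ (s ≤ p ∨ q ≤ s)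

/-- The Möbius transformation `s ↦ (s - p) / (q - s)`. -/
def moebius (p q : ℝ) (hpq : p < q) : OnePoint ℂ ≃ₜ OnePoint ℂ :=
  ((Homeomorph.subLeft (q : ℂ)).onePointCongr.trans sphereInversion).trans
    (((Homeomorph.mulLeft₀ ((q - p : ℝ) : ℂ)
      (ofReal_ne_zero.2 (_root_.sub_ne_zero.2 hpq.ne'))).trans
      (Homeomorph.subRight (1 : ℂ))).onePointCongr)

theorem moebius_infty (hpq : p < q) : moebius p q hpq infty = ((-1 : ℂ) : OnePoint ℂ) := by
  have : moebius p q hpq infty = (((q - p : ℝ) * 0 - 1 : ℂ) : OnePoint ℂ) := rfl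
  rw [this]; simp

theorem moebius_end (hpq : p < q) : moebius p q hpq ((q : ℂ) : OnePoint ℂ) = infty := by
  have : moebius p q hpq ((q : ℂ) : OnePoint ℂ) =
    OnePoint.map (fun z : ℂ => (q - p : ℝ) * z - 1) (sphereInv (q - q)) := rfl
  rw [this]; simp

theorem moebius_coe (hpq : p < q) {s : ℂ} (hs : s ≠ q) :
    moebius p q hpq (s : OnePoint ℂ) = (((q - p : ℝ) * (q - s)⁻¹ - 1 : ℂ) : OnePoint ℂ) := by
  have : moebius p q hpq (s : OnePoint ℂ) =
    OnePoint.map (fun z : ℂ => (q - p : ℝ) * z - 1) (sphereInv (q - s)) := rfl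
  rw [this, sphereInv_of_ne_zero (_root_.sub_ne_zero.2 hs.symm)]; rfl

theorem moebius_mem_closedHalf (hpq : p < q) (w : OnePoint ℂ) :
    moebius p q hpq w ∈ closedHalf true ↔ w ∈ closedHalf true := by
  induction w using OnePoint.rec with
  | infty => simp [moebius_infty, infty_mem_closedHalf]
  | coe s =>
    by_cases hs : s = q
    · simp [hs, moebius_end, infty_mem_closedHalf]
    · have h0 : 0 < normSq (q - s) := normSq_pos.2 (_root_.sub_ne_zero.2 (Ne.symm hs))
      rw [moebius_coe hpq hs, coe_mem_closedHalf_true_iff, coe_mem_closedHalf_true_iff, sub_im,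
        im_ofReal_mul, inv_im, one_im, sub_zero, sub_im, ofReal_im,
        zero_sub, neg_neg, mul_div_assoc', le_div_iff₀ h0, zero_mul,
        mul_nonneg_iff_of_pos_left (sub_pos.2 hpq)]

/-- The folding of the closed upper half-sphere onto a closed quarter sphere, under which `[p, q]`
becomes one of the sides. -/
def quarterSphere (p q : ℝ) (hpq : p < q) (w : OnePoint ℂ) : OnePoint ℂ :=
  OnePoint.map quarter (moebius p q hpq w)

theorem continuous_quarterSphere (hpq : p < q) : Continuous (quarterSphere p q hpq) :=
  (continuous_onePoint_map (K := 0) continuous_quarter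
    fun z => by linarith [norm_le_two_mul_norm_quarter z]).comp (moebius p q hpq).continuous

theorem quarterSphere_inj (hpq : p < q) {w w' : OnePoint ℂ} (hw : w ∈ closedHalf true)
    (hw' : w' ∈ closedHalf true) (e : quarterSphere p q hpq w = quarterSphere p q hpq w') :
    w = w' := by
  refine (moebius p q hpq).injective ?_
  rw [← moebius_mem_closedHalf hpq] at hw hw'
  rw [quarterSphere, quarterSphere] at e
  generalize moebius p q hpq w = z at *
  generalize moebius p q hpq w' = z' at *
  induction z using OnePoint.rec <;> induction z' using OnePoint.rec
  · rfl
  · simp at e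
  · simp at e
  · rw [map_some, map_some, OnePoint.coe_eq_coe] at e
    rw [quarter_inj (coe_mem_closedHalf.1 hw) (coe_mem_closedHalf.1 hw') e]

theorem exists_quarterSphere_eq (hpq : p < q) {v : OnePoint ℂ}
    (hv : ∀ z : ℂ, v = z → 0 ≤ z.re ∧ 0 ≤ z.im) :
    ∃ w ∈ closedHalf true, quarterSphere p q hpq w = v := by
  obtain ⟨z, hz, e⟩ : ∃ z ∈ closedHalf true, OnePoint.map quarter z = v := by
    induction v using OnePoint.rec with
    | infty => exact ⟨infty, infty_mem_closedHalf _, rfl⟩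
    | coe v =>
      obtain ⟨z, hz, e⟩ := exists_quarter_eq true (hv v rfl).1 (hv v rfl).2
      exact ⟨z, coe_mem_closedHalf.2 hz, by rw [map_some, e]⟩
  refine ⟨(moebius p q hpq).symm z, ?_, ?_⟩
  · rw [← moebius_mem_closedHalf hpq, Homeomorph.apply_symm_apply]; exact hz
  · rw [quarterSphere, Homeomorph.apply_symm_apply, e]

theorem quarterSphere_nonneg (hpq : p < q) {w : OnePoint ℂ} {z : ℂ}
    (h : quarterSphere p q hpq w = z) : 0 ≤ z.re ∧ 0 ≤ z.im := by
  rw [quarterSphere] at h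
  generalize moebius p q hpq w = u at h
  induction u using OnePoint.rec with
  | infty => simp at h
  | coe u =>
    rw [map_some, OnePoint.coe_eq_coe] at h
    exact h ▸ ⟨quarter_re_nonneg u, quarter_im_nonneg u⟩

theorem moebius_ofReal (hpq : p < q) {s : ℝ} (hs : s ≠ q) :
    moebius p q hpq ((s : ℂ) : OnePoint ℂ) = (((s - p) / (q - s) : ℝ) : ℂ) := by
  rw [moebius_coe hpq (by exact_mod_cast hs)]
  have h1 : (q : ℂ) - s ≠ 0 := _root_.sub_ne_zero.2 (by exact_mod_cast hs.symm)
  congr 1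
  push_cast
  field_simp
  ring

/-- The Möbius map sends p to 0 and q to ∞, hence [p, q] to the positive axis and the complementary
arc to the negative one; folding makes them the two sides of the quadrant. Infinity is a corner
common to both sides, which is why the condition concerns finite values only. -/
theorem isSeg_iff (hpq : p < q) (w : OnePoint ℂ) :
    IsSeg p q w ↔ ∀ z : ℂ, quarterSphere p q hpq w = z → z.im = 0 := by
  constructor
  · rintro ⟨s, rfl, h1, h2⟩ z hz
    rcases eq_or_ne s q with rfl | hs
    · simp [quarterSphere, moebius_end] at hz
    · have h2 := lt_of_le_of_ne h2 hs
      rw [quarterSphere, moebius_ofReal hpq hs, map_some, quarter_ofReal_of_nonneg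
        (div_nonneg (by linarith) (by linarith)), OnePoint.coe_eq_coe] at hz
      rw [← hz, ofReal_im]
  · intro h
    have key : moebius p q hpq w = infty ∨ ∃ x : ℝ, 0 ≤ x ∧ moebius p q hpq w = (x : ℂ) := by
      rw [quarterSphere] at h
      generalize moebius p q hpq w = u at h
      induction u using OnePoint.rec with
      | infty => exact Or.inl rfl
      | coe u =>
        obtain ⟨x, hx, rfl⟩ := eq_ofReal_of_quarter_im (h _ rfl)
        exact Or.inr ⟨x, hx, rfl⟩
    rcases key with key | ⟨x, hx, key⟩
    · rw [← moebius_end hpq] at key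
      exact ⟨q, (moebius p q hpq).injective key, hpq.le, le_rfl⟩
    · refine ⟨(p + q * x) / (1 + x), (moebius p q hpq).injective ?_, ?_, ?_⟩
      · have h1 : (p + q * x) / (1 + x) ≠ q := by
          rw [Ne, div_eq_iff (by positivity)]; intro h; linarith
        rw [key, moebius_ofReal hpq h1]
        congr 2
        have h2 : q - (p + q * x) / (1 + x) = (q - p) / (1 + x) := by field_simp; ring
        have h3 : q - p ≠ 0 := by linarith
        rw [h2]
        field_simp
        ring
      · rw [le_div_iff₀ (by positivity)]; nlinarith
      · rw [div_le_iff₀ (by positivity)]; nlinarith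

theorem isCoSeg_iff (hpq : p < q) (w : OnePoint ℂ) :
    IsCoSeg p q w ↔ ∀ z : ℂ, quarterSphere p q hpq w = z → z.re = 0 := by
  constructor
  · rintro (rfl | ⟨s, rfl, h1⟩) z hz
    · have : (-1 : ℂ) = ((-1 : ℝ) : ℂ) := by simp
      rw [quarterSphere, moebius_infty, map_some, this, quarter_ofReal_of_nonpos (by norm_num),
        OnePoint.coe_eq_coe] at hz
      rw [← hz]
    · rcases eq_or_ne s q with rfl | hs
      · simp [quarterSphere, moebius_end] at hz
      · rw [quarterSphere, moebius_ofReal hpq hs, map_some, quarter_ofReal_of_nonpos,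
          OnePoint.coe_eq_coe] at hz
        · rw [← hz]
        · rcases h1 with h1 | h1
          · exact div_nonpos_of_nonpos_of_nonneg (by linarith) (by linarith)
          · exact div_nonpos_of_nonneg_of_nonpos (by linarith) (by linarith)
  · intro h
    have key : moebius p q hpq w = infty ∨ ∃ x : ℝ, x ≤ 0 ∧ moebius p q hpq w = (x : ℂ) := by
      rw [quarterSphere] at h
      generalize moebius p q hpq w = u at h
      induction u using OnePoint.rec with
      | infty => exact Or.inl rfl
      | coe u =>
        obtain ⟨x, hx, rfl⟩ := eq_ofReal_of_quarter_re (h _ rfl)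
        exact Or.inr ⟨x, hx, rfl⟩
    rcases key with key | ⟨x, hx, key⟩
    · rw [← moebius_end hpq] at key
      exact Or.inr ⟨q, (moebius p q hpq).injective key, Or.inr le_rfl⟩
    · induction w using OnePoint.rec with
      | infty => exact Or.inl rfl
      | coe s =>
        rcases eq_or_ne x (-1) with rfl | h1
        · have := moebius_infty hpq
          rw [show (-1 : ℂ) = ((-1 : ℝ) : ℂ) by simp, ← key] at this
          exact Or.inl ((moebius p q hpq).injective this).symm
        have h1' : 1 + x ≠ 0 := fun h => h1 (by linarith)
        refine Or.inr ⟨(p + q * x) / (1 + x), (moebius p q hpq).injective ?_, ?_⟩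
        · have h1 : (p + q * x) / (1 + x) ≠ q := by
            rw [Ne, div_eq_iff h1']; intro h; linarith
          rw [key, moebius_ofReal hpq h1]
          congr 2
          have h2 : q - (p + q * x) / (1 + x) = (q - p) / (1 + x) := by field_simp; ring
          have h3 : q - p ≠ 0 := by linarith
          rw [h2]
          field_simp
          ring
        · rcases lt_or_gt_of_ne h1' with h2 | h2
          · right; rw [le_div_iff_of_neg h2]; nlinarith
          · left; rw [div_le_iff₀ h2]; nlinarith

/-- The reflections of the plane in the coordinate axes: the real part changes sign unless `r`, and
the imaginary part changes sign unless `i`. -/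
def flip (r i : Bool) (v : ℂ) : ℂ := ⟨if r then v.re else -v.re, if i then v.im else -v.im⟩

theorem continuous_map_flip (r i : Bool) : Continuous (OnePoint.map (flip r i)) := by
  refine continuous_onePoint_map (K := 0) ?_ fun z => ?_
  · have : flip r i = fun v => (((if r then v.re else -v.re : ℝ) : ℂ) +
        (if i then v.im else -v.im : ℝ) * I) := by
      funext z; apply Complex.ext <;> simp [flip]
    rw [this]
    cases r <;> cases i <;> simp only [if_true, if_false, Bool.false_eq_true] <;> fun_prop
  · have h1 := abs_re_le_norm (flip r i z)
    have h2 := abs_im_le_norm (flip r i z)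
    have h3 := norm_le_abs_re_add_abs_im z
    have e1 : |(flip r i z).re| = |z.re| := by cases r <;> simp [flip]
    have e2 : |(flip r i z).im| = |z.im| := by cases i <;> simp [flip]
    linarith

/-! ### The map from the half-sheets to the sphere. -/

/-- The folding of a sheet onto the upper half-plane. -/
def foldSheet (c₁ c₃ : ℝ) : Fin 4 → ℂ → ℂ := ![foldOut c₁, foldIn c₁, foldIn c₃, foldOut c₃]

/-- Whether the real part keeps its sign in the last step. -/
def keepsRe (j : Fin 4) (h : Bool) : Bool := h == ![false, true, false, true] j

/-- Whether the imaginary part keeps its sign in the last step. -/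
def keepsIm (j : Fin 4) : Bool := ![true, true, false, false] j

/-- The point of the upper half-sphere onto which a point of a half-sheet is folded. -/
def foldPoint (c₁ c₃ : ℝ) (P : HalfSheets) : OnePoint ℂ :=
  OnePoint.map (foldSheet c₁ c₃ P.1.1) P.1.2.2

/-- The map from the half-sheets to the sphere. -/
def toSphere (c₁ c₃ p q : ℝ) (hpq : p < q) (P : HalfSheets) : OnePoint ℂ :=
  OnePoint.map (flip (keepsRe P.1.1 P.1.2.1) (keepsIm P.1.1))
    (quarterSphere p q hpq (foldPoint c₁ c₃ P))

theorem continuous_toSphere (hpq : p < q) : Continuous (toSphere c₁ c₃ p q hpq) := by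
  have : Continuous fun P : Fin 4 × Bool × OnePoint ℂ =>
      OnePoint.map (flip (keepsRe P.1 P.2.1) (keepsIm P.1))
        (quarterSphere p q hpq (OnePoint.map (foldSheet c₁ c₃ P.1) P.2.2)) := by
    rw [continuous_prod_of_discrete_left]
    intro j
    rw [continuous_prod_of_discrete_left]
    intro h
    refine (continuous_map_flip (keepsRe j h) (keepsIm j)).comp
      ((continuous_quarterSphere hpq).comp ?_)
    fin_cases j
    · exact continuous_map_foldOut c₁
    · exact continuous_map_foldIn c₁
    · exact continuous_map_foldIn c₃
    · exact continuous_map_foldOut c₃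
  exact this.comp continuous_subtype_val

theorem foldIn_im_nonneg (c : ℝ) (z : ℂ) : 0 ≤ (foldIn c z).im := by
  simpa [foldIn] using quarter_im_nonneg (z + c)

theorem foldOut_im_nonneg (c : ℝ) (z : ℂ) : 0 ≤ (foldOut c z).im := quarter_im_nonneg (z + c)

theorem foldPoint_mem (P : HalfSheets) : foldPoint c₁ c₃ P ∈ closedHalf true := by
  obtain ⟨⟨j, h, x⟩, hx⟩ := P
  simp only [foldPoint]
  induction x using OnePoint.rec with
  | infty => exact infty_mem_closedHalf _
  | coe z =>
    rw [map_some, coe_mem_closedHalf_true_iff]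
    fin_cases j
    · exact foldOut_im_nonneg c₁ z
    · exact foldIn_im_nonneg c₁ z
    · exact foldIn_im_nonneg c₃ z
    · exact foldOut_im_nonneg c₃ z

theorem map_flip_eq {r i r' i' : Bool} {v v' : OnePoint ℂ}
    (hv : ∀ z : ℂ, v = z → 0 ≤ z.re ∧ 0 ≤ z.im) (hv' : ∀ z : ℂ, v' = z → 0 ≤ z.re ∧ 0 ≤ z.im)
    (e : OnePoint.map (flip r i) v = OnePoint.map (flip r' i') v') :
    v = v' ∧ (r ≠ r' → ∀ z : ℂ, v = z → z.re = 0) ∧ (i ≠ i' → ∀ z : ℂ, v = z → z.im = 0) := by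
  induction v using OnePoint.rec <;> induction v' using OnePoint.rec
  · simp
  · simp at e
  · simp at e
  · rename_i z z'
    obtain ⟨h1, h2⟩ := hv z rfl
    obtain ⟨h3, h4⟩ := hv' z' rfl
    rw [map_some, map_some, OnePoint.coe_eq_coe] at e
    have e1 := congrArg re e
    have e2 := congrArg im e
    simp only [flip] at e1 e2
    have k1 : z.re = z'.re ∧ (r ≠ r' → z.re = 0) := by
      cases r <;> cases r' <;> grind
    have k2 : z.im = z'.im ∧ (i ≠ i' → z.im = 0) := by
      cases i <;> cases i' <;> grind
    refine ⟨congrArg _ (Complex.ext k1.1 k2.1), fun h w hw => ?_, fun h w hw => ?_⟩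
    · rw [OnePoint.coe_eq_coe] at hw; exact hw ▸ k1.2 h
    · rw [OnePoint.coe_eq_coe] at hw; exact hw ▸ k2.2 h

theorem map_flip_congr {r i r' i' : Bool} {v : OnePoint ℂ}
    (hr : r ≠ r' → ∀ z : ℂ, v = z → z.re = 0) (hi : i ≠ i' → ∀ z : ℂ, v = z → z.im = 0) :
    OnePoint.map (flip r i) v = OnePoint.map (flip r' i') v := by
  induction v using OnePoint.rec with
  | infty => rfl
  | coe z =>
    rw [map_some, map_some]
    congr 1
    apply Complex.ext
    · have := fun h => hr h z rfl
      cases r <;> cases r' <;> simp_all [flip]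
    · have := fun h => hi h z rfl
      cases i <;> cases i' <;> simp_all [flip]

theorem mem_closedHalf_of_eq_ofReal {x : ℝ} (h : Bool) : ((x : ℂ) : OnePoint ℂ) ∈ closedHalf h :=
  coe_mem_closedHalf.2 (by cases h <;> simp [InHalf])

theorem eq_ofReal_of_mem_closedHalf {x : OnePoint ℂ} (hu : x ∈ closedHalf true)
    (hl : x ∈ closedHalf false) : x = infty ∨ ∃ s : ℝ, x = (s : ℂ) := by
  induction x using OnePoint.rec with
  | infty => exact Or.inl rfl
  | coe z =>
    rw [coe_mem_closedHalf_true_iff] at hu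
    rw [coe_mem_closedHalf_false_iff] at hl
    exact Or.inr ⟨z.re, congrArg _ (Complex.ext rfl (by simpa using le_antisymm hl hu))⟩

/-- Gluing along an outer cut takes place inside one folded half-sphere, so neither sign changes.
Gluing along [p, q] leaves the folded point in place and may change only the sign of the imaginary
part. -/
theorem foldPoint_eq_of_glue_swap {x : ℝ} {j l : Fin 4} {i : Fin 3}
    (hc₁ : 0 ≤ c₁) (hc₃ : 0 ≤ c₃) (hp : 0 ≤ p) (hi : (j = i.castSucc ∧ l = i.succ) ∨ (j = i.succ ∧ l = i.castSucc))
    (hx : x ∈ stdCuts c₁ c₃ p q i) :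
    foldSheet c₁ c₃ j x = foldSheet c₁ c₃ l x ∧ keepsRe j true = keepsRe l false ∧
      (keepsIm j ≠ keepsIm l → foldSheet c₁ c₃ j x = x ∧ p ≤ x ∧ x ≤ q) := by
  fin_cases i
  · have hx : x ≤ -c₁ := hx
    rcases hi with ⟨rfl, rfl⟩ | ⟨rfl, rfl⟩ <;>
      simp [foldSheet, keepsRe, keepsIm, foldIn_ofReal_of_le hx, foldOut_ofReal_of_le hx]
  · have hx : x ∈ Icc p q := hx
    have h1 : -c₁ ≤ x := by linarith [hx.1]
    have h3 : -c₃ ≤ x := by linarith [hx.1]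
    rcases hi with ⟨rfl, rfl⟩ | ⟨rfl, rfl⟩ <;>
      simp [foldSheet, keepsRe, keepsIm, foldIn_ofReal_of_ge h1, foldIn_ofReal_of_ge h3, hx.1, hx.2]
  · have hx : x ≤ -c₃ := hx
    rcases hi with ⟨rfl, rfl⟩ | ⟨rfl, rfl⟩ <;>
      simp [foldSheet, keepsRe, keepsIm, foldIn_ofReal_of_le hx, foldOut_ofReal_of_le hx]

/-- Off its cuts a sheet is glued to itself, which changes only the sign of the real part, so the
folded point has to lie on the complementary arc. For an outer sheet x ↦ −x − 2c sends [−c, ∞) to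
(−∞, −c], which lies to the left of p since p ≥ 0. -/
theorem isCoSeg_foldSheet {x : ℝ} {j : Fin 4} (hc₁ : 0 ≤ c₁) (hc₃ : 0 ≤ c₃) (hp : 0 ≤ p)
    (hpq : p < q) (hx : x ∈ closure (cutsIn (stdCuts c₁ c₃ p q) j)ᶜ) :
    IsCoSeg p q (foldSheet c₁ c₃ j x : ℂ) := by
  rw [cutsIn_stdCuts] at hx
  refine Or.inr ?_
  fin_cases j
  · have hx : -c₁ ≤ x := by simpa using hx
    exact ⟨_, congrArg _ (foldOut_ofReal_of_ge hx), Or.inl (by linarith)⟩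
  · have hx := (mem_closure_compl_Iic_union_Icc hc₁ hp hpq).1 hx
    exact ⟨_, congrArg _ (foldIn_ofReal_of_ge (by grind)), by grind⟩
  · simp only [Fin.reduceFinMk, Matrix.cons_val] at hx
    rw [union_comm, mem_closure_compl_Iic_union_Icc hc₃ hp hpq] at hx
    exact ⟨_, congrArg _ (foldIn_ofReal_of_ge (by grind)), by grind⟩
  · have hx : -c₃ ≤ x := by simpa using hx
    exact ⟨_, congrArg _ (foldOut_ofReal_of_ge hx), Or.inl (by linarith)⟩

theorem toSphere_eq_of_glue (hc₁ : 0 ≤ c₁) (hc₃ : 0 ≤ c₃) (hp : 0 ≤ p) (hpq : p < q)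
    {P Q : HalfSheets} (h : Glue (stdCuts c₁ c₃ p q) P Q) :
    toSphere c₁ c₃ p q hpq P = toSphere c₁ c₃ p q hpq Q := by
  obtain ⟨⟨j, h1, x⟩, hx⟩ := P
  obtain ⟨⟨l, h2, x'⟩, hx'⟩ := Q
  obtain ⟨e1, e2, e3, h⟩ := h
  simp only at e1 e2 e3 h
  subst e1 e2 e3
  rcases eq_ofReal_of_mem_closedHalf hx hx' with rfl | ⟨s, rfl⟩
  · simp only [toSphere, foldPoint, OnePoint.map_infty]
    rcases h with ⟨rfl, -⟩ | ⟨i, hi, hxi⟩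
    · refine map_flip_congr (fun _ => ?_) fun h => absurd rfl h
      exact (isCoSeg_iff hpq _).1 (Or.inl rfl)
    · fin_cases i
      · rcases hi with ⟨rfl, rfl⟩ | ⟨rfl, rfl⟩ <;> rfl
      · exact absurd hxi infty_notMem_sphereClosure_Icc
      · rcases hi with ⟨rfl, rfl⟩ | ⟨rfl, rfl⟩ <;> rfl
  · simp only [toSphere, foldPoint, map_some]
    rcases h with ⟨rfl, hxj⟩ | ⟨i, hi, hxi⟩
    · refine map_flip_congr (fun _ => ?_) fun h => absurd rfl h
      exact (isCoSeg_iff hpq _).1 (isCoSeg_foldSheet hc₁ hc₃ hp hpq (coe_mem_sphereClosure.1 hxj))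
    · have hcl : IsClosed (stdCuts c₁ c₃ p q i) := by
        fin_cases i
        exacts [isClosed_Iic, isClosed_Icc, isClosed_Iic]
      rw [coe_mem_sphereClosure, hcl.closure_eq] at hxi
      obtain ⟨k1, k2, k3⟩ := foldPoint_eq_of_glue_swap hc₁ hc₃ hp hi hxi
      rw [← k1, ← k2]
      refine map_flip_congr (fun h => absurd rfl h) fun h => ?_
      obtain ⟨k4, k5, k6⟩ := k3 h
      rw [k4]
      exact (isSeg_iff hpq _).1 ⟨s, rfl, k5, k6⟩

theorem Surface.mk_eq_mk_not {S : Fin 3 → Set ℝ} {j l : Fin 4} {h : Bool} {x : OnePoint ℂ}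
    (hx : x ∈ closedHalf h) (hx' : x ∈ closedHalf (!h))
    (H : (j = l ∧ x ∈ sphereClosure (cutsIn S j)ᶜ) ∨
      ∃ i : Fin 3, ((j = i.castSucc ∧ l = i.succ) ∨ (j = i.succ ∧ l = i.castSucc)) ∧
        x ∈ sphereClosure (S i)) :
    Surface.mk S ⟨(j, h, x), hx⟩ = Surface.mk S ⟨(l, !h, x), hx'⟩ := by
  cases h
  · refine (Quot.sound ((glue_iff hx' hx).2 ?_)).symm
    rcases H with ⟨rfl, H⟩ | ⟨i, H, hi⟩
    · exact Or.inl ⟨rfl, H⟩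
    · exact Or.inr ⟨i, by tauto, hi⟩
  · exact Quot.sound ((glue_iff hx hx').2 H)

theorem map_foldSheet_inj {j : Fin 4} {h : Bool} {x y : OnePoint ℂ} (hx : x ∈ closedHalf h)
    (hy : y ∈ closedHalf h)
    (e : OnePoint.map (foldSheet c₁ c₃ j) x = OnePoint.map (foldSheet c₁ c₃ j) y) : x = y := by
  induction x using OnePoint.rec <;> induction y using OnePoint.rec
  · rfl
  · simp at e
  · simp at e
  · rw [map_some, map_some, OnePoint.coe_eq_coe] at e
    rw [coe_mem_closedHalf] at hx hy
    congr 1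
    fin_cases j
    exacts [foldOut_inj hx hy e, foldIn_inj hx hy e, foldIn_inj hx hy e, foldOut_inj hx hy e]

theorem eq_of_map_foldIn_eq_map_foldOut {c : ℝ} {x y : OnePoint ℂ}
    (e : OnePoint.map (foldIn c) x = OnePoint.map (foldOut c) y) :
    y = x ∧ x ∈ sphereClosure (Iic (-c)) := by
  induction x using OnePoint.rec <;> induction y using OnePoint.rec
  · exact ⟨rfl, infty_mem_sphereClosure_Iic _⟩
  · simp at e
  · simp at e
  · rw [map_some, map_some, OnePoint.coe_eq_coe] at e
    obtain ⟨s, hs, rfl, rfl⟩ := eq_of_foldIn_eq_foldOut e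
    exact ⟨rfl, coe_mem_sphereClosure.2 (subset_closure hs)⟩

/-- Equal signs mean either the same half-sheet, on which folding is injective, or the opposite
halves of an inner and an outer sheet. The folded images of the latter meet only along their common
cut, where the halves are glued. -/
theorem mk_eq_of_foldPoint_eq {P Q : HalfSheets} (e : foldPoint c₁ c₃ P = foldPoint c₁ c₃ Q)
    (hr : keepsRe P.1.1 P.1.2.1 = keepsRe Q.1.1 Q.1.2.1) (hi : keepsIm P.1.1 = keepsIm Q.1.1) :
    Surface.mk (stdCuts c₁ c₃ p q) P = Surface.mk (stdCuts c₁ c₃ p q) Q := by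
  obtain ⟨⟨j, h, x⟩, hx⟩ := P
  obtain ⟨⟨l, g, y⟩, hy⟩ := Q
  simp only [foldPoint] at e hr hi
  rcases eq_or_ne j l with rfl | hjl
  · have hg : g = h := by cases h <;> cases g <;> simp_all [keepsRe]
    subst hg
    obtain rfl := map_foldSheet_inj hx hy e
    rfl
  have key : ∀ i : Fin 3, i = 0 ∨ i = 2 →
      (j = i.castSucc ∧ l = i.succ) ∨ (j = i.succ ∧ l = i.castSucc) → y = x →
      x ∈ sphereClosure (stdCuts c₁ c₃ p q i) →
      Surface.mk (stdCuts c₁ c₃ p q) ⟨(j, h, x), hx⟩ =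
        Surface.mk (stdCuts c₁ c₃ p q) ⟨(l, g, y), hy⟩ := by
    rintro i hi hjl rfl hxi
    have hg : g = !h := by
      rcases hi with rfl | rfl <;> rcases hjl with ⟨rfl, rfl⟩ | ⟨rfl, rfl⟩ <;>
        cases h <;> cases g <;> simp_all [keepsRe]
    subst hg
    exact Surface.mk_eq_mk_not hx hy (Or.inr ⟨i, hjl, hxi⟩)
  have hcases : (j = 0 ∧ l = 1) ∨ (j = 1 ∧ l = 0) ∨ (j = 2 ∧ l = 3) ∨ (j = 3 ∧ l = 2) := by
    have : ∀ j l : Fin 4, keepsIm j = keepsIm l → j ≠ l →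
        (j = 0 ∧ l = 1) ∨ (j = 1 ∧ l = 0) ∨ (j = 2 ∧ l = 3) ∨ (j = 3 ∧ l = 2) := by decide
    exact this j l hi hjl
  rcases hcases with ⟨rfl, rfl⟩ | ⟨rfl, rfl⟩ | ⟨rfl, rfl⟩ | ⟨rfl, rfl⟩
  · obtain ⟨rfl, k⟩ := eq_of_map_foldIn_eq_map_foldOut (c := c₁) e.symm
    exact key 0 (Or.inl rfl) (Or.inl ⟨rfl, rfl⟩) rfl k
  · obtain ⟨rfl, k⟩ := eq_of_map_foldIn_eq_map_foldOut (c := c₁) e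
    exact key 0 (Or.inl rfl) (Or.inr ⟨rfl, rfl⟩) rfl k
  · obtain ⟨rfl, k⟩ := eq_of_map_foldIn_eq_map_foldOut (c := c₃) e
    exact key 2 (Or.inr rfl) (Or.inl ⟨rfl, rfl⟩) rfl k
  · obtain ⟨rfl, k⟩ := eq_of_map_foldIn_eq_map_foldOut (c := c₃) e.symm
    exact key 2 (Or.inr rfl) (Or.inr ⟨rfl, rfl⟩) rfl k

theorem keepsRe_beq (j : Fin 4) (r : Bool) :
    keepsRe j (r == ![false, true, false, true] j) = r := by
  revert j r; decide

theorem keepsRe_not (j : Fin 4) (h : Bool) : keepsRe j (!h) = !keepsRe j h := by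
  revert j h; decide

/-- A folded point on the complementary arc has a representative over a real point, or infinity, in
the closure of the complement of the cuts of some sheet with the same imaginary sign. There the two
halves of this sheet are glued, which changes the real sign. -/
theorem mk_eq_of_isCoSeg (hc₁ : 0 ≤ c₁) (hc₃ : 0 ≤ c₃) (hp : 0 ≤ p) (hpq : p < q)
    {P Q : HalfSheets} (e : foldPoint c₁ c₃ P = foldPoint c₁ c₃ Q)
    (hw : IsCoSeg p q (foldPoint c₁ c₃ P)) (hi : keepsIm P.1.1 = keepsIm Q.1.1) :
    Surface.mk (stdCuts c₁ c₃ p q) P = Surface.mk (stdCuts c₁ c₃ p q) Q := by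
  by_cases hr : keepsRe P.1.1 P.1.2.1 = keepsRe Q.1.1 Q.1.2.1
  · exact mk_eq_of_foldPoint_eq e hr hi
  obtain ⟨j, x, hx, hj, hxw, hxj⟩ : ∃ (j : Fin 4) (x : OnePoint ℂ), (∀ h, x ∈ closedHalf h) ∧
      keepsIm j = keepsIm P.1.1 ∧ OnePoint.map (foldSheet c₁ c₃ j) x = foldPoint c₁ c₃ P ∧
      x ∈ sphereClosure (cutsIn (stdCuts c₁ c₃ p q) j)ᶜ := by
    rcases hw with hw | ⟨s, hw, hs⟩
    · exact ⟨P.1.1, infty, infty_mem_closedHalf, rfl, by rw [hw]; rfl,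
        infty_mem_sphereClosure_compl_cutsIn _⟩
    · rw [hw]
      have out : ∀ c : ℝ, s ≤ -c → foldOut c ((-s - 2 * c : ℝ) : ℂ) = s := fun c hc => by
        rw [foldOut_ofReal_of_ge (by linarith)]; congr 1; ring
      have cl : ∀ (j : Fin 4) (x : ℝ), x ∈ closure (![Iic (-c₁), Iic (-c₁) ∪ Icc p q,
          Icc p q ∪ Iic (-c₃), Iic (-c₃)] j)ᶜ →
          ((x : ℂ) : OnePoint ℂ) ∈ sphereClosure (cutsIn (stdCuts c₁ c₃ p q) j)ᶜ := fun j x hx => by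
        rw [coe_mem_sphereClosure, cutsIn_stdCuts]; exact hx
      cases hk : keepsIm P.1.1
      · rcases le_or_gt s (-c₃) with h | h
        · refine ⟨3, ((-s - 2 * c₃ : ℝ) : ℂ), mem_closedHalf_of_eq_ofReal, rfl,
            congrArg _ (out c₃ h), cl _ _ ?_⟩
          simpa using by linarith
        · refine ⟨2, (s : ℂ), mem_closedHalf_of_eq_ofReal, rfl,
            congrArg _ (foldIn_ofReal_of_ge h.le), cl _ _ ?_⟩
          simp only [Matrix.cons_val]
          rw [union_comm, mem_closure_compl_Iic_union_Icc hc₃ hp hpq]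
          grind
      · rcases le_or_gt s (-c₁) with h | h
        · refine ⟨0, ((-s - 2 * c₁ : ℝ) : ℂ), mem_closedHalf_of_eq_ofReal, rfl,
            congrArg _ (out c₁ h), cl _ _ ?_⟩
          simpa using by linarith
        · refine ⟨1, (s : ℂ), mem_closedHalf_of_eq_ofReal, rfl,
            congrArg _ (foldIn_ofReal_of_ge h.le), cl _ _ ?_⟩
          simp only [Matrix.cons_val]
          rw [mem_closure_compl_Iic_union_Icc hc₁ hp hpq]
          grind
  set h : Bool := keepsRe P.1.1 P.1.2.1 == ![false, true, false, true] j with hh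
  have e1 : keepsRe j h = keepsRe P.1.1 P.1.2.1 := keepsRe_beq _ _
  have e2 : keepsRe j (!h) = keepsRe Q.1.1 Q.1.2.1 := by
    rw [keepsRe_not, e1]; revert hr; generalize keepsRe P.1.1 P.1.2.1 = u
    generalize keepsRe Q.1.1 Q.1.2.1 = v; revert u v; decide
  rw [← mk_eq_of_foldPoint_eq (P := ⟨(j, h, x), hx h⟩) hxw e1 hj,
    ← mk_eq_of_foldPoint_eq (P := ⟨(j, !h, x), hx _⟩) (hxw.trans e) e2 (hj.trans hi)]
  exact Surface.mk_eq_mk_not _ _ (Or.inl ⟨rfl, hxj⟩)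

/-- The counterpart for the other side: a point of [p, q] is represented on both inner sheets, and
the middle cut glues these crosswise, changing the imaginary sign. -/
theorem mk_eq_of_isSeg (hc₁ : 0 ≤ c₁) (hc₃ : 0 ≤ c₃) (hp : 0 ≤ p)
    {P Q : HalfSheets} (e : foldPoint c₁ c₃ P = foldPoint c₁ c₃ Q)
    (hw : IsSeg p q (foldPoint c₁ c₃ P))
    (hr : keepsRe P.1.1 P.1.2.1 = keepsRe Q.1.1 Q.1.2.1) :
    Surface.mk (stdCuts c₁ c₃ p q) P = Surface.mk (stdCuts c₁ c₃ p q) Q := by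
  by_cases hi : keepsIm P.1.1 = keepsIm Q.1.1
  · exact mk_eq_of_foldPoint_eq e hr hi
  obtain ⟨s, hs, h1, h2⟩ := hw
  obtain ⟨j, l, hjl, hj, hl⟩ : ∃ j l : Fin 4, ((j = 1 ∧ l = 2) ∨ (j = 2 ∧ l = 1)) ∧
      keepsIm j = keepsIm P.1.1 ∧ keepsIm l = keepsIm Q.1.1 := by
    revert hi
    generalize keepsIm P.1.1 = u
    generalize keepsIm Q.1.1 = v
    revert u v; decide
  have hf : ∀ m : Fin 4, m = 1 ∨ m = 2 → foldSheet c₁ c₃ m s = s := by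
    rintro m (rfl | rfl)
    · exact foldIn_ofReal_of_ge (by linarith)
    · exact foldIn_ofReal_of_ge (by linarith)
  set h : Bool := keepsRe P.1.1 P.1.2.1 == ![false, true, false, true] j with hh
  have e1 : keepsRe j h = keepsRe P.1.1 P.1.2.1 := keepsRe_beq _ _
  have e2 : keepsRe l (!h) = keepsRe Q.1.1 Q.1.2.1 := by
    rw [← hr, ← e1]
    rcases hjl with ⟨rfl, rfl⟩ | ⟨rfl, rfl⟩ <;> cases h <;> rfl
  rw [← mk_eq_of_foldPoint_eq (P := ⟨(j, h, (s : ℂ)), mem_closedHalf_of_eq_ofReal h⟩)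
      ((congrArg _ (hf j (by tauto))).trans hs.symm) e1 hj,
    ← mk_eq_of_foldPoint_eq (P := ⟨(l, !h, (s : ℂ)), mem_closedHalf_of_eq_ofReal _⟩)
      ((congrArg _ (hf l (by tauto))).trans (hs.symm.trans e)) e2 hl]
  refine Surface.mk_eq_mk_not _ _ (Or.inr ⟨1, ?_, coe_mem_sphereClosure.2 (subset_closure ⟨h1, h2⟩)⟩)
  exact hjl

theorem exists_foldPoint_eq {w : OnePoint ℂ} (hw : w ∈ closedHalf true) (r i : Bool) :
    ∃ P : HalfSheets, foldPoint c₁ c₃ P = w ∧ keepsRe P.1.1 P.1.2.1 = r ∧ keepsIm P.1.1 = i := by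
  induction w using OnePoint.rec with
  | infty =>
    obtain ⟨j, hj⟩ : ∃ j, keepsIm j = i := by revert i; decide
    exact ⟨⟨(j, r == ![false, true, false, true] j, infty), infty_mem_closedHalf _⟩, rfl,
      keepsRe_beq _ _, hj⟩
  | coe w =>
    rw [coe_mem_closedHalf_true_iff] at hw
    have : ∃ j : Fin 4, keepsIm j = i ∧ ∀ h, ∃ z, InHalf h z ∧ foldSheet c₁ c₃ j z = w := by
      cases i
      · rcases le_total w.re (-c₃) with h | h
        · exact ⟨3, rfl, fun b => exists_foldOut_eq b h hw⟩
        · exact ⟨2, rfl, fun b => exists_foldIn_eq b h hw⟩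
      · rcases le_total w.re (-c₁) with h | h
        · exact ⟨0, rfl, fun b => exists_foldOut_eq b h hw⟩
        · exact ⟨1, rfl, fun b => exists_foldIn_eq b h hw⟩
    obtain ⟨j, hj, hz⟩ := this
    obtain ⟨z, hz, e⟩ := hz (r == ![false, true, false, true] j)
    exact ⟨⟨(j, _, z), coe_mem_closedHalf.2 hz⟩, congrArg _ e, keepsRe_beq _ _, hj⟩

instance : CompactSpace HalfSheets := by
  refine isCompact_iff_compactSpace.1 (IsClosed.isCompact ?_)
  have h : ∀ b, IsClosed (closedHalf b) := by
    intro b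
    have hc : closedHalf b = OnePoint.some '' {z | InHalf b z} ∪ {infty} := by
      ext x
      induction x using OnePoint.rec with
      | infty => simp [infty_mem_closedHalf]
      | coe z => simp [coe_mem_closedHalf]
    have hcl : IsClosed {z | InHalf b z} := by
      cases b
      · exact isClosed_le continuous_im continuous_const
      · exact isClosed_le continuous_const continuous_im
    rw [hc, ← isOpen_compl_iff, OnePoint.isOpen_iff_of_notMem (by simp)]
    convert hcl.isOpen_compl using 1
    ext z; simp
  have : {P : Fin 4 × Bool × OnePoint ℂ | P.2.2 ∈ closedHalf P.2.1} =
      ⋃ b : Bool, {P | P.2.1 = b} ∩ {P | P.2.2 ∈ closedHalf b} := by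
    ext P; simp
  change IsClosed {P : Fin 4 × Bool × OnePoint ℂ | P.2.2 ∈ closedHalf P.2.1}
  rw [this]
  refine isClosed_iUnion_of_finite fun b => IsClosed.inter ?_ ?_
  · exact (isClosed_discrete {b}).preimage (by fun_prop : Continuous
      fun P : Fin 4 × Bool × OnePoint ℂ => P.2.1)
  · exact (h b).preimage (by fun_prop)

instance (S : Fin 3 → Set ℝ) : CompactSpace (Surface S) :=
  inferInstanceAs (CompactSpace (Quot (Glue S)))

/-- A half of an inner sheet and the opposite half of its outer neighbour fold onto the two parts of
one closed half-sphere, divided by the image of their cut. Eight half-sheets thus give four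
half-spheres, which are joined along [p, q] if they belong to different inner sheets and along the
complementary arc if they belong to the same one. Folded to quarter-spheres and reflected, these
four pieces tile the sphere. The resulting map is a continuous bijection from a compact space to a
Hausdorff space. -/
theorem nonempty_surface_homeomorph (hc₁ : 0 ≤ c₁) (hc₃ : 0 ≤ c₃) (hp : 0 ≤ p) (hpq : p < q) :
    Nonempty (Surface (stdCuts c₁ c₃ p q) ≃ₜ OnePoint ℂ) := by
  set Φ : Surface (stdCuts c₁ c₃ p q) → OnePoint ℂ :=
    Quot.lift (toSphere c₁ c₃ p q hpq) fun _ _ h => toSphere_eq_of_glue hc₁ hc₃ hp hpq h with hΦ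
  have hcont : Continuous Φ :=
    continuous_coinduced_dom.2 (continuous_toSphere hpq)
  have hinj : Function.Injective Φ := by
    rintro ⟨P⟩ ⟨Q⟩ (e : toSphere c₁ c₃ p q hpq P = toSphere c₁ c₃ p q hpq Q)
    change Surface.mk _ P = Surface.mk _ Q
    obtain ⟨e1, e2, e3⟩ := map_flip_eq (fun _ => quarterSphere_nonneg hpq)
      (fun _ => quarterSphere_nonneg hpq) e
    rw [← isCoSeg_iff] at e2
    rw [← isSeg_iff] at e3
    have e1 := quarterSphere_inj hpq (foldPoint_mem P) (foldPoint_mem Q) e1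
    by_cases hr : keepsRe P.1.1 P.1.2.1 = keepsRe Q.1.1 Q.1.2.1
    · by_cases hi : keepsIm P.1.1 = keepsIm Q.1.1
      · exact mk_eq_of_foldPoint_eq e1 hr hi
      · exact mk_eq_of_isSeg hc₁ hc₃ hp e1 (e3 hi) hr
    · by_cases hi : keepsIm P.1.1 = keepsIm Q.1.1
      · exact mk_eq_of_isCoSeg hc₁ hc₃ hp hpq e1 (e2 hr) hi
      -- When both signs differ, the folded point lies on both sides of the quarter-sphere. The
      -- identification is made in two moves, through a point that differs from each by one sign.
      · obtain ⟨P', k1, k2, k3⟩ := exists_foldPoint_eq (c₁ := c₁) (c₃ := c₃) (foldPoint_mem P)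
          (keepsRe Q.1.1 Q.1.2.1) (keepsIm P.1.1)
        exact (mk_eq_of_isCoSeg hc₁ hc₃ hp hpq k1.symm (e2 hr) k3.symm).trans
          (mk_eq_of_isSeg hc₁ hc₃ hp (k1.trans e1) (k1 ▸ e3 hi) k2)
  have hsurj : Function.Surjective Φ := by
    intro u
    obtain ⟨r, i, v, hv, e⟩ : ∃ r i, ∃ v : OnePoint ℂ, (∀ z : ℂ, v = z → 0 ≤ z.re ∧ 0 ≤ z.im) ∧
        OnePoint.map (flip r i) v = u := by
      induction u using OnePoint.rec with
      | infty => exact ⟨true, true, infty, by simp, rfl⟩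
      | coe u =>
        refine ⟨decide (0 ≤ u.re), decide (0 ≤ u.im), ((⟨|u.re|, |u.im|⟩ : ℂ) : OnePoint ℂ),
          fun z hz => ?_, ?_⟩
        · rw [OnePoint.coe_eq_coe] at hz
          exact hz ▸ ⟨abs_nonneg _, abs_nonneg _⟩
        · rw [map_some]
          congr 1
          apply Complex.ext <;> simp only [flip, decide_eq_true_eq] <;> split_ifs with h
          · exact abs_of_nonneg h
          · rw [abs_of_neg (not_le.1 h), neg_neg]
          · exact abs_of_nonneg h
          · rw [abs_of_neg (not_le.1 h), neg_neg]
    obtain ⟨w, hw, rfl⟩ := exists_quarterSphere_eq hpq hv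
    obtain ⟨P, k1, k2, k3⟩ := exists_foldPoint_eq (c₁ := c₁) (c₃ := c₃) hw r i
    refine ⟨Surface.mk _ P, ?_⟩
    rw [← e, ← k1, ← k2, ← k3]
    rfl
  exact ⟨hcont.homeoOfEquivCompactToT2 (f := Equiv.ofBijective Φ ⟨hinj, hsurj⟩)⟩

end Sphere

/-! ### Local coordinates of the surface -/

section Charts

open Complex Metric Set Filter OnePoint
open scoped ComplexConjugate

/-- The continuous branch of the `k`-th root on the closed upper or lower half-plane that is
positive on the positive half-line. -/
def halfRoot (k : ℕ) (h : Bool) (y : ℂ) : ℂ :=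
  if h then y ^ (k⁻¹ : ℂ) else conj (conj y ^ (k⁻¹ : ℂ))

theorem halfRoot_pow {k : ℕ} (hk : k ≠ 0) (h : Bool) (y : ℂ) : halfRoot k h y ^ k = y := by
  cases h
  · simp only [halfRoot, Bool.false_eq_true, if_false]
    rw [← map_pow, cpow_nat_inv_pow _ hk, conj_conj]
  · exact cpow_nat_inv_pow _ hk

theorem halfRoot_zero {k : ℕ} (hk : k ≠ 0) (h : Bool) : halfRoot k h 0 = 0 :=
  pow_eq_zero_iff hk |>.1 (halfRoot_pow hk h 0)

theorem halfRoot_one (h : Bool) (y : ℂ) : halfRoot 1 h y = y := by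
  simpa using halfRoot_pow one_ne_zero h y

theorem continuousOn_halfRoot {k : ℕ} (hk : k ≠ 0) (h : Bool) :
    ContinuousOn (halfRoot k h) {y | InHalf h y} := by
  have key : ContinuousOn (fun y : ℂ => y ^ (k⁻¹ : ℂ)) {y | 0 ≤ y.im} := by
    intro y hy
    by_cases h1 : 0 ≤ y.re ∨ y.im ≠ 0
    · refine (continuousAt_cpow_const_of_re_pos h1 ?_).continuousWithinAt
      rw [← ofReal_natCast, ← ofReal_inv, ofReal_re]
      exact inv_pos.2 (Nat.cast_pos.2 (Nat.pos_of_ne_zero hk))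
    · push Not at h1
      have hy0 : y ≠ 0 := fun h => by simp [h] at h1
      have h2 : ContinuousWithinAt (fun y : ℂ => Complex.exp (Complex.log y * (k⁻¹ : ℂ)))
          {y | 0 ≤ y.im} y :=
        ((continuousWithinAt_log_of_re_neg_of_im_zero h1.1 h1.2).mul_const _).cexp
      refine h2.congr_of_eventuallyEq ?_ (cpow_def_of_ne_zero hy0 _)
      filter_upwards [mem_nhdsWithin_of_mem_nhds (isOpen_ne.mem_nhds hy0)] with w hw
      exact cpow_def_of_ne_zero hw _
  cases h
  · exact continuous_conj.comp_continuousOn (key.comp continuous_conj.continuousOn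
      fun y hy => by simpa [InHalf] using hy)
  · exact key

theorem halfRoot_of_nonneg (k : ℕ) {y : ℝ} (hy : 0 ≤ y) :
    halfRoot k true y = halfRoot k false y := by
  simp only [halfRoot, if_true, Bool.false_eq_true, if_false, conj_ofReal]
  rw [← ofReal_natCast, ← ofReal_inv, ← ofReal_cpow hy, conj_ofReal]

/-- The argument on the negative axis is π seen from above and −π seen from below. The resulting
factor e^(2πi/k) is compensated by the labels of `exists_cycle_label`. -/
theorem halfRoot_of_nonpos {k : ℕ} (hk : k ≠ 0) {y : ℝ} (hy : y ≤ 0) :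
    halfRoot k true y = Complex.exp (2 * Real.pi * I / k) * halfRoot k false y := by
  rcases hy.eq_or_lt with rfl | hy
  · simp [halfRoot_zero hk]
  have hy0 : (y : ℂ) ≠ 0 := ofReal_ne_zero.2 hy.ne
  simp only [halfRoot, if_true, Bool.false_eq_true, if_false, conj_ofReal]
  have hlog : Complex.log y = Real.log (-y) + Real.pi * I := by
    apply Complex.ext
    · simp [log_re, abs_of_neg hy]
    · simp [log_im, arg_ofReal_of_neg hy]
  rw [cpow_def_of_ne_zero hy0, ← exp_conj, ← Complex.exp_add, hlog]
  congr 1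
  simp only [map_mul, map_add, conj_ofReal, conj_I, map_inv₀, conj_natCast]
  have : (k : ℂ) ≠ 0 := Nat.cast_ne_zero.2 hk
  field_simp
  ring

/-- The points of a cycle of a permutation can be labelled by the roots of unity. -/
theorem exists_cycle_label {α : Type*} [Finite α] (m : Equiv.Perm α) (j₀ : α) :
    ∃ (k : ℕ) (O : Set α) (e : α → ℂ), k ≠ 0 ∧ j₀ ∈ O ∧ (∀ j, m j ∈ O ↔ j ∈ O) ∧
      (∀ j ∈ O, e j ^ k = 1) ∧ (∀ j ∈ O, e (m j) = Complex.exp (2 * Real.pi * I / k) * e j) ∧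
      InjOn e O ∧ (∀ u : ℂ, u ^ k = 1 → ∃ j ∈ O, e j = u) ∧ (∀ j ∈ O, ∃ n, m^[n] j₀ = j) ∧
      (m j₀ = j₀ → k = 1 ∧ O = {j₀} ∧ e j₀ = 1) := by
  classical
  set k := Function.minimalPeriod m j₀ with hk
  have hk0 : k ≠ 0 := by
    have hper : j₀ ∈ Function.periodicPts m := by
      refine Function.mk_mem_periodicPts (orderOf_pos m) ?_
      rw [Function.IsPeriodicPt, Function.IsFixedPt, Equiv.Perm.iterate_eq_pow, pow_orderOf_eq_one]
      rfl
    exact (Function.minimalPeriod_pos_of_mem_periodicPts hper).ne'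
  set w := Complex.exp (2 * Real.pi * I / k) with hw
  have hprim : IsPrimitiveRoot w k := Complex.isPrimitiveRoot_exp k hk0
  have hmod : ∀ n n' : ℕ, m^[n] j₀ = m^[n'] j₀ ↔ w ^ n = w ^ n' := by
    intro n n'
    have hlt : ∀ n, n % k < k := fun n => Nat.mod_lt _ (Nat.pos_of_ne_zero hk0)
    have hw' : ∀ n, w ^ n = w ^ (n % k) := fun n => by
      conv_rhs => rw [hprim.eq_orderOf, pow_mod_orderOf]
    rw [hw' n, hw' n', ← Function.iterate_mod_minimalPeriod_eq (n := n),
      ← Function.iterate_mod_minimalPeriod_eq (n := n')]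
    exact ⟨fun h => by rw [hk, Function.iterate_injOn_Iio_minimalPeriod (hlt n) (hlt n') h],
      fun h => by rw [← hk, hprim.pow_inj (hlt n) (hlt n') h]⟩
  -- The n-th point of the cycle gets the label wⁿ. By `hmod` this is independent of the choice of
  -- n, both sequences having exact period k.
  set e : α → ℂ := fun j => if h : ∃ n, m^[n] j₀ = j then w ^ h.choose else 0 with he
  have heq : ∀ n, e (m^[n] j₀) = w ^ n := by
    intro n
    have h : ∃ n', m^[n'] j₀ = m^[n] j₀ := ⟨n, rfl⟩
    simp only [he, dif_pos h]
    exact (hmod _ _).1 h.choose_spec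
  have hne : NeZero k := ⟨hk0⟩
  refine ⟨k, {j | ∃ n, m^[n] j₀ = j}, e, hk0, ⟨0, rfl⟩, fun j => ⟨?_, ?_⟩, ?_, ?_, ?_, ?_,
    fun j hj => hj, fun h => ?_⟩
  · rintro ⟨n, hn⟩
    refine ⟨n + (k - 1), m.injective ?_⟩
    rw [← Function.iterate_succ_apply' m, ← hn]
    have : (n + (k - 1)).succ = n + k := by omega
    rw [this, Function.iterate_add_apply, hk, Function.iterate_minimalPeriod]
  · rintro ⟨n, rfl⟩
    exact ⟨n + 1, Function.iterate_succ_apply' m n j₀⟩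
  · rintro _ ⟨n, rfl⟩
    rw [heq, ← pow_mul, mul_comm, pow_mul, hprim.pow_eq_one, one_pow]
  · rintro _ ⟨n, rfl⟩
    rw [← Function.iterate_succ_apply' m, heq, heq, pow_succ']
  · rintro _ ⟨n, rfl⟩ _ ⟨n', rfl⟩ h
    rw [heq, heq] at h
    exact (hmod _ _).2 h
  · intro u hu
    obtain ⟨i, -, rfl⟩ := hprim.eq_pow_of_pow_eq_one hu
    exact ⟨_, ⟨i, rfl⟩, heq i⟩
  · refine ⟨Function.minimalPeriod_eq_one_iff_isFixedPt.2 h, ?_, heq 0⟩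
    ext j
    constructor
    · rintro ⟨n, rfl⟩
      exact Function.IsFixedPt.iterate h n
    · rintro rfl
      exact ⟨0, rfl⟩

/-! ### Charts obtained from functions on the half-sheets. -/

variable {S : Fin 3 → Set ℝ}

theorem isQuotientMap_mk : IsQuotientMap (Surface.mk S) := isQuotientMap_quot_mk

theorem preimage_mk_image_mk {A : Set HalfSheets}
    (hA : ∀ P Q, Glue S P Q → (P ∈ A ↔ Q ∈ A)) : Surface.mk S ⁻¹' (Surface.mk S '' A) = A := by
  refine Subset.antisymm ?_ (subset_preimage_image _ _)
  rintro Q ⟨P, hP, e⟩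
  have := congrArg (Quot.lift (· ∈ A) fun P Q h => propext (hA P Q h)) e
  exact this.mp hP

/-- A continuous function on a saturated open set of half-sheet points that separates the points of
the surface gives a chart. -/
theorem exists_openPartialHomeomorph_of_separates {A K : Set HalfSheets} {T : Set ℂ}
    {g : HalfSheets → ℂ} (hA : IsOpen A) (hK : IsClosed K) (hAK : A ⊆ K) (hT : IsOpen T)
    (hAs : ∀ P Q, Glue S P Q → (P ∈ A ↔ Q ∈ A)) (hKs : ∀ P Q, Glue S P Q → (P ∈ K ↔ Q ∈ K))
    (hg : ContinuousOn g K) (hgs : ∀ P Q, Glue S P Q → P ∈ K → g P = g Q)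
    (hinj : ∀ P ∈ K, ∀ Q ∈ K, g P = g Q → Surface.mk S P = Surface.mk S Q)
    (hAT : ∀ P ∈ K, g P ∈ T ↔ P ∈ A) (hsurj : ∀ ζ ∈ T, ∃ P ∈ A, g P = ζ) :
    ∃ e : OpenPartialHomeomorph (Surface S) ℂ, e.source = Surface.mk S '' A ∧ e.target = T ∧
      (∀ P ∈ A, e (Surface.mk S P) = g P) ∧ ∀ P ∈ A, e.symm (g P) = Surface.mk S P := by
  classical
  set G : Surface S → ℂ := Quot.lift (fun P => if P ∈ K then g P else 0) fun P Q h => by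
    by_cases hP : P ∈ K
    · simp only [if_pos hP, if_pos ((hKs P Q h).1 hP), hgs P Q h hP]
    · simp only [if_neg hP, if_neg fun hQ => hP ((hKs P Q h).2 hQ)] with hG
  have hGmk : ∀ P ∈ K, G (Surface.mk S P) = g P := fun P hP => if_pos hP
  set K' := Surface.mk S '' K with hK'
  have hKpre := preimage_mk_image_mk hKs
  have hGK : ContinuousOn G K' := by
    rw [continuousOn_iff_isClosed]
    intro C hC
    obtain ⟨D, hD, hDe⟩ := continuousOn_iff_isClosed.1 hg C hC
    refine ⟨Surface.mk S '' (D ∩ K), ?_, ?_⟩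
    · have hsat : ∀ P Q, Glue S P Q → (P ∈ D ∩ K ↔ Q ∈ D ∩ K) := by
        intro P Q h
        rw [← hDe]
        constructor
        · rintro ⟨h1, h2⟩
          exact ⟨by rw [mem_preimage, ← hgs P Q h h2]; exact h1, (hKs P Q h).1 h2⟩
        · rintro ⟨h1, h2⟩
          have h2 := (hKs P Q h).2 h2
          exact ⟨by rw [mem_preimage, hgs P Q h h2]; exact h1, h2⟩
      rw [← isQuotientMap_mk.isClosed_preimage, preimage_mk_image_mk hsat]
      exact hD.inter hK
    · ext X
      constructor
      · rintro ⟨hX, P, hP, rfl⟩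
        rw [mem_preimage, hGmk P hP] at hX
        have : P ∈ D ∩ K := hDe ▸ ⟨hX, hP⟩
        exact ⟨⟨P, this, rfl⟩, P, hP, rfl⟩
      · rintro ⟨⟨P, hP, rfl⟩, -⟩
        rw [← hDe] at hP
        exact ⟨by rw [mem_preimage, hGmk P hP.2]; exact hP.1, P, hP.2, rfl⟩
  have hGinj : InjOn G K' := by
    rintro _ ⟨P, hP, rfl⟩ _ ⟨Q, hQ, rfl⟩ e
    rw [hGmk P hP, hGmk Q hQ] at e
    exact hinj P hP Q hQ e
  have hK'c : IsCompact K' := hK.isCompact.image isQuotientMap_mk.continuous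
  have hne : Nonempty (Surface S) := ⟨Surface.mk S ⟨(0, true, infty), infty_mem_closedHalf _⟩⟩
  have hleft : ∀ P ∈ K, Function.invFunOn G K' (g P) = Surface.mk S P := fun P hP => by
    rw [← hGmk P hP]
    exact hGinj.leftInvOn_invFunOn ⟨P, hP, rfl⟩
  -- The inverse is continuous because images of closed subsets of the compact set `K'` are compact.
  -- This is the purpose of the closed set K around the open set A; the surface need not be known to
  -- be Hausdorff.
  have hinv : ContinuousOn (Function.invFunOn G K') T := by
    rw [continuousOn_iff_isClosed]
    intro C hC
    refine ⟨G '' (K' ∩ C), ((hK'c.inter_right hC).image_of_continuousOn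
      (hGK.mono inter_subset_left)).isClosed, ?_⟩
    ext ζ
    refine and_congr_left fun hζ => ?_
    obtain ⟨P, hP, rfl⟩ := hsurj ζ hζ
    rw [mem_preimage, hleft P (hAK hP)]
    constructor
    · intro h
      exact ⟨_, ⟨⟨P, hAK hP, rfl⟩, h⟩, hGmk P (hAK hP)⟩
    · rintro ⟨_, ⟨⟨Q, hQ, rfl⟩, h⟩, e⟩
      rw [hGmk Q hQ] at e
      rwa [← hinj Q hQ P (hAK hP) e]
  refine ⟨{ toFun := G
            invFun := Function.invFunOn G K'
            source := Surface.mk S '' A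
            target := T
            map_source' := ?_
            map_target' := fun ζ hζ => ?_
            left_inv' := ?_
            right_inv' := fun ζ hζ => ?_
            open_source := ?_
            open_target := hT
            continuousOn_toFun := hGK.mono (image_mono hAK)
            continuousOn_invFun := hinv }, rfl, rfl, fun P hP => hGmk P (hAK hP),
    fun P hP => hleft P (hAK hP)⟩
  · rintro _ ⟨P, hP, rfl⟩
    rw [hGmk P (hAK hP)]
    exact (hAT P (hAK hP)).2 hP
  · obtain ⟨P, hP, rfl⟩ := hsurj ζ hζ
    rw [hleft P (hAK hP)]
    exact ⟨P, hP, rfl⟩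
  · rintro _ ⟨P, hP, rfl⟩
    rw [hGmk P (hAK hP)]
    exact hleft P (hAK hP)
  · obtain ⟨P, hP, rfl⟩ := hsurj ζ hζ
    rw [hleft P (hAK hP)]
    exact hGmk P (hAK hP)
  · rw [← isQuotientMap_mk.isOpen_preimage, preimage_mk_image_mk hAs]
    exact hA

variable {ι : ℂ → OnePoint ℂ} {r : ℝ} {L R : Equiv.Perm (Fin 4)}

theorem IsLocalModel.mem_closedHalf (hM : IsLocalModel S ι r L R) {h : Bool} {y : ℂ} :
    ι y ∈ closedHalf h ↔ InHalf h y := by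
  cases h
  · simpa [InHalf] using hM.mem_false y
  · simpa [InHalf] using hM.mem_true y

/-- The points of the surface over `ι y`. -/
def IsLocalModel.point (hM : IsLocalModel S ι r L R) (j : Fin 4) (h : Bool) (y : ℂ)
    (hy : InHalf h y) : Surface S :=
  Surface.mk S ⟨(j, h, ι y), hM.mem_closedHalf.2 hy⟩

theorem inHalf_zero (h : Bool) : InHalf h 0 := by cases h <;> simp [InHalf]

theorem inHalf_ofReal (h : Bool) (y : ℝ) : InHalf h y := by cases h <;> simp [InHalf]

theorem IsLocalModel.point_eq (hM : IsLocalModel S ι r L R) {j l : Fin 4} {y : ℝ} (hy : |y| < r)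
    (h : (0 ≤ y ∧ l = R j) ∨ (y ≤ 0 ∧ l = L j)) :
    hM.point j true y (inHalf_ofReal _ y) = hM.point l false y (inHalf_ofReal _ y) :=
  Quot.sound ((hM.glue j l y _ _ hy).2 h)

/-- The index of the upper half-sheet that is glued on the right to the given half-sheet. -/
def upperIndex (R : Equiv.Perm (Fin 4)) (P : HalfSheets) : Fin 4 :=
  if P.1.2.1 then P.1.1 else R.symm P.1.1

theorem IsLocalModel.of_glue (hM : IsLocalModel S ι r L R) {P Q : HalfSheets} (h : Glue S P Q)
    {u : ℂ} (hu : ‖u‖ < r) (hP : P.1.2.2 = ι u) :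
    ∃ y : ℝ, u = y ∧ P.1.2.1 = true ∧ Q.1.2.1 = false ∧ Q.1.2.2 = ι u ∧
      ((0 ≤ y ∧ upperIndex R Q = upperIndex R P) ∨
        (y ≤ 0 ∧ upperIndex R Q = (R⁻¹ * L) (upperIndex R P))) := by
  obtain ⟨⟨j, b, x⟩, hx⟩ := P
  obtain ⟨⟨l, b', x'⟩, hx'⟩ := Q
  have h0 := h
  obtain ⟨e1, e2, e3, -⟩ := h0
  simp only at e1 e2 e3 hP
  subst e1 e2 e3 hP
  have h1 := (hM.mem_true u).1 hx
  have h2 := (hM.mem_false u).1 hx'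
  obtain ⟨y, rfl⟩ : ∃ y : ℝ, u = y :=
    ⟨u.re, Complex.ext rfl (by simpa using le_antisymm h2 h1)⟩
  rw [norm_real, Real.norm_eq_abs] at hu
  refine ⟨y, rfl, rfl, rfl, rfl, ?_⟩
  rcases (hM.glue j l y hx hx' hu).1 h with ⟨hy, rfl⟩ | ⟨hy, rfl⟩
  · exact Or.inl ⟨hy, by simp [upperIndex]⟩
  · exact Or.inr ⟨hy, by simp [upperIndex]⟩

theorem continuousOn_halfSheets {f : Fin 4 → Bool → OnePoint ℂ → ℂ} {K : Set HalfSheets}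
    {B : Set (OnePoint ℂ)} (hf : ∀ j h, ContinuousOn (f j h) (B ∩ closedHalf h))
    (hK : ∀ P ∈ K, P.1.2.2 ∈ B) : ContinuousOn (fun P : HalfSheets => f P.1.1 P.1.2.1 P.1.2.2) K := by
  have h : ContinuousOn (fun P : Fin 4 × Bool × OnePoint ℂ => f P.1 P.2.1 P.2.2)
      {P | P.2.2 ∈ B ∩ closedHalf P.2.1} := by
    rw [continuousOn_prod_of_discrete_left]
    intro j
    rw [continuousOn_prod_of_discrete_left]
    intro h
    exact hf j h
  exact h.comp continuous_subtype_val.continuousOn fun P hP => ⟨hK P hP, P.2⟩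

theorem isClosed_halfSheets {F : Set (Fin 4 × Bool)} {B : Set (OnePoint ℂ)} (hB : IsClosed B) :
    IsClosed {P : HalfSheets | P.1.2.2 ∈ B ∧ (P.1.1, P.1.2.1) ∈ F} :=
  (hB.preimage (by fun_prop)).inter ((isClosed_discrete F).preimage (by fun_prop))

theorem isOpen_halfSheets {F : Set (Fin 4 × Bool)} {B : Set (OnePoint ℂ)} (hB : IsOpen B) :
    IsOpen {P : HalfSheets | P.1.2.2 ∈ B ∧ (P.1.1, P.1.2.1) ∈ F} :=
  (hB.preimage (by fun_prop)).inter ((isOpen_discrete F).preimage (by fun_prop))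

theorem _root_.Topology.IsOpenEmbedding.continuousOn_invFun {X Y : Type*} [TopologicalSpace X]
    [TopologicalSpace Y] [Nonempty X] {f : X → Y} (hf : IsOpenEmbedding f) :
    ContinuousOn (Function.invFun f) (range f) := by
  rintro _ ⟨x, rfl⟩
  refine (hf.continuousAt_iff.1 ?_).continuousWithinAt
  rw [show Function.invFun f ∘ f = id from (Function.leftInverse_invFun hf.injective).comp_eq_id]
  exact continuousAt_id

/-- The chart around a point over `ℝ ∪ {∞}`. -/
theorem IsLocalModel.exists_chart (hM : IsLocalModel S ι r L R) (j₀ : Fin 4) :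
    ∃ (k : ℕ) (ρ : ℝ) (e : OpenPartialHomeomorph (Surface S) ℂ), k ≠ 0 ∧ 0 < ρ ∧ ρ < r ∧
      e.target = {ζ | ‖ζ‖ ^ k < ρ} ∧
      hM.point j₀ true 0 (inHalf_zero true) ∈ e.source ∧
      e.symm 0 = hM.point j₀ true 0 (inHalf_zero true) ∧
      (∀ ζ ∈ e.target, Surface.proj (e.symm ζ) = ι (ζ ^ k)) ∧
      (L = R → k = 1 ∧ (∀ ζ ∈ e.target, ∀ h, e.symm ζ = hM.point j₀ true ζ h) ∧
        ∀ ζ ∈ e.target, ∀ h, e.symm ζ = hM.point (R j₀) false ζ h) := by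
  obtain ⟨k, O, e, hk, hj₀, hOm, hek, hem, heinj, hesurj, hconn, htriv⟩ :=
    exists_cycle_label (R⁻¹ * L) j₀
  set m := R⁻¹ * L with hm
  have hRm : ∀ j, R (m j) = L j := fun j => by simp [hm]
  set κ := Function.invFun ι with hκ
  have hκι : ∀ y, κ (ι y) = y := Function.leftInverse_invFun hM.isOpenEmbedding.injective
  have hr := hM.pos
  set ρ := r / 2 with hρ
  set F : Set (Fin 4 × Bool) := {i | (if i.2 then i.1 else R.symm i.1) ∈ O} with hF
  set A : Set HalfSheets := {P | P.1.2.2 ∈ ι '' ball 0 ρ ∧ (P.1.1, P.1.2.1) ∈ F} with hA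
  set K : Set HalfSheets := {P | P.1.2.2 ∈ ι '' closedBall 0 ρ ∧ (P.1.1, P.1.2.1) ∈ F} with hK
  -- The coordinate is a k-th root of y times a root of unity chosen by the sheet. Gluing along y ≥
  -- 0 keeps `upperIndex`; gluing along y ≤ 0 applies the monodromy R⁻¹L, and the factor e^(2πi/k)
  -- of its labels is exactly the jump of `halfRoot`. So `g` agrees on glued points.
  set g : HalfSheets → ℂ := fun P => e (upperIndex R P) * halfRoot k P.1.2.1 (κ P.1.2.2) with hg
  have hsat : ∀ B : Set ℂ, B ⊆ ball 0 r → ∀ P Q, Glue S P Q →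
      ((P.1.2.2 ∈ ι '' B ∧ (P.1.1, P.1.2.1) ∈ F) ↔ (Q.1.2.2 ∈ ι '' B ∧ (Q.1.1, Q.1.2.1) ∈ F)) := by
    intro B hB P Q h
    rw [← h.2.2.1]
    refine and_congr_right ?_
    rintro ⟨u, hu, hPu⟩
    obtain ⟨y, -, -, -, -, h⟩ := hM.of_glue h (mem_ball_zero_iff.1 (hB hu)) hPu.symm
    change upperIndex R P ∈ O ↔ upperIndex R Q ∈ O
    rcases h with ⟨-, h⟩ | ⟨-, h⟩
    · rw [h]
    · rw [h]; exact (hOm _).symm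
  have hρr : closedBall (0 : ℂ) ρ ⊆ ball 0 r := closedBall_subset_ball (by linarith)
  have hgk : ∀ P ∈ K, g P ^ k = κ P.1.2.2 := by
    rintro P ⟨-, hP⟩
    rw [hg, mul_pow, halfRoot_pow hk, hek (upperIndex R P) hP, one_mul]
  have hgs : ∀ P Q, Glue S P Q → P ∈ K → g P = g Q := by
    rintro P Q h ⟨⟨u, hu, hPu⟩, hPO⟩
    obtain ⟨y, rfl, hPt, hQf, hQu, h⟩ := hM.of_glue h (mem_ball_zero_iff.1 (hρr hu)) hPu.symm
    simp only [hg, hPt, hQf, hQu, ← hPu, hκι]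
    rcases h with ⟨hy, h⟩ | ⟨hy, h⟩
    · rw [h, halfRoot_of_nonneg k hy]
    · rw [h, halfRoot_of_nonpos hk hy, ← hm, hem (upperIndex R P) hPO]; ring
  -- Over 0 both gluings apply, so all half-sheets of the cycle share one point, which is the branch
  -- point if k > 1.
  have hzero : ∀ j ∈ O, hM.point j true 0 (inHalf_zero true) =
      hM.point j₀ true 0 (inHalf_zero true) := by
    intro j hj
    obtain ⟨n, rfl⟩ := hconn j hj
    induction n with
    | zero => rfl
    | succ n ih =>
      have hj' := hj
      rw [Function.iterate_succ_apply'] at hj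
      rw [← ih ((hOm _).1 hj)]
      have h0 : |(0 : ℝ)| < r := by simpa using hr
      have e1 := hM.point_eq (j := m^[n + 1] j₀) (l := L (m^[n] j₀)) h0
        (Or.inl ⟨le_rfl, by rw [Function.iterate_succ_apply', hRm]⟩)
      have e2 := hM.point_eq (j := m^[n] j₀) (l := L (m^[n] j₀)) h0 (Or.inr ⟨le_rfl, rfl⟩)
      simp only [ofReal_zero] at e1 e2
      exact e1.trans e2.symm
  -- An upper and a lower half meet over a real y ≠ 0 only. The root can be cancelled there, and
  -- injectivity of the labels shows that the sheets are those glued on that side.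
  have hmixed : ∀ P ∈ K, ∀ Q ∈ K, P.1.2.1 = true → Q.1.2.1 = false → P.1.2.2 = Q.1.2.2 →
      κ P.1.2.2 ≠ 0 → g P = g Q → Surface.mk S P = Surface.mk S Q := by
    rintro ⟨⟨j, _, x⟩, hx⟩ ⟨⟨u, hu, hPu⟩, hPO⟩ ⟨⟨l, _, x'⟩, hx'⟩ ⟨-, hQO⟩ hPt hQf hxx hne heq
    simp only at hPt hQf hxx hPu
    subst hPt hQf hxx hPu
    have h1 := (hM.mem_true u).1 hx
    have h2 := (hM.mem_false u).1 hx'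
    obtain ⟨y, rfl⟩ : ∃ y : ℝ, u = y :=
      ⟨u.re, Complex.ext rfl (by simpa using le_antisymm h2 h1)⟩
    simp only [hκι] at hne
    have hyr : |y| < r := by simpa using hρr hu
    simp only [hg, upperIndex, hκι, if_true, Bool.false_eq_true, if_false] at heq
    simp only [hF, mem_ofPred_eq, if_true, Bool.false_eq_true, if_false] at hPO hQO
    have hrne : halfRoot k false (y : ℂ) ≠ 0 := fun h => hne (by
      rw [← halfRoot_pow hk false (y : ℂ), h, zero_pow hk])
    refine hM.point_eq hyr ?_
    rcases le_total 0 y with hy | hy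
    · rw [halfRoot_of_nonneg k hy] at heq
      have := heinj hPO hQO (mul_right_cancel₀ hrne heq)
      exact Or.inl ⟨hy, by rw [this, Equiv.apply_symm_apply]⟩
    · rw [halfRoot_of_nonpos hk hy, ← mul_assoc, mul_comm (e j), ← hem j hPO] at heq
      have := heinj ((hOm j).2 hPO) hQO (mul_right_cancel₀ hrne heq)
      exact Or.inr ⟨hy, by rw [← hRm, this, Equiv.apply_symm_apply]⟩
  have hinj : ∀ P ∈ K, ∀ Q ∈ K, g P = g Q → Surface.mk S P = Surface.mk S Q := by
    intro P hP Q hQ heq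
    have hpos : P.1.2.2 = Q.1.2.2 := by
      have := congrArg (· ^ k) heq
      simp only [hgk P hP, hgk Q hQ] at this
      obtain ⟨⟨u, -, hu⟩, -⟩ := hP
      obtain ⟨⟨v, -, hv⟩, -⟩ := hQ
      rw [← hu, ← hv, hκι, hκι] at this
      rw [← hu, ← hv, this]
    by_cases hne : κ P.1.2.2 = 0
    · have hz : ∀ P ∈ K, κ P.1.2.2 = 0 →
          Surface.mk S P = hM.point j₀ true 0 (inHalf_zero true) := by
        rintro ⟨⟨j, b, x⟩, hx⟩ ⟨⟨u, hu, hPu⟩, hPO⟩ h0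
        simp only at hPu h0
        subst hPu
        rw [hκι] at h0
        subst h0
        have h0 : |(0 : ℝ)| < r := by simpa using hr
        cases b
        · have e1 := hM.point_eq (j := R.symm j) (l := j) h0 (Or.inl ⟨le_rfl, by simp⟩)
          simp only [ofReal_zero] at e1
          rw [← hzero _ hPO]
          exact e1.symm
        · exact hzero j hPO
      rw [hz P hP hne, hz Q hQ (hpos ▸ hne)]
    · rcases hb : P.1.2.1 with _ | _ <;> rcases hb' : Q.1.2.1 with _ | _
      case false.true =>
        exact (hmixed Q hQ P hP hb' hb hpos.symm (hpos ▸ hne) heq.symm).symm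
      case true.false => exact hmixed P hP Q hQ hb hb' hpos hne heq
      all_goals
        have hrne : halfRoot k P.1.2.1 (κ P.1.2.2) ≠ 0 := fun h => hne (by
          rw [← halfRoot_pow hk P.1.2.1 (κ P.1.2.2), h, zero_pow hk])
        have hbb : P.1.2.1 = Q.1.2.1 := hb.trans hb'.symm
        simp only [hg, ← hpos, ← hbb] at heq
        have := heinj hP.2 hQ.2 (mul_right_cancel₀ hrne heq)
        simp only [hb, hb', Bool.false_eq_true, if_true, if_false] at this
        congr 1
        refine Subtype.ext (Prod.ext ?_ (Prod.ext hbb hpos))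
        simpa using this
  have hcont : ContinuousOn g K := by
    refine continuousOn_halfSheets (f := fun j h x => e (if h then j else R.symm j) *
      halfRoot k h (κ x)) (B := ι '' closedBall 0 ρ) (fun j h => ?_) fun P hP => hP.1
    refine continuousOn_const.mul ((continuousOn_halfRoot hk h).comp
      (hM.isOpenEmbedding.continuousOn_invFun.mono fun x hx => ?_) ?_)
    · exact image_subset_range _ _ hx.1
    · rintro _ ⟨⟨u, -, rfl⟩, hx⟩
      rw [hκι]
      exact hM.mem_closedHalf.1 hx
  have hnorm : ∀ P ∈ K, ‖g P‖ ^ k = ‖κ P.1.2.2‖ := fun P hP => by rw [← norm_pow, hgk P hP]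
  have hsurj : ∀ ζ ∈ {ζ : ℂ | ‖ζ‖ ^ k < ρ}, ∃ P ∈ A, g P = ζ := by
    intro ζ hζ
    obtain ⟨b, hb⟩ : ∃ b, InHalf b (ζ ^ k) := by
      rcases le_total 0 (ζ ^ k).im with h | h
      exacts [⟨true, h⟩, ⟨false, h⟩]
    have hζm : ζ ^ k ∈ ball (0 : ℂ) ρ := by rw [mem_ball_zero_iff, norm_pow]; exact hζ
    obtain ⟨u, hu, hζu⟩ : ∃ u : ℂ, u ^ k = 1 ∧ u * halfRoot k b (ζ ^ k) = ζ := by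
      by_cases hζ0 : ζ = 0
      · exact ⟨1, one_pow _, by rw [hζ0, zero_pow hk, halfRoot_zero hk, mul_zero]⟩
      · have hne : halfRoot k b (ζ ^ k) ≠ 0 := fun h => hζ0 (pow_eq_zero_iff hk |>.1 (by
          rw [← halfRoot_pow hk b (ζ ^ k), h, zero_pow hk]))
        exact ⟨ζ / halfRoot k b (ζ ^ k), by
          rw [div_pow, halfRoot_pow hk, div_self (pow_ne_zero k hζ0)], div_mul_cancel₀ _ hne⟩
    obtain ⟨j, hj, rfl⟩ := hesurj u hu
    have hidx : (if b then (if b then j else R j) else R.symm (if b then j else R j)) = j := by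
      cases b <;> simp
    refine ⟨⟨(if b then j else R j, b, ι (ζ ^ k)), hM.mem_closedHalf.2 hb⟩,
      ⟨⟨_, hζm, rfl⟩, ?_⟩, ?_⟩
    · change (if b then (if b then j else R j) else R.symm (if b then j else R j)) ∈ O
      rwa [hidx]
    · simp only [hg, upperIndex, hκι, hidx]
      exact hζu
  have hT : IsOpen {ζ : ℂ | ‖ζ‖ ^ k < ρ} := isOpen_lt (by fun_prop) continuous_const
  have hAK : A ⊆ K := fun P hP => ⟨image_mono ball_subset_closedBall hP.1, hP.2⟩
  obtain ⟨c, hcs, hct, hc, hcinv⟩ := exists_openPartialHomeomorph_of_separates (A := A) (K := K)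
    (T := {ζ : ℂ | ‖ζ‖ ^ k < ρ})
    (isOpen_halfSheets (hM.isOpenEmbedding.isOpenMap _ isOpen_ball))
    (isClosed_halfSheets ((isCompact_closedBall 0 ρ).image
      hM.isOpenEmbedding.continuous).isClosed) hAK hT
    (hsat _ (ball_subset_closedBall.trans hρr)) (hsat _ hρr) hcont hgs hinj
    (fun P hP => by
      rw [mem_ofPred_eq, hnorm P hP]
      obtain ⟨⟨u, hu, hPu⟩, hPO⟩ := hP
      rw [← hPu, hκι]
      constructor
      · intro h; exact ⟨⟨u, mem_ball_zero_iff.2 h, hPu⟩, hPO⟩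
      · rintro ⟨⟨v, hv, hPv⟩, -⟩
        rw [← hPu] at hPv
        rw [← hM.isOpenEmbedding.injective hPv]
        exact mem_ball_zero_iff.1 hv) hsurj
  have hP₀ : (⟨(j₀, true, ι 0), hM.mem_closedHalf.2 (inHalf_zero true)⟩ : HalfSheets) ∈ A :=
    ⟨⟨0, by simp [hρ, hr], rfl⟩, hj₀⟩
  refine ⟨k, ρ, c, hk, by positivity, by linarith, hct, hcs ▸ ⟨_, hP₀, rfl⟩, ?_, fun ζ hζ => ?_,
    fun hLR => ?_⟩
  · have : g ⟨(j₀, true, ι 0), hM.mem_closedHalf.2 (inHalf_zero true)⟩ = 0 := by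
      simp only [hg, hκι, halfRoot_zero hk, mul_zero]
    exact (congrArg c.symm this).symm.trans (hcinv _ hP₀)
  · rw [hct] at hζ
    obtain ⟨P, hP, rfl⟩ := hsurj ζ hζ
    rw [hcinv P hP, hgk P (hAK hP)]
    obtain ⟨⟨u, -, hu⟩, -⟩ := hP
    change P.1.2.2 = _
    rw [← hu, hκι]
  · obtain ⟨rfl, -, he1⟩ := htriv (by rw [hm, hLR, inv_mul_cancel]; rfl)
    refine ⟨rfl, fun ζ hζ h => ?_, fun ζ hζ h => ?_⟩
    · rw [hct, mem_ofPred_eq, pow_one] at hζ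
      have hP : (⟨(j₀, true, ι ζ), hM.mem_closedHalf.2 h⟩ : HalfSheets) ∈ A :=
        ⟨⟨ζ, mem_ball_zero_iff.2 hζ, rfl⟩, hj₀⟩
      have : g ⟨(j₀, true, ι ζ), hM.mem_closedHalf.2 h⟩ = ζ := by
        simp [hg, upperIndex, hκι, halfRoot_one, he1]
      exact (congrArg c.symm this).symm.trans (hcinv _ hP)
    · rw [hct, mem_ofPred_eq, pow_one] at hζ
      have hP : (⟨(R j₀, false, ι ζ), hM.mem_closedHalf.2 h⟩ : HalfSheets) ∈ A :=
        ⟨⟨ζ, mem_ball_zero_iff.2 hζ, rfl⟩, by simpa [hF] using hj₀⟩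
      have : g ⟨(R j₀, false, ι ζ), hM.mem_closedHalf.2 h⟩ = ζ := by
        simp [hg, upperIndex, hκι, halfRoot_one, he1]
      exact (congrArg c.symm this).symm.trans (hcinv _ hP)

theorem inHalf_of_mem_closedBall {h : Bool} {z₀ z : ℂ} (hz₀ : z₀.im ≠ 0) (hh : InHalf h z₀)
    (hz : z ∈ closedBall z₀ (|z₀.im| / 2)) : InHalf h z ∧ z.im ≠ 0 := by
  rw [mem_closedBall, Complex.dist_eq] at hz
  have h1 := (abs_im_le_norm (z - z₀)).trans hz
  rw [sub_im] at h1
  have h2 := abs_le.1 h1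
  cases h
  · have hh : z₀.im < 0 := lt_of_le_of_ne hh hz₀
    rw [abs_of_neg hh] at h2
    exact ⟨by change z.im ≤ 0; linarith, by intro; linarith⟩
  · have hh : 0 < z₀.im := lt_of_le_of_ne hh hz₀.symm
    rw [abs_of_pos hh] at h2
    exact ⟨by change 0 ≤ z.im; linarith, by intro; linarith⟩

/-- The chart around a point that does not lie over `ℝ ∪ {∞}`. -/
theorem exists_chart_of_im_ne_zero {z₀ : ℂ} (hz₀ : z₀.im ≠ 0) (j : Fin 4) {h : Bool}
    (hh : InHalf h z₀) :
    ∃ e : OpenPartialHomeomorph (Surface S) ℂ, z₀ ∈ e.target ∧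
      Surface.mk S ⟨(j, h, z₀), coe_mem_closedHalf.2 hh⟩ ∈ e.source ∧
      ∀ z ∈ e.target, z.im ≠ 0 ∧
        ∃ hz : InHalf h z, e.symm z = Surface.mk S ⟨(j, h, z), coe_mem_closedHalf.2 hz⟩ := by
  set ρ := |z₀.im| / 2 with hρ
  have hρ0 : 0 < ρ := half_pos (abs_pos.2 hz₀)
  have hκ : ∀ z : ℂ, Function.invFun OnePoint.some ((z : ℂ) : OnePoint ℂ) = z :=
    Function.leftInverse_invFun (OnePoint.coe_injective (X := ℂ))
  set A : Set HalfSheets := {P | P.1.2.2 ∈ OnePoint.some '' ball z₀ ρ ∧ (P.1.1, P.1.2.1) ∈ ({(j, h)} : Set _)}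
    with hA
  set K : Set HalfSheets := {P | P.1.2.2 ∈ OnePoint.some '' closedBall z₀ ρ ∧
    (P.1.1, P.1.2.1) ∈ ({(j, h)} : Set _)} with hK
  have hglue : ∀ P Q, Glue S P Q → P.1.2.2 ∉ OnePoint.some '' closedBall z₀ ρ := by
    rintro P Q hPQ ⟨z, hz, e⟩
    have h1 := P.2
    have h2 := Q.2
    rw [hPQ.1, ← e, coe_mem_closedHalf_true_iff] at h1
    rw [hPQ.2.1, ← hPQ.2.2.1, ← e, coe_mem_closedHalf_false_iff] at h2
    exact (inHalf_of_mem_closedBall hz₀ hh hz).2 (le_antisymm h2 h1)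
  have hsat : ∀ B ⊆ closedBall z₀ ρ, ∀ P Q, Glue S P Q →
      ((P.1.2.2 ∈ OnePoint.some '' B ∧ (P.1.1, P.1.2.1) ∈ ({(j, h)} : Set _)) ↔
        (Q.1.2.2 ∈ OnePoint.some '' B ∧ (Q.1.1, Q.1.2.1) ∈ ({(j, h)} : Set _))) := by
    intro B hB P Q hPQ
    have hn := fun hP => hglue P Q hPQ (image_mono hB hP)
    exact ⟨fun hP => absurd hP.1 hn, fun hQ => absurd (hPQ.2.2.1 ▸ hQ.1) hn⟩
  have hmem : ∀ P ∈ K, ∃ z, ∃ hz : z ∈ closedBall z₀ ρ, P = ⟨(j, h, z), coe_mem_closedHalf.2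
      (inHalf_of_mem_closedBall hz₀ hh hz).1⟩ := by
    rintro ⟨⟨l, b, x⟩, hx⟩ ⟨⟨z, hz, rfl⟩, hP⟩
    obtain ⟨rfl, rfl⟩ : l = j ∧ b = h := by simpa using hP
    exact ⟨z, hz, rfl⟩
  obtain ⟨c, hcs, hct, hc, hcinv⟩ := exists_openPartialHomeomorph_of_separates (S := S) (A := A)
    (K := K) (T := ball z₀ ρ) (g := fun P => Function.invFun OnePoint.some P.1.2.2)
    (isOpen_halfSheets (isOpenEmbedding_coe.isOpenMap _ isOpen_ball))
    (isClosed_halfSheets ((isCompact_closedBall z₀ ρ).image continuous_coe).isClosed)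
    (fun P hP => ⟨image_mono ball_subset_closedBall hP.1, hP.2⟩) isOpen_ball
    (hsat _ ball_subset_closedBall) (hsat _ subset_rfl)
    (isOpenEmbedding_coe.continuousOn_invFun.comp (by fun_prop)
      fun P hP => image_subset_range _ _ hP.1)
    (fun P Q hPQ hP => absurd hP.1 (hglue P Q hPQ))
    (fun P hP Q hQ e => by
      obtain ⟨z, hz, rfl⟩ := hmem P hP
      obtain ⟨w, hw, rfl⟩ := hmem Q hQ
      simp only [hκ] at e
      subst e
      rfl)
    (fun P hP => by
      obtain ⟨z, hz, rfl⟩ := hmem P hP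
      simp [hA, hκ])
    (fun ζ hζ => ⟨⟨(j, h, ζ), coe_mem_closedHalf.2
      (inHalf_of_mem_closedBall hz₀ hh (ball_subset_closedBall hζ)).1⟩, ⟨⟨ζ, hζ, rfl⟩, rfl⟩, hκ ζ⟩)
  have hz0 : z₀ ∈ ball z₀ ρ := mem_ball_self hρ0
  refine ⟨c, hct ▸ hz0, hcs ▸ ⟨⟨(j, h, z₀), coe_mem_closedHalf.2 hh⟩,
    ⟨⟨z₀, hz0, rfl⟩, rfl⟩, rfl⟩, fun z hz => ?_⟩
  rw [hct] at hz
  have hz' := inHalf_of_mem_closedBall hz₀ hh (ball_subset_closedBall hz)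
  refine ⟨hz'.2, hz'.1, ?_⟩
  have := hcinv ⟨(j, h, z), coe_mem_closedHalf.2 hz'.1⟩ ⟨⟨z, hz, rfl⟩, rfl⟩
  rwa [hκ] at this

theorem SphereAnalyticAt.congr {f g : ℂ → OnePoint ℂ} {w : ℂ} (hf : SphereAnalyticAt f w)
    (h : ∀ᶠ u in 𝓝 w, g u = f u) : SphereAnalyticAt g w := by
  rcases hf with ⟨F, hF, hFe⟩ | ⟨F, hF, hFe⟩
  · exact Or.inl ⟨F, hF, (h.and hFe).mono fun u hu => hu.1.trans hu.2⟩
  · exact Or.inr ⟨F, hF, (h.and hFe).mono fun u hu => hu.1.trans hu.2⟩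

theorem sphereAnalyticAt_coe {f : ℂ → ℂ} {w : ℂ} (hf : AnalyticAt ℂ f w) :
    SphereAnalyticAt (fun u => (f u : OnePoint ℂ)) w := Or.inl ⟨f, hf, .of_forall fun _ => rfl⟩

theorem IsLocalModel.mem_holomorphicCharts (hM : IsLocalModel S ι r L R) {k : ℕ}
    {e : OpenPartialHomeomorph (Surface S) ℂ}
    (he : ∀ ζ ∈ e.target, Surface.proj (e.symm ζ) = ι (ζ ^ k)) : e ∈ holomorphicCharts S :=
  fun w hw => (hM.sphereAnalyticAt (fun u => u ^ k) w (by fun_prop)).congr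
    (eventually_of_mem (e.open_target.mem_nhds hw) he)

theorem mem_holomorphicCharts_of_im_ne_zero {j : Fin 4} {h : Bool}
    {e : OpenPartialHomeomorph (Surface S) ℂ} (he : ∀ z ∈ e.target, z.im ≠ 0 ∧
        ∃ hz : InHalf h z, e.symm z = Surface.mk S ⟨(j, h, z), coe_mem_closedHalf.2 hz⟩) :
    e ∈ holomorphicCharts S :=
  fun w hw => (sphereAnalyticAt_coe analyticAt_id).congr
    (eventually_of_mem (e.open_target.mem_nhds hw) fun u hu => by
      obtain ⟨-, hz, hu⟩ := he u hu
      rw [hu]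
      rfl)

variable {c₁ c₃ p q : ℝ}

/-- Every point lies over a non-real point, over a real point or over infinity. -/
theorem surface_cases (P : Surface S) :
    (∃ z : ℂ, z.im ≠ 0 ∧ ∃ j h, ∃ hz : InHalf h z,
      P = Surface.mk S ⟨(j, h, z), coe_mem_closedHalf.2 hz⟩) ∨
    (∃ x : ℝ, Surface.proj P = ((x : ℂ) : OnePoint ℂ)) ∨ Surface.proj P = infty := by
  obtain ⟨⟨⟨j, h, x⟩, hx⟩⟩ := P
  induction x using OnePoint.rec with
  | infty => exact Or.inr (Or.inr rfl)
  | coe z =>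
    by_cases hz : z.im = 0
    · exact Or.inr (Or.inl ⟨z.re, congrArg OnePoint.some (Complex.ext rfl hz : z = z.re)⟩)
    · exact Or.inl ⟨z, hz, j, h, coe_mem_closedHalf.1 hx, rfl⟩

theorem IsLocalModel.exists_eq_point (hM : IsLocalModel S ι r L R) {P : Surface S}
    (hP : Surface.proj P = ι 0) : ∃ j, P = hM.point j true 0 (inHalf_zero true) := by
  obtain ⟨⟨⟨j, h, x⟩, hx⟩⟩ := P
  obtain rfl : x = ι 0 := hP
  cases h
  · have h0 : |(0 : ℝ)| < r := by simpa using hM.pos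
    have e1 := hM.point_eq (j := R.symm j) (l := j) h0 (Or.inl ⟨le_rfl, by simp⟩)
    simp only [ofReal_zero] at e1
    exact ⟨_, e1.symm⟩
  · exact ⟨j, rfl⟩

theorem exists_mem_holomorphicCharts (hc₁ : 0 ≤ c₁) (hc₃ : 0 ≤ c₃) (hp : 0 ≤ p) (hpq : p < q)
    (P : Surface (stdCuts c₁ c₃ p q)) :
    ∃ e ∈ holomorphicCharts (stdCuts c₁ c₃ p q), P ∈ e.source := by
  have key : ∀ {ι r L R} (hM : IsLocalModel (stdCuts c₁ c₃ p q) ι r L R), Surface.proj P = ι 0 →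
      ∃ e ∈ holomorphicCharts (stdCuts c₁ c₃ p q), P ∈ e.source := by
    intro ι r L R hM hP
    obtain ⟨j, rfl⟩ := hM.exists_eq_point hP
    obtain ⟨k, ρ, e, -, -, -, -, hs, -, he, -⟩ := hM.exists_chart j
    exact ⟨e, hM.mem_holomorphicCharts he, hs⟩
  rcases surface_cases P with ⟨z, hz, j, h, hh, rfl⟩ | ⟨x, hx⟩ | hP
  · obtain ⟨e, -, hs, he⟩ := exists_chart_of_im_ne_zero hz j hh
    exact ⟨e, mem_holomorphicCharts_of_im_ne_zero he, hs⟩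
  · obtain ⟨r, hM⟩ := exists_isLocalModel_coe hc₁ hc₃ hp hpq x
    exact key hM (by simpa using hx)
  · obtain ⟨r, hM⟩ := exists_isLocalModel_infty hc₁ hc₃ hp hpq
    exact key hM (by simpa using hP)

end Charts

/-! ### The complex structure of the surface -/

section ComplexStructure

open Complex Metric Set Filter OnePoint

variable {S : Fin 3 → Set ℝ}

theorem SphereAnalyticAt.comp {F : ℂ → OnePoint ℂ} {τ : ℂ → ℂ} {w : ℂ}
    (hF : SphereAnalyticAt F (τ w)) (hτ : AnalyticAt ℂ τ w) :
    SphereAnalyticAt (fun u => F (τ u)) w := by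
  rcases hF with ⟨f, hf, hFe⟩ | ⟨f, hf, hFe⟩
  · exact Or.inl ⟨fun u => f (τ u), hf.comp hτ, hτ.continuousAt.eventually hFe⟩
  · exact Or.inr ⟨fun u => f (τ u), hf.comp hτ, hτ.continuousAt.eventually hFe⟩

theorem SphereAnalyticAt.eventually_continuousAt {F : ℂ → OnePoint ℂ} {w : ℂ}
    (hF : SphereAnalyticAt F w) : ∀ᶠ u in 𝓝 w, ContinuousAt F u := by
  rcases hF with ⟨f, hf, hFe⟩ | ⟨f, hf, hFe⟩
  · filter_upwards [hf.eventually_analyticAt, hFe.eventually_nhds] with u hu hFu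
    exact (continuous_coe.continuousAt.comp hu.continuousAt).congr (hFu.mono fun _ h => h.symm)
  · filter_upwards [hf.eventually_analyticAt, hFe.eventually_nhds] with u hu hFu
    exact (isOpenEmbedding_sphereInv.continuous.continuousAt.comp hu.continuousAt).congr
      (hFu.mono fun _ h => h.symm)

theorem SphereAnalyticAt.exists_coe {F : ℂ → OnePoint ℂ} {w : ℂ} (hF : SphereAnalyticAt F w)
    (h : F w ≠ infty) : ∃ f : ℂ → ℂ, AnalyticAt ℂ f w ∧ ∀ᶠ u in 𝓝 w, F u = (f u : OnePoint ℂ) := by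
  rcases hF with hF | ⟨f, hf, hFe⟩
  · exact hF
  · have hf0 : f w ≠ 0 := fun h0 => h (by rw [hFe.self_of_nhds, h0, sphereInv_zero])
    refine ⟨fun u => (f u)⁻¹, hf.inv hf0, ?_⟩
    filter_upwards [hFe, hf.continuousAt.eventually_ne hf0] with u h1 h2
    rw [h1, sphereInv_of_ne_zero h2]

theorem SphereAnalyticAt.exists_sphereInv {F : ℂ → OnePoint ℂ} {w : ℂ} (hF : SphereAnalyticAt F w)
    (h : F w = infty) : ∃ f : ℂ → ℂ, AnalyticAt ℂ f w ∧ ∀ᶠ u in 𝓝 w, F u = sphereInv (f u) := by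
  rcases hF with ⟨f, hf, hFe⟩ | hF
  · exact absurd (hFe.self_of_nhds.symm.trans h) (OnePoint.coe_ne_infty _)
  · exact hF

/-- Since the two values coincide, the same standard coordinate of the sphere is usable for both
maps. -/
theorem SphereAnalyticAt.exists_common {F F' : ℂ → OnePoint ℂ} {w w' : ℂ}
    (hF : SphereAnalyticAt F w) (hF' : SphereAnalyticAt F' w') (h : F w = F' w') :
    ∃ (κ : ℂ → OnePoint ℂ) (f f' : ℂ → ℂ), Function.Injective κ ∧ AnalyticAt ℂ f w ∧
      AnalyticAt ℂ f' w' ∧ (∀ᶠ u in 𝓝 w, F u = κ (f u)) ∧ ∀ᶠ u in 𝓝 w', F' u = κ (f' u) := by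
  by_cases hw : F w = infty
  · obtain ⟨f, hf, hfe⟩ := hF.exists_sphereInv hw
    obtain ⟨f', hf', hfe'⟩ := hF'.exists_sphereInv (h ▸ hw)
    exact ⟨_, f, f', isOpenEmbedding_sphereInv.injective, hf, hf', hfe, hfe'⟩
  · obtain ⟨f, hf, hfe⟩ := hF.exists_coe hw
    obtain ⟨f', hf', hfe'⟩ := hF'.exists_coe (h ▸ hw)
    exact ⟨_, f, f', OnePoint.coe_injective, hf, hf', hfe, hfe'⟩

theorem AnalyticAt.eventually_eq_of_deriv_eq_zero {f : ℂ → ℂ} {w : ℂ} (hf : AnalyticAt ℂ f w)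
    (h : ∀ᶠ u in 𝓝 w, deriv f u = 0) : ∀ᶠ u in 𝓝 w, f u = f w := by
  obtain ⟨r, hr, hb⟩ := Metric.eventually_nhds_iff_ball.1 (h.and hf.eventually_analyticAt)
  filter_upwards [ball_mem_nhds w hr] with u hu
  exact isOpen_ball.is_const_of_deriv_eq_zero (convex_ball w r).isPreconnected
    (fun z hz => (hb z hz).2.differentiableAt.differentiableWithinAt) (fun z hz => (hb z hz).1) hu
    (mem_ball_self hr)

/-- A continuous solution `τ` of `f' ∘ τ = f` with `f` and `f'` analytic is analytic. -/
theorem analyticAt_of_comp_eq {τ f f' : ℂ → ℂ} {w : ℂ} (hτ : ∀ᶠ u in 𝓝 w, ContinuousAt τ u)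
    (hinj : ∀ᶠ u in 𝓝[≠] w, τ u ≠ τ w) (hf : AnalyticAt ℂ f w) (hf' : AnalyticAt ℂ f' (τ w))
    (hnc : ¬∀ᶠ v in 𝓝 (τ w), f' v = f' (τ w)) (e : ∀ᶠ u in 𝓝 w, f u = f' (τ u)) :
    AnalyticAt ℂ τ w := by
  have hτw := hτ.self_of_nhds
  -- As f' is not locally constant, its critical points are isolated. Off them τ is a local inverse
  -- of f' composed with f, hence differentiable, and the remaining point is removable by
  -- continuity.
  have hd : ∀ᶠ v in 𝓝[≠] (τ w), deriv f' v ≠ 0 :=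
    hf'.deriv.eventually_eq_zero_or_eventually_ne_zero.resolve_left fun h =>
      hnc (AnalyticAt.eventually_eq_of_deriv_eq_zero hf' h)
  have ht : Tendsto τ (𝓝[≠] w) (𝓝[≠] (τ w)) :=
    tendsto_nhdsWithin_iff.2 ⟨hτw.tendsto.mono_left nhdsWithin_le_nhds, hinj⟩
  refine Complex.analyticAt_of_differentiable_on_punctured_nhds_of_continuousAt ?_ hτw
  filter_upwards [ht.eventually hd, nhdsWithin_le_nhds hτ, nhdsWithin_le_nhds e.eventually_nhds,
    nhdsWithin_le_nhds hf.eventually_analyticAt,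
    nhdsWithin_le_nhds (hτw.eventually hf'.eventually_analyticAt)] with u h1 h2 h3 h4 h5
  have hs : HasStrictDerivAt f' (deriv f' (τ u)) (τ u) := h5.hasStrictDerivAt
  have hinv := hs.to_localInverse h1
  rw [← h3.self_of_nhds] at hinv
  refine (hinv.hasDerivAt.differentiableAt.comp u h4.differentiableAt).congr_of_eventuallyEq ?_
  have hl : ∀ᶠ v in 𝓝 (τ u), hs.localInverse f' _ _ h1 (f' v) = v :=
    (hs.hasStrictFDerivAt_equiv h1).eventually_left_inverse
  filter_upwards [h2.eventually hl, h3] with v hv hv'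
  rw [Function.comp_apply, hv', hv]

theorem finite_fiber (x : OnePoint ℂ) : {P : Surface S | Surface.proj P = x}.Finite := by
  classical
  refine ((Set.toFinite (univ : Set (Fin 4 × Bool))).image fun i =>
    if h : x ∈ closedHalf i.2 then Surface.mk S ⟨(i.1, i.2, x), h⟩
    else Surface.mk S ⟨(0, true, infty), infty_mem_closedHalf _⟩).subset ?_
  rintro ⟨⟨⟨j, h, y⟩, hy⟩⟩ hP
  obtain rfl : y = x := hP
  exact ⟨(j, h), mem_univ _, dif_pos hy⟩

/-- The coordinate changes are holomorphic. -/
theorem analyticAt_transition {e e' : OpenPartialHomeomorph (Surface S) ℂ}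
    (he : e ∈ holomorphicCharts S) (he' : e' ∈ holomorphicCharts S) {w : ℂ}
    (hw : w ∈ (e.symm.trans e').source) : AnalyticAt ℂ (fun u => e' (e.symm u)) w := by
  set τ : ℂ → ℂ := fun u => e' (e.symm u) with hτ
  have hsrc : ∀ u ∈ (e.symm.trans e').source, u ∈ e.target ∧ e.symm u ∈ e'.source := fun u hu => by
    simpa using hu
  have hopen := (e.symm.trans e').open_source
  have hev : ∀ᶠ u in 𝓝 w, u ∈ (e.symm.trans e').source := hopen.mem_nhds hw
  obtain ⟨hw1, hw2⟩ := hsrc w hw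
  have hsymm : ∀ u ∈ (e.symm.trans e').source, e'.symm (τ u) = e.symm u := fun u hu =>
    e'.left_inv (hsrc u hu).2
  have hτt : τ w ∈ e'.target := e'.map_source hw2
  obtain ⟨κ, f, f', hκ, hf, hf', hfe, hfe'⟩ := (he w hw1).exists_common (he' (τ w) hτt)
    (by rw [hsymm w hw])
  have hcont : ∀ u ∈ (e.symm.trans e').source, ContinuousAt τ u := fun u hu =>
    (e.symm.trans e').continuousOn.continuousAt (hopen.mem_nhds hu)
  refine analyticAt_of_comp_eq (hev.mono hcont) ?_ hf hf' (fun hconst => ?_) ?_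
  · filter_upwards [nhdsWithin_le_nhds hev, self_mem_nhdsWithin] with u hu hne h
    exact hne ((e.symm.trans e').injOn hu hw h)
  -- If the projection were constant in the chart, a whole neighbourhood would inject into a single
  -- fibre, which is finite.
  · have hfin : ∀ᶠ v in 𝓝 (τ w), v ∈ e'.target ∧
        v ∈ e'.symm ⁻¹' {P | Surface.proj P = κ (f' (τ w))} := by
      filter_upwards [hconst, hfe', e'.open_target.mem_nhds hτt] with v h1 h2 h3
      exact ⟨h3, h2.trans (congrArg κ h1)⟩
    have : (e'.target ∩ e'.symm ⁻¹' {P | Surface.proj P = κ (f' (τ w))}).Finite :=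
      Set.Finite.of_finite_image ((finite_fiber _).subset (by rintro _ ⟨v, hv, rfl⟩; exact hv.2))
        (e'.symm.injOn.mono inter_subset_left)
    exact (infinite_of_mem_nhds (τ w) hfin) this
  · filter_upwards [hev, hfe, (hcont w hw).eventually hfe'] with u h1 h2 h3
    refine hκ ?_
    rw [← h2, ← h3, hsymm u h1]

/-- The complex structure on the surface. -/
abbrev surfaceChartedSpace (h : ∀ P : Surface S, ∃ e ∈ holomorphicCharts S, P ∈ e.source) :
    ChartedSpace ℂ (Surface S) where
  atlas := holomorphicCharts S
  chartAt P := (h P).choose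
  mem_chart_source P := (h P).choose_spec.2
  chart_mem_atlas P := (h P).choose_spec.1

theorem isManifold_surface (h : ∀ P : Surface S, ∃ e ∈ holomorphicCharts S, P ∈ e.source) :
    let _ := surfaceChartedSpace h
    IsManifold (modelWithCornersSelf ℂ ℂ) ω (Surface S) := by
  let _ := surfaceChartedSpace h
  refine isManifold_of_contDiffOn _ _ _ fun e e' he he' w hw => ?_
  have hw : w ∈ (e.symm.trans e').source := by simpa using hw
  exact ((analyticAt_transition he he' hw).contDiffAt (n := ω)).contDiffWithinAt

end ComplexStructure

/-! ### Meromorphic continuation to the surface -/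

section Extension

open Complex Metric Set Filter OnePoint

/-- The points of the half-sheets that do not lie over `ℝ ∪ {∞}`. -/
def nonrealPoints : Set HalfSheets := {P | ∃ z : ℂ, z.im ≠ 0 ∧ P.1.2.2 = z}

variable {S : Fin 3 → Set ℝ}

/-- Gluing takes place over ℝ ∪ {∞} only, so a non-real point of the surface has a single
representative. -/
theorem eq_of_mk_eq {P Q : HalfSheets} (hP : P ∈ nonrealPoints)
    (e : Surface.mk S Q = Surface.mk S P) : Q = P := by
  obtain ⟨z, hz, hPz⟩ := hP
  have hglue : ∀ P' Q', Glue S P' Q' → P'.1.2.2 ≠ P.1.2.2 := by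
    intro P' Q' h he
    have h1 := P'.2
    have h2 := Q'.2
    rw [h.1, he, hPz, coe_mem_closedHalf_true_iff] at h1
    rw [h.2.1, ← h.2.2.1, he, hPz, coe_mem_closedHalf_false_iff] at h2
    exact hz (le_antisymm h2 h1)
  have : Q ∈ Surface.mk S ⁻¹' (Surface.mk S '' {P}) := ⟨P, rfl, e.symm⟩
  rw [preimage_mk_image_mk] at this
  · exact this
  · intro P' Q' h
    have h1 := hglue P' Q' h
    refine ⟨fun h' => absurd (by rw [mem_singleton_iff.1 h']) h1,
      fun h' => absurd (by rw [h.2.2.1, mem_singleton_iff.1 h']) h1⟩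

/-- The filter of non-real points that converge to a point of the surface. -/
def surfaceFilter (X : Surface S) : Filter HalfSheets :=
  comap (Surface.mk S) (𝓝 X) ⊓ 𝓟 nonrealPoints

/-- The vertical direction into a half-plane. -/
def vert (h : Bool) (s : ℝ) : ℂ := ((if h then |s| else -|s| : ℝ) : ℂ) * I

theorem inHalf_vert (h : Bool) (s : ℝ) : InHalf h (vert h s) := by
  cases h <;> simp [InHalf, vert]

theorem vert_im_ne_zero (h : Bool) {s : ℝ} (hs : 0 < s) : (vert h s).im ≠ 0 := by
  cases h <;> simp [vert, hs.ne']

theorem vert_zero (h : Bool) : vert h 0 = 0 := by cases h <;> simp [vert]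

theorem continuous_vert (h : Bool) : Continuous (vert h) := by
  change Continuous fun s => vert h s
  cases h <;> simp only [vert, if_true, Bool.false_eq_true, if_false] <;> fun_prop

/-- Vertical approach from inside a half-sheet. It shows that the filter is nontrivial, so that
limits along it are unique, and computes these limits at points of the sheets. -/
theorem tendsto_surfaceFilter {ι : ℂ → OnePoint ℂ} (hι : Continuous ι) (j : Fin 4) (h : Bool)
    (hmem : ∀ s, ι (vert h s) ∈ closedHalf h)
    (hne : ∀ s > 0, ∃ z : ℂ, z.im ≠ 0 ∧ ι (vert h s) = z) :
    Tendsto (fun s => (⟨(j, h, ι (vert h s)), hmem s⟩ : HalfSheets)) (𝓝[>] 0)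
      (surfaceFilter (Surface.mk S ⟨(j, h, ι (vert h 0)), hmem 0⟩)) := by
  refine tendsto_inf.2 ⟨tendsto_comap_iff.2 ?_, tendsto_principal.2 ?_⟩
  · have hc : Continuous fun s => (⟨(j, h, ι (vert h s)), hmem s⟩ : HalfSheets) := by
      have := hι.comp (continuous_vert h)
      exact (continuous_const.prodMk (continuous_const.prodMk this)).subtype_mk _
    exact ((isQuotientMap_mk.continuous.comp hc).tendsto 0).mono_left nhdsWithin_le_nhds
  · filter_upwards [self_mem_nhdsWithin] with s hs
    exact hne s hs

theorem tendsto_surfaceFilter_coe {z : ℂ} (j : Fin 4) {h : Bool} (hz : InHalf h z) :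
    Tendsto (fun s => (⟨(j, h, (z + vert h s : ℂ)), coe_mem_closedHalf.2 (by
        have := inHalf_vert h s
        cases h <;> simp only [InHalf, add_im, if_true, Bool.false_eq_true, if_false] at * <;>
          linarith)⟩ : HalfSheets)) (𝓝[>] 0)
      (surfaceFilter (Surface.mk S ⟨(j, h, z), coe_mem_closedHalf.2 hz⟩)) := by
  have := tendsto_surfaceFilter (S := S) (ι := fun y => ((z + y : ℂ) : OnePoint ℂ))
    (continuous_coe.comp (by fun_prop)) j h (fun s => coe_mem_closedHalf.2 (by
        have := inHalf_vert h s
        cases h <;> simp only [InHalf, add_im, if_true, Bool.false_eq_true, if_false] at * <;>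
          linarith)) fun s hs => ⟨_, by
        have h1 := inHalf_vert h s
        have h2 := vert_im_ne_zero h hs
        cases h <;> simp only [InHalf, add_im, if_true, Bool.false_eq_true, if_false] at * <;>
          grind, rfl⟩
  simpa only [vert_zero, add_zero] using this

instance (X : Surface S) : (surfaceFilter X).NeBot := by
  obtain ⟨⟨⟨j, h, x⟩, hx⟩⟩ := X
  induction x using OnePoint.rec with
  | infty =>
    have := tendsto_surfaceFilter (S := S) (ι := fun y => sphereInv (-y))
      (isOpenEmbedding_sphereInv.continuous.comp continuous_neg) j h (fun s => by
        have := inHalf_vert h s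
        cases h
        · exact sphereInv_neg_mem_closedHalf.2.2 this
        · exact sphereInv_neg_mem_closedHalf.1.2 this) fun s hs => by
        have h1 := vert_im_ne_zero h hs
        have h2 : vert h s ≠ 0 := fun h0 => h1 (by rw [h0, zero_im])
        refine ⟨_, ?_, sphereInv_of_ne_zero (neg_ne_zero.2 h2)⟩
        rw [inv_im, neg_im, neg_neg]
        exact div_ne_zero h1 (normSq_pos.2 (neg_ne_zero.2 h2)).ne'
    simp only [vert_zero, neg_zero, sphereInv_zero] at this
    exact this.neBot
  | coe z => exact (tendsto_surfaceFilter_coe j (coe_mem_closedHalf.1 hx)).neBot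

variable (Ξ : ℂ → Fin 4 → ℂ)

/-- The value given by a formula on the four sheets. -/
def sheetValue (P : HalfSheets) : OnePoint ℂ :=
  OnePoint.elim P.1.2.2 infty fun z => ((Ξ z P.1.1 : ℂ) : OnePoint ℂ)

/-- The extension by continuity of a function given by a formula on the four sheets. -/
def sheetExtension (X : Surface S) : OnePoint ℂ := limUnder (surfaceFilter X) (sheetValue Ξ)

/-- In some chart at `X` the formula represents a meromorphic function. -/
def HasLift (X : Surface S) : Prop :=
  ∃ e ∈ holomorphicCharts S, X ∈ e.source ∧ ∃ g : ℂ → OnePoint ℂ, SphereAnalyticAt g (e X) ∧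
    ∀ᶠ ζ in 𝓝 (e X), ∀ P ∈ nonrealPoints, Surface.mk S P = e.symm ζ → sheetValue Ξ P = g ζ

variable {Ξ}

theorem tendsto_sheetValue {X : Surface S} {e : OpenPartialHomeomorph (Surface S) ℂ}
    (hX : X ∈ e.source) {g : ℂ → OnePoint ℂ} (hg : ContinuousAt g (e X))
    (h : ∀ᶠ ζ in 𝓝 (e X), ∀ P ∈ nonrealPoints, Surface.mk S P = e.symm ζ → sheetValue Ξ P = g ζ) :
    Tendsto (sheetValue Ξ) (surfaceFilter X) (𝓝 (g (e X))) := by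
  have h1 : Tendsto (Surface.mk S) (surfaceFilter X) (𝓝 X) := tendsto_comap.mono_left inf_le_left
  refine (hg.tendsto.comp ((e.continuousAt hX).tendsto.comp h1)).congr' ?_
  filter_upwards [h1.eventually ((e.continuousAt hX).eventually h),
    h1.eventually (e.open_source.mem_nhds hX),
    (inf_le_right : surfaceFilter X ≤ _) (mem_principal_self _)] with P hP hPe hPn
  exact (hP P hPn (e.left_inv hPe).symm).symm

/-- The formula is compared with `g` at non-real points only. Since these accumulate at every point
and `g` is continuous, the limits that define the extension coincide with `g` at all nearby points,
real or not. -/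
theorem eventually_sheetExtension_eq {X : Surface S} {e : OpenPartialHomeomorph (Surface S) ℂ}
    (hX : X ∈ e.source) {g : ℂ → OnePoint ℂ} (hg : SphereAnalyticAt g (e X))
    (h : ∀ᶠ ζ in 𝓝 (e X), ∀ P ∈ nonrealPoints, Surface.mk S P = e.symm ζ → sheetValue Ξ P = g ζ) :
    ∀ᶠ ζ in 𝓝 (e X), sheetExtension Ξ (e.symm ζ) = g ζ := by
  filter_upwards [h.eventually_nhds, hg.eventually_continuousAt,
    e.open_target.mem_nhds (e.map_source hX)] with ζ h1 h2 h3
  have := tendsto_sheetValue (e.map_target h3) (g := g) (by rwa [e.right_inv h3])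
    (by rwa [e.right_inv h3])
  rw [e.right_inv h3] at this
  exact this.limUnder_eq

theorem HasLift.tendsto {X : Surface S} (h : HasLift Ξ X) :
    Tendsto (sheetValue Ξ) (surfaceFilter X) (𝓝 (sheetExtension Ξ X)) := by
  obtain ⟨e, -, hX, g, hg, hge⟩ := h
  exact tendsto_nhds_limUnder ⟨_, tendsto_sheetValue hX hg.eventually_continuousAt.self_of_nhds hge⟩

theorem HasLift.sheetExtension_eq {P : HalfSheets} (h : HasLift Ξ (Surface.mk S P))
    (hP : P ∈ nonrealPoints) : sheetExtension Ξ (Surface.mk S P) = sheetValue Ξ P := by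
  have hle : pure P ≤ surfaceFilter (Surface.mk S P) :=
    le_inf (map_le_iff_le_comap.1 (by rw [map_pure]; exact pure_le_nhds _))
      ((pure_le_principal P).2 hP)
  exact tendsto_nhds_unique (h.tendsto.mono_left hle) (tendsto_pure_nhds _ P)

/-- A lift in one chart is transported to any other by the holomorphic coordinate change. -/
theorem HasLift.sphereAnalyticAt {X : Surface S} (h : HasLift Ξ X)
    {e : OpenPartialHomeomorph (Surface S) ℂ} (he : e ∈ holomorphicCharts S) (hX : X ∈ e.source) :
    SphereAnalyticAt (fun u => sheetExtension Ξ (e.symm u)) (e X) := by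
  obtain ⟨e', he', hX', g, hg, hge⟩ := h
  have hsrc : e X ∈ (e.symm.trans e').source := by
    simpa [hX] using hX'
  have hτ := analyticAt_transition he he' hsrc
  have hτX : e' (e.symm (e X)) = e' X := by rw [e.left_inv hX]
  rw [← hτX] at hg
  refine (hg.comp (τ := fun u => e' (e.symm u)) hτ).congr ?_
  have hev := eventually_sheetExtension_eq hX' (hτX ▸ hg) hge
  rw [← hτX] at hev
  filter_upwards [hτ.continuousAt.eventually hev,
    (e.symm.trans e').open_source.mem_nhds hsrc] with u hu hu'
  have hu'' : e.symm u ∈ e'.source := by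
    have := hu'
    simp only [OpenPartialHomeomorph.trans_source, mem_inter_iff, mem_preimage] at this
    exact this.2
  rwa [e'.left_inv hu''] at hu

/-- Over points that are not real the formula itself is a lift. -/
theorem hasLift_of_im_ne_zero (hΞ : ∀ j, DifferentiableOn ℂ (Ξ · j) {z | z.im ≠ 0}) {z : ℂ}
    (hz : z.im ≠ 0) (j : Fin 4) {h : Bool} (hh : InHalf h z) :
    HasLift Ξ (Surface.mk S ⟨(j, h, z), coe_mem_closedHalf.2 hh⟩) := by
  obtain ⟨e, hzt, hs, he⟩ := exists_chart_of_im_ne_zero (S := S) hz j hh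
  have hez : e (Surface.mk S ⟨(j, h, z), coe_mem_closedHalf.2 hh⟩) = z := by
    obtain ⟨_, _, e1⟩ := he z hzt
    rw [← e1, e.right_inv hzt]
  have hg : SphereAnalyticAt (fun z => ((Ξ z j : ℂ) : OnePoint ℂ)) z :=
    sphereAnalyticAt_coe ((hΞ j).analyticAt (isOpen_im_ne_zero.mem_nhds hz))
  have hge : ∀ᶠ ζ in 𝓝 z, ∀ P ∈ nonrealPoints, Surface.mk S P = e.symm ζ →
      sheetValue Ξ P = ((Ξ ζ j : ℂ) : OnePoint ℂ) := by
    filter_upwards [e.open_target.mem_nhds hzt] with ζ hζ P hP hPζ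
    obtain ⟨h1, h2, h3⟩ := he ζ hζ
    rw [eq_of_mk_eq (S := S) ⟨ζ, h1, rfl⟩ (hPζ.trans h3)]
    rfl
  rw [← hez] at hg hge
  exact ⟨e, mem_holomorphicCharts_of_im_ne_zero he, hs, _, hg, hge⟩

/-- At an isolated point where the growth is at most polynomial there is a lift. -/
theorem IsLocalModel.hasLift {ι : ℂ → OnePoint ℂ} {r : ℝ} {L R : Equiv.Perm (Fin 4)}
    (hM : IsLocalModel S ι r L R)
    (hreg : ∀ᶠ y in 𝓝[≠] (0 : ℂ), ∀ Y : Surface S, Surface.proj Y = ι y →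
      HasLift Ξ Y ∧ sheetExtension Ξ Y ≠ infty) {C : ℝ}
    (hC : ∀ᶠ y in 𝓝 (0 : ℂ), ∀ z : ℂ, ι y = z → z.im ≠ 0 → ∀ j, ‖Ξ z j‖ * ‖y‖ ≤ C)
    {X : Surface S} (hX : Surface.proj X = ι 0) : HasLift Ξ X := by
  obtain ⟨j, rfl⟩ := hM.exists_eq_point hX
  obtain ⟨k, ρ, e, hk, hρ, -, htar, hs, h0, hproj, -⟩ := hM.exists_chart j
  have he := hM.mem_holomorphicCharts hproj
  have h0t : (0 : ℂ) ∈ e.target := by rw [htar]; simpa [hk] using hρ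
  set X := hM.point j true 0 (inHalf_zero true) with hXdef
  have heX : e X = 0 := by rw [← h0, e.right_inv h0t]
  have hpow : Tendsto (fun ζ : ℂ => ζ ^ k) (𝓝 0) (𝓝 0) := by
    have : Continuous fun ζ : ℂ => ζ ^ k := by fun_prop
    simpa [hk] using this.tendsto 0
  have hpow' : Tendsto (fun ζ : ℂ => ζ ^ k) (𝓝[≠] 0) (𝓝[≠] 0) :=
    tendsto_nhdsWithin_iff.2 ⟨hpow.mono_left nhdsWithin_le_nhds,
      eventually_mem_nhdsWithin.mono fun ζ hζ => pow_ne_zero k hζ⟩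
  have htar' : ∀ᶠ ζ in 𝓝[≠] (0 : ℂ), ζ ∈ e.target :=
    nhdsWithin_le_nhds (e.open_target.mem_nhds h0t)
  have hlift : ∀ᶠ ζ in 𝓝[≠] (0 : ℂ), HasLift Ξ (e.symm ζ) ∧ sheetExtension Ξ (e.symm ζ) ≠ infty := by
    filter_upwards [hpow'.eventually hreg, htar'] with ζ h1 h2
    exact h1 _ (hproj ζ h2)
  -- The value 0 given to ∞ is a default; by `hlift` the extension is finite at all points ζ ≠ 0
  -- near 0.
  set f : ℂ → ℂ := fun ζ => OnePoint.elim (sheetExtension Ξ (e.symm ζ)) 0 id with hf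
  have hfe : ∀ᶠ ζ in 𝓝[≠] (0 : ℂ), sheetExtension Ξ (e.symm ζ) = ((f ζ : ℂ) : OnePoint ℂ) := by
    filter_upwards [hlift] with ζ hζ
    obtain ⟨v, hv⟩ := OnePoint.ne_infty_iff_exists.1 hζ.2
    simp only [hf, ← hv, OnePoint.elim_some, id]
  have hdiff : ∀ᶠ ζ in 𝓝[≠] (0 : ℂ), DifferentiableAt ℂ f ζ := by
    filter_upwards [hlift, htar'] with ζ h1 h2
    have h3 := h1.1.sphereAnalyticAt he (e.map_target h2)
    rw [e.right_inv h2] at h3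
    obtain ⟨f', hf', hfe'⟩ := h3.exists_coe h1.2
    refine hf'.differentiableAt.congr_of_eventuallyEq ?_
    filter_upwards [hfe'] with u hu
    simp only [hf, hu, OnePoint.elim_some, id]
  -- As y = ζᵏ, the bound of `hC` reads ‖ζ‖ᵏ times the function. It is given at non-real points and
  -- passes to the limit along `surfaceFilter`.
  have hbound : ∀ᶠ ζ in 𝓝[≠] (0 : ℂ), ‖f ζ‖ * ‖ζ - 0‖ ^ k ≤ C := by
    filter_upwards [hlift, htar', hfe, nhdsWithin_le_nhds (hpow.eventually hC).eventually_nhds]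
      with ζ h1 h2 h3 h4
    have ht := h1.1.tendsto
    rw [h3] at ht
    have hel : ContinuousAt (fun x : OnePoint ℂ => ‖OnePoint.elim x 0 (id : ℂ → ℂ)‖)
        ((f ζ : ℂ) : OnePoint ℂ) := by
      rw [continuousAt_coe]; exact continuous_norm.continuousAt
    have h5 : Tendsto (fun P => e (Surface.mk S P)) (surfaceFilter (e.symm ζ)) (𝓝 ζ) := by
      have := (e.continuousAt (e.map_target h2)).tendsto
      rw [e.right_inv h2] at this
      exact this.comp (tendsto_comap.mono_left inf_le_left)
    have h6 := (hel.tendsto.comp ht).mul ((h5.norm).pow k)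
    rw [sub_zero]
    refine le_of_tendsto h6 ?_
    have hsrc : ∀ᶠ P in surfaceFilter (e.symm ζ), Surface.mk S P ∈ e.source :=
      (tendsto_comap.mono_left inf_le_left : Tendsto (Surface.mk S) (surfaceFilter (e.symm ζ)) _)
        (e.open_source.mem_nhds (e.map_target h2))
    filter_upwards [h5.eventually h4, hsrc,
      (inf_le_right : surfaceFilter (e.symm ζ) ≤ _) (mem_principal_self _)] with P h7 h8 h9
    obtain ⟨z, hz, hPz⟩ := h9
    have h10 := hproj _ (e.map_source h8)
    rw [e.left_inv h8] at h10
    have h11 := h7 z (h10.symm.trans hPz) hz P.1.1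
    simp only [Function.comp_apply, sheetValue, hPz, OnePoint.elim_some, id]
    rwa [norm_pow] at h11
  obtain ⟨g, hg, hge⟩ := MeromorphicAt.exists_sphereAnalyticAt
    (meromorphicAt_of_norm_mul_pow_le hdiff hbound)
  refine ⟨e, he, hs, g, heX ▸ hg, ?_⟩
  rw [heX]
  have hall : ∀ᶠ ζ in 𝓝[≠] (0 : ℂ), ∀ P ∈ nonrealPoints, Surface.mk S P = e.symm ζ →
      sheetValue Ξ P = g ζ := by
    filter_upwards [hge, hfe, hlift] with ζ h1 h2 h3 P hP hPζ
    rw [h1, ← h2, ← hPζ]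
    rw [← hPζ] at h3
    exact (h3.1.sheetExtension_eq hP).symm
  rw [eventually_nhdsWithin_iff] at hall
  filter_upwards [hall] with ζ hζ
  -- At the centre the condition is vacuous: ι 0 lies in both closed halves, so no non-real point
  -- projects to it.
  by_cases h : ζ = 0
  · rintro P ⟨z, hz, hPz⟩ hPζ
    rw [h, h0] at hPζ
    have h1 : ((z : ℂ) : OnePoint ℂ) = ι 0 := by rw [← hPz, ← hX, ← hPζ]; rfl
    have h2 := (hM.mem_true 0).2 le_rfl
    have h3 := (hM.mem_false 0).2 le_rfl
    rw [← h1, coe_mem_closedHalf_true_iff] at h2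
    rw [← h1, coe_mem_closedHalf_false_iff] at h3
    exact absurd (le_antisymm h3 h2) hz
  · exact hζ h

/-! ### Lifts of ξ at all points of the surface. -/

variable {a b t : ℝ} {μ₁ μ₂ μ₃ : Measure ℝ} {c₁ c₃ p q : ℝ}

theorem CutData.differentiableAt_xiFormula (h : CutData a b t μ₁ μ₂ μ₃ c₁ c₃ p q) {z : ℂ}
    {j : Fin 4} (hz : z ∈ slitPlane) (hj : z ∈ sheet (stdCuts c₁ c₃ p q) j) :
    DifferentiableAt ℂ (fun z => xiFormula a b t μ₁ μ₂ μ₃ z j) z := by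
  have f2 := h.min.left.isFiniteMeasure'
  have hslit : ∀ c : ℝ, 0 ≤ c → ∀ x ∈ Iic (-c), z ≠ (x : ℂ) := by
    rintro c hc x hx rfl
    have : 0 < x := by simpa using hz
    have : x ≤ -c := hx
    linarith
  have dG : ∀ {c s c₀ : ℝ} {μ : Measure ℝ}, 0 < s → 0 ≤ c₀ →
      (constraintMeasure c s - μ).support = Iic (-c₀) →
      DifferentiableAt ℂ (cauchyTransform (constraintMeasure c s - μ)) z := fun hs hc₀ hS =>
    differentiableAt_cauchyTransform (IsConstrainedMin.cauchyIntegrable_sub hs) isClosed_Iic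
      ((ae_lt_of_support_sub_eq hS).mono fun y hy => le_of_lt hy) (hslit _ hc₀)
  have d1 := dG h.ht₀ h.hc₁ h.hS₁
  have d3 := dG (by linarith [h.ht₁]) h.hc₃ h.hS₃
  have d2 : Icc p q ⊆ cutsIn (stdCuts c₁ c₃ p q) j → DifferentiableAt ℂ (cauchyTransform μ₂) z :=
    fun hsub => differentiableAt_cauchyTransform (cauchyIntegrable_of_isFiniteMeasure _)
      isClosed_Icc (by rw [← h.hS₂]; exact Measure.support_mem_ae) fun x hx => hj x (hsub hx)
  rw [cutsIn_stdCuts] at d2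
  have hev : ∀ᶠ w in 𝓝 z, w ∈ slitPlane := isOpen_slitPlane.mem_nhds hz
  fin_cases j
  · refine (d1.add_const (1 / (t * (1 - t)) : ℂ)).congr_of_eventuallyEq ?_
    filter_upwards [hev] with w hw using by rw [h.xiFormula_eq hw]; rfl
  · refine ((d1.fun_neg.fun_sub (d2 subset_union_right)).add_const
      (1 / (t * (1 - t)) : ℂ)).congr_of_eventuallyEq ?_
    filter_upwards [hev] with w hw using by rw [h.xiFormula_eq hw]; rfl
  · refine ((d2 subset_union_left).fun_add d3).congr_of_eventuallyEq ?_
    filter_upwards [hev] with w hw using by rw [h.xiFormula_eq hw]; rfl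
  · refine d3.fun_neg.congr_of_eventuallyEq ?_
    filter_upwards [hev] with w hw using by rw [h.xiFormula_eq hw]; rfl

theorem CutData.differentiableOn_xiFormula (h : CutData a b t μ₁ μ₂ μ₃ c₁ c₃ p q) (j : Fin 4) :
    DifferentiableOn ℂ (fun z => xiFormula a b t μ₁ μ₂ μ₃ z j) {z | z.im ≠ 0} := fun z hz =>
  (h.differentiableAt_xiFormula (mem_slitPlane_of_im_ne_zero hz) fun x _ hzx =>
    hz (by rw [hzx, ofReal_im])).differentiableWithinAt

/-- Over a real point that is no end of a cut, the gluings to the left and to the right coincide, so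
the chart is unramified with coordinate z − x, and the continuation from `CutData.exists_crossing`
is the lift. -/
theorem CutData.hasLift_of_proj_eq_coe (h : CutData a b t μ₁ μ₂ μ₃ c₁ c₃ p q) {z : ℂ}
    (hz : ∀ e : ℝ, e ∈ ({-c₁, -c₃, p, q} : Finset ℝ) → z ≠ e)
    {X : Surface (stdCuts c₁ c₃ p q)} (hX : Surface.proj X = z) :
    HasLift (xiFormula a b t μ₁ μ₂ μ₃) X ∧
      sheetExtension (xiFormula a b t μ₁ μ₂ μ₃) X ≠ infty := by
  by_cases hzi : z.im = 0
  · obtain ⟨x, rfl⟩ : ∃ x : ℝ, z = x := ⟨z.re, Complex.ext rfl hzi⟩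
    obtain ⟨r₀, hr₀, hfar⟩ := exists_pos_forall_abs_sub_lt x {-c₁, -c₃, p, q}
    have hout : ∀ e ∈ ({-c₁, -c₃, p, q} : Finset ℝ), e ∉ Ioo (x - r₀) (x + r₀) := fun e he hmem =>
      hz e he (by rw [hfar e he (abs_lt.2 ⟨by linarith [hmem.1], by linarith [hmem.2]⟩)])
    have n1 := hout (-c₁) (by simp)
    have n3 := hout (-c₃) (by simp)
    have np := hout p (by simp)
    have nq := hout q (by simp)
    obtain ⟨r, hM⟩ := exists_isLocalModel_coe h.hc₁ h.hc₃ h.hp h.hpq x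
    have hLR : gluePermLeft c₁ c₃ p q x = gluePermRight c₁ c₃ p q x := by
      simp only [gluePermLeft, gluePermRight]
      simp only [mem_Ioo, not_and_or, not_lt] at n1 n3 np nq
      congr 1 <;> grind
    obtain ⟨j, rfl⟩ := hM.exists_eq_point (by simpa using hX)
    obtain ⟨k, ρ, e, hk, hρ, -, htar, hs, h0, hproj, htriv⟩ := hM.exists_chart j
    obtain ⟨rfl, hup, hlo⟩ := htriv hLR
    have h0t : (0 : ℂ) ∈ e.target := by rw [htar]; simpa using hρ
    have heX : e (hM.point j true 0 (inHalf_zero true)) = 0 := by rw [← h0, e.right_inv h0t]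
    obtain ⟨f, hf, hfu, hfl⟩ := h.exists_crossing hr₀ n1 n3 np nq j
    have hxb : (x : ℂ) ∈ ball (x : ℂ) r₀ := mem_ball_self hr₀
    have hg : SphereAnalyticAt (fun ζ => ((f (x + ζ) : ℂ) : OnePoint ℂ)) 0 := by
      refine sphereAnalyticAt_coe (AnalyticAt.fun_comp ?_ (by fun_prop))
      rw [add_zero]
      exact hf.analyticAt (isOpen_ball.mem_nhds hxb)
    have hge : ∀ᶠ ζ in 𝓝 (0 : ℂ), ∀ P ∈ nonrealPoints,
        Surface.mk (stdCuts c₁ c₃ p q) P = e.symm ζ →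
        sheetValue (xiFormula a b t μ₁ μ₂ μ₃) P = ((f (x + ζ) : ℂ) : OnePoint ℂ) := by
      filter_upwards [e.open_target.mem_nhds h0t, ball_mem_nhds (0 : ℂ) hr₀] with ζ h1 h2 P hP hPζ
      have hb : (x + ζ : ℂ) ∈ ball (x : ℂ) r₀ := by simpa using h2
      have hζ : ζ.im ≠ 0 := by
        obtain ⟨w, hw, hPw⟩ := hP
        have h3 := hproj ζ h1
        rw [← hPζ, pow_one] at h3
        have h4 : (w : OnePoint ℂ) = ((x + ζ : ℂ) : OnePoint ℂ) := hPw.symm.trans h3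
        rw [OnePoint.coe_eq_coe] at h4
        simpa [h4] using hw
      have hζ' : (x + ζ : ℂ).im ≠ 0 := by simpa using hζ
      rcases lt_or_gt_of_ne hζ with h5 | h5
      · rw [← eq_of_mk_eq hP ((hlo ζ h1 h5.le).symm.trans hPζ.symm), hfl _ hb (by simpa using h5)]
        rfl
      · rw [← eq_of_mk_eq hP ((hup ζ h1 h5.le).symm.trans hPζ.symm), hfu _ hb (by simpa using h5)]
        rfl
    rw [← heX] at hg hge
    refine ⟨⟨e, hM.mem_holomorphicCharts hproj, hs, _, hg, hge⟩, ?_⟩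
    rw [sheetExtension, (tendsto_sheetValue hs hg.eventually_continuousAt.self_of_nhds
      hge).limUnder_eq]
    exact OnePoint.coe_ne_infty _
  · obtain ⟨⟨⟨j, b, x⟩, hx⟩⟩ := X
    obtain rfl : x = z := hX
    have hl := hasLift_of_im_ne_zero (S := stdCuts c₁ c₃ p q) h.differentiableOn_xiFormula hzi j
      (coe_mem_closedHalf.1 hx)
    refine ⟨hl, ?_⟩
    have := hl.sheetExtension_eq ⟨z, hzi, rfl⟩
    exact fun h0 => OnePoint.coe_ne_infty _ (this.symm.trans h0)

/-- The points left over after `CutData.hasLift_of_proj_eq_coe` lie over finitely many points of the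
sphere, so they are isolated and the growth bounds make them at most poles. At infinity boundedness
is more than enough, since the coordinate satisfies ‖y‖ ≤ 1. -/
theorem CutData.hasLift (h : CutData a b t μ₁ μ₂ μ₃ c₁ c₃ p q) (X : Surface (stdCuts c₁ c₃ p q)) :
    HasLift (xiFormula a b t μ₁ μ₂ μ₃) X := by
  have hreg : ∀ {ι r L R}, IsLocalModel (stdCuts c₁ c₃ p q) ι r L R →
      ∀ᶠ y in 𝓝[≠] (0 : ℂ), ∀ Y : Surface (stdCuts c₁ c₃ p q), Surface.proj Y = ι y →
        HasLift (xiFormula a b t μ₁ μ₂ μ₃) Y ∧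
          sheetExtension (xiFormula a b t μ₁ μ₂ μ₃) Y ≠ infty := by
    intro ι r L R hM
    have hfin : (insert infty ((fun e : ℝ => ((e : ℂ) : OnePoint ℂ)) ''
        ({-c₁, -c₃, p, q} : Finset ℝ))).Finite := ((Finset.finite_toSet _).image _).insert _
    have hpre := hfin.preimage (f := ι) hM.isOpenEmbedding.injective.injOn
    filter_upwards [nhdsNE_le_cofinite _ hpre.compl_mem_cofinite] with y hy Y hY
    obtain ⟨z, hz⟩ := OnePoint.ne_infty_iff_exists.1 (fun h0 => hy (Or.inl h0) : ι y ≠ infty)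
    refine h.hasLift_of_proj_eq_coe (z := z) (fun e he hze => hy (Or.inr ⟨e, he, ?_⟩)) (hY.trans hz.symm)
    rw [← hz, hze]
  rcases surface_cases X with ⟨z, hz, j, b, hh, rfl⟩ | ⟨x, hx⟩ | hX
  · exact hasLift_of_im_ne_zero h.differentiableOn_xiFormula hz j hh
  · obtain ⟨r, hM⟩ := exists_isLocalModel_coe h.hc₁ h.hc₃ h.hp h.hpq x
    obtain ⟨C, hC⟩ := h.exists_norm_xiFormula_mul_le x
    refine hM.hasLift (hreg hM) (C := C) ?_ (by simpa using hx)
    have ht : Tendsto (fun y : ℂ => x + y) (𝓝 0) (𝓝 (x : ℂ)) := by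
      have : Continuous fun y : ℂ => (x : ℂ) + y := by fun_prop
      simpa using this.tendsto 0
    filter_upwards [ht.eventually hC] with y hy z hz hzi j
    obtain rfl := OnePoint.coe_eq_coe.1 hz
    simpa using hy hzi j
  · obtain ⟨r, hM⟩ := exists_isLocalModel_infty h.hc₁ h.hc₃ h.hp h.hpq
    obtain ⟨C, M, hC⟩ := h.exists_norm_xiFormula_le
    refine hM.hasLift (hreg hM) (C := C) ?_ (by simpa using hX)
    have hM0 : 0 < |M| + 1 := by positivity
    filter_upwards [ball_mem_nhds (0 : ℂ) (inv_pos.2 hM0)] with y hy z hz hzi j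
    rw [mem_ball_zero_iff] at hy
    have hy0 : y ≠ 0 := by
      rintro rfl
      rw [neg_zero, sphereInv_zero] at hz
      exact OnePoint.coe_ne_infty z hz.symm
    rw [sphereInv_of_ne_zero (neg_ne_zero.2 hy0), OnePoint.coe_eq_coe] at hz
    have hz' : |M| + 1 < ‖z‖ := by
      rw [← hz, norm_inv, norm_neg]
      exact (lt_inv_comm₀ (norm_pos_iff.2 hy0) hM0).1 hy
    have h1 := hC z (by linarith [le_abs_self M]) hzi j
    have h2 : ‖y‖ ≤ 1 := hy.le.trans (inv_le_one_of_one_le₀ (by linarith [abs_nonneg M]))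
    exact (mul_le_of_le_one_right (norm_nonneg _) h2).trans h1

theorem CutData.isMeromorphic (h : CutData a b t μ₁ μ₂ μ₃ c₁ c₃ p q)
    (hcov : ∀ P : Surface (stdCuts c₁ c₃ p q), ∃ e ∈ holomorphicCharts (stdCuts c₁ c₃ p q),
      P ∈ e.source) :
    letI := surfaceChartedSpace hcov
    IsMeromorphic (X := Surface (stdCuts c₁ c₃ p q))
      (sheetExtension (xiFormula a b t μ₁ μ₂ μ₃)) := by
  refine ⟨fun e he w hw => ?_, fun X => ?_⟩
  · have := (h.hasLift (e.symm w)).sphereAnalyticAt he (e.map_target hw)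
    rwa [e.right_inv hw] at this
  · refine mem_closure_of_tendsto (f := Surface.mk _) (b := surfaceFilter X)
      (tendsto_comap.mono_left inf_le_left) ?_
    filter_upwards [(inf_le_right : surfaceFilter X ≤ _) (mem_principal_self _)] with P hP
    rw [(h.hasLift _).sheetExtension_eq hP]
    obtain ⟨z, -, hz⟩ := hP
    simp [sheetValue, hz]

/-- For real z off the cuts and off (−∞, 0] the extension is defined by a limit as well; the formula
is continuous at such z, so the vertical limit is its value, from either half. -/
theorem CutData.sheetExtension_pt (h : CutData a b t μ₁ μ₂ μ₃ c₁ c₃ p q) {j : Fin 4} {z : ℂ}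
    (hz : z ∈ sheet (stdCuts c₁ c₃ p q) j) (hs : z ∈ slitPlane) :
    sheetExtension (xiFormula a b t μ₁ μ₂ μ₃) (Surface.pt (stdCuts c₁ c₃ p q) j z) =
      ((xiFormula a b t μ₁ μ₂ μ₃ z j : ℂ) : OnePoint ℂ) := by
  have key : ∀ (β : Bool) (hβ : InHalf β z), sheetExtension (xiFormula a b t μ₁ μ₂ μ₃)
      (Surface.mk (stdCuts c₁ c₃ p q) ⟨(j, β, z), coe_mem_closedHalf.2 hβ⟩) =
        ((xiFormula a b t μ₁ μ₂ μ₃ z j : ℂ) : OnePoint ℂ) := by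
    intro β hβ
    refine tendsto_nhds_unique ((h.hasLift _).tendsto.comp (tendsto_surfaceFilter_coe j hβ)) ?_
    have hv : Tendsto (fun s => z + vert β s) (𝓝[>] 0) (𝓝 z) := by
      have := ((continuous_vert β).tendsto 0).const_add z
      rw [vert_zero, add_zero] at this
      exact this.mono_left nhdsWithin_le_nhds
    exact (continuous_coe.tendsto _).comp
      ((h.differentiableAt_xiFormula hs hz).continuousAt.tendsto.comp hv)
  rw [Surface.pt]
  split_ifs with h0
  · exact key true h0
  · exact key false (le_of_not_ge h0)

end Extension

theorem CutData.cuts_eq {a b t : ℝ} {μ₁ μ₂ μ₃ : Measure ℝ} {c₁ c₃ p q : ℝ}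
    (h : CutData a b t μ₁ μ₂ μ₃ c₁ c₃ p q) : cuts a b t μ₁ μ₂ μ₃ = stdCuts c₁ c₃ p q := by
  rw [cuts, h.hS₁, h.hS₂, h.hS₃, stdCuts]

end BesselXi

end
theorem theorem4p1 (a b t : ℝ) (ha : 0 < a) (hb : 0 < b) (ht₀ : 0 < t) (ht₁ : t < 1)
    (μ₁ μ₂ μ₃ : MeasureTheory.Measure ℝ) (hμ : BesselXi.IsMinimizer a b t μ₁ μ₂ μ₃)
    (S : Fin 3 → Set ℝ) (hS : S = BesselXi.cuts a b t μ₁ μ₂ μ₃) :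
    -- the surface is compact, connected and of genus zero
    Nonempty (BesselXi.Surface S ≃ₜ OnePoint ℂ) ∧
    -- it is a Riemann surface for the complex structure that makes the projection holomorphic
    ∃ _ : ChartedSpace ℂ (BesselXi.Surface S),
      atlas ℂ (BesselXi.Surface S) = BesselXi.holomorphicCharts S ∧
      IsManifold (modelWithCornersSelf ℂ ℂ) ω (BesselXi.Surface S) ∧
      -- the function extends to a meromorphic function on it
      ∃ ξ : BesselXi.Surface S → OnePoint ℂ, BesselXi.IsMeromorphic ξ ∧
        ∀ j : Fin 4, ∀ z ∈ BesselXi.sheet S j, z ∈ Complex.slitPlane →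
          ξ (BesselXi.Surface.pt S j z) =
            ((BesselXi.xiFormula a b t μ₁ μ₂ μ₃ z j : ℂ) : OnePoint ℂ) := by
  obtain ⟨c₁, c₃, p, q, h⟩ := hμ.exists_cutData ha hb ht₀ ht₁
  rw [h.cuts_eq] at hS
  subst hS
  have hcov := BesselXi.exists_mem_holomorphicCharts h.hc₁ h.hc₃ h.hp h.hpq
  exact ⟨BesselXi.nonempty_surface_homeomorph h.hc₁ h.hc₃ h.hp h.hpq,
    BesselXi.surfaceChartedSpace hcov, rfl, BesselXi.isManifold_surface hcov,
    BesselXi.sheetExtension (BesselXi.xiFormula a b t μ₁ μ₂ μ₃), h.isMeromorphic hcov,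
    fun _ _ hz hs => h.sheetExtension_pt hz hs⟩
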